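/- Let $F$ be a finite extension of $\mathbb{Q}_p$, let $\breve F$ be the completion of a maximal unramified extension of $F$, with Frobenius automorphism $\sigma$ over $F$ and normalized additive valuation $v_{\breve F}$, and let $K$ be a henselian discretely valued field with uniformizer $\pi$ whose ring of integers $\mathcal{O}_K$ contains $\breve F$. An isocrystal $D=(D,\phi)$ is a finite-dimensional $\breve F$-vector space with a bijective $\sigma$-semilinear map $\phi$; put $\dim(D)=v_{\breve F}(\det\phi)$ and $D_K=D\otimes_{\breve F}K$. Let $\mathbf{BunIsoc}^K$ be the category of pairs $(D,\Xi)$ with $D$ an isocrystal and $\Xi\subset D_K$ an $\mathcal{O}_K$-lattice, where morphisms are morphisms of isocrystals mapping the first lattice into the second; the tensor product is $(D\otimes D',\Xi\otimes\Xi')$. Let $\mathbf{NIsoc}^K$ be the category of normed isocrystals $(D,\alpha)$, where $\alpha$ is a splittable (i.e. possessing an orthogonal basis) $K$-norm on $D_K$ and morphisms do not increase norms. For splittable norms $\alpha,\beta$ on a finite-dimensional $K$-vector space and a common orthogonal basis $(e_i)$ with $\alpha(e_i)=|\pi|^{\lambda_i}$, $\beta(e_i)=|\pi|^{\mu_i}$,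 put $\nu(\alpha,\beta)=\sum_i(\mu_i-\lambda_i)$. Set $\mathrm{rank}(D,\alpha)=\dim_{\breve F}D$ and $\deg(D,\alpha)=\nu(\alpha_{\Xi_0},\alpha)-\dim(D)$, where $\Xi_0=D\otimes_{\breve F}\mathcal{O}_K$ and $\alpha_\Xi(v)=\inf\{|\lambda| : v\in\lambda\Xi\}$ is the gauge norm of a lattice $\Xi$; set $\mathrm{rank}(D,\Xi)=\mathrm{rank}(D,\alpha_\Xi)$ and $\deg(D,\Xi)=\deg(D,\alpha_\Xi)$. In either category, a nonzero object is semistable if every nonzero subisocrystal, with the induced lattice or norm, has slope $\deg/\mathrm{rank}$ at most that of the object. A Harder–Narasimhan filtration of an object is an exhaustive, separated, decreasing, left-continuous $\mathbb{R}$-filtration of $D$ by subisocrystals such that each graded piece $\mathrm{gr}^s$, with the induced lattice or norm, is zero or semistable of slope $s$. Then: 1. $\mathrm{rank}$ and $\deg$ define a Harder–Narasimhan formalism on $\mathbf{BunIsoc}^K$: the rank vanishes exactly on zero objects; rank and degree are additive on short exact sequences; on a morphism that is both a monomorphism and an epimorphism the rank is constant and the degree is non-decreasing, the degree being constant if and only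 if the morphism is an isomorphism; and each object $(D,\Xi)$ has a unique Harder–Narasimhan filtration $\mathcal{F}_{\mathrm{HN}}(D,\Xi)$, which is functorial in $(D,\Xi)$, so that $\mathcal{F}_{\mathrm{HN}}$ is a functor from $\mathbf{BunIsoc}^K$ to isocrystals filtered by subisocrystals. 2. This functor is induced by the Harder–Narasimhan filtration on $\mathbf{NIsoc}^K$ through the gauge functor $(D,\Xi)\mapsto(D,\alpha_\Xi)$: $\mathcal{F}_{\mathrm{HN}}(D,\Xi)$ is the unique Harder–Narasimhan filtration of the normed isocrystal $(D,\alpha_\Xi)$. 3. $\mathcal{F}_{\mathrm{HN}}$ is compatible with tensor products: $\mathcal{F}_{\mathrm{HN}}\big((D,\Xi)\otimes(D',\Xi')\big)=\mathcal{F}_{\mathrm{HN}}(D,\Xi)\otimes\mathcal{F}_{\mathrm{HN}}(D',\Xi')$, where $\mathrm{Fil}^a(f\otimes f')=\sum_{s+t=a}\mathrm{Fil}^s_f\otimes\mathrm{Fil}^t_{f'}$. Equivalently, the tensor product of two semistable objects of $\mathbf{BunIsoc}^K$ is semistable. -/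

import Mathlib

open TensorProduct CategoryTheory

noncomputable section

namespace IsocLat

universe w

/-! ### Discretely valued fields -/

/-- The ring of integers `{x | ‖x‖ ≤ 1}` of a field with a non-archimedean absolute value. -/
abbrev integers (E : Type*) [NormedField E] [IsUltrametricDist E] : ValuationSubring E :=
  (NormedField.valuation (K := E)).valuationSubring

/-- The largest absolute value `< 1`; for a discretely valued field this is the absolute value
`|π|` of a uniformizer. -/
def uniformizerNorm (E : Type*) [NormedField E] : ℝ :=
  sSup {r : ℝ | r < 1 ∧ ∃ x : E, ‖x‖ = r}

/-- For a real number `r > 0`, the exponent `t` with `r = |π| ^ t`. -/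
def expo (E : Type*) [NormedField E] (r : ℝ) : ℝ :=
  Real.log r / Real.log (uniformizerNorm E)

/-- The normalized additive valuation (a uniformizer has valuation `1`). -/
def addVal {E : Type*} [NormedField E] (x : E) : ℝ := expo E ‖x‖

/-! ### The completed maximal unramified extension and its Frobenius -/

section Breve

variable {p : ℕ} [Fact p.Prime] {F : Type*} [Field F] [Algebra ℚ_[p] F]

/-- A maximal unramified extension of (the image in `ℂ_p` of) a finite extension `F` of `ℚ_p`:
the field generated over `F` by all roots of unity of order prime to `p`. -/
def maxUnramified (ι : F →ₐ[ℚ_[p]] ℂ_[p]) : Subfield ℂ_[p] :=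
  Subfield.closure (Set.range ι ∪ {ζ : ℂ_[p] | ∃ n : ℕ, ¬ p ∣ n ∧ ζ ^ n = 1})

/-- The completion of the maximal unramified extension of `F`, realized as
its closure in the complete field `ℂ_p`. -/
def Breve (ι : F →ₐ[ℚ_[p]] ℂ_[p]) : Subfield ℂ_[p] :=
  (maxUnramified ι).topologicalClosure

lemma mem_breve (ι : F →ₐ[ℚ_[p]] ℂ_[p]) (x : F) : ι x ∈ Breve ι :=
  Subfield.le_topologicalClosure _ (Subfield.subset_closure (Or.inl ⟨x, rfl⟩))

/-- The cardinality `q` of the residue field of `F`. -/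
def residueCard (ι : F →ₐ[ℚ_[p]] ℂ_[p]) : ℕ :=
  Nat.card (IsLocalRing.ResidueField ((integers ℂ_[p]).comap (ι : F →+* ℂ_[p])))

/-- `σ` is the Frobenius `F`-automorphism: it fixes `F` and induces `x ↦ x ^ q` on the residue
field. -/
structure IsFrobenius (ι : F →ₐ[ℚ_[p]] ℂ_[p]) (σ : Breve ι ≃+* Breve ι) : Prop where
  fixes : ∀ x : F, σ ⟨ι x, mem_breve ι x⟩ = ⟨ι x, mem_breve ι x⟩
  frob : ∀ x : Breve ι, ‖x‖ ≤ 1 → ‖σ x - x ^ residueCard ι‖ < 1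

end Breve

/-! ### Isocrystals -/

/-- Isocrystals: finite dimensional vector spaces with a bijective `σ`-semilinear map. -/
structure Isoc {L : Type*} [Field L] (σ : L ≃+* L) where
  V : Type w
  [grp : AddCommGroup V]
  [mod : Module L V]
  [fin : FiniteDimensional L V]
  φ : V →ₛₗ[(σ : L →+* L)] V
  bij : Function.Bijective φ

attribute [instance] Isoc.grp Isoc.mod Isoc.fin

namespace Isoc

section Basic

variable {L : Type*} [Field L] {σ : L ≃+* L}

/-- Morphisms of isocrystals: linear maps commuting with the Frobenius. -/
@[ext]
structure Hom (D E : Isoc.{w} σ) where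
  lin : D.V →ₗ[L] E.V
  comm : ∀ x, lin (D.φ x) = E.φ (lin x)

instance : Category (Isoc.{w} σ) where
  Hom D E := Hom D E
  id D := ⟨LinearMap.id, fun _ => rfl⟩
  comp f g := ⟨g.lin ∘ₗ f.lin, fun x => by simp [f.comm, g.comm]⟩

/-- A subspace `W` is (the underlying space of) a subisocrystal if `φ` restricts to a bijection
of `W`, i.e. if `W` is its own preimage under `φ`. -/
def IsSub (D : Isoc.{w} σ) (W : Submodule L D.V) : Prop := ∀ x, D.φ x ∈ W ↔ x ∈ W

/-- A subisocrystal, as an isocrystal. -/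
def sub (D : Isoc.{w} σ) (W : Submodule L D.V) (h : D.IsSub W) : Isoc.{w} σ where
  V := W
  φ := (D.φ.domRestrict W).codRestrict W fun x => (h x).2 x.2
  bij := by
    constructor
    · intro x y hxy
      exact Subtype.ext (D.bij.1 (congrArg Subtype.val hxy))
    · intro y
      obtain ⟨x, hx⟩ := D.bij.2 y
      exact ⟨⟨x, (h x).1 (hx ▸ y.2)⟩, Subtype.ext hx⟩

/-- The quotient of an isocrystal by a subisocrystal. -/
def quot (D : Isoc.{w} σ) (W : Submodule L D.V) (h : D.IsSub W) : Isoc.{w} σ where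
  V := D.V ⧸ W
  φ := W.mapQ W D.φ fun x hx => (h x).2 hx
  bij := by
    constructor
    · rw [injective_iff_map_eq_zero]
      intro a
      obtain ⟨x, rfl⟩ := W.mkQ_surjective a
      simp only [Submodule.mkQ_apply, Submodule.mapQ_apply, Submodule.Quotient.mk_eq_zero]
      exact (h x).1
    · intro a
      obtain ⟨y, rfl⟩ := W.mkQ_surjective a
      obtain ⟨x, rfl⟩ := D.bij.2 y
      exact ⟨W.mkQ x, rfl⟩

/-- The tensor product of two isocrystals. -/
def tensor (D E : Isoc.{w} σ) : Isoc.{w} σ where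
  V := D.V ⊗[L] E.V
  φ := TensorProduct.map D.φ E.φ
  bij := by
    have := RingHomInvPair.of_ringEquiv σ
    have := RingHomInvPair.symm (σ : L →+* L) (σ.symm : L →+* L)
    exact (TensorProduct.congr (LinearEquiv.ofBijective D.φ D.bij)
      (LinearEquiv.ofBijective E.φ E.bij)).bijective

/-- Finite exhaustive separated decreasing `ℝ`-filtrations, left continuous, by
subisocrystals. -/
@[ext]
structure Filtration (D : Isoc.{w} σ) where
  Fil : ℝ → Submodule L D.V
  isSub : ∀ s, D.IsSub (Fil s)
  antitone : Antitone Fil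
  exhaustive : ∃ s, Fil s = ⊤
  separated : ∃ s, Fil s = ⊥
  left_cont : ∀ s, Fil s = ⨅ t : Set.Iio s, Fil t

lemma isSub_iSup (D : Isoc.{w} σ) {J : Type*} (W : J → Submodule L D.V)
    (h : ∀ j, D.IsSub (W j)) : D.IsSub (⨆ j, W j) := by
  have hmap : ∀ x, x ∈ (⨆ j, W j) → D.φ x ∈ (⨆ j, W j) := fun x hx => by
    have : (⨆ j, W j) ≤ (⨆ j, W j).comap D.φ :=
      iSup_le fun j y hy => Submodule.mem_iSup_of_mem j ((h j y).2 hy)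
    exact this hx
  intro x
  refine ⟨fun hx => ?_, hmap x⟩
  have key : ∀ y ∈ (⨆ j, W j), ∃ z ∈ (⨆ j, W j), D.φ z = y := by
    intro y hy
    induction hy using Submodule.iSup_induction' with
    | mem j y hy =>
      obtain ⟨z, rfl⟩ := D.bij.2 y
      exact ⟨z, Submodule.mem_iSup_of_mem j ((h j z).1 hy), rfl⟩
    | zero => exact ⟨0, zero_mem _, map_zero _⟩
    | add a b _ _ ha hb =>
      obtain ⟨a', ha', rfl⟩ := ha
      obtain ⟨b', hb', rfl⟩ := hb
      exact ⟨a' + b', add_mem ha' hb', map_add _ _ _⟩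
  obtain ⟨z, hz, hzx⟩ := key _ hx
  exact D.bij.1 hzx ▸ hz

namespace Filtration

variable {D : Isoc.{w} σ}

/-- `Fil^{s+}`, the union of all `Fil^t` with `t > s`. -/
def plus (f : D.Filtration) (s : ℝ) : Submodule L D.V := ⨆ t : Set.Ioi s, f.Fil t

/-- `Fil^{s+}` as a subspace of `Fil^s`. -/
def plusIn (f : D.Filtration) (s : ℝ) : Submodule L (f.Fil s) :=
  (f.plus s).comap (f.Fil s).subtype

lemma isSub_plusIn (f : D.Filtration) (s : ℝ) :
    (D.sub (f.Fil s) (f.isSub s)).IsSub (f.plusIn s) :=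
  fun x => D.isSub_iSup (fun t : Set.Ioi s => f.Fil t) (fun t => f.isSub t) x.1

/-- The graded piece `gr^s = Fil^s / Fil^{s+}`. -/
def gr (f : D.Filtration) (s : ℝ) : Isoc.{w} σ :=
  (D.sub (f.Fil s) (f.isSub s)).quot (f.plusIn s) (f.isSub_plusIn s)

/-- The tensor product of two filtrations: `Fil^a = ∑_{s + t = a} Fil^s ⊗ Fil^t`. -/
def tensorFil {E : Isoc.{w} σ} (f : D.Filtration) (g : E.Filtration) (a : ℝ) :
    Submodule L (D.tensor E).V :=
  ⨆ st : {st : ℝ × ℝ // st.1 + st.2 = a},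
    Submodule.map₂ (TensorProduct.mk L D.V E.V) (f.Fil st.1.1) (g.Fil st.1.2)

end Filtration

end Basic

/-- The dimension `v(det φ)` of an isocrystal: the valuation of the determinant of the matrix of
`φ` in a basis. -/
def dim {L : Type*} [NormedField L] {σ : L ≃+* L} (D : Isoc.{w} σ) : ℝ :=
  addVal (Matrix.det (Matrix.of fun i j =>
    (Module.finBasis L D.V).repr (D.φ (Module.finBasis L D.V j)) i))

/-- The rank of an isocrystal. -/
def rank {L : Type*} [Field L] {σ : L ≃+* L} (D : Isoc.{w} σ) : ℕ := Module.finrank L D.V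

end Isoc

/-! ### Norms and lattices on vector spaces -/

section Norms

variable {K : Type*} [NormedField K] {U : Type*} [AddCommGroup U] [Module K U]

/-- Non-archimedean norms on a `K`-vector space. -/
structure IsNorm (α : U → ℝ) : Prop where
  nonneg : ∀ v, 0 ≤ α v
  eq_zero_iff : ∀ v, α v = 0 ↔ v = 0
  smul : ∀ (c : K) v, α (c • v) = ‖c‖ * α v
  add_le : ∀ v v', α (v + v') ≤ max (α v) (α v')

/-- `b` is an orthogonal basis for `α`: `α (∑ cᵢ bᵢ) = max ‖cᵢ‖ α(bᵢ)`. -/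
def IsOrthogonal {n : ℕ} (α : U → ℝ) (b : Module.Basis (Fin n) K U) : Prop :=
  ∀ v, α v = ⨆ i, ‖b.repr v i‖ * α (b i)

variable (K) in
/-- A norm is splittable if it has an orthogonal basis. -/
def IsSplittable (α : U → ℝ) : Prop :=
  ∃ (n : ℕ) (b : Module.Basis (Fin n) K U), IsOrthogonal α b

open Classical in
variable (K) in
/-- `ν(α, β) = ∑ (μᵢ - λᵢ)`, where `α(eᵢ) = |π| ^ λᵢ` and `β(eᵢ) = |π| ^ μᵢ` for a common orthogonal
basis `e` of `α` and `β`. -/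
def nu (α β : U → ℝ) : ℝ :=
  if h : ∃ b : Module.Basis (Fin (Module.finrank K U)) K U, IsOrthogonal α b ∧ IsOrthogonal β b then
    ∑ i, (expo K (β (h.choose i)) - expo K (α (h.choose i)))
  else 0

variable [IsUltrametricDist K] [Module (integers K) U]

variable (K) in
/-- The gauge norm `α_Ξ(v) = inf {|c| : v ∈ c Ξ}` of a lattice. -/
def gauge (Ξ : Submodule (integers K) U) (v : U) : ℝ :=
  sInf {r : ℝ | ∃ c : K, ∃ ξ ∈ Ξ, v = c • ξ ∧ ‖c‖ = r}

section GaugeLemmas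

lemma mem_integers {E : Type*} [NormedField E] [IsUltrametricDist E] {x : E} :
    x ∈ integers E ↔ ‖x‖ ≤ 1 := by
  rw [Valuation.mem_valuationSubring_iff, NormedField.valuation_apply]
  exact_mod_cast Iff.rfl

variable [IsScalarTower (integers K) K U] [IsDiscreteValuationRing (integers K)]

lemma mem_lattice_iff (Ξ : Submodule (integers K) U) [Submodule.IsLattice K Ξ] {n : ℕ}
    (b : Module.Basis (Fin n) (integers K) Ξ) (u : U) :
    u ∈ Ξ ↔ ∀ i, ‖(b.extendOfIsLattice K).repr u i‖ ≤ 1 := by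
  constructor
  · intro hu i
    have h1 : u = ∑ j, ((b.repr ⟨u, hu⟩ j : integers K) : K) • (b.extendOfIsLattice K) j := by
      have h := congrArg (Subtype.val : Ξ → U) (b.sum_repr ⟨u, hu⟩)
      rw [AddSubmonoidClass.coe_finsetSum] at h
      refine h.symm.trans ?_
      refine Finset.sum_congr rfl fun j _ => ?_
      rw [Module.Basis.extendOfIsLattice_apply, Submodule.coe_smul]
      exact (algebraMap_smul K (b.repr ⟨u, hu⟩ j) (b j : U)).symm
    have h2 := congrArg (fun w => (b.extendOfIsLattice K).repr w i) h1
    have h3 : (b.extendOfIsLattice K).repr u i = ((b.repr ⟨u, hu⟩ i : integers K) : K) := by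
      refine h2.trans ?_
      rw [Module.Basis.repr_sum_self]
    rw [h3]
    exact mem_integers.1 (b.repr ⟨u, hu⟩ i).2
  · intro h
    rw [← (b.extendOfIsLattice K).sum_repr u]
    refine Submodule.sum_mem _ fun i _ => ?_
    rw [Module.Basis.extendOfIsLattice_apply]
    have h1 := Ξ.smul_mem (⟨_, mem_integers.2 (h i)⟩ : integers K) (b i).2
    rwa [← algebraMap_smul K] at h1

lemma gauge_isLeast (Ξ : Submodule (integers K) U) [Submodule.IsLattice K Ξ] {n : ℕ}
    (b : Module.Basis (Fin n) (integers K) Ξ) (v : U) :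
    IsLeast {r : ℝ | ∃ c : K, ∃ ξ ∈ Ξ, v = c • ξ ∧ ‖c‖ = r}
      (⨆ i, ‖(b.extendOfIsLattice K).repr v i‖) := by
  set B := b.extendOfIsLattice K with hB
  have hbdd : BddAbove (Set.range fun i => ‖B.repr v i‖) := (Set.finite_range _).bddAbove
  have hlow : ∀ r ∈ {r : ℝ | ∃ c : K, ∃ ξ ∈ Ξ, v = c • ξ ∧ ‖c‖ = r},
      (⨆ i, ‖B.repr v i‖) ≤ r := by
    rintro r ⟨c, ξ, hξ, rfl, rfl⟩
    refine Real.iSup_le (fun i => ?_) (norm_nonneg _)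
    rw [map_smul, Finsupp.smul_apply, smul_eq_mul, norm_mul]
    exact mul_le_of_le_one_right (norm_nonneg _) ((mem_lattice_iff Ξ b ξ).1 hξ i)
  obtain ⟨c, hc⟩ : ∃ c : K, ‖c‖ = ⨆ i, ‖B.repr v i‖ := by
    rcases isEmpty_or_nonempty (Fin n) with hn | hn
    · exact ⟨0, by simp⟩
    · obtain ⟨i, hi⟩ := exists_eq_ciSup_of_finite (f := fun i => ‖B.repr v i‖)
      exact ⟨_, hi⟩
  have hmem : (⨆ i, ‖B.repr v i‖) ∈ {r : ℝ | ∃ c : K, ∃ ξ ∈ Ξ, v = c • ξ ∧ ‖c‖ = r} := by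
    by_cases h0 : c = 0
    · refine ⟨c, 0, zero_mem _, ?_, hc⟩
      rw [smul_zero]
      refine B.repr.map_eq_zero_iff.1 (Finsupp.ext fun i => ?_)
      have := le_ciSup hbdd i
      rw [← hc, h0, norm_zero] at this
      exact norm_le_zero_iff.1 this
    · refine ⟨c, c⁻¹ • v, (mem_lattice_iff Ξ b _).2 fun i => ?_, by rw [smul_inv_smul₀ h0], hc⟩
      rw [map_smul, Finsupp.smul_apply, smul_eq_mul, norm_mul, norm_inv, inv_mul_le_one₀
        (norm_pos_iff.2 h0), hc]
      exact le_ciSup hbdd i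
  exact ⟨hmem, hlow⟩

lemma gauge_eq (Ξ : Submodule (integers K) U) [Submodule.IsLattice K Ξ] {n : ℕ}
    (b : Module.Basis (Fin n) (integers K) Ξ) (v : U) :
    gauge K Ξ v = ⨆ i, ‖(b.extendOfIsLattice K).repr v i‖ :=
  (gauge_isLeast Ξ b v).csInf_eq

lemma exists_lattice_basis (Ξ : Submodule (integers K) U) [Submodule.IsLattice K Ξ] :
    ∃ n : ℕ, Nonempty (Module.Basis (Fin n) (integers K) Ξ) :=
  ⟨_, ⟨Module.finBasis (integers K) Ξ⟩⟩

/-- The gauge norm of a lattice is a norm. -/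
lemma gauge_isNorm (Ξ : Submodule (integers K) U) [Submodule.IsLattice K Ξ] :
    IsNorm (K := K) (gauge K Ξ) := by
  obtain ⟨n, ⟨b⟩⟩ := exists_lattice_basis Ξ
  have hf : ∀ f : Fin n → ℝ, BddAbove (Set.range f) := fun f => (Set.finite_range f).bddAbove
  have hnn : ∀ v, 0 ≤ gauge K Ξ v := fun v => by
    rw [gauge_eq Ξ b]; exact Real.iSup_nonneg fun i => norm_nonneg _
  refine ⟨hnn, fun v => ⟨fun h => ?_, ?_⟩, fun c v => ?_, fun v v' => ?_⟩
  · rw [gauge_eq Ξ b] at h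
    refine (b.extendOfIsLattice K).repr.map_eq_zero_iff.1 (Finsupp.ext fun i => ?_)
    have := le_ciSup (hf fun i => ‖(b.extendOfIsLattice K).repr v i‖) i
    rw [h] at this
    exact norm_le_zero_iff.1 this
  · rintro rfl
    rw [gauge_eq Ξ b]
    simp
  · rw [gauge_eq Ξ b, gauge_eq Ξ b, Real.mul_iSup_of_nonneg (norm_nonneg _)]
    simp
  · refine (gauge_eq Ξ b (v + v')).trans_le
      (Real.iSup_le (fun i => ?_) (le_max_of_le_left (hnn v)))
    rw [map_add, Finsupp.add_apply, gauge_eq Ξ b, gauge_eq Ξ b]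
    exact (IsUltrametricDist.norm_add_le_max _ _).trans
      (max_le_max (le_ciSup (hf fun i => ‖(b.extendOfIsLattice K).repr v i‖) i)
        (le_ciSup (hf fun i => ‖(b.extendOfIsLattice K).repr v' i‖) i))

/-- The gauge norm of a lattice is splittable. -/
lemma gauge_isSplittable (Ξ : Submodule (integers K) U) [Submodule.IsLattice K Ξ] :
    IsSplittable K (gauge K Ξ) := by
  obtain ⟨n, ⟨b⟩⟩ := exists_lattice_basis Ξ
  refine ⟨n, b.extendOfIsLattice K, fun v => ?_⟩
  rw [gauge_eq Ξ b]
  congr 1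
  ext i
  have : gauge K Ξ ((b.extendOfIsLattice K) i) = 1 := by
    rw [gauge_eq Ξ b]
    have hbdd : BddAbove (Set.range fun j =>
      ‖(b.extendOfIsLattice K).repr ((b.extendOfIsLattice K) i) j‖) := (Set.finite_range _).bddAbove
    apply le_antisymm
    · refine Real.iSup_le (fun j => ?_) zero_le_one
      rw [Module.Basis.repr_self, Finsupp.single_apply]
      split_ifs <;> simp
    · have := le_ciSup hbdd i
      refine le_trans (le_of_eq ?_) this
      simp only [Module.Basis.repr_self, Finsupp.single_eq_same, norm_one]
  rw [this, mul_one]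

end GaugeLemmas

/-- The submodule generated by the values of a bilinear map on two lattices is a lattice, if the
bilinear map generates the target. -/
lemma isLattice_bilin [IsScalarTower (integers K) K U]
    {U' U'' : Type*} [AddCommGroup U'] [Module K U'] [Module (integers K) U']
    [IsScalarTower (integers K) K U'] [AddCommGroup U''] [Module K U''] [Module (integers K) U'']
    [IsScalarTower (integers K) K U'']
    (Ξ : Submodule (integers K) U) (Θ : Submodule (integers K) U')
    [h1 : Submodule.IsLattice K Ξ] [h2 : Submodule.IsLattice K Θ] (B : U →ₗ[K] U' →ₗ[K] U'')
    (hB : Submodule.span K {v | ∃ x y, v = B x y} = ⊤) :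
    Submodule.IsLattice K (Submodule.span (integers K) {v | ∃ ξ ∈ Ξ, ∃ θ ∈ Θ, v = B ξ θ}) := by
  have hset : {v | ∃ ξ ∈ Ξ, ∃ θ ∈ Θ, v = B ξ θ} =
      Set.image2 (fun x y => B x y) (Ξ : Set U) (Θ : Set U') := by
    ext v
    simp only [Set.mem_ofPred_eq, Set.mem_image2, SetLike.mem_coe, eq_comm]
  have hset' : {v | ∃ x y, v = B x y} =
      Set.image2 (fun x y => B x y) (Set.univ : Set U) (Set.univ : Set U') := by
    ext v
    simp [eq_comm]
  rw [hset]
  constructor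
  · have := Submodule.FG.map₂ (LinearMap.restrictScalars₁₂ (integers K) (integers K) B) h1.fg h2.fg
    rw [Submodule.map₂_eq_span_image2] at this
    exact this
  · rw [Submodule.span_span_of_tower, ← hB, hset',
      ← Submodule.map₂_span_span K B, ← Submodule.map₂_span_span K B, h1.span_eq_top,
      h2.span_eq_top, Submodule.span_univ, Submodule.span_univ]

end Norms

/-! ### Degrees, slopes, semistability, Harder–Narasimhan filtrations -/

namespace Isoc

variable {L : Type*} [NormedField L] {σ : L ≃+* L}
  {K : Type*} [NormedField K] [IsUltrametricDist K] [Algebra L K]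

variable (K) in
/-- The base change `D_K = K ⊗ D`. -/
abbrev bc (D : Isoc.{w} σ) : Type _ := K ⊗[L] D.V

variable (K) in
/-- The standard lattice `𝒪_K ⊗ D` in `D_K`. -/
def stdLattice (D : Isoc.{w} σ) : Submodule (integers K) (D.bc K) :=
  Submodule.span (integers K) (Set.range fun d : D.V => (1 : K) ⊗ₜ[L] d)

/-! #### For norms -/

/-- The degree `ν(𝐨, α) - dim D` of `(D, α)`; here `𝐨` is the gauge norm of `𝒪_K ⊗ D`. -/
def deg (D : Isoc.{w} σ) (α : D.bc K → ℝ) : ℝ := nu K (gauge K (D.stdLattice K)) α - D.dim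

/-- The slope of `(D, α)`, for `D ≠ 0`. -/
def slope (D : Isoc.{w} σ) (α : D.bc K → ℝ) : ℝ := D.deg α / D.rank

/-- The restriction of a norm to a subspace. -/
def subNorm (D : Isoc.{w} σ) (α : D.bc K → ℝ) (W : Submodule L D.V) : K ⊗[L] W → ℝ :=
  fun v => α (W.subtype.baseChange K v)

/-- The quotient norm. -/
def quotNorm (D : Isoc.{w} σ) (α : D.bc K → ℝ) (W : Submodule L D.V) : K ⊗[L] (D.V ⧸ W) → ℝ :=
  fun u => sInf {r : ℝ | ∃ v : D.bc K, W.mkQ.baseChange K v = u ∧ α v = r}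

/-- `(D, α)` is semistable: `D ≠ 0`, and the slopes of nonzero subisocrystals with the restricted
norm do not exceed the slope of `(D, α)`. -/
def IsSemistable (D : Isoc.{w} σ) (α : D.bc K → ℝ) : Prop :=
  Nontrivial D.V ∧ ∀ (W : Submodule L D.V) (h : D.IsSub W), W ≠ ⊥ →
    (D.sub W h).slope (K := K) (D.subNorm α W) ≤ D.slope α

/-- The norm induced on `gr^s`. -/
def Filtration.grNorm {D : Isoc.{w} σ} (f : D.Filtration) (α : D.bc K → ℝ) (s : ℝ) :
    (f.gr s).bc K → ℝ :=
  (D.sub (f.Fil s) (f.isSub s)).quotNorm (D.subNorm α (f.Fil s)) (f.plusIn s)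

/-- `f` is a Harder–Narasimhan filtration of `(D, α)`: every graded piece `gr^s` with the induced
norm is zero or semistable of slope `s`. -/
def Filtration.IsHN {D : Isoc.{w} σ} (f : D.Filtration) (α : D.bc K → ℝ) : Prop :=
  ∀ s, Subsingleton (f.gr s).V ∨
    ((f.gr s).IsSemistable (f.grNorm α s) ∧ (f.gr s).slope (f.grNorm α s) = s)

/-! #### For lattices -/

/-- The degree of an isocrystal with lattice: the degree for the gauge norm. -/
def degLat (D : Isoc.{w} σ) (Ξ : Submodule (integers K) (D.bc K)) : ℝ := D.deg (gauge K Ξ)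

/-- The slope of an isocrystal with lattice. -/
def slopeLat (D : Isoc.{w} σ) (Ξ : Submodule (integers K) (D.bc K)) : ℝ := D.degLat Ξ / D.rank

/-- The lattice `Ξ ∩ W_K` induced on a subspace. -/
def subLat (D : Isoc.{w} σ) (Ξ : Submodule (integers K) (D.bc K)) (W : Submodule L D.V) :
    Submodule (integers K) (K ⊗[L] W) :=
  Ξ.comap ((W.subtype.baseChange K).restrictScalars (integers K))

/-- The image of a lattice in a quotient. -/
def quotLat (D : Isoc.{w} σ) (Ξ : Submodule (integers K) (D.bc K)) (W : Submodule L D.V) :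
    Submodule (integers K) (K ⊗[L] (D.V ⧸ W)) :=
  Ξ.map ((W.mkQ.baseChange K).restrictScalars (integers K))

/-- `(D, Ξ)` is semistable: `D ≠ 0`, and the slopes of its nonzero strict subobjects
do not exceed the slope of `(D, Ξ)`. -/
def IsSemistableLat (D : Isoc.{w} σ) (Ξ : Submodule (integers K) (D.bc K)) : Prop :=
  Nontrivial D.V ∧ ∀ (W : Submodule L D.V) (h : D.IsSub W), W ≠ ⊥ →
    (D.sub W h).slopeLat (K := K) (D.subLat Ξ W) ≤ D.slopeLat Ξ

/-- The lattice induced on `gr^s`. -/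
def Filtration.grLat {D : Isoc.{w} σ} (f : D.Filtration) (Ξ : Submodule (integers K) (D.bc K))
    (s : ℝ) : Submodule (integers K) ((f.gr s).bc K) :=
  (D.sub (f.Fil s) (f.isSub s)).quotLat (D.subLat Ξ (f.Fil s)) (f.plusIn s)

/-- `f` is a Harder–Narasimhan filtration of `(D, Ξ)`: every graded piece `gr^s` with the induced
lattice is zero or semistable of slope `s`. -/
def Filtration.IsHNLat {D : Isoc.{w} σ} (f : D.Filtration)
    (Ξ : Submodule (integers K) (D.bc K)) : Prop :=
  ∀ s, Subsingleton (f.gr s).V ∨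
    ((f.gr s).IsSemistableLat (f.grLat Ξ s) ∧ (f.gr s).slopeLat (f.grLat Ξ s) = s)

end Isoc

/-! ### The categories of isocrystals with lattice and of normed isocrystals -/

section Categories

variable {L : Type*} [NormedField L] (σ : L ≃+* L)
  (K : Type*) [NormedField K] [IsUltrametricDist K] [Algebra L K]

/-- Isocrystals with a `K`-lattice. -/
structure BunIsoc where
  D : Isoc.{w} σ
  Ξ : Submodule (integers K) (D.bc K)
  lattice : Submodule.IsLattice K Ξ

/-- Normed isocrystals: isocrystals `D` with a splittable norm on `D_K`. -/
structure NIsoc where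
  D : Isoc.{w} σ
  α : D.bc K → ℝ
  isNorm : IsNorm (K := K) α
  splittable : IsSplittable K α

variable {σ K}

/-- Morphisms of isocrystals with lattice map the first lattice into the second. -/
@[ext]
structure BunIsoc.Hom (X Y : BunIsoc.{w} σ K) where
  hom : X.D ⟶ Y.D
  map_mem : ∀ v ∈ X.Ξ, hom.lin.baseChange K v ∈ Y.Ξ

/-- Morphisms of normed isocrystals do not increase the norm. -/
@[ext]
structure NIsoc.Hom (X Y : NIsoc.{w} σ K) where
  hom : X.D ⟶ Y.D
  le : ∀ v, Y.α (hom.lin.baseChange K v) ≤ X.α v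

lemma baseChange_id_lin (D : Isoc.{w} σ) (v : D.bc K) : (𝟙 D : D ⟶ D).lin.baseChange K v = v := by
  change (LinearMap.id : D.V →ₗ[L] D.V).baseChange K v = v
  simp

lemma baseChange_comp_lin {D E G : Isoc.{w} σ} (f : D ⟶ E) (g : E ⟶ G) (v : D.bc K) :
    (f ≫ g).lin.baseChange K v = g.lin.baseChange K (f.lin.baseChange K v) := by
  change (g.lin ∘ₗ f.lin).baseChange K v = _
  rw [LinearMap.baseChange_comp]
  rfl

instance : Category (BunIsoc.{w} σ K) where
  Hom X Y := BunIsoc.Hom X Y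
  id X := ⟨𝟙 X.D, fun v hv => by rwa [baseChange_id_lin]⟩
  comp f g := ⟨f.hom ≫ g.hom, fun v hv => by
    rw [baseChange_comp_lin]; exact g.map_mem _ (f.map_mem v hv)⟩

instance : Category (NIsoc.{w} σ K) where
  Hom X Y := NIsoc.Hom X Y
  id X := ⟨𝟙 X.D, fun v => by rw [baseChange_id_lin]⟩
  comp f g := ⟨f.hom ≫ g.hom, fun v => by
    rw [baseChange_comp_lin]; exact (g.le _).trans (f.le v)⟩

/-- The functor `(D, Ξ) ↦ (D, α_Ξ)` sending a lattice to its gauge norm. -/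
def gaugeFunctor [IsDiscreteValuationRing (integers K)] : BunIsoc.{w} σ K ⥤ NIsoc.{w} σ K where
  obj X :=
    have := X.lattice
    { D := X.D
      α := gauge K X.Ξ
      isNorm := gauge_isNorm X.Ξ
      splittable := gauge_isSplittable X.Ξ }
  map {X Y} f :=
    { hom := f.hom
      le := fun v => by
        have := X.lattice
        obtain ⟨n, ⟨b⟩⟩ := exists_lattice_basis X.Ξ
        obtain ⟨c, ξ, hξ, hv, hc⟩ := (gauge_isLeast X.Ξ b v).1
        refine le_trans ?_ (hc.trans (gauge_eq X.Ξ b v).symm).le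
        refine csInf_le ⟨0, ?_⟩ ⟨c, _, f.map_mem ξ hξ, ?_, rfl⟩
        · rintro r ⟨c, _, _, _, rfl⟩
          exact norm_nonneg c
        · rw [hv, map_smul] }

/-- The tensor product of isocrystals with lattice; the lattice in
`(D ⊗ D')_K = D_K ⊗ D'_K` is generated by the tensors `ξ ⊗ ξ'`, with `ξ` and `ξ'` in the given
lattices. -/
def tensorLat (D E : Isoc.{w} σ) (Ξ : Submodule (integers K) (D.bc K))
    (Θ : Submodule (integers K) (E.bc K)) : Submodule (integers K) ((D.tensor E).bc K) :=
  Submodule.span (integers K)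
    {v | ∃ ξ ∈ Ξ, ∃ θ ∈ Θ,
      v = (AlgebraTensorModule.distribBaseChange L K D.V E.V).symm (ξ ⊗ₜ[K] θ)}

lemma tensorLat_isLattice (X Y : BunIsoc.{w} σ K) :
    Submodule.IsLattice K (tensorLat X.D Y.D X.Ξ Y.Ξ) := by
  have h1 := X.lattice
  have h2 := Y.lattice
  refine isLattice_bilin X.Ξ Y.Ξ ((TensorProduct.mk K (X.D.bc K) (Y.D.bc K)).compr₂
    (AlgebraTensorModule.distribBaseChange L K X.D.V Y.D.V).symm.toLinearMap) ?_
  rw [eq_top_iff]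
  rintro v -
  obtain ⟨t, rfl⟩ := (AlgebraTensorModule.distribBaseChange L K X.D.V Y.D.V).symm.surjective v
  induction t using TensorProduct.induction_on with
  | zero => rw [map_zero]; exact zero_mem _
  | tmul x y => exact Submodule.subset_span ⟨x, y, rfl⟩
  | add a b ha hb => rw [map_add]; exact add_mem ha hb

namespace BunIsoc

/-- The tensor product of isocrystals with lattice. -/
def tensor (X Y : BunIsoc.{w} σ K) : BunIsoc.{w} σ K where
  D := X.D.tensor Y.D
  Ξ := tensorLat X.D Y.D X.Ξ Y.Ξ
  lattice := tensorLat_isLattice X Y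

/-- The rank of an isocrystal with lattice. -/
def rank (X : BunIsoc.{w} σ K) : ℕ := X.D.rank

/-- The degree of an isocrystal with lattice. -/
def deg (X : BunIsoc.{w} σ K) : ℝ := X.D.degLat X.Ξ

/-- Semistability of an isocrystal with lattice. -/
def IsSemistable (X : BunIsoc.{w} σ K) : Prop := X.D.IsSemistableLat X.Ξ

/-- `f` is a Harder–Narasimhan filtration of the isocrystal with lattice `X`. -/
def IsHN (X : BunIsoc.{w} σ K) (f : X.D.Filtration) : Prop := f.IsHNLat X.Ξ

/-- Short exact sequences `0 → X → Y → Z → 0`: short exact sequences of isocrystals in which the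
lattice of `X` is induced from that of `Y`, and the lattice of `Z` is the image of that
of `Y`. -/
structure ShortExact {X Y Z : BunIsoc.{w} σ K} (f : X ⟶ Y) (g : Y ⟶ Z) : Prop where
  inj : Function.Injective f.hom.lin
  exact : Function.Exact f.hom.lin g.hom.lin
  surj : Function.Surjective g.hom.lin
  sub : ∀ v : X.D.bc K, v ∈ X.Ξ ↔ f.hom.lin.baseChange K v ∈ Y.Ξ
  quot : ∀ u ∈ Z.Ξ, ∃ v ∈ Y.Ξ, g.hom.lin.baseChange K v = u

variable (σ K) in
/-- The axioms on rank and degree in a Harder–Narasimhan formalism: the rank vanishes exactly on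
zero objects, rank and degree are additive on short exact sequences, the rank is constant and the
degree is nondecreasing on mono-epis, with equality only for isomorphisms. -/
structure RankDegreeAxioms : Prop where
  rank_eq_zero : ∀ X : BunIsoc.{w} σ K, X.rank = 0 ↔ Subsingleton X.D.V
  rank_add : ∀ {X Y Z : BunIsoc.{w} σ K} (f : X ⟶ Y) (g : Y ⟶ Z), ShortExact f g →
    Y.rank = X.rank + Z.rank
  deg_add : ∀ {X Y Z : BunIsoc.{w} σ K} (f : X ⟶ Y) (g : Y ⟶ Z), ShortExact f g →
    Y.deg = X.deg + Z.deg
  rank_eq : ∀ {X Y : BunIsoc.{w} σ K} (f : X ⟶ Y) [Mono f] [Epi f], X.rank = Y.rank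
  deg_le : ∀ {X Y : BunIsoc.{w} σ K} (f : X ⟶ Y) [Mono f] [Epi f], X.deg ≤ Y.deg
  deg_eq_iff : ∀ {X Y : BunIsoc.{w} σ K} (f : X ⟶ Y) [Mono f] [Epi f],
    X.deg = Y.deg ↔ IsIso f

end BunIsoc

/-- `f` is a Harder–Narasimhan filtration of the normed isocrystal `X`. -/
def NIsoc.IsHN (X : NIsoc.{w} σ K) (f : X.D.Filtration) : Prop := f.IsHN X.α

variable (σ K) in
/-- Functors from isocrystals with lattice to filtered isocrystals which are the identity on the
underlying isocrystals and morphisms: a filtration of each object by subisocrystals, respected by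
all morphisms. -/
structure FilteringFunctor where
  fil : ∀ X : BunIsoc.{w} σ K, X.D.Filtration
  map_mem : ∀ {X Y : BunIsoc.{w} σ K} (f : X ⟶ Y) (s : ℝ),
    ∀ x ∈ (fil X).Fil s, f.hom.lin x ∈ (fil Y).Fil s

end Categories

end IsocLat

end

/-!
Harder–Narasimhan filtrations. The degree is a supermodular function on the modular lattice of
subisocrystals (`subDeg_supermodular`), so for every real `s` the function `deg - s · rank` has a
largest maximizer. These maximizers form a filtration, and a filtration has semistable graded pieces
of the right slopes if and only if its steps are these maximizers (`isHNLat_iff_eq`). Existence,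
uniqueness and functoriality (`hnFil_map`) follow, since a morphism does not decrease degrees.
The norms induced by a gauge norm on subobjects and quotients are the gauge norms of the induced
lattices (`subNorm_gauge`, `quotNorm_gauge`), so the filtrations of `(D, Ξ)` and of its normed
isocrystal are the same (`isHN_gauge`).

Tensor products of semistable objects. Let `U` be a `d`-dimensional subisocrystal of `V ⊗ W`. Real
weights `a`, `b` on bases of `V` and `W` give weights to the Plücker coordinates of `U`. In analogy
with Kempf's optimal destabilizing one-parameter subgroups, consider over the algebraic closure the
weighted bases maximizing `min wt - (∑ a ^ 2 + ∑ b ^ 2) / 2`, where the minimum is over the nonzero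
Plücker coordinates. Two filtrations have a common adapted basis and the objective is strictly
concave there, so the optimal pair of filtrations is unique (`IsOptimal.level_eq`). By Galois descent
it is therefore defined over the base field (`exists_isGeomOptimal`), and it is stable under the
Frobenius (`IsGeomOptimal.triangular`), hence a pair of filtrations by subisocrystals. The vanishing
of the derivative at the optimum says that for any further weights `η`, `θ` some nonzero Plücker
coordinate of the associated graded space has weight at most `∑ a η + ∑ b θ`
(`IsGeomOptimal.exists_weight_le`), in bases of the graded pieces over any extension field.

This inequality is used twice. Over the residue field of `K`, with the elementary divisors of the
lattices on the graded pieces as weights, it bounds the covolume of the lattice of `U`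
(`IsGeomOptimal.exists_addVal_minor_le`). Over the base field, with the Newton slopes of the graded
pieces as weights, it bounds the determinant of the Frobenius on `U`
(`IsGeomOptimal.log_det_le`). The Dieudonné–Manin classification is not needed for the latter: it is
enough to have a basis whose exponents of growth under the iterates of the Frobenius sum up to the
logarithm of the determinant (`exists_newton_basis`). The exponents come from the
Harder–Narasimhan filtration of the standard lattice, and the growth estimate from the absence of
larger slopes (`SlopesLT.exists_bound`).

The two bounds combine to `exists_degree_bound`: the degree of `U` is at most the sum of `a` times
the degrees of the graded pieces of `V` and `b` times those of `W`, where `∑ a = ∑ b = d`. If `V` and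
`W` are semistable, then summation by parts bounds this by `d` times the sum of the slopes
(`isSemistableLat_tensor`).

Compatibility with tensor products in general. Since a morphism from a semistable object to an object
with smaller slopes vanishes, induction on the steps shows that the tensor product filtration is
contained in the Harder–Narasimhan filtration of the tensor product (`tmul_mem_hnFil`). The weights of
both have total sum equal to the degree of the tensor product, so they agree (`hnFil_tensor`).
-/

noncomputable section

namespace IsocLat

open scoped Kronecker Matrix

universe w

set_option linter.unusedSectionVars false

/-! ### Valuations and the Frobenius -/

section Valuations

variable {E : Type*} [NormedField E]

lemma expo_mul {r s : ℝ} (hr : r ≠ 0) (hs : s ≠ 0) : expo E (r * s) = expo E r + expo E s := by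
  rw [expo, expo, expo, Real.log_mul hr hs, add_div]

@[simp] lemma addVal_one : addVal (1 : E) = 0 := by simp [addVal, expo]

lemma addVal_mul {x y : E} (hx : x ≠ 0) (hy : y ≠ 0) : addVal (x * y) = addVal x + addVal y := by
  rw [addVal, norm_mul, expo_mul (norm_ne_zero_iff.2 hx) (norm_ne_zero_iff.2 hy)]
  rfl

lemma addVal_eq_of_norm_eq {x y : E} (h : ‖x‖ = ‖y‖) : addVal x = addVal y := by
  rw [addVal, addVal, h]

lemma addVal_eq_zero_of_norm {x : E} (h : ‖x‖ = 1) : addVal x = 0 := by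
  rw [addVal, h, expo, Real.log_one, zero_div]

lemma addVal_inv (x : E) : addVal x⁻¹ = -addVal x := by
  rw [addVal, addVal, norm_inv, expo, expo, Real.log_inv, neg_div]

lemma addVal_pow (x : E) (n : ℕ) : addVal (x ^ n) = n * addVal x := by
  rw [addVal, addVal, norm_pow, expo, expo, Real.log_pow, mul_div_assoc]

lemma addVal_prod {ι : Type*} (s : Finset ι) (f : ι → E) (h : ∀ i ∈ s, f i ≠ 0) :
    addVal (∏ i ∈ s, f i) = ∑ i ∈ s, addVal (f i) := by
  classical
  induction s using Finset.induction_on with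
  | empty => simp
  | insert a s ha ih =>
    rw [Finset.prod_insert ha, Finset.sum_insert ha, addVal_mul (h a (Finset.mem_insert_self a s))
      (Finset.prod_ne_zero_iff.2 fun i hi => h i (Finset.mem_insert_of_mem hi)),
      ih fun i hi => h i (Finset.mem_insert_of_mem hi)]

lemma uniformizerNorm_nonneg : 0 ≤ uniformizerNorm E :=
  Real.sSup_nonneg (by rintro r ⟨-, x, rfl⟩; exact norm_nonneg x)

lemma uniformizerNorm_le_one : uniformizerNorm E ≤ 1 :=
  Real.sSup_le (by rintro r ⟨h, -⟩; exact h.le) zero_le_one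

lemma log_uniformizerNorm_nonpos : Real.log (uniformizerNorm E) ≤ 0 :=
  Real.log_nonpos uniformizerNorm_nonneg uniformizerNorm_le_one

variable [IsUltrametricDist E] [IsDiscreteValuationRing (integers E)]

lemma exists_uniformizer : ∃ x : E, ‖x‖ = uniformizerNorm E ∧ 0 < ‖x‖ ∧ ‖x‖ < 1 := by
  obtain ⟨ϖ, hϖ⟩ := IsDiscreteValuationRing.exists_irreducible (integers E)
  have h0 : (ϖ : E) ≠ 0 := fun h => hϖ.ne_zero (Subtype.ext h)
  have hunit : ∀ x : integers E, IsUnit x ↔ ‖(x : E)‖ = 1 := by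
    intro x
    constructor
    · rintro ⟨y, rfl⟩
      have h1 := mem_integers.1 (y : integers E).2
      have h2 := mem_integers.1 ((y⁻¹ : (integers E)ˣ) : integers E).2
      have h3 : ((y : integers E) : E) * ((y⁻¹ : (integers E)ˣ) : integers E) = 1 := by
        exact_mod_cast congrArg Subtype.val y.mul_inv
      have h4 := congrArg norm h3
      rw [norm_mul, norm_one] at h4
      nlinarith [norm_nonneg ((y : integers E) : E),
        norm_nonneg (((y⁻¹ : (integers E)ˣ) : integers E) : E)]
    · intro h
      have hx : (x : E) ≠ 0 := by rw [← norm_ne_zero_iff, h]; exact one_ne_zero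
      refine IsUnit.of_mul_eq_one (⟨(x : E)⁻¹, mem_integers.2 (by rw [norm_inv, h, inv_one])⟩ : integers E)
        (Subtype.ext ?_)
      exact mul_inv_cancel₀ hx
  have hlt : ‖(ϖ : E)‖ < 1 := lt_of_le_of_ne (mem_integers.1 ϖ.2) fun h =>
    hϖ.not_isUnit ((hunit ϖ).2 h)
  refine ⟨ϖ, ?_, norm_pos_iff.2 h0, hlt⟩
  have hmax : IsGreatest {r : ℝ | r < 1 ∧ ∃ x : E, ‖x‖ = r} ‖(ϖ : E)‖ := by
    refine ⟨⟨hlt, ϖ, rfl⟩, ?_⟩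
    rintro r ⟨hr, x, rfl⟩
    have hx : (⟨x, mem_integers.2 hr.le⟩ : integers E) ∈ IsLocalRing.maximalIdeal (integers E) := by
      rw [IsLocalRing.mem_maximalIdeal, mem_nonunits_iff, hunit]
      exact hr.ne
    rw [hϖ.maximalIdeal_eq, Ideal.mem_span_singleton] at hx
    obtain ⟨y, hy⟩ := hx
    have hy' : x = ϖ * y := congrArg Subtype.val hy
    rw [hy', norm_mul]
    exact mul_le_of_le_one_right (norm_nonneg _) (mem_integers.1 y.2)
  exact hmax.csSup_eq.symm

lemma log_uniformizerNorm_neg : Real.log (uniformizerNorm E) < 0 := by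
  obtain ⟨x, hx, h0, h1⟩ := exists_uniformizer (E := E)
  rw [← hx]
  exact Real.log_neg h0 h1

lemma addVal_nonneg_iff {x : E} : 0 ≤ addVal x ↔ ‖x‖ ≤ 1 := by
  rw [addVal, expo, ← Real.log_nonpos_iff (norm_nonneg x), div_nonneg_iff]
  have := log_uniformizerNorm_neg (E := E)
  constructor
  · rintro (h | h)
    · exact absurd h.2 this.not_ge
    · exact h.1
  · exact fun h => Or.inr ⟨h, this.le⟩

lemma addVal_eq_zero_iff {x : E} (hx : x ≠ 0) : addVal x = 0 ↔ ‖x‖ = 1 := by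
  refine ⟨fun h => le_antisymm (addVal_nonneg_iff.1 h.ge) ?_, addVal_eq_zero_of_norm⟩
  have h1 := (addVal_nonneg_iff (x := x⁻¹)).1 (by rw [addVal_inv, h, neg_zero])
  rw [norm_inv] at h1
  exact (inv_le_one₀ (norm_pos_iff.2 hx)).1 h1

end Valuations

section Frobenius

/-- An endomorphism of an ultrametric field which is congruent to a power map on the ring of
integers preserves the valuation ring, and it is an isometry as soon as it fixes some element of
absolute value in `(0, 1)`, which pins down the exponent relating the two absolute values. -/
lemma norm_eq_of_congr_pow {E : Type*} [NormedField E] [IsUltrametricDist E] (σ : E ≃+* E) (q : ℕ)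
    (hσ : ∀ x, ‖x‖ ≤ 1 → ‖σ x - x ^ q‖ < 1) (ϖ : E) (hϖ : σ ϖ = ϖ) (h0 : 0 < ‖ϖ‖) (h1 : ‖ϖ‖ < 1)
    (x : E) : ‖σ x‖ = ‖x‖ := by
  have hq : q ≠ 0 := by
    rintro rfl
    have := hσ 0 (by simp)
    simp at this
  have hlt : ∀ y, ‖y‖ < 1 → ‖σ y‖ < 1 := fun y hy => by
    have h2 : ‖y ^ q‖ < 1 := by rw [norm_pow]; exact pow_lt_one₀ (norm_nonneg _) hy hq
    have h3 := IsUltrametricDist.norm_add_le_max (σ y - y ^ q) (y ^ q)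
    rw [sub_add_cancel] at h3
    exact h3.trans_lt (max_lt (hσ y hy.le) h2)
  have hgt : ∀ y, 1 < ‖y‖ → 1 < ‖σ y‖ := fun y hy => by
    have h2 := hlt y⁻¹ (by rw [norm_inv]; exact inv_lt_one_of_one_lt₀ hy)
    rw [map_inv₀, norm_inv] at h2
    by_contra! h3
    have hy0 : σ y ≠ 0 := by
      rw [Ne, map_eq_zero]; rintro rfl; simp at hy; linarith
    exact absurd h2 ((one_le_inv₀ (norm_pos_iff.2 hy0)).2 h3).not_gt
  by_cases hx : x = 0
  · simp [hx]
  have hx' : σ x ≠ 0 := by simpa using hx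
  have hpos := norm_pos_iff.2 hx
  have hpos' := norm_pos_iff.2 hx'
  have hϖ0 : ϖ ≠ 0 := norm_pos_iff.1 h0
  set P := -Real.log ‖ϖ‖ with hP
  have hPpos : 0 < P := by rw [hP, neg_pos]; exact Real.log_neg h0 h1
  have hlog : ∀ (z : E) (n : ℕ) (m : ℤ), z ≠ 0 →
      Real.log ‖z ^ n * ϖ ^ m‖ = n * Real.log ‖z‖ - m * P := fun z n m hz => by
    rw [norm_mul, Real.log_mul (norm_ne_zero_iff.2 (pow_ne_zero _ hz))
      (norm_ne_zero_iff.2 (zpow_ne_zero _ hϖ0)), norm_pow, norm_zpow, Real.log_pow, Real.log_zpow]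
    ring
  have hne : ∀ (z : E) (n : ℕ) (m : ℤ), z ≠ 0 → 0 < ‖z ^ n * ϖ ^ m‖ := fun z n m hz =>
    norm_pos_iff.2 (mul_ne_zero (pow_ne_zero _ hz) (zpow_ne_zero _ hϖ0))
  have hmap : ∀ (n : ℕ) (m : ℤ), σ (x ^ n * ϖ ^ m) = (σ x) ^ n * ϖ ^ m := fun n m => by
    rw [map_mul, map_pow, map_zpow₀, hϖ]
  have hA : ∀ (n : ℕ) (m : ℤ), n * Real.log ‖x‖ < m * P → n * Real.log ‖σ x‖ < m * P := by
    intro n m h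
    have h2 := hlt (x ^ n * ϖ ^ m) ((Real.log_neg_iff (hne x n m hx)).1
      (by rw [hlog x n m hx]; linarith))
    rw [hmap] at h2
    have h3 := Real.log_neg (hne _ n m hx') h2
    rw [hlog _ n m hx'] at h3
    linarith
  have hB : ∀ (n : ℕ) (m : ℤ), m * P < n * Real.log ‖x‖ → m * P < n * Real.log ‖σ x‖ := by
    intro n m h
    have h2 := hgt (x ^ n * ϖ ^ m) ((Real.log_pos_iff (hne x n m hx).le).1
      (by rw [hlog x n m hx]; linarith))
    rw [hmap] at h2
    have h3 := Real.log_pos h2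
    rw [hlog _ n m hx'] at h3
    linarith
  refine Real.log_injOn_pos hpos' hpos (le_antisymm ?_ ?_)
  · by_contra! h
    obtain ⟨n, hn⟩ := exists_nat_gt (P / (Real.log ‖σ x‖ - Real.log ‖x‖))
    rw [div_lt_iff₀ (by linarith)] at hn
    have h2 := Int.lt_floor_add_one (n * Real.log ‖x‖ / P)
    have h3 := Int.floor_le (n * Real.log ‖x‖ / P)
    rw [div_lt_iff₀ hPpos] at h2
    rw [le_div_iff₀ hPpos] at h3
    have h4 := hA n (⌊n * Real.log ‖x‖ / P⌋ + 1) (by push_cast; linarith)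
    push_cast at h4
    nlinarith
  · by_contra! h
    obtain ⟨n, hn⟩ := exists_nat_gt (P / (Real.log ‖x‖ - Real.log ‖σ x‖))
    rw [div_lt_iff₀ (by linarith)] at hn
    have h2 := Int.ceil_lt_add_one (n * Real.log ‖x‖ / P)
    have h3 := Int.le_ceil (n * Real.log ‖x‖ / P)
    rw [← sub_lt_iff_lt_add, lt_div_iff₀ hPpos] at h2
    have h4 := hB n (⌈n * Real.log ‖x‖ / P⌉ - 1) (by push_cast; linarith)
    rw [div_le_iff₀ hPpos] at h3
    push_cast at h4
    nlinarith

variable {p : ℕ} [Fact p.Prime] {F : Type*} [Field F] [Algebra ℚ_[p] F]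

instance (ι : F →ₐ[ℚ_[p]] ℂ_[p]) : IsUltrametricDist (Breve ι) :=
  ⟨fun x y z => IsUltrametricDist.dist_triangle_max (x : ℂ_[p]) y z⟩

instance (ι : F →ₐ[ℚ_[p]] ℂ_[p]) : CompleteSpace (Breve ι) :=
  (Subfield.isClosed_topologicalClosure (maxUnramified ι)).completeSpace_coe

instance (ι : F →ₐ[ℚ_[p]] ℂ_[p]) : CharZero (Breve ι) :=
  (RingHom.charZero_iff (Breve ι).subtype.injective).2 inferInstance

lemma norm_p_breve (ι : F →ₐ[ℚ_[p]] ℂ_[p]) : ‖(p : Breve ι)‖ = (p : ℝ)⁻¹ := by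
  change ‖((p : Breve ι) : ℂ_[p])‖ = _
  have h : ((p : Breve ι) : ℂ_[p]) = algebraMap ℚ_[p] ℂ_[p] (p : ℚ_[p]) := by simp
  rw [h, norm_algebraMap', Padic.norm_p]

lemma IsFrobenius.norm_map {ι : F →ₐ[ℚ_[p]] ℂ_[p]} {σ : Breve ι ≃+* Breve ι}
    (hσ : IsFrobenius ι σ) (x : Breve ι) : ‖σ x‖ = ‖x‖ := by
  have hp := (Fact.out : p.Prime)
  refine norm_eq_of_congr_pow σ (residueCard ι) hσ.frob (p : Breve ι) (map_natCast σ p) ?_ ?_ x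
  · rw [norm_p_breve]; exact inv_pos.2 (by exact_mod_cast hp.pos)
  · rw [norm_p_breve]; exact inv_lt_one_of_one_lt₀ (by exact_mod_cast hp.one_lt)

/-- A field contained in the ring of integers of `K` is trivially normed by the norm of `K`. -/
lemma norm_algebraMap_of_integral {L K : Type*} [Field L] [NormedField K] [IsUltrametricDist K]
    [Algebra L K] (hK : ∀ x : L, algebraMap L K x ∈ integers K) {x : L} (hx : x ≠ 0) :
    ‖algebraMap L K x‖ = 1 := by
  refine le_antisymm (mem_integers.1 (hK x)) ?_
  have h1 := mem_integers.1 (hK x⁻¹)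
  rw [map_inv₀, norm_inv] at h1
  exact (inv_le_one₀ (norm_pos_iff.2 ((map_ne_zero _).2 hx))).1 h1

end Frobenius

/-! ### Bases of lattices and relative positions -/

section LatticeBases

variable {K : Type*} [NormedField K] [IsUltrametricDist K]

lemma norm_det_le_one {ι : Type*} [Fintype ι] [DecidableEq ι] (M : Matrix ι ι K)
    (h : ∀ i j, ‖M i j‖ ≤ 1) : ‖M.det‖ ≤ 1 := by
  rw [← mem_integers, Matrix.det_apply]
  refine sum_mem fun σ _ => ?_
  rw [Units.smul_def]
  exact zsmul_mem (prod_mem fun i _ => mem_integers.2 (h _ _)) _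

variable {U : Type*} [AddCommGroup U] [Module K U] [Module (integers K) U]

/-- The `K`-basis `e` is an `𝒪_K`-basis of the lattice `Ξ`: membership in `Ξ` means that all
coordinates are integral. -/
def IsBasisOf {ι : Type*} (e : Module.Basis ι K U) (Ξ : Submodule (integers K) U) : Prop :=
  ∀ v, v ∈ Ξ ↔ ∀ i, ‖e.repr v i‖ ≤ 1

namespace IsBasisOf

variable {ι κ : Type*} {e : Module.Basis ι K U} {Ξ Θ : Submodule (integers K) U}

lemma mem (h : IsBasisOf e Ξ) (i : ι) : e i ∈ Ξ := by
  classical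
  refine (h _).2 fun j => ?_
  rw [Module.Basis.repr_self, Finsupp.single_apply]
  split_ifs <;> simp

lemma reindex (h : IsBasisOf e Ξ) (f : ι ≃ κ) : IsBasisOf (e.reindex f) Ξ := fun v => by
  rw [h v]
  simp only [Module.Basis.repr_reindex, Finsupp.mapDomain_equiv_apply]
  exact ⟨fun h i => h _, fun h i => by simpa using h (f i)⟩

variable [Fintype ι] [DecidableEq ι]

lemma norm_det_le_one (h : IsBasisOf e Ξ) {f : ι → U} (hf : ∀ i, f i ∈ Ξ) : ‖e.det f‖ ≤ 1 := by
  rw [Module.Basis.det_apply]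
  exact IsocLat.norm_det_le_one _ fun i j => (h _).1 (hf j) i

lemma det_mul_det (e f g : Module.Basis ι K U) : e.det f * f.det g = e.det g := by
  rw [Module.Basis.det_apply, Module.Basis.det_apply, Module.Basis.det_apply, ← Matrix.det_mul,
    Module.Basis.toMatrix_mul_toMatrix]

lemma det_ne_zero (e f : Module.Basis ι K U) : e.det f ≠ 0 := (e.isUnit_det f).ne_zero

lemma norm_det_eq_one (h : IsBasisOf e Ξ) {f : Module.Basis ι K U} (hf : IsBasisOf f Ξ) :
    ‖e.det f‖ = 1 := by
  have h1 := h.norm_det_le_one hf.mem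
  have h2 := hf.norm_det_le_one h.mem
  have h3 := congrArg norm (det_mul_det e f e)
  rw [norm_mul, Module.Basis.det_self, norm_one] at h3
  nlinarith [norm_nonneg (e.det f), norm_nonneg (f.det e)]

/-- A sublattice with the same covolume is the whole lattice. -/
lemma le_of_norm_det_eq_one (h : IsBasisOf e Ξ) {f : Module.Basis ι K U} (hf : IsBasisOf f Θ)
    (hle : Ξ ≤ Θ) (hdet : ‖f.det e‖ = 1) : Θ ≤ Ξ := by
  intro v hv
  rw [h v]
  intro i
  have hu : IsUnit (f.toMatrix e).det := f.isUnit_det e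
  have h1 : e.toMatrix f = (f.toMatrix e).det⁻¹ • (f.toMatrix e).adjugate := by
    rw [← Ring.inverse_eq_inv', ← Matrix.inv_def]
    exact (Matrix.inv_eq_left_inv (by rw [Module.Basis.toMatrix_mul_toMatrix, Module.Basis.toMatrix_self])).symm
  have h2 : ∀ j, ‖e.toMatrix f i j‖ ≤ 1 := by
    intro j
    rw [Module.Basis.det_apply] at hdet
    rw [h1, Matrix.smul_apply, smul_eq_mul, norm_mul, norm_inv, hdet, inv_one, one_mul,
      Matrix.adjugate_apply]
    refine IsocLat.norm_det_le_one _ fun k l => ?_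
    rw [Matrix.updateRow_apply]
    split_ifs
    · rw [Pi.single_apply]; split_ifs <;> simp
    · exact (hf _).1 (hle (h.mem l)) k
  have h3 : e.repr v i = ∑ j, e.toMatrix f i j * f.repr v j := by
    exact (congrFun (Module.Basis.toMatrix_mulVec_repr f e v) i).symm
  rw [h3, ← mem_integers]
  exact sum_mem fun j _ => mul_mem (mem_integers.2 (h2 j)) (mem_integers.2 ((hf v).1 hv j))

variable [IsScalarTower (integers K) K U]

lemma sum_smul_mem {f : ι → U} (hf : ∀ i, f i ∈ Ξ) {c : ι → K} (hc : ∀ i, ‖c i‖ ≤ 1) :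
    ∑ i, c i • f i ∈ Ξ := by
  refine Submodule.sum_mem _ fun i _ => ?_
  have := Ξ.smul_mem (⟨c i, mem_integers.2 (hc i)⟩ : integers K) (hf i)
  rwa [← algebraMap_smul K] at this

lemma isLattice (h : IsBasisOf e Ξ) : Submodule.IsLattice K Ξ := by
  have hle : Ξ = Submodule.span (integers K) (Set.range e) := by
    refine le_antisymm (fun v hv => ?_) (Submodule.span_le.2 (by rintro _ ⟨i, rfl⟩; exact h.mem i))
    rw [← e.sum_repr v]
    exact sum_smul_mem (fun i => Submodule.subset_span (Set.mem_range_self i)) ((h v).1 hv)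
  constructor
  · rw [hle]
    exact Submodule.fg_span (Set.finite_range e)
  · rw [eq_top_iff, ← e.span_eq]
    exact Submodule.span_mono (by rintro _ ⟨i, rfl⟩; exact h.mem i)

lemma gauge_isLeast (h : IsBasisOf e Ξ) (v : U) :
    IsLeast {r : ℝ | ∃ c : K, ∃ ξ ∈ Ξ, v = c • ξ ∧ ‖c‖ = r} (⨆ i, ‖e.repr v i‖) := by
  have hbdd : BddAbove (Set.range fun i => ‖e.repr v i‖) := (Set.finite_range _).bddAbove
  obtain ⟨c, hc⟩ : ∃ c : K, ‖c‖ = ⨆ i, ‖e.repr v i‖ := by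
    rcases isEmpty_or_nonempty ι with hn | hn
    · exact ⟨0, by simp⟩
    · obtain ⟨i, hi⟩ := exists_eq_ciSup_of_finite (f := fun i => ‖e.repr v i‖)
      exact ⟨_, hi⟩
  constructor
  · by_cases h0 : c = 0
    · refine ⟨c, 0, zero_mem _, ?_, hc⟩
      rw [smul_zero]
      refine e.repr.map_eq_zero_iff.1 (Finsupp.ext fun i => ?_)
      have := le_ciSup hbdd i
      rw [← hc, h0, norm_zero] at this
      exact norm_le_zero_iff.1 this
    · refine ⟨c, c⁻¹ • v, (h _).2 fun i => ?_, by rw [smul_inv_smul₀ h0], hc⟩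
      rw [map_smul, Finsupp.smul_apply, smul_eq_mul, norm_mul, norm_inv, inv_mul_le_one₀
        (norm_pos_iff.2 h0), hc]
      exact le_ciSup hbdd i
  · rintro r ⟨c, ξ, hξ, rfl, rfl⟩
    refine Real.iSup_le (fun i => ?_) (norm_nonneg _)
    rw [map_smul, Finsupp.smul_apply, smul_eq_mul, norm_mul]
    exact mul_le_of_le_one_right (norm_nonneg _) ((h ξ).1 hξ i)

lemma gauge_eq (h : IsBasisOf e Ξ) (v : U) : gauge K Ξ v = ⨆ i, ‖e.repr v i‖ :=
  (h.gauge_isLeast v).csInf_eq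

/-- A lattice is the unit ball of its gauge norm. -/
lemma gauge_le_one_iff (h : IsBasisOf e Ξ) (v : U) : gauge K Ξ v ≤ 1 ↔ v ∈ Ξ := by
  have hbdd : BddAbove (Set.range fun i => ‖e.repr v i‖) := (Set.finite_range _).bddAbove
  rw [h v, h.gauge_eq]
  exact ⟨fun h1 i => (le_ciSup hbdd i).trans h1, fun h1 => Real.iSup_le h1 zero_le_one⟩

end IsBasisOf

variable [IsScalarTower (integers K) K U]

section

variable {ι : Type*} [Fintype ι] [DecidableEq ι] {Ξ : Submodule (integers K) U}

/-- Rescaling an orthogonal basis of a gauge norm gives a basis of the lattice. -/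
lemma IsOrthogonal.exists_units {n : ℕ} {b : Module.Basis (Fin n) K U}
    {e : Module.Basis ι K U} (he : IsBasisOf e Ξ) (hb : IsOrthogonal (gauge K Ξ) b) :
    ∃ x : Fin n → Kˣ, (∀ i, ‖(x i : K)‖ = gauge K Ξ (b i)) ∧
      IsBasisOf (b.unitsSMul fun i => (x i)⁻¹) Ξ := by
  have h1 : ∀ i, ∃ x : Kˣ, ‖(x : K)‖ = gauge K Ξ (b i) := by
    intro i
    obtain ⟨c, ξ, -, h2, h3⟩ := (he.gauge_isLeast (b i)).1
    refine ⟨Units.mk0 c ?_, by rw [he.gauge_eq]; exact h3⟩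
    rintro rfl
    exact b.ne_zero i (by rw [h2, zero_smul])
  choose x hx using h1
  refine ⟨x, hx, fun v => ?_⟩
  have hbdd : BddAbove (Set.range fun i => ‖b.repr v i‖ * gauge K Ξ (b i)) :=
    (Set.finite_range _).bddAbove
  have h4 : ∀ i, ‖(b.unitsSMul fun i => (x i)⁻¹).repr v i‖ = ‖b.repr v i‖ * gauge K Ξ (b i) := by
    intro i
    rw [Module.Basis.repr_unitsSMul, inv_inv, Units.smul_def, smul_eq_mul, norm_mul, hx, mul_comm]
  simp only [h4]
  rw [← he.gauge_le_one_iff, hb v]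
  exact ⟨fun h i => (le_ciSup hbdd i).trans h, fun h => Real.iSup_le h zero_le_one⟩

/-- A basis which becomes a basis of the lattice after rescaling is orthogonal for the gauge
norm. -/
lemma IsBasisOf.isOrthogonal_unitsSMul {n : ℕ} {b : Module.Basis (Fin n) K U} {x : Fin n → Kˣ}
    (h : IsBasisOf (b.unitsSMul x) Ξ) : IsOrthogonal (gauge K Ξ) b := by
  have h1 : ∀ v i, ‖(b.unitsSMul x).repr v i‖ = ‖b.repr v i‖ * ‖(x i : K)‖⁻¹ := by
    intro v i
    rw [Module.Basis.repr_unitsSMul, Units.smul_def, smul_eq_mul, norm_mul, Units.val_inv_eq_inv_val,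
      norm_inv, mul_comm]
  have h2 : ∀ i, gauge K Ξ (b i) = ‖(x i : K)‖⁻¹ := by
    intro i
    rw [h.gauge_eq]
    simp only [h1]
    have hbdd : BddAbove (Set.range fun j => ‖b.repr (b i) j‖ * ‖(x j : K)‖⁻¹) :=
      (Set.finite_range _).bddAbove
    apply le_antisymm
    · refine Real.iSup_le (fun j => ?_) (inv_nonneg.2 (norm_nonneg _))
      rw [Module.Basis.repr_self, Finsupp.single_apply]
      split_ifs with hij
      · subst hij; simp
      · simp
    · refine le_trans (le_of_eq ?_) (le_ciSup hbdd i)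
      simp
  intro v
  rw [h.gauge_eq]
  simp only [h1, h2]

end

variable [IsDiscreteValuationRing (integers K)]

lemma exists_isBasisOf (Ξ : Submodule (integers K) U) [Submodule.IsLattice K Ξ]
    {ι : Type*} [Fintype ι] (b : Module.Basis ι K U) :
    ∃ e : Module.Basis ι K U, IsBasisOf e Ξ := by
  obtain ⟨n, ⟨c⟩⟩ := exists_lattice_basis Ξ
  have h : IsBasisOf (c.extendOfIsLattice K) Ξ := mem_lattice_iff Ξ c
  exact ⟨_, h.reindex ((c.extendOfIsLattice K).indexEquiv b)⟩

/-- Elementary divisors: two lattices have proportional bases. -/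
lemma exists_proportional_bases (Ξ Θ : Submodule (integers K) U) [Submodule.IsLattice K Ξ]
    [Submodule.IsLattice K Θ] {ι : Type*} [Fintype ι] [DecidableEq ι] (b : Module.Basis ι K U) :
    ∃ (e : Module.Basis ι K U) (x : ι → Kˣ), IsBasisOf e Ξ ∧ IsBasisOf (e.unitsSMul x) Θ := by
  obtain ⟨m, ⟨c0⟩⟩ := exists_lattice_basis Ξ
  let c : Module.Basis ι (integers K) Ξ := c0.reindex ((c0.extendOfIsLattice K).indexEquiv b)
  have hc : IsBasisOf (c.extendOfIsLattice K) Ξ := by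
    have h : IsBasisOf (c0.extendOfIsLattice K) Ξ := mem_lattice_iff Ξ c0
    have h2 := h.reindex ((c0.extendOfIsLattice K).indexEquiv b)
    convert h2 using 1
    ext i
    simp [c]
  obtain ⟨f, hf⟩ := exists_isBasisOf Θ b
  obtain ⟨ϖ, -, hϖ0, hϖ1⟩ := exists_uniformizer (E := K)
  -- a power of the uniformizer which multiplies `Θ` into `Ξ`
  obtain ⟨N, hN⟩ : ∃ N : ℕ, ∀ i j, ‖ϖ ^ N * (c.extendOfIsLattice K).repr (f i) j‖ ≤ 1 := by
    have h1 : ∀ p : ι × ι, ∀ᶠ N : ℕ in Filter.atTop,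
        ‖ϖ ^ N * (c.extendOfIsLattice K).repr (f p.1) p.2‖ ≤ 1 := by
      intro p
      have h2 : Filter.Tendsto (fun N : ℕ => ‖ϖ‖ ^ N * ‖(c.extendOfIsLattice K).repr (f p.1) p.2‖)
          Filter.atTop (nhds (0 * ‖(c.extendOfIsLattice K).repr (f p.1) p.2‖)) :=
        (tendsto_pow_atTop_nhds_zero_of_lt_one (norm_nonneg _) hϖ1).mul_const _
      rw [zero_mul] at h2
      filter_upwards [h2.eventually (ge_mem_nhds zero_lt_one)] with N hN
      rwa [norm_mul, norm_pow]
    obtain ⟨N, hN⟩ := (Filter.eventually_all.2 h1).exists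
    exact ⟨N, fun i j => hN (i, j)⟩
  have hϖ : ϖ ≠ 0 := norm_pos_iff.1 hϖ0
  set u : Kˣ := Units.mk0 (ϖ ^ N) (pow_ne_zero _ hϖ) with hu
  have hmem : ∀ i, (ϖ ^ N) • f i ∈ Ξ := fun i => (hc _).2 fun j => by
    rw [map_smul, Finsupp.smul_apply, smul_eq_mul]
    exact hN i j
  -- the scaled lattice, inside `Ξ`
  let P : Submodule (integers K) Ξ :=
    Submodule.span (integers K) (Set.range fun i => (⟨_, hmem i⟩ : Ξ))
  have hg : IsBasisOf (f.unitsSMul fun _ => u) (P.map Ξ.subtype) := by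
    have h1 : P.map Ξ.subtype = Submodule.span (integers K) (Set.range (f.unitsSMul fun _ => u)) := by
      rw [Submodule.map_span, ← Set.range_comp]
      congr 1
      ext v
      simp [Module.Basis.unitsSMul_apply, hu, Units.smul_def]
    intro v
    rw [h1]
    constructor
    · intro hv
      induction hv using Submodule.span_induction with
      | mem x hx =>
        obtain ⟨i, rfl⟩ := hx
        intro j
        rw [Module.Basis.repr_self, Finsupp.single_apply]
        split_ifs <;> simp
      | zero => simp
      | add x y _ _ hx hy =>
        intro i
        rw [map_add, Finsupp.add_apply]
        exact (IsUltrametricDist.norm_add_le_max _ _).trans (max_le (hx i) (hy i))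
      | smul a x _ hx =>
        intro i
        rw [← algebraMap_smul K a x, map_smul, Finsupp.smul_apply, smul_eq_mul, norm_mul]
        exact mul_le_one₀ (mem_integers.1 a.2) (norm_nonneg _) (hx i)
    · intro hv
      rw [← (f.unitsSMul fun _ => u).sum_repr v]
      exact IsBasisOf.sum_smul_mem (fun i => Submodule.subset_span (Set.mem_range_self i)) hv
  have hP : Submodule.IsLattice K (P.map Ξ.subtype) := hg.isLattice
  have hrank : Module.finrank (integers K) P = Module.finrank (integers K) Ξ := by
    obtain ⟨m', ⟨d⟩⟩ := exists_lattice_basis (P.map Ξ.subtype)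
    have e1 : P ≃ₗ[integers K] (P.map Ξ.subtype) :=
      Submodule.equivMapOfInjective _ (Submodule.injective_subtype _) P
    rw [e1.finrank_eq, Module.finrank_eq_card_basis d, Module.finrank_eq_card_basis c0,
      Fintype.card_congr ((d.extendOfIsLattice K).indexEquiv (c0.extendOfIsLattice K))]
  obtain ⟨b', a, ab', hab⟩ := Submodule.exists_smith_normal_form_of_rank_eq c hrank
  have he : IsBasisOf (b'.extendOfIsLattice K) Ξ := by
    have h : IsBasisOf ((b'.reindex (Fintype.equivFin ι)).extendOfIsLattice K) Ξ :=
      mem_lattice_iff Ξ _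
    have h2 := h.reindex (Fintype.equivFin ι).symm
    convert h2 using 1
    ext i
    simp
  have ha : ∀ i, ((a i : integers K) : K) ≠ 0 := by
    intro i h0
    have : a i = 0 := Subtype.ext h0
    have h1 := hab i
    rw [this, zero_smul] at h1
    exact ab'.ne_zero i (Subtype.ext h1)
  refine ⟨b'.extendOfIsLattice K, fun i => u⁻¹ * Units.mk0 _ (ha i), he, fun v => ?_⟩
  have h5 : v ∈ Θ ↔ (ϖ ^ N) • v ∈ P.map Ξ.subtype := by
    rw [hf v, hg]
    refine forall_congr' fun i => ?_
    rw [Module.Basis.repr_unitsSMul, map_smul, Finsupp.smul_apply, hu, smul_eq_mul,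
      Units.smul_def, smul_eq_mul, Units.val_inv_eq_inv_val, Units.val_mk0, inv_mul_cancel_left₀
      (pow_ne_zero _ hϖ)]
  rw [h5]
  let d : Module.Basis ι (integers K) (P.map Ξ.subtype) :=
    ab'.map (Submodule.equivMapOfInjective _ (Submodule.injective_subtype _) P)
  have hd : IsBasisOf (d.extendOfIsLattice K) (P.map Ξ.subtype) := by
    have h : IsBasisOf ((d.reindex (Fintype.equivFin ι)).extendOfIsLattice K) (P.map Ξ.subtype) :=
      mem_lattice_iff _ _
    have h2 := h.reindex (Fintype.equivFin ι).symm
    convert h2 using 1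
    ext i
    simp
  have hde : d.extendOfIsLattice K = (b'.extendOfIsLattice K).unitsSMul fun i => Units.mk0 _ (ha i) := by
    ext i
    rw [Module.Basis.extendOfIsLattice_apply, Module.Basis.unitsSMul_apply,
      Module.Basis.extendOfIsLattice_apply]
    change ((ab' i : Ξ) : U) = _
    rw [hab i, Submodule.coe_smul, ← algebraMap_smul K (a i) (b' i : U)]
    rfl
  rw [hd, hde]
  refine forall_congr' fun i => ?_
  rw [Module.Basis.repr_unitsSMul, Module.Basis.repr_unitsSMul, map_smul, Finsupp.smul_apply, hu,
    mul_inv, inv_inv, mul_comm, mul_smul]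
  rfl

/-- The relative position of two gauge norms is the valuation of a determinant. -/
lemma nu_gauge {Ξ Θ : Submodule (integers K) U} {ι : Type*} [Fintype ι] [DecidableEq ι]
    {e f : Module.Basis ι K U} (he : IsBasisOf e Ξ) (hf : IsBasisOf f Θ) :
    nu K (gauge K Ξ) (gauge K Θ) = addVal (f.det e) := by
  have := he.isLattice
  have := hf.isLattice
  have : Module.Finite K U := Module.Finite.of_basis e
  have hex : ∃ b : Module.Basis (Fin (Module.finrank K U)) K U,
      IsOrthogonal (gauge K Ξ) b ∧ IsOrthogonal (gauge K Θ) b := by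
    obtain ⟨b, x, h1, h2⟩ := exists_proportional_bases Ξ Θ (Module.finBasis K U)
    refine ⟨b, IsBasisOf.isOrthogonal_unitsSMul (x := fun _ => 1) ?_, h2.isOrthogonal_unitsSMul⟩
    convert h1 using 1
    ext i
    simp [Module.Basis.unitsSMul_apply]
  rw [nu, dif_pos hex]
  generalize hex.choose = b, hex.choose_spec = hb
  obtain ⟨x, hx, hbx⟩ := hb.1.exists_units he
  obtain ⟨y, hy, hby⟩ := hb.2.exists_units hf
  let q : Fin (Module.finrank K U) ≃ ι := b.indexEquiv e
  set bx := (b.unitsSMul fun i => (x i)⁻¹)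
  set bY := (b.unitsSMul fun i => (y i)⁻¹)
  have h1 : bY.det bx = ∏ i, ((y i : K) * (x i : K)⁻¹) := by
    have h2 : ⇑bx = fun i => ((y i : K) * (x i : K)⁻¹) • bY i := by
      ext i
      rw [Module.Basis.unitsSMul_apply, Module.Basis.unitsSMul_apply, Units.smul_def, Units.smul_def,
        smul_smul]
      congr 1
      simp
      field_simp
    rw [h2, AlternatingMap.map_smul_univ, Module.Basis.det_self, smul_eq_mul, mul_one]
  have h3 : addVal (bY.det bx) =
      ∑ i, (expo K (gauge K Θ (b i)) - expo K (gauge K Ξ (b i))) := by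
    rw [h1, addVal_prod _ _ fun i _ => mul_ne_zero (y i).ne_zero (inv_ne_zero (x i).ne_zero)]
    refine Finset.sum_congr rfl fun i _ => ?_
    rw [addVal_mul (y i).ne_zero (inv_ne_zero (x i).ne_zero), addVal_inv, addVal, addVal, hx, hy]
    ring
  rw [← h3]
  have h4 : bY.det bx = (bY.reindex q).det (bx.reindex q) := by
    rw [Module.Basis.det_reindex]
    congr 1
    ext i
    simp
  have h5 := (he.norm_det_eq_one (hbx.reindex q))
  have h6 := ((hby.reindex q).norm_det_eq_one hf)
  refine addVal_eq_of_norm_eq ?_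
  rw [h4, ← IsBasisOf.det_mul_det _ f, ← IsBasisOf.det_mul_det f e, norm_mul, norm_mul, h5, h6, one_mul, mul_one]

end LatticeBases

/-! ### Degrees -/

/-- The standing assumptions relating `L`, its Frobenius `σ` and `K`: the Frobenius is isometric,
and `L` is contained in the ring of integers of `K`, so that `K` induces the trivial absolute value
on `L`. -/
class Admissible {L : Type*} [NormedField L] (σ : L ≃+* L) (K : Type*) [NormedField K]
    [Algebra L K] : Prop where
  norm_map : ∀ x, ‖σ x‖ = ‖x‖
  norm_algebraMap : ∀ x : L, x ≠ 0 → ‖algebraMap L K x‖ = 1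

/-- In a short exact sequence `0 → V' → V → V'' → 0`, a basis of `V'` and lifts of a basis of `V''`
form a basis of `V`. -/
lemma exists_basis_of_exact {k V' V V'' : Type*} [Field k] [AddCommGroup V'] [Module k V']
    [AddCommGroup V] [Module k V] [AddCommGroup V''] [Module k V''] {f : V' →ₗ[k] V}
    {g : V →ₗ[k] V''} (hf : Function.Injective f) (hfg : Function.Exact f g) {ι κ : Type*}
    [Fintype ι] [Fintype κ] (b' : Module.Basis ι k V') (b'' : Module.Basis κ k V'') (t : κ → V)
    (ht : ∀ j, g (t j) = b'' j) :
    ∃ b : Module.Basis (ι ⊕ κ) k V, (∀ i, b (Sum.inl i) = f (b' i)) ∧ (∀ j, b (Sum.inr j) = t j) ∧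
      (∀ x i, b.repr (f x) (Sum.inl i) = b'.repr x i) ∧
      (∀ x j, b.repr x (Sum.inr j) = b''.repr (g x) j) := by
  have hgf : ∀ x, g (f x) = 0 := fun x => (hfg _).2 ⟨x, rfl⟩
  have hli : LinearIndependent k (Sum.elim (fun i => f (b' i)) t) := by
    rw [Fintype.linearIndependent_iff]
    intro c hc
    rw [Fintype.sum_sum_type] at hc
    simp only [Sum.elim_inl, Sum.elim_inr] at hc
    have h1 := congrArg g hc
    simp only [map_add, map_sum, map_smul, hgf, ht, smul_zero, Finset.sum_const_zero, zero_add,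
      map_zero] at h1
    have h2 := Fintype.linearIndependent_iff.1 b''.linearIndependent _ h1
    simp only [h2, zero_smul, Finset.sum_const_zero, add_zero, ← map_smul, ← map_sum] at hc
    have h3 := Fintype.linearIndependent_iff.1 b'.linearIndependent _
      (hf (hc.trans (map_zero f).symm))
    rintro (i | j)
    · exact h3 i
    · exact h2 j
  have hsp : ⊤ ≤ Submodule.span k (Set.range (Sum.elim (fun i => f (b' i)) t)) := by
    rintro x -
    have h1 : g (x - ∑ j, b''.repr (g x) j • t j) = 0 := by
      simp only [map_sub, map_sum, map_smul, ht, b''.sum_repr, sub_self]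
    obtain ⟨y, hy⟩ := (hfg _).1 h1
    rw [← sub_add_cancel x (∑ j, b''.repr (g x) j • t j), ← hy, ← b'.sum_repr y]
    simp only [map_sum, map_smul]
    exact add_mem (Submodule.sum_mem _ fun i _ => Submodule.smul_mem _ _
      (Submodule.subset_span ⟨Sum.inl i, rfl⟩)) (Submodule.sum_mem _ fun j _ =>
      Submodule.smul_mem _ _ (Submodule.subset_span ⟨Sum.inr j, rfl⟩))
  obtain ⟨b, hb⟩ : ∃ b : Module.Basis (ι ⊕ κ) k V, ⇑b = Sum.elim (fun i => f (b' i)) t :=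
    ⟨Module.Basis.mk hli hsp, Module.Basis.coe_mk hli hsp⟩
  have hl : ∀ i, b (Sum.inl i) = f (b' i) := fun i => by rw [hb]; rfl
  have hr : ∀ j, b (Sum.inr j) = t j := fun i => by rw [hb]; rfl
  classical
  refine ⟨b, hl, hr, fun x i => ?_, fun x j => ?_⟩
  · have : b.coord (Sum.inl i) ∘ₗ f = b'.coord i := by
      refine b'.ext fun l => ?_
      simp only [LinearMap.comp_apply, ← hl, Module.Basis.coord_apply, Module.Basis.repr_self,
        Finsupp.single_apply, Sum.inl.injEq]
    exact LinearMap.congr_fun this x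
  · have : b.coord (Sum.inr j) = b''.coord j ∘ₗ g := by
      refine b.ext fun l => ?_
      rw [Module.Basis.coord_apply, Module.Basis.repr_self, LinearMap.comp_apply]
      rcases l with l | l
      · rw [hl, hgf, map_zero]; simp
      · rw [hr, ht, Module.Basis.coord_apply, Module.Basis.repr_self]
        simp only [Finsupp.single_apply, Sum.inr.injEq]
    exact LinearMap.congr_fun this x

namespace Isoc

section PhiMatrix

variable {L : Type*} [Field L] {σ : L ≃+* L}

/-- The matrix of the Frobenius of an isocrystal in a basis. -/
def phiMatrix (D : Isoc.{w} σ) {ι : Type*} (v : Module.Basis ι L D.V) : Matrix ι ι L :=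
  Matrix.of fun i j => v.repr (D.φ (v j)) i

variable (D : Isoc.{w} σ) {ι κ : Type*} [Fintype ι]

lemma repr_phi (v : Module.Basis ι L D.V) (v' : Module.Basis κ L D.V) (x : D.V) (i : κ) :
    v'.repr (D.φ x) i = ∑ k, v'.repr (D.φ (v k)) i * σ (v.repr x k) := by
  conv_lhs => rw [← v.sum_repr x]
  simp only [map_sum, LinearMap.map_smulₛₗ, map_smul]
  rw [Finsupp.finsetSum_apply]
  exact Finset.sum_congr rfl fun k _ => mul_comm _ _

variable [DecidableEq ι]

/-- The `σ`-twisted change of basis for the matrix of the Frobenius. -/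
lemma toMatrix_mul_phiMatrix (v v' : Module.Basis ι L D.V) :
    v'.toMatrix v * D.phiMatrix v = D.phiMatrix v' * (v'.toMatrix v).map σ := by
  ext i j
  rw [Matrix.mul_apply, Matrix.mul_apply]
  refine Eq.trans ?_ (D.repr_phi v' v' (v j) i)
  have h := congrFun (Module.Basis.toMatrix_mulVec_repr v v' (D.φ (v j))) i
  exact h

lemma det_phiMatrix_ne_zero (v : Module.Basis ι L D.V) : (D.phiMatrix v).det ≠ 0 := by
  intro h
  obtain ⟨c, hc0, hc⟩ := Matrix.exists_mulVec_eq_zero_iff.2 h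
  apply hc0
  have h1 : D.φ (∑ j, σ.symm (c j) • v j) = 0 := by
    refine v.repr.map_eq_zero_iff.1 (Finsupp.ext fun i => ?_)
    have h2 := congrFun hc i
    rw [D.repr_phi v v]
    simp only [map_sum, map_smul, Module.Basis.repr_self, Finsupp.finsetSum_apply,
      Finsupp.smul_apply, Finsupp.single_apply, smul_eq_mul, mul_ite, mul_one, mul_zero,
      Finset.sum_ite_eq', Finset.mem_univ, if_true, RingEquiv.apply_symm_apply]
    exact h2
  have h3 := D.bij.1 (h1.trans (map_zero D.φ).symm)
  have h4 := Fintype.linearIndependent_iff.1 v.linearIndependent _ h3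
  ext j
  simpa using h4 j

end PhiMatrix

section Dim

variable {L : Type*} [NormedField L] {σ : L ≃+* L} (hσ : ∀ x, ‖σ x‖ = ‖x‖) (D : Isoc.{w} σ)
  {ι : Type*} [Fintype ι] [DecidableEq ι]

include hσ in
lemma norm_det_phiMatrix_eq (v v' : Module.Basis ι L D.V) :
    ‖(D.phiMatrix v).det‖ = ‖(D.phiMatrix v').det‖ := by
  have h := congrArg (fun M => ‖Matrix.det M‖) (D.toMatrix_mul_phiMatrix v v')
  simp only [Matrix.det_mul, norm_mul] at h
  have h2 : ((v'.toMatrix v).map σ).det = σ (v'.toMatrix v).det :=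
    (RingHom.map_det (σ : L →+* L) _).symm
  rw [h2, hσ, mul_comm] at h
  exact mul_right_cancel₀ (norm_ne_zero_iff.2 (v'.isUnit_det v).ne_zero) h

include hσ in
/-- The dimension may be computed in any basis, since `σ` is isometric and a change of basis
multiplies the determinant of the Frobenius by some `σ x / x`. -/
lemma dim_eq (v : Module.Basis ι L D.V) : D.dim = addVal (D.phiMatrix v).det := by
  let q : ι ≃ Fin (Module.finrank L D.V) := v.indexEquiv (Module.finBasis L D.V)
  have h : (D.phiMatrix (v.reindex q)).det = (D.phiMatrix v).det := by
    rw [← Matrix.det_submatrix_equiv_self q.symm (D.phiMatrix v)]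
    congr 1
    ext i j
    simp [phiMatrix]
  rw [← h]
  exact addVal_eq_of_norm_eq (D.norm_det_phiMatrix_eq hσ _ _)

end Dim

section Degree

variable {L : Type*} [NormedField L] {σ : L ≃+* L}
  {K : Type*} [NormedField K] [IsUltrametricDist K] [Algebra L K] [Admissible σ K]

lemma norm_algebraMap_le (σ : L ≃+* L) [Admissible σ K] (x : L) : ‖algebraMap L K x‖ ≤ 1 := by
  by_cases hx : x = 0
  · simp [hx]
  · exact (Admissible.norm_algebraMap σ x hx).le

/-- A basis of `D` is a basis of the standard lattice, as all elements of `L` are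
integral in `K`. -/
lemma isBasisOf_stdLattice (D : Isoc.{w} σ) {ι : Type*} [Fintype ι] [DecidableEq ι] (v : Module.Basis ι L D.V) :
    IsBasisOf (Algebra.TensorProduct.basis K v) (D.stdLattice K) := by
  intro x
  constructor
  · intro hx
    induction hx using Submodule.span_induction with
    | mem x hx =>
      obtain ⟨d, rfl⟩ := hx
      intro i
      rw [Algebra.TensorProduct.basis_repr_tmul]
      simpa using norm_algebraMap_le σ (v.repr d i)
    | zero => simp
    | add x y _ _ hx hy =>
      intro i
      rw [map_add, Finsupp.add_apply]
      exact (IsUltrametricDist.norm_add_le_max _ _).trans (max_le (hx i) (hy i))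
    | smul a x _ hx =>
      intro i
      rw [← algebraMap_smul K a x, map_smul, Finsupp.smul_apply, smul_eq_mul, norm_mul]
      exact mul_le_one₀ (mem_integers.1 a.2) (norm_nonneg _) (hx i)
  · intro hx
    rw [← (Algebra.TensorProduct.basis K v).sum_repr x]
    refine IsBasisOf.sum_smul_mem (fun i => ?_) hx
    rw [Algebra.TensorProduct.basis_apply]
    exact Submodule.subset_span ⟨_, rfl⟩

variable [IsDiscreteValuationRing (integers K)]

/-- The degree in terms of determinants. -/
lemma degLat_eq (D : Isoc.{w} σ) {Ξ : Submodule (integers K) (D.bc K)} {ι : Type*} [Fintype ι]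
    [DecidableEq ι] (v : Module.Basis ι L D.V) {e : Module.Basis ι K (D.bc K)}
    (he : IsBasisOf e Ξ) :
    D.degLat Ξ = addVal (e.det (Algebra.TensorProduct.basis K v)) -
      addVal (D.phiMatrix v).det := by
  rw [degLat, deg, nu_gauge (D.isBasisOf_stdLattice v) he,
    D.dim_eq (Admissible.norm_map K) v]

/-- A bijective morphism of isocrystals respecting lattices does not decrease the degree; if the
degree is constant then it is an isomorphism of lattices. -/
lemma degLat_le_of_bijective {D E : Isoc.{w} σ} (f : D ⟶ E) (hf : Function.Bijective f.lin)
    {Ξ : Submodule (integers K) (D.bc K)} {Θ : Submodule (integers K) (E.bc K)}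
    [Submodule.IsLattice K Ξ] [Submodule.IsLattice K Θ]
    (hmap : ∀ v ∈ Ξ, f.lin.baseChange K v ∈ Θ) :
    D.degLat Ξ ≤ E.degLat Θ ∧
      (D.degLat Ξ = E.degLat Θ → ∀ v, f.lin.baseChange K v ∈ Θ → v ∈ Ξ) := by
  classical
  let F : D.V ≃ₗ[L] E.V := LinearEquiv.ofBijective f.lin hf
  have hFK : ∀ x, (F.baseChange L K D.V E.V) x = f.lin.baseChange K x := fun x => rfl
  let v := Module.finBasis L D.V
  let v' : Module.Basis _ L E.V := v.map F
  obtain ⟨e, he⟩ := exists_isBasisOf Ξ (Algebra.TensorProduct.basis K v)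
  obtain ⟨e', he'⟩ := exists_isBasisOf Θ (Algebra.TensorProduct.basis K v')
  let e1 : Module.Basis _ K (E.bc K) := e.map (F.baseChange L K D.V E.V)
  have hphi : E.phiMatrix v' = D.phiMatrix v := by
    ext i j
    simp only [phiMatrix, Matrix.of_apply, v', Module.Basis.map_apply, Module.Basis.map_repr,
      LinearEquiv.trans_apply]
    have : E.φ (F (v j)) = F (D.φ (v j)) := (f.comm _).symm
    rw [this, LinearEquiv.symm_apply_apply]
  have hdet : e1.det (Algebra.TensorProduct.basis K v') =
      e.det (Algebra.TensorProduct.basis K v) := by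
    rw [Module.Basis.det_map]
    congr 1
    ext i
    simp only [Function.comp, Algebra.TensorProduct.basis_apply, v', Module.Basis.map_apply]
    rw [LinearEquiv.symm_apply_eq]
    rfl
  have hmem : ∀ i, e1 i ∈ Θ := fun i => by
    rw [Module.Basis.map_apply]
    exact hmap _ (he.mem i)
  have hdeg : E.degLat Θ = D.degLat Ξ + addVal (e'.det e1) := by
    rw [D.degLat_eq v he, E.degLat_eq v' he', hphi, ← IsBasisOf.det_mul_det e' e1,
      addVal_mul (IsBasisOf.det_ne_zero (K := K) _ _) (IsBasisOf.det_ne_zero (K := K) _ _), hdet]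
    ring
  have h1 : 0 ≤ addVal (e'.det e1) := addVal_nonneg_iff.2 (he'.norm_det_le_one hmem)
  refine ⟨by linarith, fun heq u hu => ?_⟩
  have h2 : ‖e'.det e1‖ = 1 :=
    (addVal_eq_zero_iff (IsBasisOf.det_ne_zero (K := K) _ _)).1 (by linarith)
  let Ξ' : Submodule (integers K) (E.bc K) := Ξ.map ((f.lin.baseChange K).restrictScalars (integers K))
  have h3 : IsBasisOf e1 Ξ' := by
    intro x
    have h4 : x ∈ Ξ' ↔ (F.baseChange L K D.V E.V).symm x ∈ Ξ := by
      constructor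
      · rintro ⟨y, hy, rfl⟩
        have : (F.baseChange L K D.V E.V).symm ((F.baseChange L K D.V E.V) y) ∈ Ξ := by
          rwa [LinearEquiv.symm_apply_apply]
        exact this
      · intro hx
        exact ⟨_, hx, (F.baseChange L K D.V E.V).apply_symm_apply x⟩
    rw [h4, he]
    rfl
  have h5 := h3.le_of_norm_det_eq_one he' (by
    rintro _ ⟨y, hy, rfl⟩
    exact hmap y hy) h2 hu
  obtain ⟨y, hy, hyu⟩ := h5
  have : y = u := (F.baseChange L K D.V E.V).injective hyu
  exact this ▸ hy

/-- The degree is additive on short exact sequences. -/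
lemma degLat_add_of_exact {D' D D'' : Isoc.{w} σ} (f : D' ⟶ D) (g : D ⟶ D'')
    (hf : Function.Injective f.lin) (hfg : Function.Exact f.lin g.lin)
    (hg : Function.Surjective g.lin) {Ξ' : Submodule (integers K) (D'.bc K)}
    {Ξ : Submodule (integers K) (D.bc K)} {Ξ'' : Submodule (integers K) (D''.bc K)}
    [Submodule.IsLattice K Ξ'] [Submodule.IsLattice K Ξ'']
    (hsub : ∀ v, v ∈ Ξ' ↔ f.lin.baseChange K v ∈ Ξ)
    (hmap : ∀ v ∈ Ξ, g.lin.baseChange K v ∈ Ξ'')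
    (hquot : ∀ u ∈ Ξ'', ∃ v ∈ Ξ, g.lin.baseChange K v = u) :
    D.degLat Ξ = D'.degLat Ξ' + D''.degLat Ξ'' := by
  classical
  let v' := Module.finBasis L D'.V
  let v'' := Module.finBasis L D''.V
  obtain ⟨v, hv1, hv2, hv3, hv4⟩ := exists_basis_of_exact hf hfg v' v''
    (fun j => Function.surjInv hg (v'' j)) (fun j => Function.surjInv_eq hg _)
  obtain ⟨e', he'⟩ := exists_isBasisOf Ξ' (Algebra.TensorProduct.basis K v')
  obtain ⟨e'', he''⟩ := exists_isBasisOf Ξ'' (Algebra.TensorProduct.basis K v'')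
  choose t ht1 ht2 using fun j => hquot _ (he''.mem j)
  have hfK : Function.Injective (f.lin.baseChange K) :=
    Module.Flat.lTensor_preserves_injective_linearMap f.lin hf
  have hfgK : Function.Exact (f.lin.baseChange K) (g.lin.baseChange K) :=
    lTensor_exact K hfg hg
  obtain ⟨e, he1, he2, he3, he4⟩ := exists_basis_of_exact hfK hfgK e' e'' t ht2
  have he : IsBasisOf e Ξ := by
    intro x
    constructor
    · intro hx
      have h1 : ∀ j, ‖e.repr x (Sum.inr j)‖ ≤ 1 := fun j => by
        rw [he4]
        exact (he'' _).1 (hmap x hx) j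
      have h2 : x = ∑ i, e.repr x (Sum.inl i) • f.lin.baseChange K (e' i) +
          ∑ j, e.repr x (Sum.inr j) • t j := by
        conv_lhs => rw [← e.sum_repr x, Fintype.sum_sum_type]
        simp only [he1, he2]
      have h3 : f.lin.baseChange K (∑ i, e.repr x (Sum.inl i) • e' i) ∈ Ξ := by
        have h4 : f.lin.baseChange K (∑ i, e.repr x (Sum.inl i) • e' i) =
            x - ∑ j, e.repr x (Sum.inr j) • t j := by
          rw [map_sum]
          simp only [map_smul]
          exact eq_sub_of_add_eq h2.symm
        rw [h4]
        exact sub_mem hx (IsBasisOf.sum_smul_mem ht1 h1)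
      rintro (i | j)
      · have h5 := (he' _).1 ((hsub _).2 h3) i
        rwa [Module.Basis.repr_sum_self] at h5
      · exact h1 j
    · intro hx
      rw [← e.sum_repr x]
      refine IsBasisOf.sum_smul_mem (fun i => ?_) hx
      rcases i with i | j
      · rw [he1]; exact (hsub _).1 (he'.mem i)
      · rw [he2]; exact ht1 j
  have hM : e.toMatrix (Algebra.TensorProduct.basis K v) =
      Matrix.fromBlocks (e'.toMatrix (Algebra.TensorProduct.basis K v'))
        (Matrix.of fun i j => e.repr (Algebra.TensorProduct.basis K v (Sum.inr j)) (Sum.inl i)) 0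
        (e''.toMatrix (Algebra.TensorProduct.basis K v'')) := by
    ext i j
    rcases i with i | i <;> rcases j with j | j
    · have h1 : Algebra.TensorProduct.basis K v (Sum.inl j) =
          f.lin.baseChange K (Algebra.TensorProduct.basis K v' j) := by
        simp only [Algebra.TensorProduct.basis_apply, hv1, LinearMap.baseChange_tmul]
      rw [Matrix.fromBlocks_apply₁₁, Module.Basis.toMatrix_apply, h1, he3]
      rfl
    · rfl
    · have h1 : Algebra.TensorProduct.basis K v (Sum.inl j) =
          f.lin.baseChange K (Algebra.TensorProduct.basis K v' j) := by
        simp only [Algebra.TensorProduct.basis_apply, hv1, LinearMap.baseChange_tmul]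
      rw [Matrix.fromBlocks_apply₂₁, Module.Basis.toMatrix_apply, h1, he4,
        (hfgK _).2 ⟨_, rfl⟩]
      simp
    · have h1 : g.lin.baseChange K (Algebra.TensorProduct.basis K v (Sum.inr j)) =
          Algebra.TensorProduct.basis K v'' j := by
        simp only [Algebra.TensorProduct.basis_apply, hv2, LinearMap.baseChange_tmul,
          Function.surjInv_eq]
      rw [Matrix.fromBlocks_apply₂₂, Module.Basis.toMatrix_apply, he4, h1]
      rfl
  have hP : D.phiMatrix v = Matrix.fromBlocks (D'.phiMatrix v')
        (Matrix.of fun i j => v.repr (D.φ (v (Sum.inr j))) (Sum.inl i)) 0 (D''.phiMatrix v'') := by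
    ext i j
    rcases i with i | i <;> rcases j with j | j
    · rw [Matrix.fromBlocks_apply₁₁, phiMatrix, Matrix.of_apply, hv1, ← f.comm, hv3]
      rfl
    · rfl
    · rw [Matrix.fromBlocks_apply₂₁, phiMatrix, Matrix.of_apply, hv1, ← f.comm, hv4,
        (hfg _).2 ⟨_, rfl⟩]
      simp
    · rw [Matrix.fromBlocks_apply₂₂, phiMatrix, Matrix.of_apply, hv4, g.comm, hv2,
        Function.surjInv_eq hg]
      rfl
  rw [D.degLat_eq v he, D'.degLat_eq v' he', D''.degLat_eq v'' he'', Module.Basis.det_apply, hM, hP,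
    Matrix.det_fromBlocks_zero₂₁, Matrix.det_fromBlocks_zero₂₁, ← Module.Basis.det_apply,
    ← Module.Basis.det_apply, addVal_mul (IsBasisOf.det_ne_zero (K := K) _ _)
    (IsBasisOf.det_ne_zero (K := K) _ _), addVal_mul (D'.det_phiMatrix_ne_zero _)
    (D''.det_phiMatrix_ne_zero _)]
  ring

end Degree

end Isoc

/-! ### Harder–Narasimhan filtrations in lattices of finite length -/

section HNLattice

variable {α : Type*} [Lattice α]

/-- `m` is the largest element at which `δ` attains its maximum. -/
def IsLargestMax (δ : α → ℝ) (m : α) : Prop := (∀ a, δ a ≤ δ m) ∧ ∀ a, δ m ≤ δ a → a ≤ m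

lemma IsLargestMax.unique {δ : α → ℝ} {m m' : α} (h : IsLargestMax δ m) (h' : IsLargestMax δ m') :
    m = m' :=
  le_antisymm (h'.2 m (h.1 m')) (h.2 m' (h'.1 m))

variable [BoundedOrder α] {rk : α → ℕ} (hrk : StrictMono rk)
  {δ : α → ℝ} (hδ : ∀ a b, δ a + δ b ≤ δ (a ⊔ b) + δ (a ⊓ b))

include hrk hδ

/-- A supermodular function on a lattice of finite length attains its maximum on the upper
intervals: if `b > a` has minimal rank with `δ a < δ b`, then a maximum above `b` is a maximum
above `a`. -/
lemma exists_max_above (a : α) : ∃ m, a ≤ m ∧ ∀ b, a ≤ b → δ b ≤ δ m := by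
  by_cases h : ∀ b, a ≤ b → δ b ≤ δ a
  · exact ⟨a, le_rfl, h⟩
  push Not at h
  obtain ⟨b, ⟨hab, hb⟩, hmin⟩ := (measure rk).wf.has_min {b | a ≤ b ∧ δ a < δ b} h
  have hlt : a < b := lt_of_le_of_ne hab (by rintro rfl; exact lt_irrefl _ hb)
  have hlt' : rk ⊤ - rk b < rk ⊤ - rk a := by
    have := hrk hlt
    have := hrk.monotone (le_top : b ≤ ⊤)
    omega
  obtain ⟨m, hm, hmax⟩ := exists_max_above b
  refine ⟨m, hab.trans hm, fun c hc => ?_⟩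
  by_cases hbc : b ≤ c
  · exact hmax c hbc
  have h1 := hδ c b
  have h2 := hmax (c ⊔ b) le_sup_right
  have h3 : δ (c ⊓ b) ≤ δ a := by
    by_contra! h4
    refine hmin (c ⊓ b) ⟨le_inf hc hab, h4⟩ (hrk (lt_of_le_of_ne inf_le_right fun h5 => ?_))
    exact hbc (inf_eq_right.1 h5)
  linarith
termination_by rk ⊤ - rk a

/-- The supremum of two maximizers is a maximizer, by supermodularity. -/
lemma exists_isLargestMax : ∃ m, IsLargestMax δ m := by
  obtain ⟨m0, -, hm0⟩ := exists_max_above hrk hδ ⊥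
  have hfin : ∀ a, rk a ≤ rk ⊤ := fun a => hrk.monotone le_top
  obtain ⟨m, hm, hmin⟩ := (measure fun a => rk ⊤ - rk a).wf.has_min {m | δ m0 ≤ δ m}
    ⟨m0, le_refl (δ m0)⟩
  have hmax : ∀ a, δ a ≤ δ m := fun a => (hm0 a bot_le).trans hm
  refine ⟨m, hmax, fun a ha => ?_⟩
  have h1 := hδ a m
  have h2 := hmax (a ⊓ m)
  have h3 : δ m0 ≤ δ (a ⊔ m) := hm.trans (by linarith)
  by_contra hle
  refine hmin _ h3 ?_
  have h4 : m < a ⊔ m := lt_of_le_of_ne le_sup_right fun h => hle (h ▸ le_sup_left)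
  have h5 := hrk h4
  have h6 := hfin (a ⊔ m)
  change rk ⊤ - rk (a ⊔ m) < rk ⊤ - rk m
  omega

variable (hmod : ∀ a b, rk (a ⊔ b) + rk (a ⊓ b) = rk a + rk b)
include hmod

omit [BoundedOrder α] hrk in
/-- Subtracting a multiple of the modular function `rk` preserves supermodularity. -/
lemma supermodular_sub_mul (s : ℝ) (a b : α) : (δ a - s * rk a) + (δ b - s * rk b) ≤
    (δ (a ⊔ b) - s * rk (a ⊔ b)) + (δ (a ⊓ b) - s * rk (a ⊓ b)) := by
  have h1 := hδ a b
  have h2 : (rk (a ⊔ b) : ℝ) + rk (a ⊓ b) = rk a + rk b := by exact_mod_cast hmod a b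
  linear_combination h1 + s * h2

/-- The largest element maximizing `δ - s · rk`. -/
def hnLevel (s : ℝ) : α :=
  (exists_isLargestMax (δ := fun a => δ a - s * rk a) hrk (supermodular_sub_mul hδ hmod s)).choose

lemma hnLevel_spec (s : ℝ) : IsLargestMax (fun a => δ a - s * rk a) (hnLevel hrk hδ hmod s) :=
  (exists_isLargestMax (δ := fun a => δ a - s * rk a) hrk
    (supermodular_sub_mul hδ hmod s)).choose_spec

lemma hnLevel_antitone : Antitone (hnLevel hrk hδ hmod) := by
  intro s t hst
  have h1 := (hnLevel_spec hrk hδ hmod s)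
  have h2 := (hnLevel_spec hrk hδ hmod t)
  set ms := hnLevel hrk hδ hmod s
  set mt := hnLevel hrk hδ hmod t
  have h3 := h2.1 (mt ⊓ ms)
  have h4 := supermodular_sub_mul hδ hmod s mt ms
  have h5 : (rk (mt ⊓ ms) : ℝ) ≤ rk mt := by exact_mod_cast hrk.monotone inf_le_left
  refine le_sup_left.trans (h1.2 (mt ⊔ ms) ?_)
  change δ ms - s * rk ms ≤ δ (mt ⊔ ms) - s * rk (mt ⊔ ms)
  simp only at h3 h4
  nlinarith

lemma hnLevel_exhaustive : ∃ s, hnLevel hrk hδ hmod s = ⊤ := by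
  obtain ⟨m, -, hm⟩ := exists_max_above hrk hδ ⊥
  have hC : 0 ≤ δ m - δ ⊤ := sub_nonneg.2 (hm ⊤ bot_le)
  refine ⟨-(δ m - δ ⊤) - 1, (hnLevel_spec hrk hδ hmod _).unique ⟨fun a => ?_, fun a _ => le_top⟩⟩
  rcases eq_or_ne a ⊤ with rfl | ha
  · exact le_rfl
  have h1 : (rk a : ℝ) + 1 ≤ rk ⊤ := by exact_mod_cast hrk (lt_top_iff_ne_top.2 ha)
  have h2 := hm a bot_le
  simp only
  nlinarith

lemma hnLevel_separated (hrk0 : rk ⊥ = 0) : ∃ s, hnLevel hrk hδ hmod s = ⊥ := by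
  obtain ⟨m, -, hm⟩ := exists_max_above hrk hδ ⊥
  have hC : 0 ≤ δ m - δ ⊥ := sub_nonneg.2 (hm ⊥ bot_le)
  have key : ∀ a, a ≠ ⊥ → δ a - (δ m - δ ⊥ + 1) * rk a < δ ⊥ - (δ m - δ ⊥ + 1) * rk (⊥ : α) := by
    intro a ha
    have h1 : (1 : ℝ) ≤ rk a := by
      exact_mod_cast Nat.one_le_iff_ne_zero.2 fun h => by
        have := hrk (bot_lt_iff_ne_bot.2 ha); omega
    have h2 := hm a bot_le
    rw [hrk0, Nat.cast_zero]
    nlinarith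
  refine ⟨δ m - δ ⊥ + 1, (hnLevel_spec hrk hδ hmod _).unique ⟨fun a => ?_, fun a ha => ?_⟩⟩
  · rcases eq_or_ne a ⊥ with rfl | ha
    · exact le_rfl
    · exact (key a ha).le
  · by_contra h
    exact absurd ha (key a fun h' => h (h' ▸ le_rfl)).not_ge

omit [BoundedOrder α] hδ hmod in
/-- A decreasing family in a lattice of finite length is eventually constant to the left of every
point. -/
lemma exists_lt_forall_eq {M : ℝ → α} (hM : Antitone M) (s : ℝ) :
    ∃ t < s, ∀ r, t ≤ r → r < s → M r = M t := by
  obtain ⟨_, ⟨t, ht, rfl⟩, hmin⟩ := (measure fun a => rk a).wf.has_min (M '' Set.Iio s)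
    ⟨_, s - 1, by simp, rfl⟩
  refine ⟨t, ht, fun r htr hrs => ?_⟩
  by_contra h
  exact hmin (M r) ⟨r, hrs, rfl⟩ (hrk (lt_of_le_of_ne (hM htr) h))

omit hδ hmod in
/-- A decreasing family in a lattice of finite length is constant immediately to the right of every
point. -/
lemma exists_gt_forall_eq {M : ℝ → α} (hM : Antitone M) (s : ℝ) :
    ∃ t > s, ∀ r, s < r → r ≤ t → M r = M t := by
  obtain ⟨_, ⟨t, ht, rfl⟩, hmin⟩ := (measure fun a => rk ⊤ - rk a).wf.has_min (M '' Set.Ioi s)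
    ⟨_, s + 1, by simp, rfl⟩
  refine ⟨t, ht, fun r hsr hrt => ?_⟩
  by_contra h
  refine hmin (M r) ⟨r, hsr, rfl⟩ ?_
  have h1 := hrk (lt_of_le_of_ne (hM hrt) (Ne.symm h))
  have h2 := hrk.monotone (le_top : M r ≤ ⊤)
  change rk ⊤ - rk (M r) < rk ⊤ - rk (M t)
  omega

omit [BoundedOrder α] hrk hδ hmod in
/-- A point maximizing `δ - t · rk` for `t` arbitrarily close to `s` maximizes `δ - s · rk`. -/
lemma le_of_forall_near {m : α} {s : ℝ} (h : ∀ ε > 0, ∃ t, |t - s| < ε ∧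
    ∀ a, δ a - t * rk a ≤ δ m - t * rk m) (a : α) : δ a - s * rk a ≤ δ m - s * rk m := by
  by_contra! hlt
  set d := (δ a - s * rk a) - (δ m - s * rk m) with hd
  have hdpos : 0 < d := sub_pos.2 hlt
  obtain ⟨t, ht, hmax⟩ := h (d / (1 + |(rk a : ℝ) - rk m|)) (by positivity)
  have h1 := hmax a
  rw [lt_div_iff₀ (by positivity)] at ht
  have h2 : (t - s) * ((rk a : ℝ) - rk m) ≤ |t - s| * |(rk a : ℝ) - rk m| := by
    rw [← abs_mul]; exact le_abs_self _
  nlinarith [abs_nonneg (t - s)]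

/-- The steps of the filtration are eventually constant to the left of `s`, and the constant value
is a largest maximizer at `s` by passage to the limit. -/
lemma hnLevel_left_cont (s : ℝ) : ∃ t < s, hnLevel hrk hδ hmod t = hnLevel hrk hδ hmod s := by
  obtain ⟨t, hts, ht⟩ := exists_lt_forall_eq hrk (hnLevel_antitone hrk hδ hmod) s
  refine ⟨t, hts, le_antisymm ?_ (hnLevel_antitone hrk hδ hmod hts.le)⟩
  refine (hnLevel_spec hrk hδ hmod s).2 _ (le_of_forall_near (fun ε hε => ?_) _)
  refine ⟨max t (s - ε / 2), ?_, ?_⟩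
  · rw [abs_sub_lt_iff]
    constructor
    · have : max t (s - ε / 2) < s := max_lt hts (by linarith)
      linarith
    · have := le_max_right t (s - ε / 2)
      linarith
  · rw [← ht (max t (s - ε / 2)) (le_max_left _ _) (max_lt hts (by linarith))]
    exact (hnLevel_spec hrk hδ hmod _).1

/-- The filtration by the `hnLevel`s has semistable graded pieces: `M t`, for `t` slightly larger
than `s`, still maximizes `δ - s · rk`. -/
lemma isMax_of_gt {M : ℝ → α} (hM : ∀ s, IsLargestMax (fun a => δ a - s * rk a) (M s))
    {s t : ℝ} (hst : s < t) (ht : ∀ r, s < r → r ≤ t → M r = M t) (a : α) :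
    δ a - s * rk a ≤ δ (M t) - s * rk (M t) := by
  refine le_of_forall_near (fun ε hε => ?_) a
  refine ⟨min t (s + ε / 2), ?_, ?_⟩
  · rw [abs_sub_lt_iff]
    constructor
    · have := min_le_right t (s + ε / 2)
      linarith
    · have : s < min t (s + ε / 2) := lt_min hst (by linarith)
      linarith
  · rw [← ht (min t (s + ε / 2)) (lt_min hst (by linarith)) (min_le_left _ _)]
    exact (hM _).1

/-- A filtration with semistable graded pieces of the right slopes consists of the largest
maximizers of the functions `δ - s · rk`. Here `P s` is the step following `M s`. -/
lemma isLargestMax_of_semistable {M P : ℝ → α} (hM : Antitone M) (htop : ∃ s, M s = ⊤)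
    (hbot : ∃ s, M s = ⊥) (hleft : ∀ s, ∃ t < s, M t = M s)
    (hP : ∀ s, ∃ t > s, P s = M t) (hP' : ∀ s t, s < t → M t ≤ P s)
    (heq : ∀ s, δ (M s) - s * rk (M s) = δ (P s) - s * rk (P s))
    (hle : ∀ s a, P s ≤ a → a ≤ M s → δ a - s * rk a ≤ δ (P s) - s * rk (P s)) (s : ℝ) :
    IsLargestMax (fun a => δ a - s * rk a) (M s) := by
  have hPM : ∀ s, P s ≤ M s := fun s => by
    obtain ⟨t, ht, h⟩ := hP s
    exact h ▸ hM (le_of_lt ht)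
  -- the last index at which a given element is below the filtration
  have hlast : ∀ a : α, a ≠ ⊥ → ∃ r, a ≤ M r ∧ ∀ t, a ≤ M t → t ≤ r := by
    intro a ha
    obtain ⟨s0, hs0⟩ := htop
    obtain ⟨s1, hs1⟩ := hbot
    have hbdd : BddAbove {t | a ≤ M t} := ⟨s1, fun t ht => by
      by_contra! h
      exact ha (le_bot_iff.1 (ht.trans ((hM h.le).trans hs1.le)))⟩
    have hne : {t | a ≤ M t}.Nonempty := ⟨s0, by simp [hs0]⟩
    refine ⟨sSup {t | a ≤ M t}, ?_, fun t ht => le_csSup hbdd ht⟩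
    obtain ⟨t, hlt, ht⟩ := hleft (sSup {t | a ≤ M t})
    obtain ⟨t', ht', h3⟩ := exists_lt_of_lt_csSup hne hlt
    rw [← ht]
    exact le_trans ht' (hM h3.le)
  have hcut : ∀ r a, a ≤ M r → δ a - r * rk a ≤ δ (a ⊓ P r) - r * rk (a ⊓ P r) := by
    intro r a ha
    have h1 := supermodular_sub_mul hδ hmod r a (P r)
    have h2 := hle r (a ⊔ P r) le_sup_right (sup_le ha (hPM r))
    linarith
  have hbelow : ∀ n : ℕ, ∀ s, rk (M s) = n → ∀ a, a ≤ M s →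
      δ a - s * rk a ≤ δ (M s) - s * rk (M s) := by
    intro n
    induction n using Nat.strong_induction_on with
    | _ n ih =>
      intro s hn a ha
      rcases eq_or_ne (M s) ⊥ with h0 | h0
      · rw [h0] at ha ⊢
        rw [le_bot_iff.1 ha]
      obtain ⟨r, hr, hmax⟩ := hlast (M s) h0
      have hsr : s ≤ r := hmax s le_rfl
      have hMr : M r = M s := le_antisymm (hM hsr) hr
      obtain ⟨t, hrt, ht⟩ := hP r
      have hlt : M t < M s := lt_of_le_of_ne (hMr ▸ hM (le_of_lt hrt)) fun h =>
        absurd (hmax t h.ge) (not_le.2 hrt)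
      have h1 := ih _ (hn ▸ hrk hlt) t rfl (a ⊓ P r) (ht ▸ inf_le_right)
      have h2 := hcut r a (hMr ▸ ha)
      have h3 := heq r
      rw [hMr] at h3
      rw [ht] at h1 h2 h3
      have h4 : (rk (a ⊓ M t) : ℝ) ≤ rk (M t) := by exact_mod_cast hrk.monotone inf_le_right
      have h5 : (rk a : ℝ) ≤ rk (M s) := by exact_mod_cast hrk.monotone ha
      have hrt' : r < t := hrt
      nlinarith
  have habove : ∀ n : ℕ, ∀ a, rk a = n → M s ≤ a → a ≠ M s →
      δ a - s * rk a < δ (M s) - s * rk (M s) := by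
    intro n
    induction n using Nat.strong_induction_on with
    | _ n ih =>
      intro a hn ha hne
      have ha0 : a ≠ ⊥ := by
        rintro rfl
        exact hne (le_antisymm bot_le ha)
      obtain ⟨r, hr, hmax⟩ := hlast a ha0
      have hrs : r < s := by
        by_contra! h
        exact hne (le_antisymm (hr.trans (hM h)) ha)
      obtain ⟨t, hrt, ht⟩ := hP r
      have hlt : a ⊓ P r < a := lt_of_le_of_ne inf_le_left fun h =>
        absurd (hmax t (ht ▸ inf_eq_left.1 h)) (not_le.2 hrt)
      have h1 := hcut r a hr
      have h2 : (rk (a ⊓ P r) : ℝ) < rk a := by exact_mod_cast hrk hlt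
      have h3 : M s ≤ a ⊓ P r := le_inf ha (hP' r s hrs)
      have h4 : δ (a ⊓ P r) - s * rk (a ⊓ P r) ≤ δ (M s) - s * rk (M s) := by
        rcases eq_or_ne (a ⊓ P r) (M s) with h | h
        · rw [h]
        · exact (ih _ (hn ▸ hrk hlt) _ rfl h3 h).le
      nlinarith
  have key : ∀ a, δ a - s * rk a ≤ δ (a ⊔ M s) - s * rk (a ⊔ M s) := fun a => by
    have h1 := supermodular_sub_mul hδ hmod s a (M s)
    have h2 := hbelow _ s rfl (a ⊓ M s) inf_le_right
    linarith
  constructor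
  · intro a
    refine (key a).trans ?_
    rcases eq_or_ne (a ⊔ M s) (M s) with h | h
    · rw [h]
    · exact (habove _ _ rfl le_sup_right h).le
  · intro a ha
    by_contra h
    have h1 := habove _ (a ⊔ M s) rfl le_sup_right fun h' => h (h' ▸ le_sup_left)
    have h2 := key a
    simp only at ha
    linarith

end HNLattice

/-! ### Subobjects and subquotients -/

lemma finrank_add_of_exact {k V' V V'' : Type*} [Field k] [AddCommGroup V'] [Module k V']
    [AddCommGroup V] [Module k V] [AddCommGroup V''] [Module k V''] [FiniteDimensional k V]
    {f : V' →ₗ[k] V} {g : V →ₗ[k] V''} (hf : Function.Injective f) (hfg : Function.Exact f g)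
    (hg : Function.Surjective g) :
    Module.finrank k V = Module.finrank k V' + Module.finrank k V'' := by
  rw [← LinearMap.finrank_range_add_finrank_ker g, LinearMap.range_eq_top.2 hg, finrank_top,
    LinearMap.exact_iff.1 hfg, LinearMap.finrank_range_of_inj hf, add_comm]

namespace Isoc

section Homs

variable {L : Type*} [Field L] {σ : L ≃+* L} (D : Isoc.{w} σ)

/-- The lattice of subisocrystals. -/
def subobjects : Sublattice (Submodule L D.V) where
  carrier := {W | D.IsSub W}
  supClosed' := fun a ha b hb => by
    rw [sup_eq_iSup]
    exact D.isSub_iSup _ fun j => by cases j <;> assumption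
  infClosed' := fun a ha b hb x => and_congr (ha x) (hb x)

lemma isSub_top : D.IsSub ⊤ := fun _ => by simp

lemma isSub_bot : D.IsSub ⊥ := fun x => by
  rw [Submodule.mem_bot, Submodule.mem_bot]
  exact ⟨fun h => D.bij.1 (h.trans (map_zero _).symm), fun h => by rw [h, map_zero]⟩

instance : BoundedOrder D.subobjects where
  top := ⟨⊤, D.isSub_top⟩
  le_top a := le_top (a := a.1)
  bot := ⟨⊥, D.isSub_bot⟩
  bot_le a := bot_le (a := a.1)

/-- The rank of a subisocrystal. -/
def subRank (W : D.subobjects) : ℕ := Module.finrank L W.1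

lemma subRank_strictMono : StrictMono D.subRank := fun a b h =>
  Submodule.finrank_lt_finrank_of_lt (s := a.1) (t := b.1) h

lemma subRank_modular (a b : D.subobjects) :
    D.subRank (a ⊔ b) + D.subRank (a ⊓ b) = D.subRank a + D.subRank b :=
  Submodule.finrank_sup_add_finrank_inf_eq a.1 b.1

variable {D}

/-- The inclusion of a subisocrystal. -/
def subtypeHom {A : Submodule L D.V} (hA : D.IsSub A) : D.sub A hA ⟶ D :=
  (⟨A.subtype, fun _ => rfl⟩ : Hom _ _)

/-- The inclusion between two subisocrystals. -/
def inclusionHom {A B : Submodule L D.V} (hA : D.IsSub A) (hB : D.IsSub B) (h : A ≤ B) :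
    D.sub A hA ⟶ D.sub B hB :=
  (⟨Submodule.inclusion h, fun _ => rfl⟩ : Hom _ _)

/-- The projection to the quotient by a subisocrystal. -/
def mkQHom {A : Submodule L D.V} (hA : D.IsSub A) : D ⟶ D.quot A hA :=
  (⟨A.mkQ, fun _ => rfl⟩ : Hom _ _)

/-- The subquotient `A / A'` of an isocrystal. -/
def subquo (D : Isoc.{w} σ) (A' A : Submodule L D.V) (hA' : D.IsSub A') (hA : D.IsSub A) :
    Isoc.{w} σ :=
  (D.sub A hA).quot (A'.comap A.subtype) fun x => hA' x.1

/-- The projection to a subquotient. -/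
def subquoHom {A' A : Submodule L D.V} (hA' : D.IsSub A') (hA : D.IsSub A) :
    D.sub A hA ⟶ D.subquo A' A hA' hA :=
  (⟨(A'.comap A.subtype).mkQ, fun _ => rfl⟩ : Hom _ _)

lemma exact_inclusion_mkQ {A' A : Submodule L D.V} (h : A' ≤ A) :
    Function.Exact (Submodule.inclusion h) (A'.comap A.subtype).mkQ := by
  intro x
  rw [Submodule.mkQ_apply, Submodule.Quotient.mk_eq_zero]
  exact ⟨fun hx => ⟨⟨x.1, hx⟩, rfl⟩, by rintro ⟨y, rfl⟩; exact y.2⟩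

lemma isSub_ker {E : Isoc.{w} σ} (f : D ⟶ E) : D.IsSub (LinearMap.ker f.lin) := fun x => by
  rw [LinearMap.mem_ker, LinearMap.mem_ker, f.comm]
  exact ⟨fun h => E.bij.1 (h.trans (map_zero _).symm), fun h => by rw [h, map_zero]⟩

lemma isSub_comap {E : Isoc.{w} σ} (f : D ⟶ E) {B : Submodule L E.V} (hB : E.IsSub B) :
    D.IsSub (B.comap f.lin) := fun x => by
  rw [Submodule.mem_comap, Submodule.mem_comap, f.comm]
  exact hB _

lemma isSub_map {E : Isoc.{w} σ} (f : D ⟶ E) {A : Submodule L D.V} (hA : D.IsSub A) :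
    E.IsSub (A.map f.lin) := by
  intro y
  constructor
  · rintro ⟨x, hx, hxy⟩
    obtain ⟨z, rfl⟩ := D.bij.2 x
    refine ⟨z, (hA z).1 hx, E.bij.1 ?_⟩
    rw [← hxy, f.comm]
  · rintro ⟨x, hx, rfl⟩
    exact ⟨D.φ x, (hA x).2 hx, f.comm x⟩

end Homs

section SubLattices

variable {L : Type*} [NormedField L] {σ : L ≃+* L}
  {K : Type*} [NormedField K] [IsUltrametricDist K] [Algebra L K]
  [IsDiscreteValuationRing (integers K)] (D : Isoc.{w} σ)

lemma exists_smul_mem_lattice {U : Type*} [AddCommGroup U] [Module K U] [Module (integers K) U]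
    [IsScalarTower (integers K) K U] (Ξ : Submodule (integers K) U) [Submodule.IsLattice K Ξ]
    (v : U) : ∃ c : K, c ≠ 0 ∧ c • v ∈ Ξ := by
  obtain ⟨n, ⟨b⟩⟩ := exists_lattice_basis Ξ
  obtain ⟨c, ξ, hξ, hv, -⟩ := (gauge_isLeast Ξ b v).1
  by_cases hc : c = 0
  · exact ⟨1, one_ne_zero, by rw [hv, hc, zero_smul, smul_zero]; exact zero_mem _⟩
  · exact ⟨c⁻¹, inv_ne_zero hc, by rwa [hv, inv_smul_smul₀ hc]⟩

instance subLat_isLattice (Ξ : Submodule (integers K) (D.bc K)) [hΞ : Submodule.IsLattice K Ξ]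
    (W : Submodule L D.V) : Submodule.IsLattice K (D.subLat Ξ W) := by
  have hinj : Function.Injective (W.subtype.baseChange K) :=
    Module.Flat.lTensor_preserves_injective_linearMap W.subtype W.injective_subtype
  constructor
  · have h1 : IsNoetherian (integers K) Ξ := isNoetherian_of_fg_of_noetherian Ξ hΞ.fg
    refine Submodule.fg_of_fg_map_injective ((W.subtype.baseChange K).restrictScalars (integers K))
      hinj ?_
    refine isNoetherian_submodule.1 h1 _ ?_
    rintro _ ⟨x, hx, rfl⟩
    exact hx
  · rw [eq_top_iff]
    rintro x -
    obtain ⟨c, hc, h⟩ := exists_smul_mem_lattice Ξ (W.subtype.baseChange K x)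
    rw [← inv_smul_smul₀ hc x]
    refine Submodule.smul_mem _ _ (Submodule.subset_span ?_)
    change W.subtype.baseChange K (c • x) ∈ Ξ
    rwa [map_smul]

instance quotLat_isLattice (Ξ : Submodule (integers K) (D.bc K)) [hΞ : Submodule.IsLattice K Ξ]
    (W : Submodule L D.V) : Submodule.IsLattice K (D.quotLat Ξ W) := by
  have hsurj : Function.Surjective (W.mkQ.baseChange K) :=
    LinearMap.lTensor_surjective K W.mkQ_surjective
  constructor
  · exact hΞ.fg.map _
  · have h1 : ((D.quotLat Ξ W : Submodule (integers K) _) : Set (K ⊗[L] (D.V ⧸ W))) =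
        (W.mkQ.baseChange K) '' (Ξ : Set (D.bc K)) := rfl
    rw [h1, ← Submodule.map_span, hΞ.span_eq_top, Submodule.map_top, LinearMap.range_eq_top]
    exact hsurj

variable {D} (Ξ : Submodule (integers K) (D.bc K))

/-- The induced lattice `subLat`, as a lattice in the base change of the isocrystal `D.sub W hW`. -/
def subisocLat (D : Isoc.{w} σ) (Ξ : Submodule (integers K) (D.bc K)) (W : Submodule L D.V)
    (hW : D.IsSub W) : Submodule (integers K) ((D.sub W hW).bc K) := D.subLat Ξ W

instance [hΞ : Submodule.IsLattice K Ξ] (W : Submodule L D.V) (hW : D.IsSub W) :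
    Submodule.IsLattice K (D.subisocLat Ξ W hW) :=
  subLat_isLattice D Ξ W

/-- The lattice induced on a subquotient. -/
def subquoLat (D : Isoc.{w} σ) (Ξ : Submodule (integers K) (D.bc K)) (A' A : Submodule L D.V)
    (hA' : D.IsSub A') (hA : D.IsSub A) :
    Submodule (integers K) ((D.subquo A' A hA' hA).bc K) :=
  (D.sub A hA).quotLat (D.subisocLat Ξ A hA) (A'.comap A.subtype)

instance [hΞ : Submodule.IsLattice K Ξ] (A' A : Submodule L D.V) (hA' : D.IsSub A')
    (hA : D.IsSub A) : Submodule.IsLattice K (D.subquoLat Ξ A' A hA' hA) :=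
  quotLat_isLattice (D.sub A hA) (D.subisocLat Ξ A hA) _

variable (D) in
/-- The degree of a subisocrystal, with the induced lattice. -/
def subDeg (W : D.subobjects) : ℝ := (D.sub W.1 W.2).degLat (D.subisocLat Ξ W.1 W.2)

lemma mem_subLat {W : Submodule L D.V} {x : K ⊗[L] W} :
    x ∈ D.subLat Ξ W ↔ W.subtype.baseChange K x ∈ Ξ := Iff.rfl

lemma baseChange_comp_apply {V₁ V₂ V₃ : Type*} [AddCommGroup V₁] [Module L V₁] [AddCommGroup V₂]
    [Module L V₂] [AddCommGroup V₃] [Module L V₃] (g : V₂ →ₗ[L] V₃) (f : V₁ →ₗ[L] V₂)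
    (x : K ⊗[L] V₁) : g.baseChange K (f.baseChange K x) = (g ∘ₗ f).baseChange K x := by
  rw [LinearMap.baseChange_comp]
  rfl

lemma mem_subLat_inclusion {A B : Submodule L D.V} (h : A ≤ B) {x : K ⊗[L] A} :
    (Submodule.inclusion h).baseChange K x ∈ D.subLat Ξ B ↔ x ∈ D.subLat Ξ A := by
  rw [mem_subLat, mem_subLat, baseChange_comp_apply]
  rfl

variable [Admissible σ K] [hΞ : Submodule.IsLattice K Ξ]

lemma degLat_subquo {A' A : Submodule L D.V} (hA' : D.IsSub A') (hA : D.IsSub A) (h : A' ≤ A) :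
    (D.subquo A' A hA' hA).degLat (D.subquoLat Ξ A' A hA' hA) =
      D.subDeg Ξ ⟨A, hA⟩ - D.subDeg Ξ ⟨A', hA'⟩ := by
  have h1 := degLat_add_of_exact (inclusionHom hA' hA h) (subquoHom hA' hA)
    (Submodule.inclusion_injective h)
    (exact_inclusion_mkQ h) (Submodule.mkQ_surjective _) (Ξ' := D.subisocLat Ξ A' hA')
    (Ξ := D.subisocLat Ξ A hA)
    (Ξ'' := D.subquoLat Ξ A' A hA' hA) (fun v => (mem_subLat_inclusion Ξ h).symm)
    (fun v hv => ⟨v, hv, rfl⟩) (fun u hu => hu)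
  rw [subDeg, subDeg]
  linarith

lemma rank_subquo {A' A : Submodule L D.V} (hA' : D.IsSub A') (hA : D.IsSub A) (h : A' ≤ A) :
    D.subRank ⟨A, hA⟩ = D.subRank ⟨A', hA'⟩ + (D.subquo A' A hA' hA).rank :=
  finrank_add_of_exact (Submodule.inclusion_injective h) (exact_inclusion_mkQ h)
    (Submodule.mkQ_surjective _)

/-- A morphism inducing a bijection between subquotients preserves their ranks and does not decrease
their degrees. -/
lemma subDeg_sub_le {E : Isoc.{w} σ} (f : D ⟶ E) (Θ : Submodule (integers K) (E.bc K))
    [Submodule.IsLattice K Θ] (hmap : ∀ v ∈ Ξ, f.lin.baseChange K v ∈ Θ)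
    {A' A : D.subobjects} {B' B : E.subobjects} (hA : A' ≤ A) (hB : B' ≤ B)
    (h1 : A.1 ≤ B.1.comap f.lin) (h2 : A.1 ⊓ B'.1.comap f.lin = A'.1)
    (h3 : B.1 ≤ A.1.map f.lin ⊔ B'.1) :
    D.subRank A + E.subRank B' = D.subRank A' + E.subRank B ∧
    D.subDeg Ξ A - D.subDeg Ξ A' ≤ E.subDeg Θ B - E.subDeg Θ B' := by
  obtain ⟨A', hA'⟩ := A'
  obtain ⟨A, hA0⟩ := A
  obtain ⟨B', hB'⟩ := B'
  obtain ⟨B, hB0⟩ := B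
  dsimp only at h1 h2 h3
  change D.IsSub _ at hA' hA0
  change E.IsSub _ at hB' hB0
  rw [← degLat_subquo Ξ hA' hA0 hA, ← degLat_subquo Θ hB' hB0 hB]
  let F : A →ₗ[L] B := f.lin.restrict fun x hx => h1 hx
  have hF : ∀ x : A, F x ∈ B'.comap B.subtype ↔ x ∈ A'.comap A.subtype := by
    intro x
    rw [Submodule.mem_comap, Submodule.mem_comap, ← h2]
    exact ⟨fun h => ⟨x.2, h⟩, fun h => h.2⟩
  let G : (A ⧸ A'.comap A.subtype) →ₗ[L] (B ⧸ B'.comap B.subtype) :=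
    Submodule.mapQ _ _ F fun x hx => (hF x).2 hx
  have hG : ∀ x : D.subquo A' A hA' hA0 |>.V, G ((D.subquo A' A hA' hA0).φ x) =
      (E.subquo B' B hB' hB0).φ (G x) := by
    intro x
    obtain ⟨x, rfl⟩ := Submodule.mkQ_surjective _ x
    change Submodule.Quotient.mk (p := B'.comap B.subtype) (F ((D.sub A hA0).φ x)) =
      Submodule.Quotient.mk (p := B'.comap B.subtype) ((E.sub B hB0).φ (F x))
    congr 1
    exact Subtype.ext (f.comm x.1)
  have hbij : Function.Bijective G := ⟨?_, ?_⟩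
  · refine ⟨?_, (degLat_le_of_bijective (Ξ := D.subquoLat Ξ A' A hA' hA0)
      (Θ := E.subquoLat Θ B' B hB' hB0) (⟨G, hG⟩ :
      Hom (D.subquo A' A hA' hA0) (E.subquo B' B hB' hB0)) hbij ?_).1⟩
    · have h5 : (D.subquo A' A hA' hA0).rank = (E.subquo B' B hB' hB0).rank :=
        (LinearEquiv.ofBijective G hbij).finrank_eq
      have h6 := rank_subquo hA' hA0 hA
      have h7 := rank_subquo hB' hB0 hB
      omega
    · have e1 : ∀ x : K ⊗[L] A, B.subtype.baseChange K (F.baseChange K x) =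
          f.lin.baseChange K (A.subtype.baseChange K x) := fun x => by
        rw [baseChange_comp_apply, baseChange_comp_apply]
        rfl
      have e2 : ∀ x : K ⊗[L] A, (B'.comap B.subtype).mkQ.baseChange K (F.baseChange K x) =
          G.baseChange K ((A'.comap A.subtype).mkQ.baseChange K x) := fun x => by
        rw [baseChange_comp_apply, baseChange_comp_apply]
        rfl
      have e3 : ∀ x : K ⊗[L] A, x ∈ D.subLat Ξ A → F.baseChange K x ∈ E.subLat Θ B := fun x hx => by
        rw [mem_subLat, e1]
        exact hmap _ hx
      rintro _ ⟨x, hx, rfl⟩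
      exact ⟨F.baseChange K x, e3 x hx, e2 x⟩
  · refine (injective_iff_map_eq_zero G).2 fun x hx => ?_
    obtain ⟨x, rfl⟩ := Submodule.mkQ_surjective _ x
    rw [Submodule.mkQ_apply, Submodule.Quotient.mk_eq_zero]
    rw [Submodule.mkQ_apply] at hx
    exact (hF x).1 ((Submodule.Quotient.mk_eq_zero _).1 hx)
  · intro y
    obtain ⟨y, rfl⟩ := Submodule.mkQ_surjective _ y
    obtain ⟨_, ⟨x, hx, rfl⟩, z, hz, hxz⟩ := Submodule.mem_sup.1 (h3 y.2)
    refine ⟨Submodule.mkQ _ ⟨x, hx⟩, ?_⟩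
    change Submodule.Quotient.mk _ = Submodule.Quotient.mk _
    refine (Submodule.Quotient.eq _).2 ?_
    change f.lin x - y.1 ∈ B'
    rw [← hxz, sub_add_cancel_left]
    exact neg_mem hz

/-- The bijection `A / (A ⊓ B) → (A ⊔ B) / B` maps the induced lattice of the source into that of
the target, but not onto it in general. -/
lemma subDeg_supermodular (A B : D.subobjects) :
    D.subDeg Ξ A + D.subDeg Ξ B ≤ D.subDeg Ξ (A ⊔ B) + D.subDeg Ξ (A ⊓ B) := by
  have h := (subDeg_sub_le Ξ (𝟙 D) Ξ (fun v hv => by rwa [baseChange_id_lin])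
    (A' := A ⊓ B) (A := A) (B' := B) (B := A ⊔ B) inf_le_left le_sup_right
    (fun x hx => Submodule.mem_sup_left hx) rfl
    (sup_le_sup_right (fun x hx => ⟨x, hx, rfl⟩) _)).2
  linarith

lemma rank_eq_zero_iff : D.rank = 0 ↔ Subsingleton D.V := Module.finrank_zero_iff

lemma degLat_of_subsingleton {Ξ : Submodule (integers K) (D.bc K)} [Submodule.IsLattice K Ξ]
    (h : Subsingleton D.V) : D.degLat Ξ = 0 := by
  classical
  let v : Module.Basis (Fin 0) L D.V := Module.Basis.empty _
  obtain ⟨e, he⟩ := exists_isBasisOf Ξ (Algebra.TensorProduct.basis K v)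
  rw [D.degLat_eq v he, Module.Basis.det_apply, Matrix.det_isEmpty, Matrix.det_isEmpty]
  simp

lemma subDeg_bot : D.subDeg Ξ ⊥ = 0 :=
  degLat_of_subsingleton (Ξ := D.subisocLat Ξ ⊥ D.isSub_bot) (inferInstanceAs (Subsingleton (⊥ : Submodule L D.V)))

lemma subDeg_top : D.subDeg Ξ ⊤ = D.degLat Ξ := by
  have hid : ∀ v : (D.sub ⊤ D.isSub_top).bc K,
      (subtypeHom D.isSub_top).lin.baseChange K v ∈ Ξ ↔ v ∈ D.subisocLat Ξ ⊤ D.isSub_top := fun v => Iff.rfl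
  have h := degLat_le_of_bijective (subtypeHom D.isSub_top) (Ξ := D.subisocLat Ξ ⊤ D.isSub_top) (Θ := Ξ)
    ⟨Subtype.val_injective, fun x => ⟨⟨x, trivial⟩, rfl⟩⟩ (fun v hv => hv)
  refine le_antisymm h.1 ?_
  let g : D ⟶ D.sub ⊤ D.isSub_top :=
    (⟨LinearMap.codRestrict ⊤ LinearMap.id fun _ => trivial, fun _ => rfl⟩ : Hom _ _)
  refine (degLat_le_of_bijective g (Ξ := Ξ) (Θ := D.subisocLat Ξ ⊤ D.isSub_top)
    ⟨fun x y hxy => congrArg Subtype.val hxy, fun x => ⟨x.1, rfl⟩⟩ fun v hv => ?_).1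
  change (subtypeHom D.isSub_top).lin.baseChange K (g.lin.baseChange K v) ∈ Ξ
  rw [baseChange_comp_apply]
  exact (baseChange_id_lin D v).symm ▸ hv

/-- The subobject of `D` corresponding to a subobject of the subquotient `A / A'`. -/
def liftSub {A' A : Submodule L D.V} {hA' : D.IsSub A'} (hA : D.IsSub A)
    (W : (D.subquo A' A hA' hA).subobjects) : D.subobjects :=
  ⟨(W.1.comap (A'.comap A.subtype).mkQ).map A.subtype,
    isSub_map (subtypeHom hA) (isSub_comap (subquoHom hA' hA) W.2)⟩

lemma mem_liftSub {A' A : Submodule L D.V} {hA' : D.IsSub A'} {hA : D.IsSub A}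
    {W : (D.subquo A' A hA' hA).subobjects} {x : D.V} :
    x ∈ (liftSub hA W).1 ↔ ∃ h : x ∈ A, (A'.comap A.subtype).mkQ ⟨x, h⟩ ∈ W.1 := by
  constructor
  · rintro ⟨y, hy, rfl⟩
    exact ⟨y.2, hy⟩
  · rintro ⟨h, hx⟩
    exact ⟨⟨x, h⟩, hx, rfl⟩

lemma le_liftSub {A' A : Submodule L D.V} {hA' : D.IsSub A'} {hA : D.IsSub A} (h : A' ≤ A)
    (W : (D.subquo A' A hA' hA).subobjects) : A' ≤ (liftSub hA W).1 := fun x hx =>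
  mem_liftSub.2 ⟨h hx, by
    have : (A'.comap A.subtype).mkQ ⟨x, h hx⟩ = 0 := (Submodule.Quotient.mk_eq_zero _).2 hx
    rw [this]
    exact zero_mem _⟩

lemma liftSub_le {A' A : Submodule L D.V} {hA' : D.IsSub A'} {hA : D.IsSub A}
    (W : (D.subquo A' A hA' hA).subobjects) : (liftSub hA W).1 ≤ A := fun _ hx =>
  (mem_liftSub.1 hx).1

/-- Subobjects of a subquotient `A / A'` correspond to subobjects between `A'` and `A`, with
additive rank and degree. -/
lemma subDeg_liftSub {A' A : Submodule L D.V} (hA' : D.IsSub A') (hA : D.IsSub A) (h : A' ≤ A)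
    (W : (D.subquo A' A hA' hA).subobjects) :
    D.subRank (liftSub hA W) = D.subRank ⟨A', hA'⟩ + (D.subquo A' A hA' hA).subRank W ∧
    D.subDeg Ξ (liftSub hA W) = D.subDeg Ξ ⟨A', hA'⟩ +
      (D.subquo A' A hA' hA).subDeg (D.subquoLat Ξ A' A hA' hA) W := by
  let q := (A'.comap A.subtype).mkQ
  let U := liftSub hA W
  have hW : (D.subquo A' A hA' hA).IsSub W.1 := W.2
  have hU : D.IsSub U.1 := U.2
  have hAU : A' ≤ U.1 := le_liftSub h W
  let g : U.1 →ₗ[L] W.1 := (q ∘ₗ Submodule.inclusion (liftSub_le W)).codRestrict W.1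
    fun x => (mem_liftSub.1 x.2).2
  have hgsub : W.1.subtype ∘ₗ g = q ∘ₗ Submodule.inclusion (liftSub_le W) := rfl
  let G : D.sub U.1 hU ⟶ (D.subquo A' A hA' hA).sub W.1 hW := (⟨g, fun _ => rfl⟩ : Hom _ _)
  have hsurj : Function.Surjective g := by
    rintro ⟨y, hy⟩
    obtain ⟨x, rfl⟩ := Submodule.mkQ_surjective _ y
    exact ⟨⟨x.1, mem_liftSub.2 ⟨x.2, hy⟩⟩, rfl⟩
  have hex : Function.Exact (Submodule.inclusion hAU) g := by
    intro x
    have h1 : g x = 0 ↔ x.1 ∈ A' := by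
      rw [← Submodule.coe_eq_zero]
      exact Submodule.Quotient.mk_eq_zero _
    rw [h1]
    exact ⟨fun hx => ⟨⟨x.1, hx⟩, rfl⟩, by rintro ⟨y, rfl⟩; exact y.2⟩
  refine ⟨finrank_add_of_exact (Submodule.inclusion_injective hAU) hex hsurj, ?_⟩
  have hqK : ∀ x, (W.1.subtype.baseChange K) (g.baseChange K x) =
      q.baseChange K ((Submodule.inclusion (liftSub_le W)).baseChange K x) := fun x => by
    rw [baseChange_comp_apply, baseChange_comp_apply, hgsub]
    rfl
  have hWinj : Function.Injective (W.1.subtype.baseChange K) :=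
    Module.Flat.lTensor_preserves_injective_linearMap _ W.1.injective_subtype
  refine degLat_add_of_exact (Ξ' := D.subisocLat Ξ A' hA') (Ξ := D.subisocLat Ξ U.1 hU)
    (Ξ'' := ((D.subquo A' A hA' hA).subisocLat (D.subquoLat Ξ A' A hA' hA) W.1 hW))
    (inclusionHom hA' hU hAU) G (Submodule.inclusion_injective hAU) hex
    hsurj (fun v => (mem_subLat_inclusion Ξ hAU).symm) ?_ ?_
  · intro v hv
    exact ⟨_, (mem_subLat_inclusion Ξ (liftSub_le W)).2 hv, (hqK v).symm⟩
  · have key : ∀ (x : K ⊗[L] A) (u : K ⊗[L] W.1), x ∈ D.subLat Ξ A →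
        q.baseChange K x = W.1.subtype.baseChange K u →
        ∃ v ∈ D.subLat Ξ U.1, g.baseChange K v = u := ?_
    · rintro u ⟨x, hx, hxu⟩
      exact key x u hx hxu
    intro x u hx hxu
    obtain ⟨y, hy⟩ := LinearMap.lTensor_surjective K hsurj u
    have hy' : g.baseChange K y = u := hy
    have hexK : Function.Exact ((Submodule.inclusion h).baseChange K) (q.baseChange K) :=
      lTensor_exact K (exact_inclusion_mkQ h) (Submodule.mkQ_surjective _)
    have h2 : q.baseChange K (x - (Submodule.inclusion (liftSub_le W)).baseChange K y) = 0 := by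
      rw [map_sub, sub_eq_zero, ← hqK, hy']
      exact hxu
    obtain ⟨z, hz⟩ := (hexK _).1 h2
    have h3 : (Submodule.inclusion (liftSub_le W)).baseChange K
        (y + (Submodule.inclusion hAU).baseChange K z) = x := by
      rw [map_add, baseChange_comp_apply]
      have : Submodule.inclusion (liftSub_le W) ∘ₗ Submodule.inclusion hAU =
        Submodule.inclusion h := rfl
      rw [this, hz]
      abel
    refine ⟨y + (Submodule.inclusion hAU).baseChange K z, ?_, hWinj ?_⟩
    · rw [← mem_subLat_inclusion Ξ (liftSub_le W), h3]
      exact hx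
    · rw [hqK, h3]
      exact hxu

end SubLattices

end Isoc

/-! ### Harder–Narasimhan filtrations of isocrystals with lattice -/

namespace Isoc

variable {L : Type*} [NormedField L] {σ : L ≃+* L}
  {K : Type*} [NormedField K] [IsUltrametricDist K] [Algebra L K]
  [IsDiscreteValuationRing (integers K)] {D : Isoc.{w} σ} [Admissible σ K]
  (Ξ : Submodule (integers K) (D.bc K)) [hΞ : Submodule.IsLattice K Ξ]

lemma subRank_bot : D.subRank ⊥ = 0 := finrank_bot L D.V

lemma subRank_top : D.subRank ⊤ = D.rank := finrank_top L D.V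

lemma isSemistableLat_iff : D.IsSemistableLat Ξ ↔ Nontrivial D.V ∧
    ∀ W : D.subobjects, D.subDeg Ξ W ≤ D.slopeLat Ξ * D.subRank W := by
  refine and_congr_right fun _ => ⟨fun h W => ?_, fun h W hW hne => ?_⟩
  · by_cases hne : W.1 = ⊥
    · have : W = ⊥ := Subtype.ext hne
      rw [this, subDeg_bot, subRank_bot, Nat.cast_zero, mul_zero]
    · have h1 := h W.1 W.2 hne
      have h2 : 0 < D.subRank W := Module.finrank_pos_iff.2 ((Submodule.nontrivial_iff_ne_bot).2 hne)
      exact (div_le_iff₀ (by exact_mod_cast h2)).1 h1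
  · have h2 : 0 < D.subRank ⟨W, hW⟩ :=
      Module.finrank_pos_iff.2 ((Submodule.nontrivial_iff_ne_bot).2 hne)
    exact (div_le_iff₀ (by exact_mod_cast h2)).2 (h ⟨W, hW⟩)

/-- The function `deg - s · rank` on subobjects. -/
def tilt (D : Isoc.{w} σ) (Ξ : Submodule (integers K) (D.bc K)) (s : ℝ) (W : D.subobjects) : ℝ :=
  D.subDeg Ξ W - s * D.subRank W

/-- A subquotient is zero or semistable of slope `s` if and only if `deg - s · rank` takes the same
value at its ends and is not larger in between. -/
lemma subquo_semistable_iff {A' A : Submodule L D.V} (hA' : D.IsSub A') (hA : D.IsSub A)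
    (h : A' ≤ A) (s : ℝ) :
    (Subsingleton (D.subquo A' A hA' hA).V ∨
      ((D.subquo A' A hA' hA).IsSemistableLat (D.subquoLat Ξ A' A hA' hA) ∧
        (D.subquo A' A hA' hA).slopeLat (D.subquoLat Ξ A' A hA' hA) = s)) ↔
    D.tilt Ξ s ⟨A, hA⟩ = D.tilt Ξ s ⟨A', hA'⟩ ∧
      ∀ W : D.subobjects, A' ≤ W.1 → W.1 ≤ A → D.tilt Ξ s W ≤ D.tilt Ξ s ⟨A', hA'⟩ := by
  set G := D.subquo A' A hA' hA with hG
  set Θ := D.subquoLat Ξ A' A hA' hA with hΘ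
  have hdeg : G.degLat Θ = D.subDeg Ξ ⟨A, hA⟩ - D.subDeg Ξ ⟨A', hA'⟩ := degLat_subquo Ξ hA' hA h
  have hrk : (D.subRank ⟨A, hA⟩ : ℝ) = D.subRank ⟨A', hA'⟩ + G.rank := by
    exact_mod_cast rank_subquo hA' hA h
  have hlift : ∀ W : D.subobjects, A' ≤ W.1 → W.1 ≤ A →
      ∃ Z : G.subobjects, liftSub hA Z = W := by
    intro W h1 h2
    refine ⟨⟨(W.1.comap A.subtype).map (subquoHom hA' hA).lin,
      isSub_map (subquoHom hA' hA) (isSub_comap (subtypeHom hA) W.2)⟩, ?_⟩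
    refine Subtype.ext (Submodule.ext fun x => ?_)
    rw [mem_liftSub]
    constructor
    · rintro ⟨hx, y, hy, hxy⟩
      have h3 := (Submodule.Quotient.eq _).1 hxy
      have h4 : y.1 - x ∈ W.1 := h1 h3
      have h5 : y.1 ∈ W.1 := hy
      have := W.1.sub_mem h5 h4
      rwa [sub_sub_cancel] at this
    · intro hx
      exact ⟨h2 hx, ⟨x, h2 hx⟩, hx, rfl⟩
  constructor
  · rintro (hs | ⟨hs, hslope⟩)
    · have h1 : G.rank = 0 := rank_eq_zero_iff.2 hs
      have h2 : G.degLat Θ = 0 := degLat_of_subsingleton hs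
      refine ⟨?_, fun W h3 h4 => ?_⟩
      · rw [h2] at hdeg
        rw [h1, Nat.cast_zero, add_zero] at hrk
        rw [tilt, tilt, hrk]
        linarith
      · have h5 : A = A' := by
          refine le_antisymm (fun x hx => ?_) h
          have h6 : (A'.comap A.subtype).mkQ ⟨x, hx⟩ = 0 := hs.elim _ _
          have h7 : (⟨x, hx⟩ : A) ∈ A'.comap A.subtype := (Submodule.Quotient.mk_eq_zero _).1 h6
          exact h7
        have h6 : W = ⟨A', hA'⟩ := Subtype.ext (le_antisymm (h4.trans h5.le) h3)
        rw [h6]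
    · rw [isSemistableLat_iff, hslope] at hs
      obtain ⟨hnt, hs⟩ := hs
      have hpos : 0 < G.rank := Module.finrank_pos_iff.2 hnt
      have h1 : G.degLat Θ = s * G.rank := by
        rw [← hslope, slopeLat, div_mul_cancel₀]
        exact_mod_cast hpos.ne'
      refine ⟨?_, fun W h3 h4 => ?_⟩
      · rw [tilt, tilt, hrk]
        linarith
      · obtain ⟨Z, rfl⟩ := hlift W h3 h4
        obtain ⟨h5, h6⟩ := subDeg_liftSub Ξ hA' hA h Z
        have h7 := hs Z
        rw [tilt, tilt, h6, h5, Nat.cast_add]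
        change G.subDeg Θ Z ≤ s * G.subRank Z at h7
        change _ + G.subDeg Θ Z - s * (_ + (G.subRank Z : ℝ)) ≤ _
        linarith
  · rintro ⟨h1, h2⟩
    by_cases hs : Subsingleton G.V
    · exact Or.inl hs
    have hnt : Nontrivial G.V := not_subsingleton_iff_nontrivial.1 hs
    have hpos : 0 < G.rank := Module.finrank_pos_iff.2 hnt
    have hslope : G.slopeLat Θ = s := by
      rw [slopeLat, div_eq_iff (by exact_mod_cast hpos.ne'), hdeg]
      rw [tilt, tilt, hrk] at h1
      linarith
    refine Or.inr ⟨(isSemistableLat_iff Θ).2 ⟨hnt, fun Z => ?_⟩, hslope⟩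
    rw [hslope]
    obtain ⟨h5, h6⟩ := subDeg_liftSub Ξ hA' hA h Z
    have h7 := h2 (liftSub hA Z) (le_liftSub h Z) (liftSub_le Z)
    rw [tilt, tilt, h6, h5, Nat.cast_add] at h7
    change _ + G.subDeg Θ Z - s * (_ + (G.subRank Z : ℝ)) ≤ _ at h7
    linarith

/-- The `s`-th step of a filtration, as a subobject. -/
def Filtration.level (f : D.Filtration) (s : ℝ) : D.subobjects := ⟨f.Fil s, f.isSub s⟩

/-- The step following the `s`-th one, as a subobject. -/
def Filtration.next (f : D.Filtration) (s : ℝ) : D.subobjects :=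
  ⟨f.plus s, D.isSub_iSup (fun t : Set.Ioi s => f.Fil t) fun t => f.isSub t⟩

lemma Filtration.level_antitone (f : D.Filtration) : Antitone f.level := fun _ _ h => f.antitone h

lemma Filtration.exists_next_eq (f : D.Filtration) (s : ℝ) : ∃ t > s, f.next s = f.level t := by
  obtain ⟨t, hst, ht⟩ := exists_gt_forall_eq D.subRank_strictMono f.level_antitone s
  refine ⟨t, hst, Subtype.ext (le_antisymm (iSup_le fun r => ?_) ?_)⟩
  · rcases le_total r.1 t with h | h
    · exact (congrArg Subtype.val (ht r.1 r.2 h)).le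
    · exact f.antitone h
  · exact le_iSup (fun t : Set.Ioi s => f.Fil t) ⟨t, hst⟩

lemma Filtration.level_le_next (f : D.Filtration) {s t : ℝ} (h : s < t) :
    f.level t ≤ f.next s :=
  le_iSup (fun t : Set.Ioi s => f.Fil t) ⟨t, h⟩

lemma Filtration.next_le_level (f : D.Filtration) (s : ℝ) : f.next s ≤ f.level s :=
  iSup_le fun t : Set.Ioi s => f.antitone (le_of_lt t.2)

lemma Filtration.exists_level_eq (f : D.Filtration) (s : ℝ) : ∃ t < s, f.level t = f.level s := by
  obtain ⟨t, hts, ht⟩ := exists_lt_forall_eq D.subRank_strictMono f.level_antitone s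
  refine ⟨t, hts, le_antisymm ?_ (f.level_antitone hts.le)⟩
  change f.Fil t ≤ f.Fil s
  rw [f.left_cont s]
  refine le_iInf fun r => ?_
  rcases le_total t r.1 with h | h
  · exact (congrArg Subtype.val (ht r.1 h r.2)).ge
  · exact f.antitone h

/-- The Harder–Narasimhan property says that every step is the largest maximizer of
`deg - s · rank`. -/
lemma isHNLat_iff (f : D.Filtration) :
    f.IsHNLat Ξ ↔ ∀ s, IsLargestMax (D.tilt Ξ s) (f.level s) := by
  have h0 : f.IsHNLat Ξ ↔ ∀ s, D.tilt Ξ s (f.level s) = D.tilt Ξ s (f.next s) ∧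
      ∀ W : D.subobjects, f.next s ≤ W → W ≤ f.level s →
        D.tilt Ξ s W ≤ D.tilt Ξ s (f.next s) :=
    forall_congr' fun s => subquo_semistable_iff Ξ (f.next s).2 (f.isSub s) (f.next_le_level s) s
  rw [h0]
  constructor
  · intro h s
    obtain ⟨a, ha⟩ := f.exhaustive
    obtain ⟨b, hb⟩ := f.separated
    exact isLargestMax_of_semistable D.subRank_strictMono (subDeg_supermodular Ξ) D.subRank_modular
      f.level_antitone ⟨a, Subtype.ext ha⟩ ⟨b, Subtype.ext hb⟩ f.exists_level_eq f.exists_next_eq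
      (fun s t hst => f.level_le_next hst) (fun s => (h s).1) (fun s => (h s).2) s
  · intro h s
    obtain ⟨t, hst, ht⟩ := exists_gt_forall_eq D.subRank_strictMono f.level_antitone s
    have h1 : f.next s = f.level t := by
      obtain ⟨r, hr, hr'⟩ := f.exists_next_eq s
      refine le_antisymm ?_ (f.level_le_next hst)
      rw [hr']
      rcases le_total r t with h | h
      · exact (ht r hr h).le
      · exact f.level_antitone h
    have h2 := isMax_of_gt D.subRank_strictMono (subDeg_supermodular Ξ) D.subRank_modular h hst ht
    rw [h1]
    exact ⟨le_antisymm (h2 _) ((h s).1 _), fun W _ _ => h2 W⟩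

/-- The Harder–Narasimhan filtration. -/
def hnFil (D : Isoc.{w} σ) (Ξ : Submodule (integers K) (D.bc K)) [Submodule.IsLattice K Ξ] :
    D.Filtration where
  Fil s := (hnLevel D.subRank_strictMono (subDeg_supermodular Ξ) D.subRank_modular s).1
  isSub s := (hnLevel D.subRank_strictMono (subDeg_supermodular Ξ) D.subRank_modular s).2
  antitone _ _ h := hnLevel_antitone D.subRank_strictMono (subDeg_supermodular Ξ) D.subRank_modular h
  exhaustive := by
    obtain ⟨s, hs⟩ := hnLevel_exhaustive D.subRank_strictMono (subDeg_supermodular Ξ)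
      D.subRank_modular
    exact ⟨s, congrArg Subtype.val hs⟩
  separated := by
    obtain ⟨s, hs⟩ := hnLevel_separated D.subRank_strictMono (subDeg_supermodular Ξ)
      D.subRank_modular subRank_bot
    exact ⟨s, congrArg Subtype.val hs⟩
  left_cont s := by
    refine le_antisymm (le_iInf fun t => ?_) ?_
    · exact hnLevel_antitone D.subRank_strictMono (subDeg_supermodular Ξ) D.subRank_modular
        (le_of_lt t.2)
    · obtain ⟨t, hts, ht⟩ := hnLevel_left_cont D.subRank_strictMono (subDeg_supermodular Ξ)
        D.subRank_modular s
      refine (iInf_le _ (⟨t, hts⟩ : Set.Iio s)).trans (congrArg Subtype.val ht).le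

lemma hnFil_spec (s : ℝ) : IsLargestMax (D.tilt Ξ s) ((D.hnFil Ξ).level s) :=
  hnLevel_spec D.subRank_strictMono (subDeg_supermodular Ξ) D.subRank_modular s

lemma isHNLat_iff_eq (f : D.Filtration) : f.IsHNLat Ξ ↔ f = D.hnFil Ξ := by
  rw [isHNLat_iff]
  constructor
  · intro h
    exact Filtration.ext (funext fun s =>
      congrArg Subtype.val ((h s).unique (hnFil_spec Ξ s)))
  · rintro rfl
    exact hnFil_spec Ξ

/-- The largest maximizers of `deg - s · rank` are respected by morphisms. -/
lemma hnFil_map {E : Isoc.{w} σ} (f : D ⟶ E) (Θ : Submodule (integers K) (E.bc K))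
    [Submodule.IsLattice K Θ] (hmap : ∀ v ∈ Ξ, f.lin.baseChange K v ∈ Θ) (s : ℝ) :
    (D.hnFil Ξ).Fil s ≤ ((E.hnFil Θ).Fil s).comap f.lin := by
  let A := (D.hnFil Ξ).level s
  let B' := (E.hnFil Θ).level s
  let A' : D.subobjects := A ⊓ ⟨B'.1.comap f.lin, isSub_comap f B'.2⟩
  let B : E.subobjects := ⟨A.1.map f.lin, isSub_map f A.2⟩ ⊔ B'
  obtain ⟨h1, h2⟩ := subDeg_sub_le Ξ f Θ hmap (A' := A') (A := A) (B' := B') (B := B) inf_le_left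
    le_sup_right (fun x hx => Submodule.mem_sup_left ⟨x, hx, rfl⟩) rfl le_rfl
  have h3 := (hnFil_spec Ξ s).1 A'
  have h4 : B ≤ B' := by
    refine (hnFil_spec Θ s).2 B ?_
    change D.tilt Ξ s A' ≤ D.tilt Ξ s A at h3
    change E.tilt Θ s B' ≤ E.tilt Θ s B
    simp only [tilt] at h3 ⊢
    have h5 : (D.subRank A : ℝ) + E.subRank B' = D.subRank A' + E.subRank B := by exact_mod_cast h1
    linear_combination h2 + h3 - s * h5
  intro x hx
  exact h4 (Submodule.mem_sup_left ⟨x, hx, rfl⟩)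

/-! ### Gauge norms of induced lattices -/

omit [Admissible σ K] in
lemma subNorm_gauge (Ξ : Submodule (integers K) (D.bc K)) (W : Submodule L D.V) :
    D.subNorm (gauge K Ξ) W = gauge K (D.subLat Ξ W) := by
  have hinj : Function.Injective (W.subtype.baseChange K) :=
    Module.Flat.lTensor_preserves_injective_linearMap _ W.injective_subtype
  funext v
  rw [subNorm, gauge, gauge]
  congr 1
  ext r
  constructor
  · rintro ⟨c, ξ, hξ, hv, hc⟩
    by_cases h0 : c = 0
    · refine ⟨c, 0, zero_mem _, hinj ?_, hc⟩
      rw [hv, h0, zero_smul, smul_zero, map_zero]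
    · refine ⟨c, c⁻¹ • v, ?_, (smul_inv_smul₀ h0 v).symm, hc⟩
      change W.subtype.baseChange K (c⁻¹ • v) ∈ Ξ
      rwa [map_smul, hv, inv_smul_smul₀ h0]
  · rintro ⟨c, ξ, hξ, rfl, hc⟩
    exact ⟨c, W.subtype.baseChange K ξ, hξ, map_smul _ _ _, hc⟩

omit [Admissible σ K] in
/-- The infimum over all lifts in the quotient norm is compared with the gauge norm of the image
lattice. -/
lemma quotNorm_gauge (Ξ : Submodule (integers K) (D.bc K)) [Submodule.IsLattice K Ξ]
    (W : Submodule L D.V) :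
    D.quotNorm (gauge K Ξ) W = gauge K (D.quotLat Ξ W) := by
  funext u
  obtain ⟨n, ⟨b⟩⟩ := exists_lattice_basis Ξ
  have hsurj : Function.Surjective (W.mkQ.baseChange K) :=
    LinearMap.lTensor_surjective K W.mkQ_surjective
  have hle : ∀ (c : K) (ξ : D.bc K), ξ ∈ Ξ → gauge K Ξ (c • ξ) ≤ ‖c‖ := fun c ξ hξ =>
    csInf_le ⟨0, by rintro r ⟨c, _, _, _, rfl⟩; exact norm_nonneg c⟩ ⟨c, ξ, hξ, rfl, rfl⟩
  have hatt : ∀ v : D.bc K, ∃ c : K, ∃ ξ ∈ Ξ, v = c • ξ ∧ ‖c‖ = gauge K Ξ v := fun v => by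
    rw [IsocLat.gauge_eq Ξ b]
    exact (IsocLat.gauge_isLeast Ξ b v).1
  rw [quotNorm, gauge]
  refine le_antisymm ?_ ?_
  · refine le_csInf ?_ ?_
    · obtain ⟨v, rfl⟩ := hsurj u
      obtain ⟨c, ξ, hξ, rfl, hc⟩ := hatt v
      exact ⟨_, c, _, ⟨ξ, hξ, rfl⟩, map_smul _ _ _, rfl⟩
    · rintro r ⟨c, _, ⟨ξ, hξ, rfl⟩, rfl, rfl⟩
      refine le_trans (csInf_le ⟨0, ?_⟩ ⟨c • ξ, map_smul _ _ _, rfl⟩) (hle c ξ hξ)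
      rintro r ⟨v, -, rfl⟩
      exact (gauge_isNorm Ξ).nonneg v
  · refine csInf_le_csInf (?_ : BddBelow _) ?_ ?_
    · exact ⟨0, by rintro r ⟨c, _, _, _, rfl⟩; exact norm_nonneg c⟩
    · obtain ⟨v, rfl⟩ := hsurj u
      exact ⟨_, v, rfl, rfl⟩
    · rintro r ⟨v, rfl, rfl⟩
      obtain ⟨c, ξ, hξ, hv, hc⟩ := hatt v
      exact ⟨c, _, ⟨ξ, hξ, rfl⟩, by rw [hv]; exact map_smul _ _ _, hc⟩

omit [Admissible σ K] in
lemma isSemistable_gauge (Ξ : Submodule (integers K) (D.bc K)) :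
    D.IsSemistable (gauge K Ξ) ↔ D.IsSemistableLat Ξ := by
  refine and_congr_right fun _ => forall_congr' fun W => forall_congr' fun h =>
    forall_congr' fun _ => ?_
  rw [subNorm_gauge]
  rfl

omit [Admissible σ K] in
lemma isHN_gauge (Ξ : Submodule (integers K) (D.bc K)) [Submodule.IsLattice K Ξ]
    (f : D.Filtration) : f.IsHN (gauge K Ξ) ↔ f.IsHNLat Ξ := by
  refine forall_congr' fun s => ?_
  have h : f.grNorm (gauge K Ξ) s = gauge K (f.grLat Ξ s) := by
    rw [Filtration.grNorm, subNorm_gauge]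
    exact quotNorm_gauge (D := D.sub (f.Fil s) (f.isSub s))
      (D.subisocLat Ξ (f.Fil s) (f.isSub s)) (f.plusIn s)
  rw [h, isSemistable_gauge]
  rfl

end Isoc

/-! ### The axioms on rank and degree -/

namespace BunIsoc

open Isoc

variable {L : Type*} [NormedField L] {σ : L ≃+* L}
  {K : Type*} [NormedField K] [IsUltrametricDist K] [Algebra L K]
  [IsDiscreteValuationRing (integers K)]

lemma injective_of_mono {X Y : BunIsoc.{w} σ K} (f : X ⟶ Y) [Mono f] :
    Function.Injective f.hom.lin := by
  have := X.lattice
  let N := LinearMap.ker f.hom.lin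
  have hN : X.D.IsSub N := isSub_ker f.hom
  let Z : BunIsoc.{w} σ K := ⟨X.D.sub N hN, X.D.subisocLat X.Ξ N hN, inferInstance⟩
  let i : Z ⟶ X := (⟨subtypeHom hN, fun v hv => hv⟩ : BunIsoc.Hom Z X)
  let z : Z ⟶ X := (⟨(⟨0, fun _ => (map_zero _).symm⟩ : Isoc.Hom _ _), fun v _ => by
    rw [LinearMap.baseChange_zero]; exact zero_mem _⟩ : BunIsoc.Hom Z X)
  have h : i ≫ f = z ≫ f := by
    refine BunIsoc.Hom.ext (Isoc.Hom.ext (LinearMap.ext fun x => ?_))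
    have h1 : f.hom.lin x.1 = 0 := x.2
    exact h1.trans (map_zero f.hom.lin).symm
  have h2 := (cancel_mono f).1 h
  rw [← LinearMap.ker_eq_bot, Submodule.eq_bot_iff]
  intro x hx
  exact LinearMap.congr_fun (congrArg (fun k : Z ⟶ X => k.hom.lin) h2) ⟨x, hx⟩

lemma surjective_of_epi {X Y : BunIsoc.{w} σ K} (f : X ⟶ Y) [Epi f] :
    Function.Surjective f.hom.lin := by
  have := Y.lattice
  let R := (⊤ : Submodule L X.D.V).map f.hom.lin
  have hR : Y.D.IsSub R := isSub_map f.hom X.D.isSub_top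
  let Θ : Submodule (integers K) ((Y.D.quot R hR).bc K) := Y.D.quotLat Y.Ξ R
  let Z : BunIsoc.{w} σ K := ⟨Y.D.quot R hR, Θ, quotLat_isLattice Y.D Y.Ξ R⟩
  let i : Y ⟶ Z := (⟨mkQHom hR, fun v hv => ⟨v, hv, rfl⟩⟩ : BunIsoc.Hom Y Z)
  let z : Y ⟶ Z := (⟨(⟨0, fun _ => (map_zero _).symm⟩ : Isoc.Hom _ _), fun v _ => by
    rw [LinearMap.baseChange_zero]; exact zero_mem _⟩ : BunIsoc.Hom Y Z)
  have h : f ≫ i = f ≫ z := by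
    refine BunIsoc.Hom.ext (Isoc.Hom.ext (LinearMap.ext fun x => ?_))
    exact (Submodule.Quotient.mk_eq_zero R).2 ⟨x, trivial, rfl⟩
  have h2 := (cancel_epi f).1 h
  intro y
  have h3 : R.mkQ y = 0 :=
    LinearMap.congr_fun (congrArg (fun k : Y ⟶ Z => k.hom.lin) h2) y
  obtain ⟨x, -, hx⟩ := (Submodule.Quotient.mk_eq_zero R).1 h3
  exact ⟨x, hx⟩

lemma isIso_of_deg_eq [Admissible σ K] {X Y : BunIsoc.{w} σ K} (f : X ⟶ Y)
    (hf : Function.Bijective f.hom.lin) (h : X.deg = Y.deg) : IsIso f := by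
  have := X.lattice
  have := Y.lattice
  have h1 := (degLat_le_of_bijective f.hom hf f.map_mem).2 h
  let F : X.D.V ≃ₗ[L] Y.D.V := LinearEquiv.ofBijective f.hom.lin hf
  have hF : ∀ x, f.hom.lin (F.symm x) = x := F.apply_symm_apply
  have hF' : f.hom.lin ∘ₗ F.symm.toLinearMap = LinearMap.id := LinearMap.ext hF
  let g : Y ⟶ X := (⟨(⟨F.symm.toLinearMap, fun x => hf.1 (by
    change f.hom.lin (F.symm _) = f.hom.lin (X.D.φ (F.symm _))
    rw [hF, f.hom.comm, hF])⟩ : Isoc.Hom _ _), fun v hv => h1 _ (by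
      rw [baseChange_comp_apply, hF']
      simpa using hv)⟩ : BunIsoc.Hom Y X)
  refine ⟨g, BunIsoc.Hom.ext (Isoc.Hom.ext (LinearMap.ext fun x => F.symm_apply_apply x)),
    BunIsoc.Hom.ext (Isoc.Hom.ext (LinearMap.ext hF))⟩

theorem rankDegreeAxioms [Admissible σ K] : RankDegreeAxioms.{w} σ K where
  rank_eq_zero _ := rank_eq_zero_iff
  rank_add f g h := finrank_add_of_exact h.inj h.exact h.surj
  deg_add {X Y Z} f g h := by
    have := X.lattice
    have := Z.lattice
    exact degLat_add_of_exact f.hom g.hom h.inj h.exact h.surj h.sub g.map_mem h.quot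
  rank_eq f _ _ := (LinearEquiv.ofBijective f.hom.lin
    ⟨injective_of_mono f, surjective_of_epi f⟩).finrank_eq
  deg_le {X Y} f _ _ := by
    have := X.lattice
    have := Y.lattice
    exact (degLat_le_of_bijective f.hom ⟨injective_of_mono f, surjective_of_epi f⟩ f.map_mem).1
  deg_eq_iff {X Y} f _ _ := by
    refine ⟨isIso_of_deg_eq f ⟨injective_of_mono f, surjective_of_epi f⟩, fun h => ?_⟩
    have := X.lattice
    have := Y.lattice
    refine le_antisymm
      (degLat_le_of_bijective f.hom ⟨injective_of_mono f, surjective_of_epi f⟩ f.map_mem).1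
      (degLat_le_of_bijective (inv f).hom ⟨injective_of_mono _, surjective_of_epi _⟩
        (inv f).map_mem).1

end BunIsoc

/-- The functor sending an isocrystal with lattice to its Harder–Narasimhan filtration. -/
def hnFunctor {L : Type*} [NormedField L] (σ : L ≃+* L)
    (K : Type*) [NormedField K] [IsUltrametricDist K] [Algebra L K]
    [IsDiscreteValuationRing (integers K)] [Admissible σ K] : FilteringFunctor.{w} σ K where
  fil X :=
    have := X.lattice
    X.D.hnFil X.Ξ
  map_mem {X Y} f s x hx :=
    have := X.lattice
    have := Y.lattice
    Isoc.hnFil_map X.Ξ f.hom Y.Ξ f.map_mem s hx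

/-! ### Minors of matrices -/

section Minors

variable {d : ℕ} {X Y R : Type*} [CommRing R]

/-- The `d × d` minor of a matrix with `d` rows given by a family of `d` columns. -/
def minor (B : Matrix (Fin d) X R) (J : Fin d → X) : R := (B.submatrix id J).det

/-- The Cauchy–Binet expansion, as a sum over all maps instead of increasing ones. -/
lemma minor_mul [Fintype X] [DecidableEq X] (B : Matrix (Fin d) X R) (M : Matrix X Y R)
    (J : Fin d → Y) :
    minor (B * M) J = ∑ I : Fin d → X, (∏ k, M (I k) (J k)) * minor B I := by
  have h1 : ((B * M).submatrix id J).transpose =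
      fun k => ∑ x, M x (J k) • fun i => B i x := by
    ext k i
    simp [Matrix.mul_apply, mul_comm]
  rw [minor, ← Matrix.det_transpose, h1]
  change (Matrix.detRowAlternating (R := R) (n := Fin d)).toMultilinearMap _ = _
  rw [MultilinearMap.map_sum]
  refine Finset.sum_congr rfl fun I _ => ?_
  rw [MultilinearMap.map_smul_univ, smul_eq_mul, minor, ← Matrix.det_transpose]
  rfl

lemma minor_mul_left (T : Matrix (Fin d) (Fin d) R) (B : Matrix (Fin d) X R) (J : Fin d → X) :
    minor (T * B) J = T.det * minor B J := by
  rw [minor, minor, ← Matrix.det_mul]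
  rfl

lemma minor_map {S : Type*} [CommRing S] (f : R →+* S) (B : Matrix (Fin d) X R) (J : Fin d → X) :
    minor (B.map f) J = f (minor B J) := (RingHom.map_det f _).symm

lemma exists_minor_ne_zero [Nontrivial R] [Fintype X] [DecidableEq X] {B : Matrix (Fin d) X R}
    {M : Matrix X (Fin d) R} (h : B * M = 1) : ∃ J, minor B J ≠ 0 := by
  by_contra! h0
  have h1 : minor (B * M) id = 0 := by
    rw [minor_mul]
    simp [h0]
  rw [h, minor, Matrix.submatrix_id_id, Matrix.det_one] at h1
  exact one_ne_zero h1

end Minors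

lemma map_kronecker {R S ι ι' κ κ' : Type*} [CommRing R] [CommRing S] (f : R →+* S)
    (G : Matrix ι ι' R) (H : Matrix κ κ' R) : (G ⊗ₖ H).map f = G.map f ⊗ₖ H.map f := by
  ext i j
  simp [Matrix.kroneckerMap_apply]

/-! ### Bases adapted to a filtration -/

/-- A basis orthogonal for a function `N` describing an exhaustive separated filtration (`N x` is
the last index at which `x` lies in the filtration) is obtained from any basis by adding to each
vector a combination of the preceding ones, so that `N` becomes maximal. -/
lemma exists_adapted_basis {E V ι : Type*} [Field E] [AddCommGroup V] [Module E V] [Fintype ι]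
    [DecidableEq ι] (b : Module.Basis ι E V) {N : V → WithTop ℝ}
    (hadd : ∀ x y, min (N x) (N y) ≤ N (x + y)) (hsmul : ∀ (c : E) x, c ≠ 0 → N (c • x) = N x)
    (hfin : (Set.range N).Finite) {r : ι → ℕ} (hr : Function.Injective r) :
    ∃ b' : Module.Basis ι E V, (∀ i, b' i - b i ∈ Submodule.span E (b '' {j | r j < r i})) ∧
      ∀ x i, b'.repr x i ≠ 0 → N x ≤ N (b' i) := by
  have hmax : ∀ i, ∃ c : V, c - b i ∈ Submodule.span E (b '' {j | r j < r i}) ∧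
      ∀ c', c' - b i ∈ Submodule.span E (b '' {j | r j < r i}) → N c' ≤ N c := by
    intro i
    let s : Set V := {c | c - b i ∈ Submodule.span E (b '' {j | r j < r i})}
    have h1 : (N '' s).Finite := hfin.subset (Set.image_subset_range _ _)
    have h2 : (N '' s).Nonempty := ⟨_, b i, by simp [s], rfl⟩
    obtain ⟨_, ⟨c, hc, rfl⟩, hm⟩ := Set.exists_max_image (N '' s) id h1 h2
    exact ⟨c, hc, fun c' hc' => hm _ ⟨c', hc', rfl⟩⟩
  choose c hc hcmax using hmax
  have hrepr : ∀ i j, r i ≤ r j → b.repr (c i) j = if i = j then 1 else 0 := by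
    intro i j hij
    have h1 : b.repr (c i - b i) j = 0 := by
      have h2 := hc i
      rw [b.mem_span_image] at h2
      by_contra h3
      have : r j < r i := h2 (Finsupp.mem_support_iff.2 h3)
      omega
    rw [map_sub, Finsupp.sub_apply, sub_eq_zero] at h1
    rw [h1, b.repr_self, Finsupp.single_apply]
  have hli : LinearIndependent E c := by
    classical
    rw [Fintype.linearIndependent_iff]
    intro g hg
    by_contra! hne
    obtain ⟨i0, hi0⟩ := hne
    obtain ⟨i, hi, hmax⟩ := Finset.exists_max_image (Finset.univ.filter fun i => g i ≠ 0) r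
      ⟨i0, by simpa using hi0⟩
    have h1 : b.repr (∑ j, g j • c j) i = g i := by
      rw [map_sum, Finsupp.finsetSum_apply, Finset.sum_eq_single i]
      · rw [map_smul, Finsupp.smul_apply, hrepr i i le_rfl, if_pos rfl, smul_eq_mul, mul_one]
      · intro j _ hji
        rw [map_smul, Finsupp.smul_apply]
        by_cases hj : g j = 0
        · rw [hj, zero_smul]
        · rw [hrepr j i (hmax j (by simpa using hj)), if_neg hji, smul_zero]
      · simp
    rw [hg, map_zero] at h1
    exact (Finset.mem_filter.1 hi).2 h1.symm
  have hfd : FiniteDimensional E V := b.finiteDimensional_of_finite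
  let b' : Module.Basis ι E V := basisOfLinearIndependentOfCardEqFinrank' c hli
    (Module.finrank_eq_card_basis b).symm
  have hb' : ∀ i, b' i = c i := fun i => by simp [b']
  refine ⟨b', fun i => by rw [hb']; exact hc i, ?_⟩
  have hspan : ∀ i j, r j < r i → b' j ∈ Submodule.span E (b '' {j | r j < r i}) := by
    intro i j hji
    rw [hb', ← sub_add_cancel (c j) (b j)]
    refine add_mem (Submodule.span_mono (Set.image_mono fun k hk => ?_) (hc j))
      (Submodule.subset_span ⟨j, hji, rfl⟩)
    exact lt_trans (show r k < r j from hk) hji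
  have key : ∀ n : ℕ, ∀ x, (∀ i, b'.repr x i ≠ 0 → r i < n) →
      ∀ i, b'.repr x i ≠ 0 → N x ≤ N (b' i) := by
    intro n
    induction n with
    | zero => exact fun x hx i hi => absurd (hx i hi) (Nat.not_lt_zero _)
    | succ n ih =>
      intro x hx
      by_cases h : ∃ i, b'.repr x i ≠ 0 ∧ r i = n
      · obtain ⟨i0, h0, hrn⟩ := h
        obtain ⟨g, hg⟩ : ∃ g : ι → E, ∀ j, b'.repr x j = g j := ⟨_, fun _ => rfl⟩
        have hxg : x = g i0 • b' i0 + ∑ j ∈ Finset.univ.erase i0, g j • b' j := by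
          rw [Finset.add_sum_erase _ (fun j => g j • b' j) (Finset.mem_univ i0)]
          conv_lhs => rw [← b'.sum_repr x]
          simp only [hg]
        simp only [hg] at hx h0 ⊢
        have h1 : N x ≤ N (b' i0) := by
          rw [← hsmul _ x (inv_ne_zero h0), hb']
          refine hcmax i0 _ ?_
          have h2 : (g i0)⁻¹ • x - b i0 = (c i0 - b i0) +
              ∑ j ∈ Finset.univ.erase i0, ((g i0)⁻¹ * g j) • b' j := by
            rw [hxg, smul_add, smul_smul, inv_mul_cancel₀ h0, one_smul, hb' i0, Finset.smul_sum]
            simp only [smul_smul]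
            abel
          rw [h2]
          refine add_mem (hc i0) (Submodule.sum_mem _ fun j hj => ?_)
          by_cases hj0 : g j = 0
          · rw [hj0, mul_zero, zero_smul]
            exact zero_mem _
          refine Submodule.smul_mem _ _ (hspan _ _ ?_)
          have h3 := hx j hj0
          have h4 : r j ≠ r i0 := fun h => Finset.ne_of_mem_erase hj (hr h)
          omega
        have h5 : N x ≤ N (x - g i0 • b' i0) := by
          refine le_trans (le_min le_rfl ?_) (sub_eq_add_neg x (g i0 • b' i0) ▸ hadd _ _)
          rwa [← neg_smul, hsmul _ _ (neg_ne_zero.2 h0)]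
        have h6 : ∀ j, b'.repr (x - g i0 • b' i0) j = if j = i0 then 0 else g j := by
          intro j
          rw [map_sub, map_smul, Finsupp.sub_apply, Finsupp.smul_apply, b'.repr_self,
            Finsupp.single_apply, hg]
          split_ifs with h7 h8 h8
          · rw [h7, smul_eq_mul, mul_one, sub_self]
          · exact absurd h7.symm h8
          · exact absurd h8.symm h7
          · rw [smul_zero, sub_zero]
        intro i hi
        by_cases hii : i = i0
        · rwa [hii]
        refine h5.trans (ih _ (fun j hj => ?_) i ?_)
        · rw [h6] at hj
          split_ifs at hj with h7
          · exact absurd rfl hj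
          have h3 := hx j hj
          have h4 : r j ≠ r i0 := fun h => h7 (hr h)
          omega
        · rwa [h6, if_neg hii]
      · push Not at h
        exact ih x fun i hi => lt_of_le_of_ne (Nat.lt_succ_iff.1 (hx i hi)) (h i hi)
  intro x
  exact key (Finset.univ.sup r + 1) x fun i _ => Nat.lt_succ_of_le (Finset.le_sup (Finset.mem_univ i))

section Level

variable {E ι : Type*} [Field E] [Fintype ι]

/-- The filtration of `ι → E` with weights `a` on the basis formed by the rows of `G⁻¹`: the last
index at which `x` lies in the filtration. The coordinates of `x` in that basis are `x ᵥ* G`. -/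
def level (G : Matrix ι ι E) (a : ι → ℝ) (x : ι → E) : WithTop ℝ :=
  open Classical in Finset.univ.inf fun j => if (x ᵥ* G) j = 0 then ⊤ else (a j : WithTop ℝ)

lemma le_level_iff {G : Matrix ι ι E} {a : ι → ℝ} {x : ι → E} {c : WithTop ℝ} :
    c ≤ level G a x ↔ ∀ j, (x ᵥ* G) j ≠ 0 → c ≤ a j := by
  rw [level, Finset.le_inf_iff]
  refine ⟨fun h j hj => ?_, fun h j _ => ?_⟩
  · simpa [hj] using h j (Finset.mem_univ j)
  · split_ifs with h1
    · exact le_top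
    · exact h j h1

lemma level_add (G : Matrix ι ι E) (a : ι → ℝ) (x y : ι → E) :
    min (level G a x) (level G a y) ≤ level G a (x + y) := by
  rw [le_level_iff]
  intro j hj
  rw [Matrix.add_vecMul, Pi.add_apply] at hj
  by_cases h : (x ᵥ* G) j = 0
  · rw [h, zero_add] at hj
    exact (min_le_right _ _).trans (le_level_iff.1 le_rfl j hj)
  · exact (min_le_left _ _).trans (le_level_iff.1 le_rfl j h)

lemma level_smul (G : Matrix ι ι E) (a : ι → ℝ) (c : E) (x : ι → E) (hc : c ≠ 0) :
    level G a (c • x) = level G a x := by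
  classical
  refine Finset.inf_congr rfl fun j _ => if_congr ?_ rfl rfl
  rw [Matrix.smul_vecMul, Pi.smul_apply, smul_eq_zero, or_iff_right hc]

lemma level_mem_range (G : Matrix ι ι E) (a : ι → ℝ) (x : ι → E) :
    level G a x ∈ insert ⊤ (Set.range fun j => (a j : WithTop ℝ)) := by
  classical
  rcases isEmpty_or_nonempty ι with h | h
  · left
    simp [level]
  · obtain ⟨j, -, hj⟩ := Finset.exists_mem_eq_inf (Finset.univ : Finset ι) Finset.univ_nonempty
      fun j => if (x ᵥ* G) j = 0 then ⊤ else (a j : WithTop ℝ)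
    have h1 : level G a x = if (x ᵥ* G) j = 0 then ⊤ else (a j : WithTop ℝ) := by
      rw [← hj, level]
    rw [h1]
    split_ifs
    · exact Set.mem_insert _ _
    · exact Set.mem_insert_of_mem _ ⟨j, rfl⟩

lemma level_finite_range (G : Matrix ι ι E) (a : ι → ℝ) : (Set.range (level G a)).Finite :=
  ((Set.finite_range _).insert ⊤).subset (by rintro _ ⟨x, rfl⟩; exact level_mem_range G a x)

variable [DecidableEq ι]

lemma level_eq_top {G : Matrix ι ι E} (hG : G.det ≠ 0) {a : ι → ℝ} {x : ι → E}
    (h : level G a x = ⊤) : x = 0 := by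
  refine Matrix.eq_zero_of_vecMul_eq_zero hG (funext fun j => ?_)
  by_contra hj
  have h1 := le_level_iff.1 h.ge j hj
  exact absurd (top_le_iff.1 h1) (WithTop.coe_ne_top)

lemma level_map {E' : Type*} [Field E'] (f : E →+* E') (G : Matrix ι ι E) (a : ι → ℝ) (x : ι → E) :
    level (G.map f) a (f ∘ x) = level G a x := by
  have h : ∀ j, ((f ∘ x) ᵥ* G.map f) j = f ((x ᵥ* G) j) := fun j =>
    (RingHom.map_vecMul f G x j).symm
  classical
  refine Finset.inf_congr rfl fun j _ => if_congr ?_ rfl rfl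
  rw [h, map_eq_zero]

/-- The inclusion of a filtration in another one makes the transition matrix triangular. -/
lemma triangular_of_level_le {G₁ G₂ : Matrix ι ι E} (h₁ : G₁.det ≠ 0) {a₁ a₂ : ι → ℝ}
    (h : ∀ x, level G₁ a₁ x ≤ level G₂ a₂ x) {i j : ι} (hij : (G₁⁻¹ * G₂) i j ≠ 0) :
    a₁ i ≤ a₂ j := by
  have hu : IsUnit G₁.det := isUnit_iff_ne_zero.2 h₁
  have h2 : (a₁ i : WithTop ℝ) ≤ level G₁ a₁ (G₁⁻¹ i) := by
    rw [le_level_iff]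
    intro k hk
    have h3 : (G₁⁻¹ i ᵥ* G₁) k = (1 : Matrix ι ι E) i k := by
      rw [← Matrix.nonsing_inv_mul G₁ hu]; rfl
    rw [h3, Matrix.one_apply] at hk
    have : i = k := by by_contra h; exact hk (if_neg h)
    rw [this]
  exact_mod_cast le_level_iff.1 (h2.trans (h _)) j hij

/-- A change of basis which does not decrease weights does not decrease the filtration. -/
lemma level_le_of_triangular {G M : Matrix ι ι E} {a₁ a₂ : ι → ℝ}
    (h : ∀ i j, M i j ≠ 0 → a₁ i ≤ a₂ j) (x : ι → E) :
    level G a₁ x ≤ level (G * M) a₂ x := by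
  rw [le_level_iff]
  intro j hj
  rw [← Matrix.vecMul_vecMul] at hj
  obtain ⟨i, -, hi⟩ := Finset.exists_ne_zero_of_sum_ne_zero hj
  exact (le_level_iff.1 le_rfl i (left_ne_zero_of_mul hi)).trans
    (WithTop.coe_le_coe.2 (h i j (right_ne_zero_of_mul hi)))

lemma exists_perm_le {M : Matrix ι ι E} (hM : M.det ≠ 0) {a c : ι → ℝ}
    (h : ∀ i j, M i j ≠ 0 → a i ≤ c j) : ∃ π : Equiv.Perm ι, ∀ j, a (π j) ≤ c j := by
  rw [Matrix.det_apply] at hM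
  obtain ⟨π, -, hπ⟩ := Finset.exists_ne_zero_of_sum_ne_zero hM
  refine ⟨π, fun j => h _ _ ?_⟩
  have h1 : ∏ i, M (π i) i ≠ 0 := fun h0 => hπ (by rw [h0, smul_zero])
  exact Finset.prod_ne_zero_iff.1 h1 j (Finset.mem_univ j)

/-- If the filtration with weights `a₁` lies in the one with weights `a₂`, then `a₁` lies below `a₂`
up to a permutation. -/
lemma exists_perm_of_level_le {G₁ G₂ : Matrix ι ι E} (h₁ : G₁.det ≠ 0) (h₂ : G₂.det ≠ 0)
    {a₁ a₂ : ι → ℝ} (h : ∀ x, level G₁ a₁ x ≤ level G₂ a₂ x) :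
    ∃ π : Equiv.Perm ι, ∀ j, a₁ (π j) ≤ a₂ j := by
  refine exists_perm_le (M := G₁⁻¹ * G₂) ?_ fun i j hij => triangular_of_level_le h₁ h hij
  rw [Matrix.det_mul, Matrix.det_nonsing_inv, Ring.inverse_eq_inv']
  exact mul_ne_zero (inv_ne_zero h₁) h₂

/-- Weights whose sum is not larger are equal up to a permutation. -/
lemma exists_perm_eq_of_level_le {G₁ G₂ : Matrix ι ι E} (h₁ : G₁.det ≠ 0) (h₂ : G₂.det ≠ 0)
    {a₁ a₂ : ι → ℝ} (h : ∀ x, level G₁ a₁ x ≤ level G₂ a₂ x) (hsum : ∑ i, a₂ i ≤ ∑ i, a₁ i) :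
    ∃ π : Equiv.Perm ι, ∀ j, a₁ (π j) = a₂ j := by
  obtain ⟨π, hπ⟩ := exists_perm_of_level_le h₁ h₂ h
  refine ⟨π, fun j => ?_⟩
  have h3 : ∑ i, a₁ (π i) = ∑ i, a₁ i := Equiv.sum_comp π a₁
  have h4 : ∑ i, (a₂ i - a₁ (π i)) ≤ 0 := by
    rw [Finset.sum_sub_distrib, h3]
    linarith
  have h5 := (Finset.sum_eq_zero_iff_of_nonneg fun i _ => sub_nonneg.2 (hπ i)).1
    (le_antisymm h4 (Finset.sum_nonneg fun i _ => sub_nonneg.2 (hπ i))) j (Finset.mem_univ j)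
  linarith

lemma exists_perm_eq_of_level_eq {G₁ G₂ : Matrix ι ι E} (h₁ : G₁.det ≠ 0) (h₂ : G₂.det ≠ 0)
    {a₁ a₂ : ι → ℝ} (h : level G₁ a₁ = level G₂ a₂) :
    ∃ π : Equiv.Perm ι, ∀ j, a₁ (π j) = a₂ j := by
  refine exists_perm_eq_of_level_le h₁ h₂ (fun x => (congrFun h x).le) ?_
  obtain ⟨π, hπ⟩ := exists_perm_of_level_le h₂ h₁ fun x => (congrFun h x).ge
  rw [← Equiv.sum_comp π a₂]
  exact Finset.sum_le_sum fun i _ => hπ i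

/-- An injective numbering of the indices which decreases the weights. -/
lemma exists_numbering (a : ι → ℝ) : ∃ r : ι → ℕ, Function.Injective r ∧
    ∀ i j, r j < r i → a i ≤ a j := by
  let e := Fintype.equivFin ι
  let f : Fin (Fintype.card ι) → ℝ := fun k => -a (e.symm k)
  let s := Tuple.sort f
  have hs : Monotone (f ∘ s) := Tuple.monotone_sort f
  refine ⟨fun i => (s.symm (e i) : ℕ), fun i j h => ?_, fun i j h => ?_⟩
  · exact e.injective (s.symm.injective (Fin.ext h))
  · have h1 := hs (Fin.le_def.2 (le_of_lt h))
    simp only [Function.comp_apply, Equiv.apply_symm_apply, f, Equiv.symm_apply_apply] at h1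
    linarith

/-- The rows of the inverse of a matrix, as a basis. -/
lemma exists_matrix_of_basis (b : Module.Basis ι E (ι → E)) :
    ∃ P : Matrix ι ι E, P.det ≠ 0 ∧ P⁻¹ = Matrix.of b ∧ ∀ x, x ᵥ* P = b.repr x := by
  let B : Matrix ι ι E := Matrix.of b
  have hB : ∀ x, (b.repr x : ι → E) ᵥ* B = x := by
    intro x
    conv_rhs => rw [← b.sum_repr x]
    ext j
    simp [Matrix.vecMul, dotProduct, B]
  have hdet : B.det ≠ 0 := by
    intro h0
    obtain ⟨c, hc0, hc⟩ := Matrix.exists_vecMul_eq_zero_iff.2 h0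
    refine hc0 ?_
    have h1 : ∑ i, c i • b i = 0 := by
      rw [← hc]
      ext j
      simp [Matrix.vecMul, dotProduct, B]
    exact funext fun i => Fintype.linearIndependent_iff.1 b.linearIndependent c h1 i
  have hu : IsUnit B.det := isUnit_iff_ne_zero.2 hdet
  refine ⟨B⁻¹, ?_, Matrix.nonsing_inv_nonsing_inv B hu, fun x => ?_⟩
  · rw [Matrix.det_nonsing_inv, Ring.inverse_eq_inv']
    exact inv_ne_zero hdet
  · conv_lhs => rw [← hB x]
    rw [Matrix.vecMul_vecMul, Matrix.mul_nonsing_inv B hu, Matrix.vecMul_one]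

lemma level_sum (N : (ι → E) → WithTop ℝ) (hadd : ∀ x y, min (N x) (N y) ≤ N (x + y))
    (hsmul : ∀ (c : E) x, c ≠ 0 → N (c • x) = N x) (hzero : N 0 = ⊤) {b : ι → ι → E} {g : ι → E}
    {c : WithTop ℝ} (h : ∀ i, g i ≠ 0 → c ≤ N (b i)) : c ≤ N (∑ i, g i • b i) := by
  refine Finset.sum_induction (fun i => g i • b i) (fun x => c ≤ N x)
    (fun x y hx hy => (le_min hx hy).trans (hadd x y)) (by rw [hzero]; exact le_top) fun i _ => ?_
  by_cases hi : g i = 0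
  · rw [hi, zero_smul, hzero]
    exact le_top
  · rw [hsmul _ _ hi]
    exact h i hi

lemma level_zero (G : Matrix ι ι E) (a : ι → ℝ) : level G a 0 = ⊤ := by
  simp [level]

/-- Two filtrations of a vector space have a common adapted basis. -/
lemma exists_common_basis {G₁ G₂ : Matrix ι ι E} (h₁ : G₁.det ≠ 0) (h₂ : G₂.det ≠ 0)
    (a₁ a₂ : ι → ℝ) : ∃ (P : Matrix ι ι E) (c : ι → ℝ), P.det ≠ 0 ∧
      level P a₁ = level G₁ a₁ ∧ level P c = level G₂ a₂ := by
  obtain ⟨r, hr, hra⟩ := exists_numbering a₁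
  have hu : IsUnit G₁.det := isUnit_iff_ne_zero.2 h₁
  have hG1 : (G₁⁻¹).det ≠ 0 := by
    rw [Matrix.det_nonsing_inv, Ring.inverse_eq_inv']
    exact inv_ne_zero h₁
  -- the basis formed by the rows of `G₁⁻¹`
  let e : (ι → E) ≃ₗ[E] (ι → E) := LinearEquiv.ofLinearMap (Matrix.vecMulLinear G₁)
    (Matrix.vecMulLinear G₁⁻¹)
    (LinearMap.ext fun x => by simp [Matrix.vecMul_vecMul, Matrix.nonsing_inv_mul G₁ hu])
    (LinearMap.ext fun x => by simp [Matrix.vecMul_vecMul, Matrix.mul_nonsing_inv G₁ hu])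
  let b : Module.Basis ι E (ι → E) := Module.Basis.ofEquivFun e
  have hb : ∀ x i, b.repr x i = (x ᵥ* G₁) i := fun x i => rfl
  obtain ⟨b', hb', hN⟩ := exists_adapted_basis b (level_add G₂ a₂) (level_smul G₂ a₂)
    (level_finite_range G₂ a₂) hr
  obtain ⟨P, hP, hPinv, hPr⟩ := exists_matrix_of_basis b'
  have htop : ∀ i, level G₂ a₂ (b' i) ≠ ⊤ := fun i h => b'.ne_zero i (level_eq_top h₂ h)
  refine ⟨P, fun i => (level G₂ a₂ (b' i)).untop (htop i), hP, ?_, ?_⟩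
  · have hM : ∀ i j, (P⁻¹ * G₁) i j ≠ 0 → r j ≤ r i := by
      intro i j hij
      have h3 : (P⁻¹ * G₁) i j = b.repr (b' i) j := by
        rw [hPinv, hb]; rfl
      rw [h3, ← sub_add_cancel (b' i) (b i), map_add, Finsupp.add_apply, b.repr_self,
        Finsupp.single_apply] at hij
      by_contra! h4
      apply hij
      have h5 := hb' i
      rw [b.mem_span_image] at h5
      have h6 : b.repr (b' i - b i) j = 0 := by
        by_contra h7
        have : r j < r i := h5 (Finsupp.mem_support_iff.2 h7)
        omega
      rw [h6, if_neg (by rintro rfl; exact lt_irrefl _ h4), zero_add]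
    have hdetM : (P⁻¹ * G₁).det ≠ 0 := by
      rw [Matrix.det_mul, Matrix.det_nonsing_inv, Ring.inverse_eq_inv']
      exact mul_ne_zero (inv_ne_zero hP) h₁
    have huP : IsUnit P.det := isUnit_iff_ne_zero.2 hP
    have hinv : ∀ i j, ((P⁻¹ * G₁)⁻¹) i j ≠ 0 → r j ≤ r i := by
      have hbt : (P⁻¹ * G₁).BlockTriangular fun i => OrderDual.toDual (r i) := by
        intro i j hij
        by_contra h0
        exact absurd (hM i j h0) (not_le.2 hij)
      have := Matrix.invertibleOfIsUnitDet _ (isUnit_iff_ne_zero.2 hdetM)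
      have h8 := Matrix.blockTriangular_inv_of_blockTriangular hbt
      intro i j hij
      by_contra! h9
      exact hij (h8 h9)
    have hle : ∀ i j, r j ≤ r i → a₁ i ≤ a₁ j := fun i j hij => by
      rcases hij.lt_or_eq with h | h
      · exact hra i j h
      · rw [hr h]
    funext x
    apply le_antisymm
    · have h10 := level_le_of_triangular (G := P) (fun i j hij => hle i j (hM i j hij)) x
      rwa [← Matrix.mul_assoc, Matrix.mul_nonsing_inv P huP, Matrix.one_mul] at h10
    · have h10 := level_le_of_triangular (G := G₁) (fun i j hij => hle i j (hinv i j hij)) x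
      rwa [Matrix.mul_inv_rev, Matrix.nonsing_inv_nonsing_inv P huP, ← Matrix.mul_assoc,
        Matrix.mul_nonsing_inv G₁ hu, Matrix.one_mul] at h10
  · funext x
    apply le_antisymm
    · conv_rhs => rw [← b'.sum_repr x]
      refine level_sum _ (level_add G₂ a₂) (level_smul G₂ a₂) (level_zero G₂ a₂) fun i hi => ?_
      rw [← hPr] at hi
      have := le_level_iff.1 (le_refl (level P (fun i => (level G₂ a₂ (b' i)).untop (htop i)) x)) i hi
      rwa [WithTop.coe_untop] at this
    · rw [le_level_iff]
      intro j hj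
      rw [hPr] at hj
      rw [WithTop.coe_untop]
      exact hN x j hj

end Level

/-! ### Galois descent of filtrations -/

section Descent

variable {L E ι : Type*} [Field L] [Field E] [Algebra L E] [Fintype ι] [DecidableEq ι]

/-- An orthogonality property which holds for rational vectors holds for all vectors, by Galois
descent: a vector of minimal support in a step of the filtration is rational up to scaling. -/
lemma descent_orthogonal [IsGalois L E] {N : (ι → E) → WithTop ℝ}
    (hadd : ∀ x y, min (N x) (N y) ≤ N (x + y)) (hsmul : ∀ (c : E) x, c ≠ 0 → N (c • x) = N x)
    (hgal : ∀ (τ : E ≃ₐ[L] E) x, N (τ ∘ x) = N x)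
    (hrat : ∀ (y : ι → L) i, y i ≠ 0 → N (algebraMap L E ∘ y) ≤ N (Pi.single i 1))
    (x : ι → E) (i : ι) (hi : x i ≠ 0) : N x ≤ N (Pi.single i 1) := by
  classical
  let supp : (ι → E) → Finset ι := fun x => Finset.univ.filter fun i => x i ≠ 0
  have hsub : ∀ x y, N x ≤ N y → ∀ c : E, N x ≤ N (y - c • x) := by
    intro x y hxy c
    by_cases hc : c = 0
    · simpa [hc] using hxy
    · refine le_trans (le_min hxy ?_) (sub_eq_add_neg y (c • x) ▸ hadd _ _)
      rw [← neg_smul, hsmul _ _ (neg_ne_zero.2 hc)]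
  have key : ∀ n : ℕ, ∀ x : ι → E, (supp x).card = n → ∀ i, x i ≠ 0 →
      N x ≤ N (Pi.single i 1) := by
    intro n
    induction n using Nat.strong_induction_on with
    | _ n ih =>
      intro x hn i hi
      -- `y` has minimal support among the vectors supported in `supp x` and of level at least `N x`
      obtain ⟨y, ⟨hy0, hyx, hNy⟩, hmin⟩ := (measure fun y => (supp y).card).wf.has_min
        {y : ι → E | y ≠ 0 ∧ supp y ⊆ supp x ∧ N x ≤ N y}
        ⟨x, by rintro rfl; exact hi rfl, subset_rfl, le_rfl⟩
      obtain ⟨i0, hi0⟩ := Function.ne_iff.1 hy0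
      have hi0' : y i0 ≠ 0 := hi0
      set z := (y i0)⁻¹ • y with hz
      have hzi : z i0 = 1 := by simp [hz, hi0']
      have hNz : N x ≤ N z := by rw [hz, hsmul _ _ (inv_ne_zero hi0')]; exact hNy
      have hzs : supp z = supp y := by
        ext j
        simp [supp, hz, hi0']
      have hfix : ∀ τ : E ≃ₐ[L] E, τ ∘ z = z := by
        intro τ
        by_contra hne
        have hs : supp (τ ∘ z - z) ⊆ (supp y).erase i0 := by
          intro j hj
          have hj' : τ (z j) - z j ≠ 0 := (Finset.mem_filter.1 hj).2
          refine Finset.mem_erase.2 ⟨?_, ?_⟩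
          · rintro rfl
            exact hj' (by rw [hzi, map_one, sub_self])
          · rw [← hzs]
            refine Finset.mem_filter.2 ⟨Finset.mem_univ _, fun h0 => hj' ?_⟩
            rw [h0, map_zero, sub_zero]
        refine hmin (τ ∘ z - z) ⟨sub_ne_zero.2 hne, ?_, ?_⟩ ?_
        · exact hs.trans ((Finset.erase_subset _ _).trans hyx)
        · refine hNz.trans ?_
          have := hsub z (τ ∘ z) (hgal τ z).ge 1
          rwa [one_smul] at this
        · refine lt_of_le_of_lt (Finset.card_le_card hs) (Finset.card_erase_lt_of_mem ?_)
          exact Finset.mem_filter.2 ⟨Finset.mem_univ _, hi0'⟩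
      have hrat' : ∃ w : ι → L, algebraMap L E ∘ w = z := by
        have h1 : ∀ j, ∃ w, algebraMap L E w = z j := fun j => by
          have h2 := (InfiniteGalois.mem_bot_iff_fixed (k := L) (K := E) (z j)).2
            fun τ => congrFun (hfix τ) j
          exact IntermediateField.mem_bot.1 h2
        choose w hw using h1
        exact ⟨w, funext hw⟩
      obtain ⟨w, hw⟩ := hrat'
      by_cases hzi0 : z i = 0
      · have hcard : (supp (x - x i0 • z)).card < n := by
          rw [← hn]
          refine Finset.card_lt_card (Finset.ssubset_iff_subset_ne.2 ⟨?_, ?_⟩)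
          · intro j hj
            have hj' : x j - x i0 * z j ≠ 0 := (Finset.mem_filter.1 hj).2
            refine Finset.mem_filter.2 ⟨Finset.mem_univ _, fun h0 => ?_⟩
            have h1 : j ∉ supp z := fun h => (Finset.mem_filter.1 (hyx (hzs ▸ h))).2 h0
            have h2 : z j = 0 := by
              by_contra h3
              exact h1 (Finset.mem_filter.2 ⟨Finset.mem_univ _, h3⟩)
            exact hj' (by rw [h0, h2, mul_zero, sub_zero])
          · intro h0
            have h1 : i0 ∈ supp x := hyx (Finset.mem_filter.2 ⟨Finset.mem_univ _, hi0'⟩)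
            rw [← h0] at h1
            refine (Finset.mem_filter.1 h1).2 ?_
            rw [Pi.sub_apply, Pi.smul_apply, hzi, smul_eq_mul, mul_one, sub_self]
        have hle : N x ≤ N (x - x i0 • z) := by
          by_cases hx0 : x i0 = 0
          · rw [hx0, zero_smul, sub_zero]
          · refine le_trans (le_min le_rfl ?_) (sub_eq_add_neg x (x i0 • z) ▸ hadd _ _)
            rwa [← neg_smul, hsmul _ _ (neg_ne_zero.2 hx0)]
        refine hle.trans (ih _ hcard _ rfl i ?_)
        rwa [Pi.sub_apply, Pi.smul_apply, hzi0, smul_zero, sub_zero]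
      · refine hNz.trans ?_
        rw [← hw]
        refine hrat w i fun h0 => hzi0 ?_
        rw [← hw, Function.comp_apply, h0, map_zero]
  exact key _ x rfl i hi

/-- A filtration stable under the Galois group has an adapted basis of rational vectors. -/
lemma exists_descent [IsGalois L E] {G : Matrix ι ι E} (hG : G.det ≠ 0) (a : ι → ℝ)
    (hgal : ∀ (τ : E ≃ₐ[L] E) x, level G a (τ ∘ x) = level G a x) :
    ∃ (P : Matrix ι ι L) (c : ι → ℝ), P.det ≠ 0 ∧
      level (P.map (algebraMap L E)) c = level G a := by
  have hcomp : ∀ x y : ι → L, algebraMap L E ∘ (x + y) =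
      algebraMap L E ∘ x + algebraMap L E ∘ y := fun x y => by ext; simp
  have hcomp' : ∀ (c : L) (x : ι → L), algebraMap L E ∘ (c • x) =
      algebraMap L E c • (algebraMap L E ∘ x) := fun c x => by ext; simp
  obtain ⟨b', -, hN⟩ := exists_adapted_basis (Pi.basisFun L ι)
    (N := fun x => level G a (algebraMap L E ∘ x)) (fun x y => by rw [hcomp]; exact level_add _ _ _ _)
    (fun c x hc => by
      rw [hcomp']; exact level_smul _ _ _ _ ((map_ne_zero _).2 hc))
    ((level_finite_range G a).subset (by rintro _ ⟨x, rfl⟩; exact ⟨_, rfl⟩))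
    (r := fun i => (Fintype.equivFin ι i : ℕ))
    (fun i j h => (Fintype.equivFin ι).injective (Fin.ext h))
  obtain ⟨P, hP, hPinv, hPr⟩ := exists_matrix_of_basis b'
  have huP : IsUnit P.det := isUnit_iff_ne_zero.2 hP
  have htop : ∀ i, level G a (algebraMap L E ∘ b' i) ≠ ⊤ := fun i h => b'.ne_zero i (by
    have h1 := level_eq_top hG h
    ext j
    have := congrFun h1 j
    simpa using this)
  set PE := P.map (algebraMap L E) with hPE
  have hPP : PE⁻¹ = (Matrix.of b').map (algebraMap L E) := by
    rw [← hPinv]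
    refine Matrix.inv_eq_right_inv ?_
    rw [hPE, ← Matrix.map_mul, Matrix.mul_nonsing_inv P huP]
    simp
  have huPE : IsUnit PE.det := by
    rw [hPE, isUnit_iff_ne_zero]
    change ((algebraMap L E).mapMatrix P).det ≠ 0
    rw [← RingHom.map_det]
    exact (map_ne_zero _).2 hP
  have hrow : ∀ i, Pi.single i 1 ᵥ* PE⁻¹ = algebraMap L E ∘ b' i := by
    intro i
    rw [hPP, Matrix.single_one_vecMul]
    rfl
  have horth := descent_orthogonal (L := L) (N := fun y => level G a (y ᵥ* PE⁻¹))
    (fun x y => by rw [Matrix.add_vecMul]; exact level_add _ _ _ _)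
    (fun c x hc => by rw [Matrix.smul_vecMul]; exact level_smul _ _ _ _ hc)
    (fun τ x => by
      rw [← hgal τ (x ᵥ* PE⁻¹)]
      congr 1
      ext j
      have h1 := RingHom.map_vecMul (τ : E →+* E) PE⁻¹ x j
      refine Eq.trans ?_ h1.symm
      congr 2
      rw [hPP]
      ext i k
      simp)
    (fun y i hy => by
      have h1 : (algebraMap L E ∘ y) ᵥ* PE⁻¹ = algebraMap L E ∘ (y ᵥ* P⁻¹) := by
        rw [hPP, ← hPinv]
        exact funext fun j => (RingHom.map_vecMul (algebraMap L E) P⁻¹ y j).symm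
      rw [h1, hrow]
      refine hN (y ᵥ* P⁻¹) i ?_
      rwa [← hPr, Matrix.vecMul_vecMul, Matrix.nonsing_inv_mul P huP, Matrix.vecMul_one])
  refine ⟨P, fun i => (level G a (algebraMap L E ∘ b' i)).untop (htop i), hP, ?_⟩
  funext x
  apply le_antisymm
  · have hx : x = ∑ i, (x ᵥ* PE) i • (algebraMap L E ∘ b' i) := by
      have h1 : (x ᵥ* PE) ᵥ* PE⁻¹ = x := by
        rw [Matrix.vecMul_vecMul, Matrix.mul_nonsing_inv PE huPE, Matrix.vecMul_one]
      conv_lhs => rw [← h1, hPP]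
      ext j
      simp [Matrix.vecMul, dotProduct]
    conv_rhs => rw [hx]
    refine level_sum _ (level_add G a) (level_smul G a) (level_zero G a) fun i hi => ?_
    have := le_level_iff.1 (le_refl (level PE
      (fun i => (level G a (algebraMap L E ∘ b' i)).untop (htop i)) x)) i hi
    rwa [WithTop.coe_untop] at this
  · rw [le_level_iff]
    intro j hj
    rw [WithTop.coe_untop, ← hrow]
    have := horth (x ᵥ* PE) j hj
    rwa [Matrix.vecMul_vecMul, Matrix.mul_nonsing_inv PE huPE, Matrix.vecMul_one] at this

end Descent

/-! ### The optimal pair of filtrations attached to a subspace of a tensor product -/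

section Optimal

lemma sum_sq_midpoint {α : Type*} [Fintype α] (f g : α → ℝ) :
    ∑ i, ((1 / 2 : ℝ) • (f + g)) i ^ 2 =
      1 / 2 * ∑ i, f i ^ 2 + 1 / 2 * ∑ i, g i ^ 2 - 1 / 4 * ∑ i, (f i - g i) ^ 2 := by
  simp only [Finset.mul_sum, ← Finset.sum_add_distrib, ← Finset.sum_sub_distrib, Pi.smul_apply,
    Pi.add_apply, smul_eq_mul]
  exact Finset.sum_congr rfl fun i _ => by ring

lemma sq_norm_le_sum_sq {α : Type*} [Fintype α] (f : α → ℝ) : ‖f‖ ^ 2 ≤ ∑ i, f i ^ 2 := by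
  have h : ‖f‖ ≤ Real.sqrt (∑ i, f i ^ 2) := by
    refine (pi_norm_le_iff_of_nonneg (Real.sqrt_nonneg _)).2 fun i => ?_
    rw [Real.norm_eq_abs, ← Real.sqrt_sq_eq_abs]
    exact Real.sqrt_le_sqrt (Finset.single_le_sum (f := fun i => f i ^ 2)
      (fun i _ => sq_nonneg _) (Finset.mem_univ i))
  calc ‖f‖ ^ 2 ≤ Real.sqrt (∑ i, f i ^ 2) ^ 2 := by gcongr
    _ = _ := Real.sq_sqrt (Finset.sum_nonneg fun i _ => sq_nonneg _)

variable {d : ℕ} {ι κ : Type*}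

/-- The weight of a family of `d` vectors of a tensor basis. -/
def wt (a : ι → ℝ) (b : κ → ℝ) (J : Fin d → ι × κ) : ℝ := ∑ k, (a (J k).1 + b (J k).2)

lemma wt_add (a a' : ι → ℝ) (b b' : κ → ℝ) (J : Fin d → ι × κ) :
    wt (a + a') (b + b') J = wt a b J + wt a' b' J := by
  simp only [wt, ← Finset.sum_add_distrib, Pi.add_apply]
  exact Finset.sum_congr rfl fun k _ => by ring

lemma wt_smul (c : ℝ) (a : ι → ℝ) (b : κ → ℝ) (J : Fin d → ι × κ) :
    wt (c • a) (c • b) J = c * wt a b J := by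
  simp only [wt, Finset.mul_sum, Pi.smul_apply, smul_eq_mul]
  exact Finset.sum_congr rfl fun k _ => by ring

variable [Fintype ι] [Fintype κ] [DecidableEq ι] [DecidableEq κ]

/-- The nonzero Plücker coordinates of the row space of `A`, after a change of coordinates. -/
def plSupp {E : Type*} [Field E] (A : Matrix (Fin d) (ι × κ) E) (G : Matrix ι ι E)
    (H : Matrix κ κ E) : Set (Fin d → ι × κ) := {J | minor (A * G ⊗ₖ H) J ≠ 0}

/-- `m` is a lower bound for the weights of the nonzero Plücker coordinates. -/
def IsBound {E : Type*} [Field E] (A : Matrix (Fin d) (ι × κ) E) (G : Matrix ι ι E)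
    (H : Matrix κ κ E) (a : ι → ℝ) (b : κ → ℝ) (m : ℝ) : Prop := ∀ J ∈ plSupp A G H, m ≤ wt a b J

/-- The strictly concave function to be maximized. -/
def objective (a : ι → ℝ) (b : κ → ℝ) (m : ℝ) : ℝ := m - (∑ i, a i ^ 2 + ∑ j, b j ^ 2) / 2

/-- The filtrations with weights `a` and `b` on the bases given by `G` and `H` are optimal for the
row space of `A`. -/
structure IsOptimal {E : Type*} [Field E] (A : Matrix (Fin d) (ι × κ) E) (G : Matrix ι ι E)
    (H : Matrix κ κ E) (a : ι → ℝ) (b : κ → ℝ) (m : ℝ) : Prop where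
  det_left : G.det ≠ 0
  det_right : H.det ≠ 0
  bound : IsBound A G H a b m
  le : ∀ G' H' a' b' m', G'.det ≠ 0 → H'.det ≠ 0 → IsBound A G' H' a' b' m' →
    objective a' b' m' ≤ objective a b m

section Field

variable {E : Type*} [Field E] {A : Matrix (Fin d) (ι × κ) E}

lemma exists_mem_plSupp_of_mul {G M : Matrix ι ι E} {H N : Matrix κ κ E} {J : Fin d → ι × κ}
    (hJ : J ∈ plSupp A (G * M) (H * N)) :
    ∃ I ∈ plSupp A G H, ∀ k, M (I k).1 (J k).1 ≠ 0 ∧ N (I k).2 (J k).2 ≠ 0 := by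
  have h : minor (A * (G * M) ⊗ₖ (H * N)) J ≠ 0 := hJ
  rw [Matrix.mul_kronecker_mul, ← Matrix.mul_assoc, minor_mul] at h
  obtain ⟨I, -, hI⟩ := Finset.exists_ne_zero_of_sum_ne_zero h
  refine ⟨I, right_ne_zero_of_mul hI, fun k => ?_⟩
  have h1 := Finset.prod_ne_zero_iff.1 (left_ne_zero_of_mul hI) k (Finset.mem_univ k)
  rw [Matrix.kroneckerMap_apply] at h1
  exact ⟨left_ne_zero_of_mul h1, right_ne_zero_of_mul h1⟩

lemma IsBound.mul {G M : Matrix ι ι E} {H N : Matrix κ κ E} {a₁ a₂ : ι → ℝ} {b₁ b₂ : κ → ℝ} {m : ℝ}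
    (h : IsBound A G H a₁ b₁ m) (hM : ∀ i j, M i j ≠ 0 → a₁ i ≤ a₂ j)
    (hN : ∀ i j, N i j ≠ 0 → b₁ i ≤ b₂ j) : IsBound A (G * M) (H * N) a₂ b₂ m := by
  intro J hJ
  obtain ⟨I, hI, hIJ⟩ := exists_mem_plSupp_of_mul hJ
  exact (h I hI).trans (Finset.sum_le_sum fun k _ =>
    add_le_add (hM _ _ (hIJ k).1) (hN _ _ (hIJ k).2))

/-- Being a bound depends only on the filtrations. -/
lemma IsBound.of_level_eq {G₁ G₂ : Matrix ι ι E} {H₁ H₂ : Matrix κ κ E} {a₁ a₂ : ι → ℝ}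
    {b₁ b₂ : κ → ℝ} {m : ℝ} (h : IsBound A G₁ H₁ a₁ b₁ m) (hG : G₁.det ≠ 0) (hH : H₁.det ≠ 0)
    (hl : level G₁ a₁ = level G₂ a₂) (hr : level H₁ b₁ = level H₂ b₂) :
    IsBound A G₂ H₂ a₂ b₂ m := by
  have h1 := h.mul (M := G₁⁻¹ * G₂) (N := H₁⁻¹ * H₂) (a₂ := a₂) (b₂ := b₂) (fun i j hij => triangular_of_level_le hG (fun x => (congrFun hl x).le) hij)
    (fun i j hij => triangular_of_level_le hH (fun x => (congrFun hr x).le) hij)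
  rwa [← Matrix.mul_assoc, ← Matrix.mul_assoc, Matrix.mul_nonsing_inv _ (isUnit_iff_ne_zero.2 hG),
    Matrix.mul_nonsing_inv _ (isUnit_iff_ne_zero.2 hH), Matrix.one_mul, Matrix.one_mul] at h1

lemma objective_eq_of_level_eq {G₁ G₂ : Matrix ι ι E} {H₁ H₂ : Matrix κ κ E} {a₁ a₂ : ι → ℝ}
    {b₁ b₂ : κ → ℝ} {m : ℝ} (hG₁ : G₁.det ≠ 0) (hG₂ : G₂.det ≠ 0) (hH₁ : H₁.det ≠ 0)
    (hH₂ : H₂.det ≠ 0) (hl : level G₁ a₁ = level G₂ a₂) (hr : level H₁ b₁ = level H₂ b₂) :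
    objective a₁ b₁ m = objective a₂ b₂ m := by
  obtain ⟨π, hπ⟩ := exists_perm_eq_of_level_eq hG₁ hG₂ hl
  obtain ⟨π', hπ'⟩ := exists_perm_eq_of_level_eq hH₁ hH₂ hr
  rw [objective, objective, ← Equiv.sum_comp π fun i => a₁ i ^ 2,
    ← Equiv.sum_comp π' fun i => b₁ i ^ 2]
  simp only [hπ, hπ']

/-- Optimal filtrations may be described by other bases. -/
lemma IsOptimal.of_level_eq {G₁ G₂ : Matrix ι ι E} {H₁ H₂ : Matrix κ κ E} {a₁ a₂ : ι → ℝ}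
    {b₁ b₂ : κ → ℝ} {m : ℝ} (h : IsOptimal A G₁ H₁ a₁ b₁ m) (hG : G₂.det ≠ 0) (hH : H₂.det ≠ 0)
    (hl : level G₁ a₁ = level G₂ a₂) (hr : level H₁ b₁ = level H₂ b₂) :
    IsOptimal A G₂ H₂ a₂ b₂ m where
  det_left := hG
  det_right := hH
  bound := h.bound.of_level_eq h.det_left h.det_right hl hr
  le := by
    rw [← objective_eq_of_level_eq h.det_left hG h.det_right hH hl hr]
    exact h.le

/-- The optimal filtrations are unique, by strict concavity of the objective along the weights on a
common adapted basis. -/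
lemma IsOptimal.level_eq {G₁ G₂ : Matrix ι ι E} {H₁ H₂ : Matrix κ κ E} {a₁ a₂ : ι → ℝ}
    {b₁ b₂ : κ → ℝ} {m₁ m₂ : ℝ} (h₁ : IsOptimal A G₁ H₁ a₁ b₁ m₁)
    (h₂ : IsOptimal A G₂ H₂ a₂ b₂ m₂) :
    level G₁ a₁ = level G₂ a₂ ∧ level H₁ b₁ = level H₂ b₂ := by
  obtain ⟨P, a, hP, hP1, hP2⟩ := exists_common_basis h₁.det_left h₂.det_left a₁ a₂
  obtain ⟨Q, b, hQ, hQ1, hQ2⟩ := exists_common_basis h₁.det_right h₂.det_right b₁ b₂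
  have k1 := h₁.of_level_eq hP hQ hP1.symm hQ1.symm
  have k2 := h₂.of_level_eq hP hQ hP2.symm hQ2.symm
  have h12 := le_antisymm (k1.le _ _ _ _ _ hP hQ k2.bound) (k2.le _ _ _ _ _ hP hQ k1.bound)
  -- the midpoint would have a larger objective, unless the weights agree
  have hmid : IsBound A P Q ((1 / 2 : ℝ) • (a₁ + a)) ((1 / 2 : ℝ) • (b₁ + b))
      (1 / 2 * (m₁ + m₂)) := by
    intro J hJ
    rw [wt_smul, wt_add]
    have e1 := k1.bound J hJ
    have e2 := k2.bound J hJ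
    linarith
  have h3 := k1.le _ _ _ _ _ hP hQ hmid
  have key : ∑ i, (a₁ i - a i) ^ 2 + ∑ j, (b₁ j - b j) ^ 2 ≤ 0 := by
    have e2 := sum_sq_midpoint a₁ a
    have e3 := sum_sq_midpoint b₁ b
    simp only [objective] at h3 h12
    rw [e2, e3] at h3
    linarith
  have p1 : 0 ≤ ∑ i, (a₁ i - a i) ^ 2 := Finset.sum_nonneg fun i _ => sq_nonneg _
  have p2 : 0 ≤ ∑ i, (b₁ i - b i) ^ 2 := Finset.sum_nonneg fun i _ => sq_nonneg _
  have q1 : a₁ = a := funext fun i => by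
    have := (Finset.sum_eq_zero_iff_of_nonneg fun i _ => sq_nonneg _).1
      (le_antisymm (by linarith) p1) i (Finset.mem_univ i)
    exact sub_eq_zero.1 (pow_eq_zero_iff two_ne_zero |>.1 this)
  have q2 : b₁ = b := funext fun i => by
    have := (Finset.sum_eq_zero_iff_of_nonneg fun i _ => sq_nonneg _).1
      (le_antisymm (by linarith) p2) i (Finset.mem_univ i)
    exact sub_eq_zero.1 (pow_eq_zero_iff two_ne_zero |>.1 this)
  exact ⟨by rw [← hP1, ← hP2, q1], by rw [← hQ1, ← hQ2, q2]⟩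

lemma plSupp_nonempty {G : Matrix ι ι E} {H : Matrix κ κ E} (hG : G.det ≠ 0) (hH : H.det ≠ 0)
    {R : Matrix (ι × κ) (Fin d) E} (hA : A * R = 1) : (plSupp A G H).Nonempty := by
  refine exists_minor_ne_zero (M := G⁻¹ ⊗ₖ H⁻¹ * R) ?_
  rw [Matrix.mul_assoc, ← Matrix.mul_assoc (G ⊗ₖ H), ← Matrix.mul_kronecker_mul,
    Matrix.mul_nonsing_inv _ (isUnit_iff_ne_zero.2 hG),
    Matrix.mul_nonsing_inv _ (isUnit_iff_ne_zero.2 hH), Matrix.one_kronecker_one, Matrix.one_mul, hA]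

end Field

/-- For a fixed nonempty set of weights the objective attains its maximum. -/
lemma exists_max_objective (S : Set (Fin d → ι × κ)) (hS : S.Nonempty) :
    ∃ (a : ι → ℝ) (b : κ → ℝ) (m : ℝ), (∀ J ∈ S, m ≤ wt a b J) ∧
      ∀ a' b' m', (∀ J ∈ S, m' ≤ wt a' b' J) → objective a' b' m' ≤ objective a b m := by
  classical
  obtain ⟨J0, hJ0⟩ := hS
  let T : Finset (Fin d → ι × κ) := Finset.univ.filter (· ∈ S)
  have hT : T.Nonempty := ⟨J0, Finset.mem_filter.2 ⟨Finset.mem_univ _, hJ0⟩⟩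
  have hTS : ∀ J, J ∈ T ↔ J ∈ S := fun J => by simp [T]
  let q : (ι → ℝ) × (κ → ℝ) → ℝ := fun x =>
    objective x.1 x.2 (T.inf' hT fun J => wt x.1 x.2 J)
  have hcont : Continuous q := by
    have h1 : Continuous fun x : (ι → ℝ) × (κ → ℝ) => T.inf' hT fun J => wt x.1 x.2 J := by
      refine Continuous.finset_inf'_apply hT fun J _ => ?_
      unfold wt
      fun_prop
    change Continuous fun x : (ι → ℝ) × (κ → ℝ) =>
      (T.inf' hT fun J => wt x.1 x.2 J) - (∑ i, x.1 i ^ 2 + ∑ j, x.2 j ^ 2) / 2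
    exact h1.sub (by fun_prop)
  obtain ⟨x, -, hx⟩ := (isCompact_closedBall (0 : (ι → ℝ) × (κ → ℝ)) (4 * d)).exists_isMaxOn
    ⟨0, by simp⟩ hcont.continuousOn
  have h0 : q 0 ≤ q x := hx (by simp)
  have hq0 : q 0 = 0 := by
    simp only [q, objective, wt]
    simp
  -- outside of the ball of radius `4 d` the quadratic term dominates
  have hmax : ∀ y, q y ≤ q x := by
    intro y
    by_cases hy : ‖y‖ ≤ 4 * d
    · exact hx (by simpa using hy)
    refine le_trans ?_ (hq0 ▸ h0)
    push Not at hy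
    have h1 : (T.inf' hT fun J => wt y.1 y.2 J) ≤ 2 * d * ‖y‖ := by
      refine (Finset.inf'_le _ ((hTS J0).2 hJ0)).trans ?_
      have h2 : wt y.1 y.2 J0 ≤ ∑ _k : Fin d, (‖y‖ + ‖y‖) := Finset.sum_le_sum fun k _ =>
        add_le_add (((le_abs_self _).trans (norm_le_pi_norm y.1 _)).trans (norm_fst_le y))
          (((le_abs_self _).trans (norm_le_pi_norm y.2 _)).trans (norm_snd_le y))
      rw [Finset.sum_const, Finset.card_univ, Fintype.card_fin, nsmul_eq_mul] at h2
      linarith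
    have h4 : ‖y‖ ^ 2 ≤ ∑ i, y.1 i ^ 2 + ∑ j, y.2 j ^ 2 := by
      have e1 := sq_norm_le_sum_sq y.1
      have e2 := sq_norm_le_sum_sq y.2
      have e3 : 0 ≤ ∑ i, y.1 i ^ 2 := Finset.sum_nonneg fun i _ => sq_nonneg _
      have e4 : 0 ≤ ∑ i, y.2 i ^ 2 := Finset.sum_nonneg fun i _ => sq_nonneg _
      rw [Prod.norm_def]
      rcases max_cases ‖y.1‖ ‖y.2‖ with ⟨h, -⟩ | ⟨h, -⟩ <;> rw [h] <;> linarith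
    have h5 : (0 : ℝ) ≤ d := Nat.cast_nonneg d
    simp only [q, objective]
    nlinarith [norm_nonneg y]
  refine ⟨x.1, x.2, T.inf' hT fun J => wt x.1 x.2 J,
    fun J hJ => Finset.inf'_le _ ((hTS J).2 hJ), fun a' b' m' h => ?_⟩
  refine le_trans ?_ (hmax (a', b'))
  simp only [q, objective]
  have : m' ≤ T.inf' hT fun J => wt a' b' J := (Finset.le_inf'_iff hT _).2 fun J hJ =>
    h J ((hTS J).1 hJ)
  linarith

/-- Optimal filtrations exist over every field, as there are only finitely many possibilities for
the set of nonzero Plücker coordinates. -/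
lemma exists_isOptimal {E : Type*} [Field E] {A : Matrix (Fin d) (ι × κ) E}
    {R : Matrix (ι × κ) (Fin d) E} (hA : A * R = 1) :
    ∃ G H a b m, IsOptimal A G H a b m := by
  let 𝒮 : Set (Set (Fin d → ι × κ)) :=
    {S | ∃ G : Matrix ι ι E, ∃ H : Matrix κ κ E, G.det ≠ 0 ∧ H.det ≠ 0 ∧ S = plSupp A G H}
  have hne : ∀ S ∈ 𝒮, S.Nonempty := by
    rintro S ⟨G, H, hG, hH, rfl⟩
    exact plSupp_nonempty hG hH hA
  have hex : ∀ S : 𝒮, ∃ x : (ι → ℝ) × (κ → ℝ) × ℝ, (∀ J ∈ S.1, x.2.2 ≤ wt x.1 x.2.1 J) ∧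
      ∀ a' b' m', (∀ J ∈ S.1, m' ≤ wt a' b' J) →
        objective a' b' m' ≤ objective x.1 x.2.1 x.2.2 := by
    intro S
    obtain ⟨a, b, m, h⟩ := exists_max_objective S.1 (hne S.1 S.2)
    exact ⟨(a, b, m), h⟩
  choose x hx hxmax using hex
  have : Nonempty 𝒮 := ⟨⟨_, 1, 1, by simp, by simp, rfl⟩⟩
  have : Finite 𝒮 := Set.toFinite _
  obtain ⟨S, hS⟩ := Finite.exists_max fun S : 𝒮 => objective (x S).1 (x S).2.1 (x S).2.2
  obtain ⟨G, H, hG, hH, hGH⟩ := S.2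
  refine ⟨G, H, (x S).1, (x S).2.1, (x S).2.2, hG, hH, ?_, ?_⟩
  · intro J hJ
    rw [← hGH] at hJ
    exact hx S J hJ
  · intro G' H' a' b' m' hG' hH' hb
    exact (hxmax ⟨_, G', H', hG', hH', rfl⟩ a' b' m' hb).trans (hS _)

end Optimal

/-! ### Optimality over the algebraic closure -/

section Geometric

variable {d : ℕ} {ι κ : Type*} [Fintype ι] [Fintype κ] [DecidableEq ι] [DecidableEq κ]

lemma sum_sq_add_smul {α : Type*} [Fintype α] (f u : α → ℝ) (t : ℝ) :
    ∑ i, (f + t • u) i ^ 2 =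
      ∑ i, f i ^ 2 + 2 * t * ∑ i, f i * u i + t * t * ∑ i, u i ^ 2 := by
  simp only [Finset.mul_sum, ← Finset.sum_add_distrib, Pi.smul_apply, Pi.add_apply, smul_eq_mul]
  exact Finset.sum_congr rfl fun i _ => by ring

lemma plSupp_map {E E' : Type*} [Field E] [Field E'] (f : E →+* E') (A : Matrix (Fin d) (ι × κ) E)
    (G : Matrix ι ι E) (H : Matrix κ κ E) :
    plSupp (A.map f) (G.map f) (H.map f) = plSupp A G H := by
  ext J
  change minor (A.map f * G.map f ⊗ₖ H.map f) J ≠ 0 ↔ minor (A * G ⊗ₖ H) J ≠ 0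
  rw [← map_kronecker, ← Matrix.map_mul, minor_map, map_ne_zero]

lemma plSupp_mul {E : Type*} [Field E] (A : Matrix (Fin d) (ι × κ) E) (G G' : Matrix ι ι E)
    (H H' : Matrix κ κ E) : plSupp (A * G ⊗ₖ H) G' H' = plSupp A (G * G') (H * H') := by
  ext J
  change minor (A * G ⊗ₖ H * G' ⊗ₖ H') J ≠ 0 ↔ minor (A * (G * G') ⊗ₖ (H * H')) J ≠ 0
  rw [Matrix.mul_kronecker_mul, Matrix.mul_assoc]

lemma det_map_ne_zero {E E' : Type*} [Field E] [Field E'] (f : E →+* E') {G : Matrix ι ι E}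
    (hG : G.det ≠ 0) : (G.map f).det ≠ 0 := by
  change (f.mapMatrix G).det ≠ 0
  rw [← RingHom.map_det]
  exact (map_ne_zero f).2 hG

lemma IsOptimal.rebase {E : Type*} [Field E] {A : Matrix (Fin d) (ι × κ) E} {G : Matrix ι ι E}
    {H : Matrix κ κ E} {a : ι → ℝ} {b : κ → ℝ} {m : ℝ} (h : IsOptimal A G H a b m) :
    IsOptimal (A * G ⊗ₖ H) 1 1 a b m where
  det_left := by simp
  det_right := by simp
  bound J hJ := by
    rw [plSupp_mul, Matrix.mul_one, Matrix.mul_one] at hJ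
    exact h.bound J hJ
  le G' H' a' b' m' hG hH hb := by
    refine h.le (G * G') (H * H') a' b' m' ?_ ?_ fun J hJ => hb J ?_
    · rw [Matrix.det_mul]
      exact mul_ne_zero h.det_left hG
    · rw [Matrix.det_mul]
      exact mul_ne_zero h.det_right hH
    · rwa [plSupp_mul]

lemma nonempty_algHom_algebraicClosure (L k : Type*) [Field L] [Field k] [Algebra L k]
    [Algebra.FiniteType L k] : Nonempty (k →ₐ[L] AlgebraicClosure L) := by
  have : Module.Finite L k := finite_of_finite_type_of_isJacobsonRing L k
  exact ⟨IsAlgClosed.lift⟩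

/-- A finitely generated subalgebra of an extension of `L` has a point over the algebraic
closure. -/
lemma exists_algHom_algebraicClosure {L E : Type*} [Field L] [Field E] [Algebra L E]
    (s : Set E) (hs : s.Finite) :
    ∃ R : Subalgebra L E, s ⊆ R ∧ Nonempty (R →ₐ[L] AlgebraicClosure L) := by
  refine ⟨Algebra.adjoin L s, Algebra.subset_adjoin, ?_⟩
  have : Algebra.FiniteType L (Algebra.adjoin L s) :=
    (Subalgebra.fg_iff_finiteType _).1 (Subalgebra.fg_def.2 ⟨s, hs, rfl⟩)
  obtain ⟨M, hM⟩ := Ideal.exists_maximal (Algebra.adjoin L s)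
  let _ : Field (Algebra.adjoin L s ⧸ M) := Ideal.Quotient.field M
  have : Algebra.FiniteType L (Algebra.adjoin L s ⧸ M) :=
    Algebra.FiniteType.of_surjective (Ideal.Quotient.mkₐ L M) (Ideal.Quotient.mkₐ_surjective L M)
  obtain ⟨f⟩ := nonempty_algHom_algebraicClosure L (Algebra.adjoin L s ⧸ M)
  exact ⟨f.comp (Ideal.Quotient.mkₐ L M)⟩

/-- The sets of nonzero Plücker coordinates which occur over an extension of `L` also occur over the
algebraic closure. -/
lemma exists_plSupp_eq {L E : Type*} [Field L] [Field E] [Algebra L E]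
    (A : Matrix (Fin d) (ι × κ) L) {g : Matrix ι ι E} {h : Matrix κ κ E} (hg : g.det ≠ 0)
    (hh : h.det ≠ 0) : ∃ (G : Matrix ι ι (AlgebraicClosure L)) (H : Matrix κ κ (AlgebraicClosure L)),
      G.det ≠ 0 ∧ H.det ≠ 0 ∧ plSupp (A.map (algebraMap L (AlgebraicClosure L))) G H =
        plSupp (A.map (algebraMap L E)) g h := by
  -- adjoin the inverses of everything that has to stay nonzero under a specialization
  let s : Set E := (Set.range fun x : ι × ι => g x.1 x.2) ∪ (Set.range fun x : κ × κ => h x.1 x.2) ∪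
    {g.det⁻¹, h.det⁻¹} ∪ Set.range fun J => (minor (A.map (algebraMap L E) * g ⊗ₖ h) J)⁻¹
  have hs : s.Finite := (((Set.finite_range _).union (Set.finite_range _)).union
    ((Set.finite_singleton _).insert _)).union (Set.finite_range _)
  obtain ⟨R, hR, ⟨ψ⟩⟩ := exists_algHom_algebraicClosure (L := L) s hs
  let gR : Matrix ι ι R := fun i j => ⟨g i j, hR (Or.inl (Or.inl (Or.inl ⟨(i, j), rfl⟩)))⟩
  let hR' : Matrix κ κ R := fun i j => ⟨h i j, hR (Or.inl (Or.inl (Or.inr ⟨(i, j), rfl⟩)))⟩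
  have hunit : ∀ x : R, x.1 ≠ 0 → x.1⁻¹ ∈ R → ψ x ≠ 0 := fun x hx hx' h0 => by
    have h1 : x * ⟨x.1⁻¹, hx'⟩ = 1 := Subtype.ext (mul_inv_cancel₀ hx)
    have h2 := congrArg ψ h1
    rw [map_mul, h0, zero_mul, map_one] at h2
    exact zero_ne_one h2
  have hdet : (gR.map ψ).det ≠ 0 := by
    change ((ψ : R →+* AlgebraicClosure L).mapMatrix gR).det ≠ 0
    rw [← RingHom.map_det]
    have h1 : (gR.det : E) = g.det := RingHom.map_det (R.val : R →+* E) gR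
    exact hunit _ (by rwa [h1]) (by rw [h1]; exact hR (Or.inl (Or.inr (Or.inl rfl))))
  have hdet' : (hR'.map ψ).det ≠ 0 := by
    change ((ψ : R →+* AlgebraicClosure L).mapMatrix hR').det ≠ 0
    rw [← RingHom.map_det]
    have h1 : (hR'.det : E) = h.det := RingHom.map_det (R.val : R →+* E) hR'
    exact hunit _ (by rwa [h1]) (by rw [h1]; exact hR (Or.inl (Or.inr (Or.inr rfl))))
  refine ⟨gR.map ψ, hR'.map ψ, hdet, hdet', ?_⟩
  ext J
  let x : R := minor (A.map (algebraMap L R) * gR ⊗ₖ hR') J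
  have hx : (x : E) = minor (A.map (algebraMap L E) * g ⊗ₖ h) J := by
    have h1 := minor_map (R.val : R →+* E) (A.map (algebraMap L R) * gR ⊗ₖ hR') J
    rw [Matrix.map_mul, map_kronecker] at h1
    exact h1.symm
  have hx' : ψ x = minor (A.map (algebraMap L (AlgebraicClosure L)) * gR.map ψ ⊗ₖ hR'.map ψ) J := by
    have h1 := minor_map (ψ : R →+* AlgebraicClosure L) (A.map (algebraMap L R) * gR ⊗ₖ hR') J
    rw [Matrix.map_mul, map_kronecker, Matrix.map_map] at h1
    have h2 : (ψ : R →+* AlgebraicClosure L) ∘ (algebraMap L R) =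
        algebraMap L (AlgebraicClosure L) := funext fun y => ψ.commutes y
    rw [h2] at h1
    exact h1.symm
  change minor _ J ≠ 0 ↔ minor _ J ≠ 0
  rw [← hx, ← hx']
  refine ⟨fun h0 h1 => h0 ?_, fun h0 => hunit x h0 ?_⟩
  · have : x = 0 := Subtype.ext h1
    rw [this, map_zero]
  · rw [hx]
    exact hR (Or.inr ⟨J, rfl⟩)

variable {L : Type*} [Field L]

/-- The standard bases, with weights `a` and `b`, define optimal filtrations for the row space of
`A`, over the algebraic closure. -/
def IsGeomOptimal (A : Matrix (Fin d) (ι × κ) L) (a : ι → ℝ) (b : κ → ℝ) (m : ℝ) : Prop :=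
  IsOptimal (A.map (algebraMap L (AlgebraicClosure L))) 1 1 a b m

/-- Optimal filtrations over the algebraic closure are rational, by uniqueness and Galois
descent. -/
theorem exists_isGeomOptimal [CharZero L] {A : Matrix (Fin d) (ι × κ) L}
    {R : Matrix (ι × κ) (Fin d) L} (hA : A * R = 1) :
    ∃ (G : Matrix ι ι L) (H : Matrix κ κ L) (a : ι → ℝ) (b : κ → ℝ) (m : ℝ), G.det ≠ 0 ∧ H.det ≠ 0 ∧
      IsGeomOptimal (A * G ⊗ₖ H) a b m := by
  set f := algebraMap L (AlgebraicClosure L)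
  have hA' : A.map f * R.map f = 1 := by
    rw [← Matrix.map_mul, hA]
    simp
  obtain ⟨G, H, a, b, m, hopt⟩ := exists_isOptimal hA'
  -- the Galois conjugates are optimal as well, hence equal by uniqueness
  have hgal : ∀ τ : AlgebraicClosure L ≃ₐ[L] AlgebraicClosure L,
      IsOptimal (A.map f) (G.map τ) (H.map τ) a b m := by
    intro τ
    have h1 : (A.map f).map τ = A.map f := by
      ext i j
      simp [f]
    refine ⟨det_map_ne_zero (τ : AlgebraicClosure L →+* AlgebraicClosure L) hopt.det_left,
      det_map_ne_zero (τ : AlgebraicClosure L →+* AlgebraicClosure L) hopt.det_right, ?_, hopt.le⟩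
    intro J hJ
    have h2 := plSupp_map (τ : AlgebraicClosure L →+* AlgebraicClosure L) (A.map f) G H
    refine hopt.bound J ?_
    rw [← h2]
    change J ∈ plSupp ((A.map f).map τ) (G.map τ) (H.map τ)
    rwa [h1]
  have hl : ∀ (τ : AlgebraicClosure L ≃ₐ[L] AlgebraicClosure L) x,
      level G a (τ ∘ x) = level G a x := fun τ x => by
    rw [(hopt.level_eq (hgal τ)).1]
    refine (level_map (τ : AlgebraicClosure L →+* AlgebraicClosure L) G a x).trans ?_
    rw [(hopt.level_eq (hgal τ)).1]
  have hr : ∀ (τ : AlgebraicClosure L ≃ₐ[L] AlgebraicClosure L) x,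
      level H b (τ ∘ x) = level H b x := fun τ x => by
    rw [(hopt.level_eq (hgal τ)).2]
    refine (level_map (τ : AlgebraicClosure L →+* AlgebraicClosure L) H b x).trans ?_
    rw [(hopt.level_eq (hgal τ)).2]
  obtain ⟨P, c, hP, hPl⟩ := exists_descent hopt.det_left a hl
  obtain ⟨Q, e, hQ, hQl⟩ := exists_descent hopt.det_right b hr
  refine ⟨P, Q, c, e, m, hP, hQ, ?_⟩
  rw [IsGeomOptimal, Matrix.map_mul, map_kronecker]
  exact (hopt.of_level_eq (det_map_ne_zero f hP) (det_map_ne_zero f hQ) hPl.symm hQl.symm).rebase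

namespace IsGeomOptimal

variable {A : Matrix (Fin d) (ι × κ) L} {a : ι → ℝ} {b : κ → ℝ} {m : ℝ}
  (hopt : IsGeomOptimal A a b m)

include hopt

lemma bound {J : Fin d → ι × κ} (hJ : J ∈ plSupp A 1 1) : m ≤ wt a b J := by
  refine IsOptimal.bound hopt J ?_
  rw [← plSupp_map (algebraMap L (AlgebraicClosure L)) A 1 1] at hJ
  simpa using hJ

lemma objective_le {E : Type*} [Field E] [Algebra L E] {g : Matrix ι ι E} {h : Matrix κ κ E}
    (hg : g.det ≠ 0) (hh : h.det ≠ 0) {a' : ι → ℝ} {b' : κ → ℝ} {m' : ℝ}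
    (hb : IsBound (A.map (algebraMap L E)) g h a' b' m') : objective a' b' m' ≤ objective a b m := by
  obtain ⟨G, H, hG, hH, hGH⟩ := exists_plSupp_eq A hg hh
  refine IsOptimal.le hopt G H a' b' m' hG hH fun J hJ => hb J ?_
  rwa [← hGH]

/-- The derivative of the objective at the optimum: some nonzero Plücker coordinate of minimal
weight has small weight in any other weight function, for any adapted basis over any extension. -/
theorem exists_weight_le {E : Type*} [Field E] [Algebra L E] {g : Matrix ι ι E} {h : Matrix κ κ E}
    (hg : g.det ≠ 0) (hh : h.det ≠ 0) (hga : ∀ i j, g i j ≠ 0 → a i = a j)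
    (hhb : ∀ i j, h i j ≠ 0 → b i = b j) (η : ι → ℝ) (θ : κ → ℝ) :
    ∃ J ∈ plSupp (A.map (algebraMap L E)) g h, (∀ I ∈ plSupp A 1 1, wt a b J ≤ wt a b I) ∧
      wt η θ J ≤ ∑ i, a i * η i + ∑ j, b j * θ j := by
  set S := plSupp (A.map (algebraMap L E)) g h with hS
  -- a change of basis on the graded pieces does not change the minimal weight
  have hm : ∀ J ∈ S, m ≤ wt a b J := by
    intro J hJ
    rw [hS, ← Matrix.one_mul g, ← Matrix.one_mul h] at hJ
    obtain ⟨I, hI, hIJ⟩ := exists_mem_plSupp_of_mul hJ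
    have h1 : wt a b J = wt a b I := Finset.sum_congr rfl fun k _ => by
      rw [hga _ _ (hIJ k).1, hhb _ _ (hIJ k).2]
    rw [h1]
    refine hopt.bound ?_
    rw [← plSupp_map (algebraMap L E)]
    simpa using hI
  by_contra! hcon
  set c := ∑ i, a i * η i + ∑ j, b j * θ j with hc
  set C := (∑ i, η i ^ 2 + ∑ j, θ j ^ 2) / 2 + 1 with hC
  -- a small step in the direction `(η, θ)` would increase the objective: coordinates of minimal
  -- weight gain more than `t * c`, and the others stay above the minimum for small `t`
  have hev : ∀ J : Fin d → ι × κ, ∀ᶠ t : ℝ in nhdsWithin 0 (Set.Ioi 0), J ∈ S →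
      m + t * c + t * t * C ≤ wt a b J + t * wt η θ J := by
    intro J
    by_cases hJ : J ∈ S
    swap
    · exact Filter.Eventually.of_forall fun t h0 => absurd h0 hJ
    rcases (hm J hJ).eq_or_lt with h1 | h1
    · have h2 : c < wt η θ J := hcon J hJ fun I hI => h1 ▸ hopt.bound hI
      have h3 : Filter.Tendsto (fun t : ℝ => wt η θ J - c - t * C) (nhdsWithin 0 (Set.Ioi 0))
          (nhds (wt η θ J - c - 0 * C)) :=
        (Continuous.tendsto (by fun_prop) 0).mono_left nhdsWithin_le_nhds
      rw [zero_mul, sub_zero] at h3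
      filter_upwards [h3.eventually_const_lt (sub_pos.2 h2), self_mem_nhdsWithin] with t ht ht0 _
      have : 0 < t := ht0
      nlinarith
    · have h3 : Filter.Tendsto (fun t : ℝ => wt a b J - m + t * (wt η θ J - c) - t * t * C)
          (nhdsWithin 0 (Set.Ioi 0)) (nhds (wt a b J - m + 0 * (wt η θ J - c) - 0 * 0 * C)) :=
        (Continuous.tendsto (by fun_prop) 0).mono_left nhdsWithin_le_nhds
      rw [zero_mul, add_zero, zero_mul, zero_mul, sub_zero] at h3
      filter_upwards [h3.eventually_const_lt (sub_pos.2 h1)] with t ht _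
      linarith
  obtain ⟨t, ht, ht0⟩ := ((Filter.eventually_all.2 hev).and self_mem_nhdsWithin).exists
  have ht0' : 0 < t := ht0
  have hb : IsBound (A.map (algebraMap L E)) g h (a + t • η) (b + t • θ)
      (m + t * c + t * t * C) := by
    intro J hJ
    rw [wt_add, wt_smul]
    exact ht J hJ
  have h4 := hopt.objective_le hg hh hb
  simp only [objective] at h4
  rw [sum_sq_add_smul a η t, sum_sq_add_smul b θ t, hC, hc] at h4
  nlinarith [mul_pos ht0' ht0']

/-- The sums of the weights are equal to the rank. -/
lemma sum_eq : ∑ i, a i = d ∧ ∑ j, b j = d := by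
  have key : ∀ x y : ℝ, d * (x + y) ≤ (∑ i, a i) * x + (∑ j, b j) * y := by
    intro x y
    obtain ⟨J, -, -, hJ⟩ := hopt.exists_weight_le (E := L) (g := 1) (h := 1) (by simp) (by simp)
      (fun i j hij => by
        have : i = j := by by_contra h; exact hij (Matrix.one_apply_ne h)
        rw [this])
      (fun i j hij => by
        have : i = j := by by_contra h; exact hij (Matrix.one_apply_ne h)
        rw [this]) (fun _ => x) (fun _ => y)
    simp only [wt, Finset.sum_const, Finset.card_univ, Fintype.card_fin, nsmul_eq_mul,
      ← Finset.sum_mul] at hJ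
    exact hJ
  -- the inequality `key` is linear in `(x, y)`, hence an equality
  have h1 := key 1 0
  have h2 := key (-1) 0
  have h3 := key 0 1
  have h4 := key 0 (-1)
  constructor <;> linarith

/-- A semilinear automorphism stabilizing the subspace respects the optimal filtrations. -/
theorem triangular {σ : L ≃+* L} {Φ : Matrix ι ι L} {Ψ : Matrix κ κ L}
    {T : Matrix (Fin d) (Fin d) L} (hΦ : Φ.det ≠ 0) (hΨ : Ψ.det ≠ 0)
    (h : A.map σ * Φ ⊗ₖ Ψ = T * A) :
    (∀ i j, Φ i j ≠ 0 → a i ≤ a j) ∧ ∀ i j, Ψ i j ≠ 0 → b i ≤ b j := by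
  have hid : A.map (algebraMap L L) = A := by ext; simp
  have hle : ∀ (G' : Matrix ι ι L) (H' : Matrix κ κ L) a' b' m', G'.det ≠ 0 → H'.det ≠ 0 →
      IsBound (A.map σ) G' H' a' b' m' → objective a' b' m' ≤ objective a b m := by
    intro G' H' a' b' m' hG hH hb
    refine hopt.objective_le (E := L) (det_map_ne_zero (σ.symm : L →+* L) hG)
      (det_map_ne_zero (σ.symm : L →+* L) hH) fun J hJ => hb J ?_
    rw [hid] at hJ
    rw [← plSupp_map (σ.symm : L →+* L)]
    have h1 : (A.map σ).map (σ.symm : L →+* L) = A := by ext; simp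
    have h2 := h1.symm ▸ hJ
    exact h2
  -- the row space of `A.map σ` has two optimal pairs of bases: the standard ones, and `(Φ, Ψ)`
  have h1 : IsOptimal (A.map σ) 1 1 a b m := by
    refine ⟨by simp, by simp, fun J hJ => hopt.bound ?_, hle⟩
    rw [← plSupp_map (σ : L →+* L)]
    simpa using hJ
  have h2 : IsOptimal (A.map σ) Φ Ψ a b m := by
    refine ⟨hΦ, hΨ, fun J hJ => hopt.bound ?_, hle⟩
    have h3 : minor (A.map σ * Φ ⊗ₖ Ψ) J ≠ 0 := hJ
    rw [h, minor_mul_left] at h3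
    change minor (A * 1 ⊗ₖ 1) J ≠ 0
    rw [Matrix.one_kronecker_one, Matrix.mul_one]
    exact right_ne_zero_of_mul h3
  obtain ⟨h3, h4⟩ := h1.level_eq h2
  refine ⟨fun i j hij => triangular_of_level_le (G₁ := 1) (G₂ := Φ) (by simp)
    (fun x => (congrFun h3 x).le) (by simpa using hij), fun i j hij =>
    triangular_of_level_le (G₁ := 1) (G₂ := Ψ) (by simp) (fun x => (congrFun h4 x).le)
    (by simpa using hij)⟩

end IsGeomOptimal

end Geometric

/-! ### Block matrices for a weight function -/

section Blocks

variable {ι R : Type*} [Fintype ι] [DecidableEq ι] [CommRing R]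

/-- The block diagonal part of a matrix, for the partition of the indices into the level sets
of `a`. -/
def blk (a : ι → ℝ) (M : Matrix ι ι R) : Matrix ι ι R := fun i j => if a i = a j then M i j else 0

/-- The block diagonal matrix with given diagonal blocks. -/
def mkBlock (a : ι → ℝ) (P : ∀ s : ℝ, Matrix {i // a i = s} {i // a i = s} R) : Matrix ι ι R :=
  fun i j => if h : a i = a j then P (a j) ⟨i, h⟩ ⟨j, rfl⟩ else 0

variable {a : ι → ℝ}

lemma mkBlock_apply (P : ∀ s : ℝ, Matrix {i // a i = s} {i // a i = s} R) {s : ℝ}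
    (i j : {i // a i = s}) : mkBlock a P i j = P s i j := by
  obtain ⟨j, rfl⟩ := j
  rw [mkBlock, dif_pos i.2]

lemma mkBlock_apply_of_ne (P : ∀ s : ℝ, Matrix {i // a i = s} {i // a i = s} R) {i j : ι}
    (h : a i ≠ a j) : mkBlock a P i j = 0 := dif_neg h

lemma eq_of_mkBlock_ne_zero {P : ∀ s : ℝ, Matrix {i // a i = s} {i // a i = s} R} {i j : ι}
    (h : mkBlock a P i j ≠ 0) : a i = a j := by
  by_contra h0
  exact h (mkBlock_apply_of_ne P h0)

lemma blk_eq_mkBlock (M : Matrix ι ι R) : blk a M = mkBlock a fun s => M.toSquareBlock a s := by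
  ext i j
  by_cases h : a i = a j
  · rw [blk, if_pos h, mkBlock, dif_pos h]
    rfl
  · rw [blk, if_neg h, mkBlock_apply_of_ne _ h]

lemma mkBlock_mul (P Q : ∀ s : ℝ, Matrix {i // a i = s} {i // a i = s} R) :
    mkBlock a P * mkBlock a Q = mkBlock a fun s => P s * Q s := by
  ext i k
  rw [Matrix.mul_apply]
  by_cases h : a i = a k
  · rw [mkBlock_apply (fun s => P s * Q s) (s := a k) ⟨i, h⟩ ⟨k, rfl⟩, Matrix.mul_apply]
    rw [← Finset.sum_filter_of_ne (p := fun j => a j = a k)]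
    · rw [Finset.sum_subtype (p := fun j => a j = a k) _ (by simp)]
      refine Finset.sum_congr rfl fun j _ => ?_
      rw [← mkBlock_apply P (s := a k) ⟨i, h⟩ j, ← mkBlock_apply Q j ⟨k, rfl⟩]
    · intro j _ hj
      exact eq_of_mkBlock_ne_zero (right_ne_zero_of_mul hj)
  · rw [mkBlock_apply_of_ne _ h]
    refine Finset.sum_eq_zero fun j _ => ?_
    by_cases h1 : a i = a j
    · rw [mkBlock_apply_of_ne Q (fun h2 => h (h1.trans h2)), mul_zero]
    · rw [mkBlock_apply_of_ne P h1, zero_mul]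

lemma mkBlock_diagonal (x : ι → R) :
    mkBlock a (fun s => Matrix.diagonal fun i : {i // a i = s} => x i) = Matrix.diagonal x := by
  ext i j
  by_cases h : i = j
  · subst h
    rw [mkBlock_apply _ (s := a i) ⟨i, rfl⟩ ⟨i, rfl⟩, Matrix.diagonal_apply_eq,
      Matrix.diagonal_apply_eq]
  · rw [Matrix.diagonal_apply_ne _ h]
    by_cases h1 : a i = a j
    · rw [mkBlock_apply _ (s := a j) ⟨i, h1⟩ ⟨j, rfl⟩, Matrix.diagonal_apply_ne]
      exact fun h2 => h (congrArg Subtype.val h2)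
    · rw [mkBlock_apply_of_ne _ h1]

lemma mkBlock_one : mkBlock a (fun s => (1 : Matrix {i // a i = s} {i // a i = s} R)) = 1 := by
  rw [← Matrix.diagonal_one, ← mkBlock_diagonal (a := a)]
  rfl

lemma mkBlock_map {S : Type*} [CommRing S] (f : R →+* S)
    (P : ∀ s : ℝ, Matrix {i // a i = s} {i // a i = s} R) :
    (mkBlock a P).map f = mkBlock a fun s => (P s).map f := by
  ext i j
  by_cases h : a i = a j
  · rw [Matrix.map_apply, mkBlock_apply _ (s := a j) ⟨i, h⟩ ⟨j, rfl⟩,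
      mkBlock_apply _ (s := a j) ⟨i, h⟩ ⟨j, rfl⟩, Matrix.map_apply]
  · rw [Matrix.map_apply, mkBlock_apply_of_ne _ h, mkBlock_apply_of_ne _ h, map_zero]

lemma blockTriangular_mkBlock (P : ∀ s : ℝ, Matrix {i // a i = s} {i // a i = s} R) :
    (mkBlock a P).BlockTriangular a := fun _ _ h => mkBlock_apply_of_ne P h.ne'

/-- The block diagonal part is multiplicative on block triangular matrices. -/
lemma blk_mul {M N : Matrix ι ι R} (hM : M.BlockTriangular a) (hN : N.BlockTriangular a) :
    blk a (M * N) = blk a M * blk a N := by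
  ext i k
  rw [Matrix.mul_apply]
  by_cases h : a i = a k
  · rw [blk, if_pos h, Matrix.mul_apply]
    refine Finset.sum_congr rfl fun j _ => ?_
    simp only [blk]
    rcases lt_trichotomy (a i) (a j) with h1 | h1 | h1
    · rw [hN (h ▸ h1), mul_zero, if_neg h1.ne, zero_mul]
    · rw [if_pos h1, if_pos (h1.symm.trans h)]
    · rw [hM h1, if_neg h1.ne', zero_mul, zero_mul]
  · rw [blk, if_neg h]
    refine (Finset.sum_eq_zero fun j _ => ?_).symm
    simp only [blk]
    by_cases h1 : a i = a j
    · rw [if_neg (fun h2 => h (h1.trans h2)), mul_zero]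
    · rw [if_neg h1, zero_mul]

lemma blk_mkBlock (P : ∀ s : ℝ, Matrix {i // a i = s} {i // a i = s} R) :
    blk a (mkBlock a P) = mkBlock a P := by
  ext i j
  by_cases h : a i = a j
  · rw [blk, if_pos h]
  · rw [blk, if_neg h, mkBlock_apply_of_ne _ h]

lemma det_toSquareBlock_ne_zero {E : Type*} [Field E] {M : Matrix ι ι E}
    (hM : M.BlockTriangular a) (h : M.det ≠ 0) (s : ℝ) : (M.toSquareBlock a s).det ≠ 0 := by
  by_cases hs : s ∈ Finset.univ.image a
  · rw [hM.det] at h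
    exact Finset.prod_ne_zero_iff.1 h s hs
  · have : IsEmpty {i // a i = s} := ⟨fun i => hs (Finset.mem_image.2 ⟨i, Finset.mem_univ _, i.2⟩)⟩
    rw [Matrix.det_isEmpty]
    exact one_ne_zero

/-- An additive function of the determinant of a block triangular matrix is determined by the
diagonal blocks, also for the submatrices given by an upper set of weights. -/
lemma sum_eq_of_blocks {E : Type*} [Field E] {M : Matrix ι ι E} (hM : M.BlockTriangular a)
    (hdet : M.det ≠ 0) {F : E → ℝ} (hF1 : F 1 = 0)
    (hF : ∀ x y, x ≠ 0 → y ≠ 0 → F (x * y) = F x + F y) {h : ι → ℝ}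
    (hs : ∀ s, ∑ i : {i // a i = s}, h i = F (M.toSquareBlock a s).det) (s : ℝ) :
    ∑ i : {i // s ≤ a i}, h i =
      F (M.submatrix (Subtype.val : {i // s ≤ a i} → ι) Subtype.val).det := by
  set N := M.submatrix (Subtype.val : {i // s ≤ a i} → ι) Subtype.val with hN
  have hNt : N.BlockTriangular (a ∘ Subtype.val) := hM.submatrix
  have hprod : ∀ (S : Finset ℝ) (x : ℝ → E), (∀ t ∈ S, x t ≠ 0) →
      F (∏ t ∈ S, x t) = ∑ t ∈ S, F (x t) := by
    intro S x hx
    induction S using Finset.induction_on with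
    | empty => simpa using hF1
    | insert t S ht ih =>
      rw [Finset.prod_insert ht, Finset.sum_insert ht, hF _ _ (hx _ (Finset.mem_insert_self _ _))
        (Finset.prod_ne_zero_iff.2 fun y hy => hx y (Finset.mem_insert_of_mem hy)),
        ih fun y hy => hx y (Finset.mem_insert_of_mem hy)]
  have hblock : ∀ t ∈ Finset.univ.image (a ∘ (Subtype.val : {i // s ≤ a i} → ι)),
      ∃ e : {x : {i // s ≤ a i} // (a ∘ Subtype.val) x = t} ≃ {i // a i = t},
        (∀ x, (e x : ι) = x.1.1) ∧
        N.toSquareBlock (a ∘ Subtype.val) t = (M.toSquareBlock a t).submatrix e e := by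
    intro t ht
    obtain ⟨x, -, rfl⟩ := Finset.mem_image.1 ht
    exact ⟨Equiv.subtypeSubtypeEquivSubtype (p := fun i => s ≤ a i)
      (q := fun i => a i = (a ∘ Subtype.val) x) fun {y} hy => hy.symm ▸ x.2, fun _ => rfl, rfl⟩
  rw [hNt.det, hprod]
  · have h1 : ∀ i : {i // s ≤ a i}, i ∈ Finset.univ →
        (a ∘ Subtype.val) i ∈ Finset.univ.image (a ∘ (Subtype.val : {i // s ≤ a i} → ι)) :=
      fun i _ => Finset.mem_image_of_mem _ (Finset.mem_univ _)
    rw [← Finset.sum_fiberwise_of_maps_to h1]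
    refine Finset.sum_congr rfl fun t ht => ?_
    obtain ⟨e, he, hNM⟩ := hblock t ht
    rw [hNM, Matrix.det_submatrix_equiv_self, ← hs t, ← e.sum_comp,
      Finset.sum_subtype (p := fun x => (a ∘ Subtype.val) x = t) _ (by simp)]
    exact Finset.sum_congr rfl fun x _ => by rw [he]
  · intro t ht
    obtain ⟨e, he, hNM⟩ := hblock t ht
    rw [hNM, Matrix.det_submatrix_equiv_self]
    exact det_toSquareBlock_ne_zero hM hdet t

end Blocks

section MinorBlocks

variable {d : ℕ} {ι κ R : Type*} [Fintype ι] [Fintype κ] [DecidableEq ι] [DecidableEq κ]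
  [CommRing R] [IsDomain R]

/-- A minor of minimal weight only depends on the block diagonal part of the change of basis. -/
lemma minor_eq_blk {A : Matrix (Fin d) (ι × κ) R} {a : ι → ℝ} {b : κ → ℝ} {J : Fin d → ι × κ}
    (hJ : ∀ I, minor A I ≠ 0 → wt a b J ≤ wt a b I) {M : Matrix ι ι R} {N : Matrix κ κ R}
    (hM : M.BlockTriangular a) (hN : N.BlockTriangular b) :
    minor (A * M ⊗ₖ N) J = minor (A * blk a M ⊗ₖ blk b N) J := by
  rw [minor_mul, minor_mul]
  refine Finset.sum_congr rfl fun I _ => ?_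
  by_cases h0 : minor A I = 0
  · rw [h0, mul_zero, mul_zero]
  congr 1
  by_cases h : ∀ k, a (I k).1 = a (J k).1 ∧ b (I k).2 = b (J k).2
  · refine Finset.prod_congr rfl fun k _ => ?_
    rw [Matrix.kroneckerMap_apply, Matrix.kroneckerMap_apply, blk, blk, if_pos (h k).1,
      if_pos (h k).2]
  · have h1 : ∏ k, (blk a M ⊗ₖ blk b N) (I k) (J k) = 0 := by
      push Not at h
      obtain ⟨k, hk⟩ := h
      refine Finset.prod_eq_zero (Finset.mem_univ k) ?_
      rw [Matrix.kroneckerMap_apply, blk, blk]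
      by_cases h2 : a (I k).1 = a (J k).1
      · rw [if_neg (hk h2), mul_zero]
      · rw [if_neg h2, zero_mul]
    rw [h1]
    by_contra h2
    have h3 : ∀ k, a (I k).1 ≤ a (J k).1 ∧ b (I k).2 ≤ b (J k).2 := fun k => by
      have h4 := Finset.prod_ne_zero_iff.1 h2 k (Finset.mem_univ k)
      rw [Matrix.kroneckerMap_apply] at h4
      exact ⟨not_lt.1 fun h5 => left_ne_zero_of_mul h4 (hM h5),
        not_lt.1 fun h5 => right_ne_zero_of_mul h4 (hN h5)⟩
    have h5 : ∀ k ∈ Finset.univ, a (I k).1 + b (I k).2 ≤ a (J k).1 + b (J k).2 :=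
      fun k _ => add_le_add (h3 k).1 (h3 k).2
    have h6 := (Finset.sum_eq_sum_iff_of_le h5).1 (le_antisymm (Finset.sum_le_sum h5) (hJ I h0))
    refine h fun k => ?_
    have h7 := h6 k (Finset.mem_univ k)
    have h8 := h3 k
    constructor <;> linarith [h8.1, h8.2]

lemma minor_mul_diagonal (B : Matrix (Fin d) (ι × κ) R) (x : ι → R) (y : κ → R)
    (J : Fin d → ι × κ) : minor (B * Matrix.diagonal x ⊗ₖ Matrix.diagonal y) J =
      (∏ k, x (J k).1 * y (J k).2) * minor B J := by
  rw [Matrix.diagonal_kronecker_diagonal, minor, minor, ← Matrix.det_mul_row]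
  congr 1
  ext i k
  rw [Matrix.submatrix_apply, Matrix.mul_diagonal, mul_comm]
  rfl

end MinorBlocks

/-! ### The contribution of the lattices -/

section Smith

variable {K : Type*} [NormedField K] [IsUltrametricDist K]

lemma isBasisOf_span {U : Type*} [AddCommGroup U] [Module K U] [Module (integers K) U]
    [IsScalarTower (integers K) K U] {ι : Type*} [Fintype ι] (f : Module.Basis ι K U) :
    IsBasisOf f (Submodule.span (integers K) (Set.range f)) := by
  classical
  intro v
  constructor
  · intro hv
    induction hv using Submodule.span_induction with
    | mem x hx =>
      obtain ⟨j, rfl⟩ := hx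
      intro i
      rw [Module.Basis.repr_self, Finsupp.single_apply]
      split_ifs <;> simp
    | zero => intro i; simp
    | add x y _ _ hx hy =>
      intro i
      rw [map_add, Finsupp.add_apply]
      exact (IsUltrametricDist.norm_add_le_max _ _).trans (max_le (hx i) (hy i))
    | smul c x _ hx =>
      intro i
      have h1 : c • x = (c : K) • x := (algebraMap_smul K c x).symm
      rw [h1, map_smul, Finsupp.smul_apply, smul_eq_mul, norm_mul]
      exact mul_le_one₀ (mem_integers.1 c.2) (norm_nonneg _) (hx i)
  · intro h
    rw [← f.sum_repr v]
    exact IsBasisOf.sum_smul_mem (fun i => Submodule.subset_span (Set.mem_range_self i)) h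

/-- The change of basis between two bases of a lattice is integral and invertible. -/
lemma IsBasisOf.exists_integral {U : Type*} [AddCommGroup U] [Module K U] [Module (integers K) U]
    [IsScalarTower (integers K) K U] {ι : Type*} [Fintype ι] [DecidableEq ι]
    {Ξ : Submodule (integers K) U} {e f : Module.Basis ι K U} (he : IsBasisOf e Ξ)
    (hf : IsBasisOf f Ξ) : ∃ g g' : Matrix ι ι (integers K), g * g' = 1 ∧
      ∀ i j, (g i j : K) = e.repr (f i) j := by
  refine ⟨Matrix.of fun i j => ⟨_, mem_integers.2 ((he _).1 (hf.mem i) j)⟩,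
    Matrix.of fun i j => ⟨_, mem_integers.2 ((hf _).1 (he.mem i) j)⟩, ?_, fun _ _ => rfl⟩
  ext i k
  rw [Matrix.mul_apply, AddSubmonoidClass.coe_finsetSum]
  change ∑ j, e.repr (f i) j * f.repr (e j) k = _
  have h1 := congrArg (fun w => f.repr w k) (e.sum_repr (f i))
  simp only [map_sum, map_smul, Finsupp.coe_finsetSum, Finset.sum_apply, Finsupp.smul_apply,
    smul_eq_mul, Module.Basis.repr_self] at h1
  rw [h1, Matrix.one_apply, Finsupp.single_apply]
  split_ifs <;> rfl

variable [IsDiscreteValuationRing (integers K)]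

/-- The Smith normal form over the ring of integers. -/
lemma exists_smith {ι : Type*} [Fintype ι] [DecidableEq ι] {M : Matrix ι ι K} (hM : M.det ≠ 0) :
    ∃ (g g' γ γ' : Matrix ι ι (integers K)) (x : ι → K), g * g' = 1 ∧ γ * γ' = 1 ∧
      (∀ i, x i ≠ 0) ∧ M = g.map (integers K).subtype * Matrix.diagonal x *
        γ.map (integers K).subtype := by
  let b := Pi.basisFun K ι
  obtain ⟨hli, hsp⟩ := (Module.Basis.is_basis_iff_det b (v := fun i => M i)).2 (by
    rw [Pi.basisFun_det_apply]
    exact hM.isUnit)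
  let f : Module.Basis ι K (ι → K) := Module.Basis.mk hli hsp.ge
  have hf : ∀ i, f i = M i := fun i => Module.Basis.mk_apply hli hsp.ge i
  have h1 := isBasisOf_span b
  have h2 := isBasisOf_span f
  have := h1.isLattice
  have := h2.isLattice
  obtain ⟨e, x, he, hex⟩ := exists_proportional_bases (K := K)
    (Submodule.span (integers K) (Set.range b)) (Submodule.span (integers K) (Set.range f)) b
  obtain ⟨γ, γ', hγ, hγe⟩ := h1.exists_integral he
  obtain ⟨g, g', hg, hge⟩ := hex.exists_integral h2
  refine ⟨g, g', γ, γ', fun i => x i, hg, hγ, fun i => (x i).ne_zero, ?_⟩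
  ext i k
  have h3 := congrArg (fun w => b.repr w k) ((e.unitsSMul x).sum_repr (f i))
  simp only [map_sum, map_smul, Finsupp.coe_finsetSum, Finset.sum_apply, Finsupp.smul_apply,
    smul_eq_mul, Module.Basis.unitsSMul_apply, Units.smul_def] at h3
  have h4 : M i k = b.repr (f i) k := by rw [hf, Pi.basisFun_repr]
  rw [h4, ← h3, Matrix.mul_apply]
  refine Finset.sum_congr rfl fun j _ => ?_
  rw [Matrix.mul_diagonal, Matrix.map_apply, Matrix.map_apply]
  change _ = (g i j : K) * x j * (γ j k : K)
  rw [hγe, hge, mul_assoc]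

lemma norm_det_map_eq_one {ι : Type*} [Fintype ι] [DecidableEq ι] {g g' : Matrix ι ι (integers K)}
    (h : g * g' = 1) : ‖(g.map (integers K).subtype).det‖ = 1 := by
  have h1 : ∀ g : Matrix ι ι (integers K), ‖(g.map (integers K).subtype).det‖ ≤ 1 := fun g =>
    norm_det_le_one _ fun i j => mem_integers.1 (g i j).2
  have h2 := congrArg (fun m : Matrix ι ι (integers K) => ‖(m.map (integers K).subtype).det‖) h
  simp only [Matrix.map_mul, Matrix.det_mul, norm_mul] at h2
  rw [Matrix.map_one _ (map_zero _) (map_one _), Matrix.det_one, norm_one] at h2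
  nlinarith [h1 g, h1 g', norm_nonneg (g.map (integers K).subtype).det,
    norm_nonneg (g'.map (integers K).subtype).det]

/-- A blockwise Smith normal form for block triangular matrices. -/
lemma exists_blk_smith {ι : Type*} [Fintype ι] [DecidableEq ι] {a : ι → ℝ} {M : Matrix ι ι K}
    (hM : M.BlockTriangular a) (hdet : M.det ≠ 0) :
    ∃ (g g' γ' : Matrix ι ι (integers K)) (x : ι → K), g * g' = 1 ∧
      (∀ i j, g i j ≠ 0 → a i = a j) ∧ γ'.BlockTriangular a ∧
      (∀ i, x i ≠ 0) ∧ blk a (M * γ'.map (integers K).subtype) =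
        g.map (integers K).subtype * Matrix.diagonal x ∧
      ∀ s, ∑ i : {i // s ≤ a i}, addVal (x i) =
        addVal (M.submatrix (Subtype.val : {i // s ≤ a i} → ι) Subtype.val).det := by
  have h1 := fun s => exists_smith (det_toSquareBlock_ne_zero hM hdet s)
  choose g g' γ γ' x hg hγ hx hMs using h1
  have hγ' : (mkBlock a γ').BlockTriangular a := blockTriangular_mkBlock _
  refine ⟨mkBlock a g, mkBlock a g', mkBlock a γ', fun i => x (a i) ⟨i, rfl⟩, ?_,
    fun i j => eq_of_mkBlock_ne_zero, hγ', fun i => hx _ _, ?_, ?_⟩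
  · rw [mkBlock_mul, funext hg]
    exact mkBlock_one
  · rw [blk_mul hM (hγ'.map _), mkBlock_map, blk_mkBlock, blk_eq_mkBlock, mkBlock_mul,
      ← mkBlock_diagonal (a := a), mkBlock_map, mkBlock_mul]
    congr 1
    funext s
    rw [hMs s, Matrix.mul_assoc, ← Matrix.map_mul, hγ s, Matrix.map_one _ (map_zero _) (map_one _),
      Matrix.mul_one]
    congr 2
    funext i
    obtain ⟨i, rfl⟩ := i
    rfl
  · refine sum_eq_of_blocks (h := fun i => addVal (x (a i) ⟨i, rfl⟩)) hM hdet addVal_one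
      (fun y z => addVal_mul) fun s => ?_
    have h2 : ∀ i : {i // a i = s}, x (a i) ⟨i, rfl⟩ = x s i := fun ⟨i, hi⟩ => by subst hi; rfl
    simp only [h2]
    rw [← addVal_prod _ _ fun i _ => hx s i]
    refine addVal_eq_of_norm_eq ?_
    have h3 := norm_det_map_eq_one (hγ s)
    have h4 := norm_det_map_eq_one (hg s)
    rw [hMs s, Matrix.det_mul, Matrix.det_mul, Matrix.det_diagonal, norm_mul, norm_mul, h3, h4,
      one_mul, mul_one]

lemma det_map_ne_zero_of_mul_eq_one {R E ι : Type*} [CommRing R] [Field E] [Fintype ι]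
    [DecidableEq ι] (f : R →+* E) {y y' : Matrix ι ι R} (h : y * y' = 1) : (y.map f).det ≠ 0 := by
  have h1 := congrArg (fun m : Matrix ι ι R => (m.map f).det) h
  simp only [Matrix.map_mul, Matrix.det_mul] at h1
  rw [Matrix.map_one _ (map_zero _) (map_one _), Matrix.det_one] at h1
  exact left_ne_zero_of_mul_eq_one h1

lemma addVal_le_of_norm_le {x y : K} (hx : x ≠ 0) (h : ‖x‖ ≤ ‖y‖) : addVal y ≤ addVal x := by
  have hy : 0 < ‖y‖ := (norm_pos_iff.2 hx).trans_le h
  have h1 : 0 ≤ addVal (x * y⁻¹) := addVal_nonneg_iff.2 (by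
    rw [norm_mul, norm_inv, ← div_eq_mul_inv]
    exact div_le_one_of_le₀ h hy.le)
  rw [addVal_mul hx (inv_ne_zero (norm_pos_iff.1 hy)), addVal_inv] at h1
  linarith

variable {L : Type*} [Field L] [Algebra L K] {d : ℕ} {ι κ : Type*} [Fintype ι] [Fintype κ]
  [DecidableEq ι] [DecidableEq κ]

/-- The lattice part of the degree bound: in terms of bases of the lattices adapted to the optimal
filtrations, some minor has small valuation. The derivative of the objective is applied over the
residue field of `K`. -/
theorem IsGeomOptimal.exists_addVal_minor_le {A : Matrix (Fin d) (ι × κ) L} {a : ι → ℝ}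
    {b : κ → ℝ} {m : ℝ} (hopt : IsGeomOptimal A a b m)
    (hL : ∀ x : L, algebraMap L K x ∈ integers K) {M : Matrix ι ι K} {N : Matrix κ κ K}
    (hM : M.BlockTriangular a) (hN : N.BlockTriangular b) (hMdet : M.det ≠ 0) (hNdet : N.det ≠ 0) :
    ∃ (h : ι → ℝ) (h' : κ → ℝ) (J : Fin d → ι × κ),
      (∀ s, ∑ i : {i // s ≤ a i}, h i =
        addVal (M.submatrix (Subtype.val : {i // s ≤ a i} → ι) Subtype.val).det) ∧
      (∀ s, ∑ i : {i // s ≤ b i}, h' i =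
        addVal (N.submatrix (Subtype.val : {i // s ≤ b i} → κ) Subtype.val).det) ∧
      minor (A.map (algebraMap L K) * M ⊗ₖ N) J ≠ 0 ∧
      addVal (minor (A.map (algebraMap L K) * M ⊗ₖ N) J) ≤
        ∑ i, a i * h i + ∑ j, b j * h' j := by
  obtain ⟨g, g₁, γ, x, hg, hga, hγ, hx, hMb, hxs⟩ := exists_blk_smith hM hMdet
  obtain ⟨g', g₁', γ', x', hg', hga', hγ', hx', hNb, hxs'⟩ := exists_blk_smith hN hNdet
  let ρ : L →+* integers K := (algebraMap L K).codRestrict (integers K) hL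
  let k := IsLocalRing.ResidueField (integers K)
  let res : integers K →+* k := IsLocalRing.residue (integers K)
  let _ : Algebra L k := (res.comp ρ).toAlgebra
  have hρ : A.map (algebraMap L K) = (A.map ρ).map (integers K).subtype := rfl
  -- `L` embeds into the residue field, over which `g` and `g'` are still invertible
  obtain ⟨J, hJ, hmin, hle⟩ := hopt.exists_weight_le (E := k) (det_map_ne_zero_of_mul_eq_one res hg)
    (det_map_ne_zero_of_mul_eq_one res hg')
    (fun i j hij => hga i j fun h0 => hij (by rw [Matrix.map_apply, h0, map_zero]))
    (fun i j hij => hga' i j fun h0 => hij (by rw [Matrix.map_apply, h0, map_zero]))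
    (fun i => addVal (x i)) (fun i => addVal (x' i))
  -- a minor of an integral matrix which is nonzero in the residue field is a unit
  have hunit : ‖minor (A.map (algebraMap L K) * g.map (integers K).subtype ⊗ₖ
      g'.map (integers K).subtype) J‖ = 1 := by
    have h1 : minor (A.map (algebraMap L K) * g.map (integers K).subtype ⊗ₖ
        g'.map (integers K).subtype) J = (integers K).subtype (minor (A.map ρ * g ⊗ₖ g') J) := by
      rw [hρ, ← map_kronecker, ← Matrix.map_mul, minor_map]
    have h2 : res (minor (A.map ρ * g ⊗ₖ g') J) ≠ 0 := by
      rw [← minor_map, Matrix.map_mul, map_kronecker]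
      exact hJ
    rw [h1]
    generalize minor (A.map ρ * g ⊗ₖ g') J = z at h2
    have h3 : IsUnit z := by
      by_contra h4
      exact h2 ((IsLocalRing.residue_eq_zero_iff _).2 h4)
    obtain ⟨y, hy⟩ := h3.exists_right_inv
    have h6 : ‖(z : K)‖ * ‖(y : K)‖ = 1 := by
      rw [← norm_mul, ← norm_one (α := K)]
      exact congrArg (fun z : integers K => ‖(z : K)‖) hy
    have h7 := mem_integers.1 z.2
    have h8 := mem_integers.1 y.2
    change ‖(z : K)‖ = 1
    nlinarith [norm_nonneg (z : K), norm_nonneg (y : K)]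
  have hminK : ∀ I, minor (A.map (algebraMap L K)) I ≠ 0 → wt a b J ≤ wt a b I := by
    intro I hI
    rw [minor_map] at hI
    refine hmin I ?_
    change minor (A * 1 ⊗ₖ 1) I ≠ 0
    rw [Matrix.one_kronecker_one, Matrix.mul_one]
    exact fun h0 => hI (by rw [h0, map_zero])
  -- after an integral change of the lattice bases, the minor `J` has valuation `wt h h' J`
  have heq := minor_eq_blk hminK (hM.mul (hγ.map (integers K).subtype))
    (hN.mul (hγ'.map (integers K).subtype))
  rw [hMb, hNb, Matrix.mul_kronecker_mul, Matrix.mul_kronecker_mul, ← Matrix.mul_assoc,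
    ← Matrix.mul_assoc, minor_mul_diagonal] at heq
  have hprod : ∀ k ∈ Finset.univ, x (J k).1 * x' (J k).2 ≠ 0 := fun k _ => mul_ne_zero (hx _) (hx' _)
  have hval : addVal (minor (A.map (algebraMap L K) * M ⊗ₖ N * γ.map (integers K).subtype ⊗ₖ
      γ'.map (integers K).subtype) J) = wt (fun i => addVal (x i)) (fun i => addVal (x' i)) J := by
    rw [heq]
    have h1 : addVal ((∏ k, x (J k).1 * x' (J k).2) * minor (A.map (algebraMap L K) *
        g.map (integers K).subtype ⊗ₖ g'.map (integers K).subtype) J) =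
        addVal (∏ k, x (J k).1 * x' (J k).2) := by
      refine addVal_eq_of_norm_eq ?_
      rw [norm_mul, hunit, mul_one]
    rw [h1, addVal_prod _ _ hprod]
    exact Finset.sum_congr rfl fun k _ => addVal_mul (hx _) (hx' _)
  have hne : minor (A.map (algebraMap L K) * M ⊗ₖ N * γ.map (integers K).subtype ⊗ₖ
      γ'.map (integers K).subtype) J ≠ 0 := by
    rw [heq]
    refine mul_ne_zero (Finset.prod_ne_zero_iff.2 hprod) fun h0 => ?_
    rw [h0, norm_zero] at hunit
    exact zero_ne_one hunit
  -- a minor for the original bases has at least the same absolute value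
  obtain ⟨I, hI⟩ : ∃ I, ‖minor (A.map (algebraMap L K) * M ⊗ₖ N * γ.map (integers K).subtype ⊗ₖ
      γ'.map (integers K).subtype) J‖ ≤ ‖minor (A.map (algebraMap L K) * M ⊗ₖ N) I‖ := by
    by_contra! hcon
    rw [minor_mul] at hcon
    have h1 : (Finset.univ : Finset (Fin d → ι × κ)).Nonempty := ⟨J, Finset.mem_univ _⟩
    obtain ⟨I, -, hI⟩ := IsUltrametricDist.exists_norm_finsetSum_le_of_nonempty h1
      (fun I : Fin d → ι × κ => (∏ k, (γ.map (integers K).subtype ⊗ₖ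
        γ'.map (integers K).subtype) (I k) (J k)) * minor (A.map (algebraMap L K) * M ⊗ₖ N) I)
    refine (hcon I).not_ge (hI.trans ?_)
    rw [norm_mul, norm_prod]
    refine mul_le_of_le_one_left (norm_nonneg _) (Finset.prod_le_one (fun _ _ => norm_nonneg _)
      fun k _ => ?_)
    rw [Matrix.kroneckerMap_apply, norm_mul]
    exact mul_le_one₀ (mem_integers.1 (γ _ _).2) (norm_nonneg _) (mem_integers.1 (γ' _ _).2)
  have hIne : minor (A.map (algebraMap L K) * M ⊗ₖ N) I ≠ 0 := by
    intro h0
    rw [h0, norm_zero] at hI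
    exact hne (norm_le_zero_iff.1 hI)
  refine ⟨fun i => addVal (x i), fun i => addVal (x' i), I, hxs, hxs', hIne, ?_⟩
  refine le_trans ?_ (hval.trans_le hle)
  exact addVal_le_of_norm_le hne hI

end Smith

section Hermite

variable {K : Type*} [NormedField K] [IsUltrametricDist K] [IsDiscreteValuationRing (integers K)]
  {U : Type*} [AddCommGroup U] [Module K U] [Module (integers K) U]
  [IsScalarTower (integers K) K U]

/-- A linear form attains its maximal absolute value on every submodule of a lattice. -/
lemma exists_max_norm {Ξ : Submodule (integers K) U} [Submodule.IsLattice K Ξ]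
    (Θ : Submodule (integers K) U) (hle : Θ ≤ Ξ) (f : U →ₗ[K] K) :
    ∃ x ∈ Θ, ∀ y ∈ Θ, ‖f y‖ ≤ ‖f x‖ := by
  have hΞ : Ξ.FG := (inferInstance : Submodule.IsLattice K Ξ).fg
  have := isNoetherian_of_fg_of_noetherian Ξ hΞ
  have hΘ : Θ.FG := by
    have h1 := IsNoetherian.noetherian (Θ.comap Ξ.subtype)
    have h2 := h1.map Ξ.subtype
    rwa [Submodule.map_comap_subtype, inf_eq_right.2 hle] at h2
  obtain ⟨s, rfl⟩ := hΘ
  have hsm : ∀ (c : integers K) (y : U), f (c • y) = (c : K) * f y := fun c y => by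
    rw [← algebraMap_smul K c y, map_smul, smul_eq_mul]
    rfl
  rcases s.eq_empty_or_nonempty with rfl | hs
  · refine ⟨0, zero_mem _, fun y hy => ?_⟩
    rw [Finset.coe_empty, Submodule.span_empty, Submodule.mem_bot] at hy
    rw [hy]
  obtain ⟨x, hx, hmax⟩ := s.exists_max_image (fun y => ‖f y‖) hs
  refine ⟨x, Submodule.subset_span hx, fun y hy => ?_⟩
  induction hy using Submodule.span_induction with
  | mem y hy => exact hmax y hy
  | zero => simp
  | add y z _ _ hy hz =>
    rw [map_add]
    exact (IsUltrametricDist.norm_add_le_max _ _).trans (max_le hy hz)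
  | smul c y _ hy =>
    rw [hsm, norm_mul]
    exact (mul_le_of_le_one_left (norm_nonneg _) (mem_integers.1 c.2)).trans hy

/-- A lattice has a basis adapted to a full flag. -/
lemma exists_triangular_isBasisOf (Ξ : Submodule (integers K) U) [Submodule.IsLattice K Ξ]
    {ι : Type*} [Fintype ι] [DecidableEq ι] (v : Module.Basis ι K U) {r : ι → ℕ}
    (hr : Function.Injective r) : ∃ e : Module.Basis ι K U, IsBasisOf e Ξ ∧
      ∀ i j, v.repr (e i) j ≠ 0 → r j ≤ r i := by
  let Θ : ι → Submodule (integers K) U := fun i =>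
    { carrier := {x | x ∈ Ξ ∧ ∀ j, r i < r j → v.repr x j = 0}
      zero_mem' := ⟨zero_mem _, fun j _ => by simp⟩
      add_mem' := fun hx hy => ⟨add_mem hx.1 hy.1, fun j hj => by
        rw [map_add, Finsupp.add_apply, hx.2 j hj, hy.2 j hj, add_zero]⟩
      smul_mem' := fun c x hx => ⟨Ξ.smul_mem c hx.1, fun j hj => by
        rw [← algebraMap_smul K c x, map_smul, Finsupp.smul_apply, hx.2 j hj, smul_zero]⟩ }
  have hex := fun i => exists_max_norm (Θ i) (fun x hx => hx.1) (v.coord i)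
  choose e he hmax using hex
  have hne : ∀ i, v.repr (e i) i ≠ 0 := by
    intro i
    obtain ⟨c, hc, hci⟩ := Isoc.exists_smul_mem_lattice Ξ (v i)
    have h1 := hmax i (c • v i) ⟨hci, fun j hj => by
      rw [map_smul, Finsupp.smul_apply, Module.Basis.repr_self, Finsupp.single_apply, if_neg,
        smul_zero]
      rintro rfl
      exact hj.false⟩
    rw [Module.Basis.coord_apply, Module.Basis.coord_apply, map_smul, Finsupp.smul_apply,
      Module.Basis.repr_self, Finsupp.single_eq_same, smul_eq_mul, mul_one] at h1
    exact norm_pos_iff.1 ((norm_pos_iff.2 hc).trans_le h1)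
  -- successive elimination of the coordinates
  have hspan : ∀ (n : ℕ) (x : U), x ∈ Ξ → (∀ j, n ≤ r j → v.repr x j = 0) →
      ∃ c : ι → K, (∀ i, ‖c i‖ ≤ 1) ∧ x = ∑ i, c i • e i := by
    intro n
    induction n with
    | zero =>
      intro x _ hx
      refine ⟨0, by simp, ?_⟩
      have : x = 0 := v.repr.map_eq_zero_iff.1 (Finsupp.ext fun j => hx j (Nat.zero_le _))
      simp [this]
    | succ n ih =>
      intro x hxΞ hx
      by_cases hn : ∃ i, r i = n
      · obtain ⟨i, rfl⟩ := hn
        have h1 := hmax i x ⟨hxΞ, fun j hj => hx j hj⟩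
        rw [Module.Basis.coord_apply, Module.Basis.coord_apply] at h1
        set c := v.repr x i / v.repr (e i) i with hc
        have hc1 : ‖c‖ ≤ 1 := by
          rw [hc, norm_div]
          exact div_le_one_of_le₀ h1 (norm_nonneg _)
        have h2 : c • e i ∈ Ξ := by
          have := Ξ.smul_mem (⟨c, mem_integers.2 hc1⟩ : integers K) (he i).1
          rwa [← algebraMap_smul K] at this
        obtain ⟨c', hc', hx'⟩ := ih (x - c • e i) (sub_mem hxΞ h2) fun j hj => by
          rw [map_sub, map_smul, Finsupp.sub_apply, Finsupp.smul_apply, smul_eq_mul]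
          rcases hj.eq_or_lt with h3 | h3
          · rw [← hr h3, hc, div_mul_cancel₀ _ (hne i), sub_self]
          · rw [hx j h3, (he i).2 j h3, mul_zero, sub_zero]
        refine ⟨c' + Pi.single i c, fun j => ?_, ?_⟩
        · refine (IsUltrametricDist.norm_add_le_max _ _).trans (max_le (hc' j) ?_)
          rw [Pi.single_apply]
          split_ifs
          · exact hc1
          · simp
        · rw [eq_add_of_sub_eq hx']
          simp only [Pi.add_apply, add_smul, Finset.sum_add_distrib]
          congr 1
          rw [Finset.sum_eq_single i]
          · rw [Pi.single_eq_same]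
          · intro j _ hj
            rw [Pi.single_eq_of_ne hj, zero_smul]
          · exact fun h => absurd (Finset.mem_univ i) h
      · refine ih x hxΞ fun j hj => hx j ?_
        exact Nat.succ_le_of_lt (hj.lt_of_ne fun h => hn ⟨j, h.symm⟩)
  have hspan' : ∀ x ∈ Ξ, ∃ c : ι → K, (∀ i, ‖c i‖ ≤ 1) ∧ x = ∑ i, c i • e i := fun x hx =>
    hspan (Finset.univ.sup r + 1) x hx fun j hj =>
      absurd (Finset.le_sup (f := r) (Finset.mem_univ j)) (by omega)
  have hsp : ⊤ ≤ Submodule.span K (Set.range e) := by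
    rw [← (inferInstance : Submodule.IsLattice K Ξ).span_eq_top, Submodule.span_le]
    intro x hx
    obtain ⟨c, -, rfl⟩ := hspan' x hx
    exact Submodule.sum_mem _ fun i _ => Submodule.smul_mem _ _ (Submodule.subset_span ⟨i, rfl⟩)
  let e' : Module.Basis ι K U := basisOfTopLeSpanOfCardEqFinrank e hsp
    (Module.finrank_eq_card_basis v).symm
  have he' : ∀ i, e' i = e i := fun i => by simp [e']
  refine ⟨e', fun x => ⟨fun hx i => ?_, fun h => ?_⟩, fun i j hij => ?_⟩
  · obtain ⟨c, hc, rfl⟩ := hspan' x hx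
    simp only [← he']
    rw [Module.Basis.repr_sum_self]
    exact hc i
  · rw [← e'.sum_repr x]
    exact IsBasisOf.sum_smul_mem (fun i => by rw [he']; exact (he i).1) h
  · rw [he'] at hij
    by_contra h
    exact hij ((he i).2 j (not_le.1 h))

end Hermite

/-! ### Growth of the iterates of the Frobenius -/

section FiniteDimensionalNorms

variable {L : Type*} [NormedField L] [IsUltrametricDist L]

lemma norm_det_le {ι : Type*} [Fintype ι] [DecidableEq ι] (M : Matrix ι ι L) {c : ℝ} (hc : 0 ≤ c)
    (h : ∀ i j, ‖M i j‖ ≤ c) : ‖M.det‖ ≤ c ^ Fintype.card ι := by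
  rw [Matrix.det_apply]
  refine IsUltrametricDist.norm_sum_le_of_forall_le_of_nonneg (pow_nonneg hc _) fun τ _ => ?_
  have h1 : ‖Equiv.Perm.sign τ • ∏ i, M (τ i) i‖ = ‖∏ i, M (τ i) i‖ := by
    rcases Int.units_eq_one_or (Equiv.Perm.sign τ) with h | h <;> simp [h]
  rw [h1, norm_prod, ← Finset.card_univ, ← Finset.prod_const]
  exact Finset.prod_le_prod (fun _ _ => norm_nonneg _) fun i _ => h _ _

/-- Semilinear maps between finite dimensional spaces are bounded. -/
lemma exists_bound_of_semilinear {V V' ι κ : Type*} [AddCommGroup V] [Module L V]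
    [AddCommGroup V'] [Module L V'] [Fintype ι] [Fintype κ] (b : Module.Basis ι L V)
    (b' : Module.Basis κ L V') {τ : L →+* L} (hτ : ∀ x, ‖τ x‖ = ‖x‖) (f : V →ₛₗ[τ] V') :
    ∃ C : ℝ, 0 ≤ C ∧ ∀ x, ‖b'.equivFun (f x)‖ ≤ C * ‖b.equivFun x‖ := by
  refine ⟨∑ i, ‖b'.equivFun (f (b i))‖, Finset.sum_nonneg fun _ _ => norm_nonneg _, fun x => ?_⟩
  conv_lhs => rw [← b.sum_equivFun x]
  rw [map_sum, map_sum, Finset.sum_mul]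
  refine (norm_sum_le _ _).trans (Finset.sum_le_sum fun i _ => ?_)
  rw [LinearMap.map_smulₛₗ, map_smul, norm_smul, hτ, mul_comm]
  exact mul_le_mul_of_nonneg_left (norm_le_pi_norm (b.equivFun x) i) (norm_nonneg _)

variable [CompleteSpace L]

/-- Over a complete field, every norm on a finite dimensional space dominates the coordinates. -/
lemma IsNorm.exists_bound (hL : ∃ w : L, 1 < ‖w‖) {V ι : Type*} [AddCommGroup V] [Module L V]
    [Fintype ι] (b : Module.Basis ι L V) {α : V → ℝ} (hα : IsNorm (K := L) α) :
    ∃ C : ℝ, 0 ≤ C ∧ ∀ x, ‖b.equivFun x‖ ≤ C * α x := by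
  let _ : NontriviallyNormedField L := { ‹NormedField L› with non_trivial := hL }
  let _ : NormedAddCommGroup V := AddGroupNorm.toNormedAddCommGroup
    { toFun := α
      map_zero' := (hα.eq_zero_iff 0).2 rfl
      add_le' := fun x y => (hα.add_le x y).trans
        (max_le_add_of_nonneg (hα.nonneg x) (hα.nonneg y))
      neg' := fun x => by rw [← neg_one_smul L x, hα.smul, norm_neg, norm_one, one_mul]
      eq_zero_of_map_eq_zero' := fun x hx => (hα.eq_zero_iff x).1 hx }
  let _ : NormedSpace L V := ⟨fun c x => (hα.smul c x).le⟩
  have : FiniteDimensional L V := b.finiteDimensional_of_finite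
  let F : V →L[L] (ι → L) := LinearMap.toContinuousLinearMap b.equivFun.toLinearMap
  exact ⟨‖F‖, norm_nonneg _, fun x => F.le_opNorm x⟩

/-- A separated scaled family of additive subgroups of a finite dimensional space over a complete
field is bounded. -/
lemma exists_bound_of_family (hL : ∃ w : L, 1 < ‖w‖) {V ι : Type*} [AddCommGroup V] [Module L V]
    [Fintype ι] (b : Module.Basis ι L V) (G : ℝ → Set V) (hmono : ∀ M M', M ≤ M' → G M ⊆ G M')
    (hadd : ∀ M x y, x ∈ G M → y ∈ G M → x + y ∈ G M)
    (hsmul : ∀ (c : L) M x, x ∈ G M → c • x ∈ G (‖c‖ * M)) (hex : ∀ x, ∃ M > 0, x ∈ G M)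
    (hsep : ∀ x, (∀ M > 0, x ∈ G M) → x = 0) :
    ∃ C : ℝ, 0 ≤ C ∧ ∀ M > 0, ∀ x ∈ G M, ‖b.equivFun x‖ ≤ C * M := by
  let α : V → ℝ := fun x => sInf {M | 0 < M ∧ x ∈ G M}
  have hbdd : ∀ x, BddBelow {M | 0 < M ∧ x ∈ G M} := fun x => ⟨0, fun M hM => hM.1.le⟩
  have hne : ∀ x, {M | 0 < M ∧ x ∈ G M}.Nonempty := fun x => by
    obtain ⟨M, h1, h2⟩ := hex x
    exact ⟨M, h1, h2⟩
  have hlt : ∀ x M, α x < M → 0 < M ∧ x ∈ G M := fun x M h => by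
    obtain ⟨M', ⟨h1, h2⟩, h3⟩ := exists_lt_of_csInf_lt (hne x) h
    exact ⟨h1.trans h3, hmono _ _ h3.le h2⟩
  have hle : ∀ x M, 0 < M → x ∈ G M → α x ≤ M := fun x M h1 h2 => csInf_le (hbdd x) ⟨h1, h2⟩
  have hnn : ∀ x, 0 ≤ α x := fun x => le_csInf (hne x) fun M hM => hM.1.le
  have hsm : ∀ (c : L) x, c ≠ 0 → α (c • x) ≤ ‖c‖ * α x := fun c x hc => by
    have hc' : 0 < ‖c‖ := norm_pos_iff.2 hc
    refine le_of_forall_gt_imp_ge_of_dense fun M hM => ?_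
    have h1 : α x < M / ‖c‖ := by rwa [lt_div_iff₀ hc', mul_comm]
    obtain ⟨h2, h3⟩ := hlt _ _ h1
    have h4 := hsmul c _ _ h3
    rw [mul_div_cancel₀ _ hc'.ne'] at h4
    exact hle _ _ ((div_pos_iff_of_pos_right hc').1 h2) h4
  have hz : ∀ x, α x = 0 ↔ x = 0 := by
    intro x
    constructor
    · intro h
      exact hsep x fun M hM => (hlt x M (by rw [h]; exact hM)).2
    · rintro rfl
      refine le_antisymm (le_of_forall_gt_imp_ge_of_dense fun M hM => ?_) (hnn 0)
      obtain ⟨M', hM', h0⟩ := hex 0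
      refine hle _ _ hM ?_
      have h1 := hsmul 0 M' 0 h0
      rw [smul_zero, norm_zero, zero_mul] at h1
      exact hmono _ _ hM.le h1
  have hα : IsNorm (K := L) α := by
    refine ⟨hnn, hz, fun c x => ?_, fun x y => ?_⟩
    · by_cases hc : c = 0
      · rw [hc, zero_smul, norm_zero, zero_mul, hz]
      · refine le_antisymm (hsm c x hc) ?_
        have h1 := hsm c⁻¹ (c • x) (inv_ne_zero hc)
        rw [inv_smul_smul₀ hc, norm_inv, inv_mul_eq_div, le_div_iff₀ (norm_pos_iff.2 hc)] at h1
        rwa [mul_comm]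
    · refine le_of_forall_gt_imp_ge_of_dense fun M hM => ?_
      obtain ⟨h1, h2⟩ := hlt x M ((le_max_left _ _).trans_lt hM)
      obtain ⟨-, h3⟩ := hlt y M ((le_max_right _ _).trans_lt hM)
      exact hle _ _ h1 (hadd M x y h2 h3)
  obtain ⟨C, hC, h⟩ := hα.exists_bound hL b
  exact ⟨C, hC, fun M hM x hx => (h x).trans (mul_le_mul_of_nonneg_left (hle x M hM hx) hC)⟩

end FiniteDimensionalNorms

namespace Isoc

section Iterates

variable {L : Type*} [Field L] {σ : L ≃+* L}

/-- The iterates of the Frobenius. -/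
def iter (D : Isoc.{w} σ) (k : ℕ) : D.V →+ D.V :=
  (show AddMonoid.End D.V from D.φ.toAddMonoidHom) ^ k

variable (D : Isoc.{w} σ)

@[simp] lemma iter_zero (x : D.V) : D.iter 0 x = x := rfl

lemma iter_succ (k : ℕ) (x : D.V) : D.iter (k + 1) x = D.φ (D.iter k x) := by
  rw [iter, pow_succ']
  rfl

lemma iter_succ' (k : ℕ) (x : D.V) : D.iter (k + 1) x = D.iter k (D.φ x) := by
  rw [iter, pow_succ]
  rfl

lemma map_iter {D E : Isoc.{w} σ} (f : D ⟶ E) (k : ℕ) (x : D.V) :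
    f.lin (D.iter k x) = E.iter k (f.lin x) := by
  induction k with
  | zero => rfl
  | succ k ih => rw [iter_succ, iter_succ, ← ih, f.comm]

/-- The `k`-th iterate of `φ` is semilinear for the `k`-th iterate of `σ`. -/
lemma iter_smul (k : ℕ) (c : L) (x : D.V) : D.iter k (c • x) = (σ ^ k) c • D.iter k x := by
  induction k with
  | zero => rfl
  | succ k ih =>
    rw [iter_succ, ih, LinearMap.map_smulₛₗ, iter_succ, pow_succ']
    rfl

/-- A subspace stable under `φ` is a subisocrystal. -/
lemma isSub_of_le {W : Submodule L D.V} (h : ∀ x ∈ W, D.φ x ∈ W) : D.IsSub W := by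
  have := RingHomInvPair.of_ringEquiv σ
  have := RingHomInvPair.symm (σ : L →+* L) (σ.symm : L →+* L)
  let e : D.V ≃ₛₗ[(σ : L →+* L)] D.V := LinearEquiv.ofBijective D.φ D.bij
  have h1 : W.map e.toLinearMap ≤ W := by
    rintro _ ⟨x, hx, rfl⟩
    exact h x hx
  have h2 : Module.finrank L (W.map e.toLinearMap) = Module.finrank L W :=
    (congrArg Cardinal.toNat (rank_eq_of_equiv_equiv σ (e.submoduleMap W).toAddEquiv σ.bijective
      fun c x => (e.submoduleMap W).map_smulₛₗ c x)).symm
  have h3 := Submodule.eq_of_le_of_finrank_eq h1 h2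
  intro x
  refine ⟨fun hx => ?_, h x⟩
  rw [← h3] at hx
  obtain ⟨y, hy, hyx⟩ := hx
  exact D.bij.1 hyx ▸ hy

end Iterates

section Hull

variable {L : Type*} [NormedField L] [IsUltrametricDist L] {σ : L ≃+* L} (D : Isoc.{w} σ)
  {ι : Type*} [Fintype ι] (b : Module.Basis ι L D.V)

/-- The sums `∑ φ ^ k (z k)` over `k < n`, where `z k` has coordinates bounded by `M r ^ k`. -/
def hull (r : ℝ) (n : ℕ) (M : ℝ) : Set D.V :=
  {x | ∃ z : ℕ → D.V, (∀ k, ‖b.equivFun (z k)‖ ≤ M * r ^ k) ∧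
    x = ∑ k ∈ Finset.range n, D.iter k (z k)}

variable {D b} {r : ℝ} (hr : 0 < r) {n : ℕ} {M : ℝ}

include hr

lemma hull_mono {n' : ℕ} {M' : ℝ} (hM : 0 ≤ M) (hn : n ≤ n') (h : M ≤ M') :
    D.hull b r n M ⊆ D.hull b r n' M' := by
  rintro x ⟨z, hz, rfl⟩
  have hr' : ∀ k, 0 < r ^ k := fun k => pow_pos hr k
  refine ⟨fun k => if k < n then z k else 0, fun k => ?_, ?_⟩
  · dsimp only
    split_ifs
    · exact (hz k).trans (mul_le_mul_of_nonneg_right h (hr' k).le)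
    · rw [map_zero, norm_zero]
      exact mul_nonneg (hM.trans h) (hr' k).le
  · rw [← Finset.sum_subset (Finset.range_mono hn)]
    · refine Finset.sum_congr rfl fun k hk => ?_
      dsimp only
      rw [if_pos (Finset.mem_range.1 hk)]
    · intro k _ hk
      dsimp only
      rw [if_neg (fun h => hk (Finset.mem_range.2 h)), map_zero]

omit hr in
lemma add_mem_hull {x y : D.V} (hx : x ∈ D.hull b r n M) (hy : y ∈ D.hull b r n M) :
    x + y ∈ D.hull b r n M := by
  obtain ⟨z, hz, rfl⟩ := hx
  obtain ⟨z', hz', rfl⟩ := hy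
  refine ⟨z + z', fun k => ?_, ?_⟩
  · rw [Pi.add_apply, map_add]
    exact (IsUltrametricDist.norm_add_le_max _ _).trans (max_le (hz k) (hz' k))
  · rw [← Finset.sum_add_distrib]
    exact Finset.sum_congr rfl fun k _ => by rw [Pi.add_apply, map_add]

omit hr in
lemma norm_pow_apply (hσ : ∀ x, ‖σ x‖ = ‖x‖) (k : ℕ) (c : L) : ‖(σ ^ k) c‖ = ‖c‖ := by
  induction k with
  | zero => rfl
  | succ k ih =>
    rw [pow_succ', ← ih]
    exact hσ _

omit hr in
lemma smul_mem_hull (hσ : ∀ x, ‖σ x‖ = ‖x‖) (c : L) {x : D.V} (hx : x ∈ D.hull b r n M) :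
    c • x ∈ D.hull b r n (‖c‖ * M) := by
  obtain ⟨z, hz, rfl⟩ := hx
  have h1 : ∀ k : ℕ, ∃ c' : L, (σ ^ k) c' = c := fun k => (σ ^ k).surjective c
  choose c' hc' using h1
  refine ⟨fun k => c' k • z k, fun k => ?_, ?_⟩
  · have h2 : ‖c' k‖ = ‖c‖ := by rw [← norm_pow_apply hσ k, hc']
    rw [map_smul, norm_smul, h2, mul_assoc]
    exact mul_le_mul_of_nonneg_left (hz k) (norm_nonneg _)
  · rw [Finset.smul_sum]
    exact Finset.sum_congr rfl fun k _ => by rw [iter_smul, hc']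

lemma phi_mem_hull (hM : 0 ≤ M) {x : D.V} (hx : x ∈ D.hull b r n M) :
    D.φ x ∈ D.hull b r (n + 1) (M / r) := by
  obtain ⟨z, hz, rfl⟩ := hx
  refine ⟨fun k => if k = 0 then 0 else z (k - 1), fun k => ?_, ?_⟩
  · rcases k with _ | k
    · dsimp only
      rw [if_pos rfl, map_zero, norm_zero]
      positivity
    · dsimp only
      rw [if_neg k.succ_ne_zero, Nat.add_sub_cancel, pow_succ', ← mul_assoc,
        div_mul_cancel₀ _ hr.ne']
      exact hz k
  · rw [Finset.sum_range_succ', map_sum]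
    simp only [if_true, map_zero, add_zero, Nat.add_one_ne_zero, if_false, Nat.add_sub_cancel]
    exact Finset.sum_congr rfl fun k _ => (D.iter_succ k _).symm

lemma mem_hull_one {x : D.V} (hx : ‖b.equivFun x‖ ≤ M) : x ∈ D.hull b r 1 M := by
  refine ⟨fun k => if k = 0 then x else 0, fun k => ?_, by simp⟩
  have hM : 0 ≤ M := (norm_nonneg _).trans hx
  dsimp only
  split_ifs with h
  · rw [h, pow_zero, mul_one]
    exact hx
  · rw [map_zero, norm_zero]
    positivity

lemma exists_of_mem_hull_succ {x : D.V} (hx : x ∈ D.hull b r (n + 1) M) :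
    ∃ z, ‖b.equivFun z‖ ≤ M ∧ ∃ y ∈ D.hull b r n (M * r), x = z + D.φ y := by
  obtain ⟨z, hz, rfl⟩ := hx
  refine ⟨z 0, by simpa using hz 0, _, ⟨fun k => z (k + 1), fun k => ?_, rfl⟩, ?_⟩
  · rw [mul_assoc, ← pow_succ']
    exact hz (k + 1)
  · rw [Finset.sum_range_succ', add_comm, map_sum]
    congr 1
    exact Finset.sum_congr rfl fun k _ => D.iter_succ k _

omit hr in
lemma exists_bound_iter (hσ : ∀ x, ‖σ x‖ = ‖x‖) (b : Module.Basis ι L D.V) :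
    ∃ C : ℝ, 0 ≤ C ∧ ∀ k x, ‖b.equivFun (D.iter k x)‖ ≤ C ^ k * ‖b.equivFun x‖ := by
  obtain ⟨C, hC, h⟩ := exists_bound_of_semilinear b b hσ D.φ
  refine ⟨C, hC, fun k x => ?_⟩
  induction k with
  | zero => simp
  | succ k ih =>
    rw [iter_succ, pow_succ', mul_assoc]
    exact (h _).trans (mul_le_mul_of_nonneg_left ih hC)

/-- For a bounded number of iterates, the hulls of balls are uniformly bounded. -/
lemma exists_bound_hull (hσ : ∀ x, ‖σ x‖ = ‖x‖) (n : ℕ) :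
    ∃ C : ℝ, 0 ≤ C ∧ ∀ M, ∀ x ∈ D.hull b r n M, ‖b.equivFun x‖ ≤ C * M := by
  obtain ⟨C, hC, h⟩ := exists_bound_iter hσ b
  refine ⟨∑ k ∈ Finset.range n, C ^ k * r ^ k, Finset.sum_nonneg fun k _ => by positivity, ?_⟩
  rintro M x ⟨z, hz, rfl⟩
  rw [map_sum, Finset.sum_mul]
  refine (norm_sum_le _ _).trans (Finset.sum_le_sum fun k _ => (h _ _).trans ?_)
  rw [mul_assoc, mul_comm (r ^ k)]
  exact mul_le_mul_of_nonneg_left (hz k) (pow_nonneg hC k)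

omit hr in
/-- The iterates of the Frobenius multiply volumes by the powers of its determinant. -/
lemma norm_det_iter [DecidableEq ι] (hσ : ∀ x, ‖σ x‖ = ‖x‖) (k : ℕ) (x : ι → D.V) :
    ‖b.det fun i => D.iter k (x i)‖ = ‖(D.phiMatrix b).det‖ ^ k * ‖b.det x‖ := by
  have h1 : ∀ x : ι → D.V, ‖b.det fun i => D.φ (x i)‖ = ‖(D.phiMatrix b).det‖ * ‖b.det x‖ := by
    intro x
    have h2 : b.toMatrix (fun i => D.φ (x i)) = D.phiMatrix b * (b.toMatrix x).map σ := by
      ext i j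
      rw [Module.Basis.toMatrix_apply, D.repr_phi b b, Matrix.mul_apply]
      rfl
    have h3 : ((b.toMatrix x).map σ).det = σ (b.toMatrix x).det :=
      (RingHom.map_det (σ : L →+* L) _).symm
    rw [Module.Basis.det_apply, h2, Matrix.det_mul, h3, norm_mul, hσ, Module.Basis.det_apply]
  induction k with
  | zero => simp
  | succ k ih =>
    simp only [iter_succ]
    rw [h1, ih, pow_succ', mul_assoc]

/-- If the hulls of arbitrarily small balls contain a basis, then the inverses of the iterates of
`φ` grow at most like the powers of `r`, which bounds the determinant of `φ` from below. -/
lemma one_le_of_mem_hull [DecidableEq ι] (hσ : ∀ x, ‖σ x‖ = ‖x‖) (n : ℕ)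
    (hb : ∀ i, b i ∈ D.hull b r n (1 / 2)) :
    1 ≤ ‖(D.phiMatrix b).det‖ * r ^ Fintype.card ι := by
  have hb' : ∀ i, b i ∈ D.hull b r (n + 1) (1 / 2) := fun i =>
    hull_mono hr (by norm_num) n.le_succ le_rfl (hb i)
  have h0 : ∀ (M : ℝ) x, ‖b.equivFun x‖ ≤ M → x ∈ D.hull b r (n + 1) (M / 2) := by
    intro M x hx
    have hM : 0 ≤ M := (norm_nonneg _).trans hx
    rw [← b.sum_equivFun x]
    refine Finset.sum_induction _ (· ∈ D.hull b r (n + 1) (M / 2)) (fun _ _ => add_mem_hull) ?_ ?_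
    · exact ⟨0, fun k => by simpa using by positivity, by simp⟩
    · intro i _
      have h1 := (norm_le_pi_norm (b.equivFun x) i).trans hx
      refine hull_mono hr (by positivity) le_rfl ?_ (smul_mem_hull hσ (b.equivFun x i) (hb' i))
      linarith
  -- up to an error term which can be made arbitrarily small, `x` is the image under `φ` of an
  -- element of the hull of a ball which is larger by the factor `r`
  have h1 : ∀ (j : ℕ) (M : ℝ) x, ‖b.equivFun x‖ ≤ M → ∃ x', ‖b.equivFun x'‖ ≤ M / 2 ^ j ∧
      ∃ y ∈ D.hull b r (n + 1) (M * r), x = x' + D.φ y := by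
    intro j M x hx
    have hM : 0 ≤ M := (norm_nonneg _).trans hx
    induction j with
    | zero =>
      refine ⟨x, by simpa using hx, 0, ⟨0, fun k => ?_, by simp⟩, by simp⟩
      rw [Pi.zero_apply, map_zero, norm_zero]
      positivity
    | succ j ih =>
      obtain ⟨x', hx', y, hy, rfl⟩ := ih
      obtain ⟨z, hz, y', hy', rfl⟩ := exists_of_mem_hull_succ hr (h0 _ _ hx')
      refine ⟨z, by rwa [pow_succ, ← div_div], y' + y, add_mem_hull ?_ hy, ?_⟩
      · refine hull_mono hr (by positivity) n.le_succ ?_ hy'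
        refine mul_le_mul_of_nonneg_right ?_ hr.le
        rw [div_div, ← pow_succ]
        exact div_le_self hM (one_le_pow₀ one_le_two)
      · rw [map_add]
        abel
  have := RingHomInvPair.of_ringEquiv σ
  have := RingHomInvPair.symm (σ : L →+* L) (σ.symm : L →+* L)
  let e : D.V ≃ₛₗ[(σ : L →+* L)] D.V := LinearEquiv.ofBijective D.φ D.bij
  obtain ⟨C', hC', hinv⟩ := exists_bound_of_semilinear b b (τ := (σ.symm : L →+* L))
    (fun x => by
      have := hσ (σ.symm x)
      rw [σ.apply_symm_apply] at this
      exact this.symm) e.symm.toLinearMap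
  -- a sufficiently small error term is itself the image of a small element, since `φ⁻¹` is bounded
  have h2 : ∀ (M : ℝ) x, ‖b.equivFun x‖ ≤ M → ∃ y ∈ D.hull b r (n + 1) (M * r), x = D.φ y := by
    intro M x hx
    have hM : 0 ≤ M := (norm_nonneg _).trans hx
    obtain ⟨j, hj⟩ := pow_unbounded_of_one_lt (C' / r) (one_lt_two (α := ℝ))
    obtain ⟨x', hx', y, hy, rfl⟩ := h1 j M x hx
    refine ⟨e.symm x' + y, add_mem_hull ?_ hy, ?_⟩
    · have h3 : ‖b.equivFun (e.symm x')‖ ≤ M * r := by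
        refine (hinv x').trans ((mul_le_mul_of_nonneg_left hx' hC').trans ?_)
        rw [div_lt_iff₀ hr] at hj
        rw [mul_div_assoc', div_le_iff₀ (by positivity)]
        nlinarith
      exact hull_mono hr (by positivity) (Nat.le_add_left 1 n) le_rfl (mem_hull_one hr h3)
    · rw [map_add]
      congr 1
      exact (e.apply_symm_apply x').symm
  have h3 : ∀ (M : ℝ), 0 ≤ M → ∀ x ∈ D.hull b r (n + 1) M,
      ∃ y ∈ D.hull b r (n + 1) (M * r), x = D.φ y := by
    intro M hM x hx
    obtain ⟨z, hz, y, hy, rfl⟩ := exists_of_mem_hull_succ hr hx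
    obtain ⟨y', hy', rfl⟩ := h2 M z hz
    exact ⟨y' + y, add_mem_hull hy' (hull_mono hr (by positivity) n.le_succ le_rfl hy),
      (map_add _ _ _).symm⟩
  have h4 : ∀ (k : ℕ) (M : ℝ), 0 ≤ M → ∀ x ∈ D.hull b r (n + 1) M,
      ∃ y ∈ D.hull b r (n + 1) (M * r ^ k), x = D.iter k y := by
    intro k M hM x hx
    induction k with
    | zero => exact ⟨x, by simpa using hx, rfl⟩
    | succ k ih =>
      obtain ⟨y, hy, rfl⟩ := ih
      obtain ⟨y', hy', rfl⟩ := h3 _ (by positivity) y hy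
      exact ⟨y', by rwa [pow_succ, ← mul_assoc], (D.iter_succ' k y').symm⟩
  obtain ⟨C, hC, hbound⟩ := exists_bound_hull (D := D) (b := b) hr hσ (n + 1)
  by_contra! hlt
  set q := ‖(D.phiMatrix b).det‖ * r ^ Fintype.card ι with hq
  have hq0 : 0 ≤ q := by positivity
  -- comparison of volumes: the basis `b` is the image under `φ ^ k` of vectors bounded by `r ^ k`
  have h5 : ∀ k : ℕ, 1 ≤ q ^ k * (C * (1 / 2)) ^ Fintype.card ι := by
    intro k
    choose y hy hby using fun i => h4 k _ (by norm_num) (b i) (hb' i)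
    have h6 : ‖b.det b‖ = ‖(D.phiMatrix b).det‖ ^ k * ‖b.det y‖ := by
      rw [← norm_det_iter hσ k y]
      congr 2
      exact funext hby
    rw [Module.Basis.det_self, norm_one] at h6
    have h7 : ‖b.det y‖ ≤ (C * (1 / 2 * r ^ k)) ^ Fintype.card ι := by
      rw [Module.Basis.det_apply]
      exact norm_det_le _ (by positivity) fun i j =>
        (norm_le_pi_norm (b.equivFun (y j)) i).trans (hbound _ _ (hy j))
    refine h6.le.trans ((mul_le_mul_of_nonneg_left h7 (by positivity)).trans (le_of_eq ?_))
    have h8 : (r ^ Fintype.card ι) ^ k = (r ^ k) ^ Fintype.card ι := by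
      rw [← pow_mul, ← pow_mul, mul_comm]
    rw [hq, mul_pow ‖_‖, h8, ← mul_assoc C, mul_pow (C * (1 / 2))]
    ring
  obtain ⟨k, hk⟩ := exists_pow_lt_of_lt_one
    (y := q) (x := 1 / ((C * (1 / 2)) ^ Fintype.card ι + 1)) (by positivity) hlt
  have h6 := h5 k
  have h7 : 0 ≤ (C * (1 / 2)) ^ Fintype.card ι := by positivity
  rw [lt_div_iff₀ (by positivity)] at hk
  nlinarith [pow_nonneg hq0 k]

end Hull

end Isoc

/-! ### Growth of the Frobenius and bounds for the slopes -/

namespace Isoc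

section Growth

variable {L : Type*} [NormedField L] {σ : L ≃+* L}

/-- The logarithm of the absolute value of the determinant of the Frobenius. -/
def logDet (D : Isoc.{w} σ) : ℝ := Real.log ‖(D.phiMatrix (Module.finBasis L D.V)).det‖

lemma logDet_eq (hσ : ∀ x, ‖σ x‖ = ‖x‖) (D : Isoc.{w} σ) {ι : Type*} [Fintype ι] [DecidableEq ι]
    (v : Module.Basis ι L D.V) : D.logDet = Real.log ‖(D.phiMatrix v).det‖ := by
  let q : ι ≃ Fin (Module.finrank L D.V) := v.indexEquiv (Module.finBasis L D.V)
  have h : (D.phiMatrix (v.reindex q)).det = (D.phiMatrix v).det := by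
    rw [← Matrix.det_submatrix_equiv_self q.symm (D.phiMatrix v)]
    congr 1
    ext i j
    simp [phiMatrix]
  rw [← h, logDet, D.norm_det_phiMatrix_eq hσ _ (v.reindex q)]

/-- `logDet` of every nonzero isocrystal mapping injectively to `D` is less than `c` times its
rank. -/
def SlopesLT (D : Isoc.{w} σ) (c : ℝ) : Prop :=
  ∀ (E : Isoc.{w} σ) (f : E ⟶ D), Function.Injective f.lin → 0 < E.rank → E.logDet < c * E.rank

lemma SlopesLT.of_injective {D E : Isoc.{w} σ} {c : ℝ} (h : D.SlopesLT c) (f : E ⟶ D)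
    (hf : Function.Injective f.lin) : E.SlopesLT c := fun G g hg hG => by
  refine h G (g ≫ f) ?_ hG
  exact hf.comp hg

variable [IsUltrametricDist L]

/-- If the iterates of `φ` on a subisocrystal and their images in a complement are bounded by the
powers of `exp c`, then so are the iterates; the error terms do not accumulate, since the norm is
ultrametric. -/
lemma exists_bound_of_extension (hσ : ∀ x, ‖σ x‖ = ‖x‖) {D E : Isoc.{w} σ} (f : E ⟶ D)
    (π : D.V →ₗ[L] E.V) (hπf : ∀ y, π (f.lin y) = y) {Q : Type*} [AddCommGroup Q] [Module L Q]
    (q : D.V →ₗ[L] Q) (s : Q →ₗ[L] D.V) (hπ : ∀ x, f.lin (π x) + s (q x) = x) {ι ι' κ : Type*}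
    [Fintype ι] [Fintype ι'] [Fintype κ] (bS : Module.Basis ι' L E.V) (b : Module.Basis ι L D.V)
    (bQ : Module.Basis κ L Q) {c C₁ C₂ : ℝ} (hC₁ : 0 ≤ C₁)
    (h₁ : ∀ k x, ‖bS.equivFun (E.iter k x)‖ ≤ C₁ * Real.exp c ^ k * ‖bS.equivFun x‖) (hC₂ : 0 ≤ C₂)
    (h₂' : ∀ k x, ‖bQ.equivFun (q (D.iter k x))‖ ≤ C₂ * Real.exp c ^ k * ‖b.equivFun x‖) :
    ∃ C : ℝ, 0 ≤ C ∧ ∀ k x, ‖b.equivFun (D.iter k x)‖ ≤ C * Real.exp c ^ k * ‖b.equivFun x‖ := by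
  have hid : ∀ x : L, ‖RingHom.id L x‖ = ‖x‖ := fun _ => rfl
  obtain ⟨C₃, hC₃, h₃⟩ := exists_bound_of_semilinear bQ bS hσ (π.comp (D.φ.comp s))
  obtain ⟨C₄, hC₄, h₄⟩ := exists_bound_of_semilinear b bS hid π
  obtain ⟨C₅, hC₅, h₅⟩ := exists_bound_of_semilinear bS b hid f.lin
  obtain ⟨C₆, hC₆, h₆⟩ := exists_bound_of_semilinear bQ b hid s
  have hstep : ∀ k x, π (D.iter (k + 1) x) =
      E.φ (π (D.iter k x)) + π (D.φ (s (q (D.iter k x)))) := by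
    intro k x
    rw [iter_succ]
    conv_lhs => rw [← hπ (D.iter k x), map_add, map_add]
    congr 1
    rw [← f.comm, hπf]
  have hsum : ∀ k x, π (D.iter k x) = E.iter k (π x) +
      ∑ j ∈ Finset.range k, E.iter (k - 1 - j) (π (D.φ (s (q (D.iter j x))))) := by
    intro k x
    induction k with
    | zero => simp
    | succ k ihk =>
      rw [hstep, ihk, map_add, map_sum, Finset.sum_range_succ, ← iter_succ, add_assoc]
      congr 2
      · refine Finset.sum_congr rfl fun j hj => ?_
        rw [← iter_succ]
        congr 2
        have := Finset.mem_range.1 hj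
        omega
      · rw [Nat.add_sub_cancel, Nat.sub_self]
        rfl
  have hπb : ∀ k x, ‖bS.equivFun (π (D.iter k x))‖ ≤
      (C₁ * C₄ + C₁ * C₃ * C₂ * Real.exp (-c)) * Real.exp c ^ k * ‖b.equivFun x‖ := by
    intro k x
    have hA : ‖bS.equivFun (E.iter k (π x))‖ ≤ C₁ * C₄ * Real.exp c ^ k * ‖b.equivFun x‖ := by
      refine (h₁ k (π x)).trans ?_
      have h6 := mul_le_mul_of_nonneg_left (h₄ x) (mul_nonneg hC₁ (pow_nonneg (Real.exp_pos c).le k))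
      refine h6.trans (le_of_eq ?_)
      ring
    have hB : ∀ j ∈ Finset.range k,
        ‖bS.equivFun (E.iter (k - 1 - j) (π (D.φ (s (q (D.iter j x))))))‖ ≤
        C₁ * C₃ * C₂ * Real.exp (-c) * Real.exp c ^ k * ‖b.equivFun x‖ := by
      intro j hj
      have hjk : k = (k - 1 - j) + j + 1 := by
        have := Finset.mem_range.1 hj
        omega
      have hrk : Real.exp (-c) * Real.exp c ^ k = Real.exp c ^ (k - 1 - j) * Real.exp c ^ j := by
        conv_lhs => rw [hjk]
        rw [pow_succ, pow_add, mul_comm, mul_assoc, ← Real.exp_add, add_neg_cancel, Real.exp_zero, mul_one]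
      refine (h₁ (k - 1 - j) _).trans ?_
      have h6 : ‖bS.equivFun (π (D.φ (s (q (D.iter j x)))))‖ ≤
          C₃ * (C₂ * Real.exp c ^ j * ‖b.equivFun x‖) :=
        (h₃ _).trans (mul_le_mul_of_nonneg_left (h₂' j x) hC₃)
      refine (mul_le_mul_of_nonneg_left h6
        (mul_nonneg hC₁ (pow_nonneg (Real.exp_pos c).le _))).trans (le_of_eq ?_)
      rw [mul_assoc (C₁ * C₃ * C₂), hrk]
      ring
    have hB0 : 0 ≤ C₁ * C₃ * C₂ * Real.exp (-c) * Real.exp c ^ k * ‖b.equivFun x‖ := by positivity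
    have hA0 : 0 ≤ C₁ * C₄ * Real.exp c ^ k * ‖b.equivFun x‖ := by positivity
    rw [hsum, map_add, map_sum]
    refine (IsUltrametricDist.norm_add_le_max _ _).trans (max_le (hA.trans ?_)
      ((IsUltrametricDist.norm_sum_le_of_forall_le_of_nonneg hB0 hB).trans ?_)) <;> linarith
  refine ⟨C₅ * (C₁ * C₄ + C₁ * C₃ * C₂ * Real.exp (-c)) + C₆ * C₂, by positivity, fun k x => ?_⟩
  rw [← hπ (D.iter k x), map_add]
  have h6 := (h₅ (π (D.iter k x))).trans (mul_le_mul_of_nonneg_left (hπb k x) hC₅)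
  have h7 := (h₆ (q (D.iter k x))).trans (mul_le_mul_of_nonneg_left (h₂' k x) hC₆)
  refine (norm_add_le _ _).trans ((add_le_add h6 h7).trans (le_of_eq ?_))
  ring

variable [CompleteSpace L]

/-- The iterates of `φ` grow at most like the powers of `exp c`, if all slopes are less
than `c`. -/
theorem SlopesLT.exists_bound (hσ : ∀ x, ‖σ x‖ = ‖x‖) (hL : ∃ w : L, 1 < ‖w‖) {c : ℝ} :
    ∀ (D : Isoc.{w} σ) (_ : D.SlopesLT c) {ι : Type} [Fintype ι] (b : Module.Basis ι L D.V),
      ∃ C : ℝ, 0 ≤ C ∧ ∀ k x, ‖b.equivFun (D.iter k x)‖ ≤ C * Real.exp c ^ k * ‖b.equivFun x‖ := by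
  suffices H : ∀ (n : ℕ) (D : Isoc.{w} σ), D.rank ≤ n → D.SlopesLT c → ∀ {ι : Type} [Fintype ι]
      (b : Module.Basis ι L D.V), ∃ C : ℝ, 0 ≤ C ∧ ∀ k x,
        ‖b.equivFun (D.iter k x)‖ ≤ C * Real.exp c ^ k * ‖b.equivFun x‖ from
    fun D h ι _ b => H D.rank D le_rfl h b
  intro n
  induction n with
  | zero =>
    intro D hD _ ι _ b
    have h1 : Subsingleton D.V := Module.finrank_zero_iff.1 (Nat.le_zero.1 hD)
    refine ⟨0, le_rfl, fun k x => ?_⟩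
    rw [h1.elim (D.iter k x) 0, map_zero, norm_zero, zero_mul, zero_mul]
  | succ n ih =>
    intro D hD hsl ι _ b
    classical
    set r := Real.exp (-c) with hrdef
    have hr : 0 < r := Real.exp_pos _
    have hrc : r⁻¹ = Real.exp c := by rw [hrdef, Real.exp_neg, inv_inv]
    -- the subspace on which the hulls of small balls accumulate
    let S : Submodule L D.V :=
      { carrier := {x | ∀ M > 0, ∃ n, x ∈ D.hull b r n M}
        zero_mem' := fun M hM => ⟨0, 0, fun k => by
          rw [Pi.zero_apply, map_zero, norm_zero]; positivity, by simp⟩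
        add_mem' := fun {x y} hx hy M hM => by
          obtain ⟨n₁, h₁⟩ := hx M hM
          obtain ⟨n₂, h₂⟩ := hy M hM
          exact ⟨max n₁ n₂, add_mem_hull (hull_mono hr hM.le (le_max_left _ _) le_rfl h₁)
            (hull_mono hr hM.le (le_max_right _ _) le_rfl h₂)⟩
        smul_mem' := fun a x hx M hM => by
          obtain ⟨n, hn⟩ := hx (M / (‖a‖ + 1)) (by positivity)
          refine ⟨n, hull_mono hr (by positivity) le_rfl ?_ (smul_mem_hull hσ a hn)⟩
          rw [mul_div_assoc', div_le_iff₀ (by positivity)]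
          nlinarith [norm_nonneg a] }
    have hS : D.IsSub S := D.isSub_of_le fun x hx M hM => by
      obtain ⟨n, hn⟩ := hx (M * r) (by positivity)
      have h1 := phi_mem_hull hr (by positivity) hn
      rw [mul_div_cancel_right₀ _ hr.ne'] at h1
      exact ⟨n + 1, h1⟩
    by_cases hn : Nontrivial D.V
    swap
    · have h1 : Subsingleton D.V := not_nontrivial_iff_subsingleton.1 hn
      refine ⟨0, le_rfl, fun k x => ?_⟩
      rw [h1.elim (D.iter k x) 0, map_zero, norm_zero, zero_mul, zero_mul]
    have hpos : 0 < D.rank := Module.finrank_pos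
    -- otherwise the slope of `D` itself would be at least `c`
    have hne : S ≠ ⊤ := by
      intro htop
      have h1 : ∀ i, ∃ n, b i ∈ D.hull b r n (1 / 2) := fun i => by
        have h2 : b i ∈ S := by rw [htop]; trivial
        exact h2 _ (by norm_num)
      choose m hm using h1
      have h2 := one_le_of_mem_hull hr hσ (Finset.univ.sup m) fun i =>
        hull_mono hr (by norm_num) (Finset.le_sup (Finset.mem_univ i)) le_rfl (hm i)
      have h3 := hsl D (𝟙 D) (fun _ _ h => h) hpos
      rw [logDet_eq hσ D b] at h3
      have h4 : 0 < ‖(D.phiMatrix b).det‖ := norm_pos_iff.2 (D.det_phiMatrix_ne_zero b)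
      have h5 := Real.log_nonneg h2
      rw [Real.log_mul h4.ne' (pow_pos hr _).ne', Real.log_pow, hrdef, Real.log_exp,
        ← Module.finrank_eq_card_basis b] at h5
      change _ < c * (Module.finrank L D.V : ℝ) at h3
      linarith
    let E := D.sub S hS
    have hErank : E.rank ≤ n := by
      have h1 : Module.finrank L S < Module.finrank L D.V := Submodule.finrank_lt hne
      exact Nat.lt_succ_iff.1 (h1.trans_le hD)
    let bS := Module.finBasis L S
    obtain ⟨C₁, hC₁, h₁⟩ := ih E hErank (hsl.of_injective (subtypeHom hS) Subtype.val_injective) bS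
    -- the quotient by `S` is separated by the hulls
    let bQ := Module.finBasis L (D.V ⧸ S)
    have hfam : ∃ C : ℝ, 0 ≤ C ∧ ∀ M > 0,
        ∀ q ∈ {q | 0 ≤ M ∧ ∃ n, ∃ x ∈ D.hull b r n M, S.mkQ x = q}, ‖bQ.equivFun q‖ ≤ C * M := by
      refine exists_bound_of_family hL bQ
        (fun M => {q | 0 ≤ M ∧ ∃ n, ∃ x ∈ D.hull b r n M, S.mkQ x = q}) ?_ ?_ ?_ ?_ ?_
      · rintro M M' hMM' q ⟨hM, n, x, hx, rfl⟩
        exact ⟨hM.trans hMM', n, x, hull_mono hr hM le_rfl hMM' hx, rfl⟩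
      · rintro M _ _ ⟨hM, n₁, x, hx, rfl⟩ ⟨-, n₂, y, hy, rfl⟩
        exact ⟨hM, max n₁ n₂, x + y, add_mem_hull (hull_mono hr hM (le_max_left _ _) le_rfl hx)
          (hull_mono hr hM (le_max_right _ _) le_rfl hy), map_add _ _ _⟩
      · rintro a M _ ⟨hM, n, x, hx, rfl⟩
        exact ⟨by positivity, n, a • x, smul_mem_hull hσ a hx, map_smul _ _ _⟩
      · intro q
        obtain ⟨x, rfl⟩ := S.mkQ_surjective q
        refine ⟨‖b.equivFun x‖ + 1, by positivity, by positivity, 1, x, mem_hull_one hr ?_, rfl⟩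
        linarith
      · intro q hq
        obtain ⟨x, rfl⟩ := S.mkQ_surjective q
        rw [Submodule.mkQ_apply, Submodule.Quotient.mk_eq_zero]
        intro M hM
        obtain ⟨-, n₁, y, hy, hyx⟩ := hq M hM
        have h3 : x - y ∈ S := (Submodule.Quotient.eq S).1 hyx.symm
        obtain ⟨n₂, h4⟩ := h3 M hM
        refine ⟨max n₁ n₂, ?_⟩
        rw [← add_sub_cancel y x]
        exact add_mem_hull (hull_mono hr hM.le (le_max_left _ _) le_rfl hy)
          (hull_mono hr hM.le (le_max_right _ _) le_rfl h4)
    obtain ⟨C₂, hC₂, h₂⟩ := hfam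
    have h₂' : ∀ k x, ‖bQ.equivFun (S.mkQ (D.iter k x))‖ ≤
        C₂ * Real.exp c ^ k * ‖b.equivFun x‖ := by
      intro k x
      rcases (norm_nonneg (b.equivFun x)).eq_or_lt with h0 | h0
      · have : x = 0 := b.equivFun.map_eq_zero_iff.1 (norm_eq_zero.1 h0.symm)
        simp [this]
      · have h3 := h₂ (Real.exp c ^ k * ‖b.equivFun x‖) (by positivity) (S.mkQ (D.iter k x))
          ⟨by positivity, k + 1, D.iter k x, ⟨fun j => if j = k then x else 0, fun j => ?_, ?_⟩, rfl⟩
        · rwa [← mul_assoc] at h3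
        · dsimp only
          split_ifs with hj
          · have h4 : Real.exp c ^ k * r ^ k = 1 := by
              rw [← hrc, ← mul_pow, inv_mul_cancel₀ hr.ne', one_pow]
            rw [hj, mul_right_comm, h4, one_mul]
          · rw [map_zero, norm_zero]
            positivity
        · rw [Finset.sum_eq_single k]
          · dsimp only
            rw [if_pos rfl]
          · intro j _ hj
            dsimp only
            rw [if_neg hj, map_zero]
          · simp
    -- the splitting need not respect `φ`
    obtain ⟨s, hs⟩ := S.mkQ.exists_rightInverse_of_surjective S.range_mkQ
    have hs' : ∀ q, S.mkQ (s q) = q := fun q => LinearMap.congr_fun hs q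
    let π : D.V →ₗ[L] S := (LinearMap.id - s ∘ₗ S.mkQ).codRestrict S fun x => by
      refine (Submodule.Quotient.mk_eq_zero S).1 ?_
      change S.mkQ _ = 0
      simp only [LinearMap.sub_apply, LinearMap.id_apply, LinearMap.comp_apply, map_sub, hs',
        sub_self]
    exact exists_bound_of_extension hσ (subtypeHom hS) π
      (fun y => Subtype.ext (by
        change y.1 - s (S.mkQ y.1) = y.1
        rw [(S.mkQ_apply y.1).trans ((Submodule.Quotient.mk_eq_zero S).2 y.2), map_zero, sub_zero]))
      S.mkQ s (fun x => by
        change x - s (S.mkQ x) + s (S.mkQ x) = x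
        abel) bS b bQ hC₁ h₁ hC₂ h₂'

end Growth

end Isoc

/-! ### Bases with controlled growth under the Frobenius -/

namespace Isoc

section NewtonBasis

variable {L : Type*} [NormedField L] {σ : L ≃+* L}

/-- `logDet` is additive on short exact sequences. -/
lemma logDet_add_of_exact (hσ : ∀ x, ‖σ x‖ = ‖x‖) {D' D D'' : Isoc.{w} σ} (f : D' ⟶ D) (g : D ⟶ D'')
    (hf : Function.Injective f.lin) (hfg : Function.Exact f.lin g.lin)
    (hg : Function.Surjective g.lin) : D.logDet = D'.logDet + D''.logDet := by
  classical
  let v' := Module.finBasis L D'.V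
  let v'' := Module.finBasis L D''.V
  obtain ⟨v, hv1, hv2, hv3, hv4⟩ := exists_basis_of_exact hf hfg v' v''
    (fun j => Function.surjInv hg (v'' j)) (fun j => Function.surjInv_eq hg _)
  have hP : D.phiMatrix v = Matrix.fromBlocks (D'.phiMatrix v')
        (Matrix.of fun i j => v.repr (D.φ (v (Sum.inr j))) (Sum.inl i)) 0 (D''.phiMatrix v'') := by
    ext i j
    rcases i with i | i <;> rcases j with j | j
    · rw [Matrix.fromBlocks_apply₁₁, phiMatrix, Matrix.of_apply, hv1, ← f.comm, hv3]
      rfl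
    · rfl
    · rw [Matrix.fromBlocks_apply₂₁, phiMatrix, Matrix.of_apply, hv1, ← f.comm, hv4,
        (hfg _).2 ⟨_, rfl⟩]
      simp
    · rw [Matrix.fromBlocks_apply₂₂, phiMatrix, Matrix.of_apply, hv4, g.comm, hv2,
        Function.surjInv_eq hg]
      rfl
  rw [logDet_eq hσ D v, hP, Matrix.det_fromBlocks_zero₂₁, norm_mul,
    Real.log_mul (norm_ne_zero_iff.2 (D'.det_phiMatrix_ne_zero _))
    (norm_ne_zero_iff.2 (D''.det_phiMatrix_ne_zero _))]
  rfl

lemma logDet_eq_of_bijective (hσ : ∀ x, ‖σ x‖ = ‖x‖) {D E : Isoc.{w} σ} (f : D ⟶ E)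
    (hf : Function.Bijective f.lin) : D.logDet = E.logDet := by
  classical
  let F : D.V ≃ₗ[L] E.V := LinearEquiv.ofBijective f.lin hf
  let v := Module.finBasis L D.V
  have hphi : E.phiMatrix (v.map F) = D.phiMatrix v := by
    ext i j
    simp only [phiMatrix, Matrix.of_apply, Module.Basis.map_apply, Module.Basis.map_repr,
      LinearEquiv.trans_apply]
    have : E.φ (F (v j)) = F (D.φ (v j)) := (f.comm _).symm
    rw [this, LinearEquiv.symm_apply_apply]
  rw [logDet_eq hσ E (v.map F), hphi]
  rfl

lemma dim_eq_logDet (D : Isoc.{w} σ) :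
    D.dim = D.logDet / Real.log (uniformizerNorm L) := rfl

section Standard

variable (K : Type*) [NormedField K] [IsUltrametricDist K] [Algebra L K] [Admissible σ K]
  [IsDiscreteValuationRing (integers K)]

instance stdLattice_isLattice (D : Isoc.{w} σ) : Submodule.IsLattice K (D.stdLattice K) :=
  (D.isBasisOf_stdLattice (Module.finBasis L D.V)).isLattice

variable {K} in
/-- A subisocrystal inherits its standard lattice. -/
lemma baseChange_mem_stdLattice_iff {E D : Isoc.{w} σ} (f : E ⟶ D) (hf : Function.Injective f.lin)
    (x : E.bc K) : f.lin.baseChange K x ∈ D.stdLattice K ↔ x ∈ E.stdLattice K := by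
  classical
  let b' := Module.finBasis L E.V
  let N := LinearMap.range f.lin
  let b'' := Module.finBasis L (D.V ⧸ N)
  have hex : Function.Exact f.lin N.mkQ := LinearMap.exact_map_mkQ_range f.lin
  obtain ⟨b, -, -, hb1, hb2⟩ := exists_basis_of_exact hf hex b' b''
    (fun j => Function.surjInv N.mkQ_surjective (b'' j)) (fun j => Function.surjInv_eq _ _)
  have hl : ∀ (x : E.bc K) i, (Algebra.TensorProduct.basis K b).repr
      (f.lin.baseChange K x) (Sum.inl i) = (Algebra.TensorProduct.basis K b').repr x i := by
    intro x i
    induction x using TensorProduct.induction_on with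
    | zero => simp
    | tmul c y =>
      rw [LinearMap.baseChange_tmul, Algebra.TensorProduct.basis_repr_tmul,
        Algebra.TensorProduct.basis_repr_tmul]
      simp [← hb1]
    | add x y hx hy => rw [map_add, map_add, map_add, Finsupp.add_apply, Finsupp.add_apply, hx, hy]
  have hr : ∀ (x : E.bc K) j, (Algebra.TensorProduct.basis K b).repr
      (f.lin.baseChange K x) (Sum.inr j) = 0 := by
    intro x j
    induction x using TensorProduct.induction_on with
    | zero => simp
    | tmul c y =>
      have h2 := hb2 (f.lin y) j
      rw [(hex _).2 ⟨y, rfl⟩, map_zero, Finsupp.zero_apply] at h2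
      rw [LinearMap.baseChange_tmul, Algebra.TensorProduct.basis_repr_tmul]
      simp [h2]
    | add x y hx hy => rw [map_add, map_add, Finsupp.add_apply, hx, hy, add_zero]
  rw [D.isBasisOf_stdLattice b, E.isBasisOf_stdLattice b']
  constructor
  · intro h i
    rw [← hl]
    exact h _
  · rintro h (i | j)
    · rw [hl]
      exact h i
    · rw [hr, norm_zero]
      exact zero_le_one

lemma degLat_stdLattice (D : Isoc.{w} σ) : D.degLat (D.stdLattice K) = -D.dim := by
  classical
  rw [D.degLat_eq (Module.finBasis L D.V) (D.isBasisOf_stdLattice (Module.finBasis L D.V)),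
    Module.Basis.det_self, addVal_one, zero_sub]
  rfl

/-- For the standard lattice, the degree is the opposite of the dimension. -/
lemma subDeg_stdLattice (D : Isoc.{w} σ) (W : D.subobjects) :
    D.subDeg (D.stdLattice K) W = -(D.sub W.1 W.2).dim := by
  have hW : D.IsSub W.1 := W.2
  have h1 : D.subisocLat (D.stdLattice K) W.1 hW = (D.sub W.1 hW).stdLattice K := by
    ext x
    exact baseChange_mem_stdLattice_iff (subtypeHom hW) Subtype.val_injective x
  rw [subDeg, h1, degLat_stdLattice]

end Standard

/-- There is a subisocrystal of maximal slope. -/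
lemma exists_max_slope (K : Type*) [NormedField K] [IsUltrametricDist K] [Algebra L K] [Admissible σ K]
    [IsDiscreteValuationRing (integers K)]
    (hlog : Real.log (uniformizerNorm L) < 0) (D : Isoc.{w} σ)
    (hD : Nontrivial D.V) : ∃ (X : Submodule L D.V) (hX : D.IsSub X) (η : ℝ), X ≠ ⊥ ∧
      (D.sub X hX).logDet = η * (D.sub X hX).rank ∧
      ∀ (E : Isoc.{w} σ) (f : E ⟶ D), Function.Injective f.lin → E.logDet ≤ η * E.rank := by
  have hσ : ∀ x, ‖σ x‖ = ‖x‖ := Admissible.norm_map K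
  let f := D.hnFil (D.stdLattice K)
  let T : Set ℝ := {s | f.level s ≠ ⊥}
  have hne : T.Nonempty := by
    obtain ⟨s, hs⟩ := f.exhaustive
    refine ⟨s, fun h => ?_⟩
    have h1 : f.Fil s = ⊥ := congrArg Subtype.val h
    exact top_ne_bot (hs.symm.trans h1)
  have hbdd : BddAbove T := by
    obtain ⟨s, hs⟩ := f.separated
    refine ⟨s, fun t ht => not_lt.1 fun hst => ht ?_⟩
    exact le_bot_iff.1 ((f.level_antitone hst.le).trans (le_of_eq (Subtype.ext hs)))
  -- the largest slope of the Harder–Narasimhan filtration of the standard lattice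
  set s := sSup T with hs
  have hsT : f.level s ≠ ⊥ := by
    obtain ⟨t, hts, ht⟩ := f.exists_level_eq s
    obtain ⟨r, hr, htr⟩ := exists_lt_of_lt_csSup hne hts
    rw [← ht]
    exact fun h => hr (le_bot_iff.1 ((f.level_antitone htr.le).trans h.le))
  have hgt : ∀ t > s, f.level t = ⊥ := fun t ht => by
    by_contra h
    exact (le_csSup hbdd h).not_gt ht
  have hle : ∀ W : D.subobjects, D.subDeg (D.stdLattice K) W ≤ s * D.subRank W := by
    intro W
    refine le_of_forall_pos_le_add fun ε hε => ?_
    have h1 : 0 < ε / (D.subRank W + 1) := by positivity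
    have h2 := (hnFil_spec (D.stdLattice K) (s + ε / (D.subRank W + 1))).1 W
    change _ ≤ D.tilt _ _ (f.level _) at h2
    rw [hgt _ (lt_add_of_pos_right s h1), tilt, tilt, subDeg_bot, subRank_bot] at h2
    have h3 : ε / (D.subRank W + 1) * D.subRank W ≤ ε := by
      rw [div_mul_eq_mul_div, div_le_iff₀ (by positivity)]
      nlinarith
    push_cast at h2
    linarith
  have hge : s * D.subRank (f.level s) ≤ D.subDeg (D.stdLattice K) (f.level s) := by
    have h2 := (hnFil_spec (D.stdLattice K) s).1 ⊥
    change _ ≤ D.tilt _ _ (f.level _) at h2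
    rw [tilt, tilt, subDeg_bot, subRank_bot] at h2
    push_cast at h2
    linarith
  have hconv : ∀ W : D.subobjects, (D.sub W.1 W.2).logDet =
      -Real.log (uniformizerNorm L) * D.subDeg (D.stdLattice K) W := by
    intro W
    rw [subDeg_stdLattice, dim_eq_logDet, neg_mul_neg, mul_div_cancel₀ _ hlog.ne]
  refine ⟨f.Fil s, f.isSub s, -Real.log (uniformizerNorm L) * s,
    fun h => hsT (Subtype.ext h), ?_, fun E g hg => ?_⟩
  · change (D.sub (f.level s).1 (f.level s).2).logDet = _
    rw [hconv (f.level s), le_antisymm (hle _) hge, mul_assoc]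
    rfl
  · let W : D.subobjects := ⟨(⊤ : Submodule L E.V).map g.lin, isSub_map g E.isSub_top⟩
    have hW : D.IsSub W.1 := W.2
    let h : E ⟶ D.sub W.1 hW := (⟨g.lin.codRestrict W.1 fun x => ⟨x, trivial, rfl⟩, fun x =>
      Subtype.ext (g.comm x)⟩ : Hom _ _)
    have hh : Function.Bijective h.lin := ⟨fun x y hxy => hg (congrArg Subtype.val hxy), by
      rintro ⟨_, x, -, rfl⟩
      exact ⟨x, rfl⟩⟩
    have h1 : E.rank = D.subRank W := (LinearEquiv.ofBijective h.lin hh).finrank_eq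
    rw [logDet_eq_of_bijective hσ h hh, hconv W, h1, mul_assoc]
    exact mul_le_mul_of_nonneg_left (hle W) (neg_nonneg.2 hlog.le)

variable [IsUltrametricDist L] [CompleteSpace L]

/-- A substitute for the slope decomposition: a basis and exponents, with sum given by the
determinant, such that the coordinates of the iterates of `φ` grow at most with these exponents. -/
theorem exists_newton_basis (K : Type*) [NormedField K] [IsUltrametricDist K] [Algebra L K] [Admissible σ K]
    [IsDiscreteValuationRing (integers K)]
    (hL : ∃ w : L, 1 < ‖w‖)
    (hlog : Real.log (uniformizerNorm L) < 0) (D : Isoc.{w} σ) :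
    ∃ (κ : Type) (_ : Fintype κ) (b : Module.Basis κ L D.V) (η : κ → ℝ), ∑ j, η j = D.logDet ∧
      ∀ ε > 0, ∀ x, ∃ C : ℝ, 0 ≤ C ∧ ∀ N j,
        ‖b.repr (D.iter N x) j‖ ≤ C * Real.exp (η j + ε) ^ N := by
  have hσ : ∀ x, ‖σ x‖ = ‖x‖ := Admissible.norm_map K
  suffices H : ∀ (n : ℕ) (D : Isoc.{w} σ), D.rank ≤ n →
      ∃ (κ : Type) (_ : Fintype κ) (b : Module.Basis κ L D.V) (η : κ → ℝ), ∑ j, η j = D.logDet ∧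
      ∀ ε > 0, ∀ x, ∃ C : ℝ, 0 ≤ C ∧ ∀ N j,
        ‖b.repr (D.iter N x) j‖ ≤ C * Real.exp (η j + ε) ^ N from H D.rank D le_rfl
  intro n
  induction n with
  | zero =>
    intro D hD
    have : Subsingleton D.V := Module.finrank_zero_iff.1 (Nat.le_zero.1 hD)
    refine ⟨Fin 0, inferInstance, Module.Basis.empty _, 0, ?_, fun ε _ x =>
      ⟨0, le_rfl, fun N j => j.elim0⟩⟩
    rw [logDet_eq hσ D (Module.Basis.empty (ι := Fin 0) D.V), Matrix.det_isEmpty]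
    simp
  | succ n ih =>
    intro D hD
    by_cases hn : Nontrivial D.V
    swap
    · have h1 : Subsingleton D.V := not_nontrivial_iff_subsingleton.1 hn
      refine ih D ?_
      have h2 : D.rank = 0 := Module.finrank_zero_iff.2 h1
      omega
    -- the subobject of maximal slope contributes the exponent `η₁` with multiplicity its rank, as
    -- the iterates on all of `D` grow at most with `η₁`; the others come from the quotient
    obtain ⟨X, hX, η₁, hX0, hXη, hmax⟩ := exists_max_slope K hlog D hn
    have hslopes : ∀ ε > 0, D.SlopesLT (η₁ + ε) := fun ε hε E f hf hE => by
      have h1 := hmax E f hf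
      have h2 : (0 : ℝ) < E.rank := by exact_mod_cast hE
      nlinarith
    have hQ : (D.quot X hX).rank ≤ n := by
      have h1 := X.finrank_quotient_add_finrank
      have h2 : 0 < Module.finrank L X := by
        have := Submodule.nontrivial_iff_ne_bot.2 hX0
        exact Module.finrank_pos
      have h3 : Module.finrank L D.V ≤ n + 1 := hD
      change Module.finrank L (D.V ⧸ X) ≤ n
      omega
    obtain ⟨κ, _, b'', η, hη, hgrow⟩ := ih (D.quot X hX) hQ
    obtain ⟨b, -, -, -, hb⟩ := exists_basis_of_exact X.injective_subtype
      (LinearMap.exact_subtype_mkQ X) (Module.finBasis L X) b''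
      (fun j => Function.surjInv X.mkQ_surjective (b'' j)) (fun j => Function.surjInv_eq _ _)
    refine ⟨Fin (Module.finrank L X) ⊕ κ, inferInstance, b, Sum.elim (fun _ => η₁) η, ?_, ?_⟩
    · rw [Fintype.sum_sum_type]
      simp only [Sum.elim_inl, Sum.elim_inr, Finset.sum_const, Finset.card_univ, Fintype.card_fin,
        nsmul_eq_mul]
      rw [hη, logDet_add_of_exact hσ (subtypeHom hX) (mkQHom hX) Subtype.val_injective
        (LinearMap.exact_subtype_mkQ X) X.mkQ_surjective, hXη, mul_comm]
      rfl
    · intro ε hε x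
      obtain ⟨C₁, hC₁, h₁⟩ := (hslopes ε hε).exists_bound hσ hL D b
      obtain ⟨C₂, hC₂, h₂⟩ := hgrow ε hε (X.mkQ x)
      refine ⟨C₁ * ‖b.equivFun x‖ + C₂, by positivity, ?_⟩
      rintro N (i | j)
      · have h3 := (norm_le_pi_norm (b.equivFun (D.iter N x)) (Sum.inl i)).trans (h₁ N x)
        refine h3.trans ?_
        have h4 : 0 ≤ C₂ * Real.exp (η₁ + ε) ^ N := by positivity
        rw [Sum.elim_inl]
        linarith
      · rw [hb]
        have h3 : X.mkQ (D.iter N x) = (D.quot X hX).iter N (X.mkQ x) := map_iter (mkQHom hX) N x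
        rw [h3, Sum.elim_inr]
        refine (h₂ N j).trans (mul_le_mul_of_nonneg_right ?_ (by positivity))
        linarith [show 0 ≤ C₁ * ‖b.equivFun x‖ by positivity]

end NewtonBasis

end Isoc

/-! ### The contribution of the Frobenius -/

section NewtonBound

/-- The exponential growth rates of two sequences are compared. -/
lemma le_of_pow_le {x y z C : ℝ} (hy : 0 < y) (hz : 0 < z) (h : ∀ N : ℕ, x ^ N * y ≤ C * z ^ N) :
    x ≤ z := by
  by_contra! hlt
  obtain ⟨N, hN⟩ := pow_unbounded_of_one_lt (C / y) ((one_lt_div hz).2 hlt)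
  rw [div_pow, div_lt_div_iff₀ hy (pow_pos hz N)] at hN
  exact hN.not_ge (h N)

section FrobIter

variable {L : Type*} [Field L] (σ : L ≃+* L) {ι : Type*} [Fintype ι] [DecidableEq ι]

/-- The matrix of the `N`-th iterate of a semilinear map with matrix `Φ` (the rows are the images of
the basis vectors). -/
def frobIter (Φ : Matrix ι ι L) : ℕ → Matrix ι ι L
  | 0 => 1
  | n + 1 => (frobIter Φ n).map σ * Φ

variable {σ}

lemma map_pow_succ {X Y : Type*} (A : Matrix X Y L) (N : ℕ) :
    A.map (σ ^ (N + 1) : L ≃+* L) = (A.map (σ ^ N : L ≃+* L)).map σ := by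
  ext i j
  simp only [Matrix.map_apply, pow_succ']
  rfl

/-- Iteration of the relation which says that the row space of `A` is stable under `Φ ⊗ Ψ`. -/
lemma frobIter_kronecker {d : ℕ} {κ : Type*} [Fintype κ] [DecidableEq κ]
    {A : Matrix (Fin d) (ι × κ) L} {Φ : Matrix ι ι L} {Ψ : Matrix κ κ L}
    {T : Matrix (Fin d) (Fin d) L} (h : A.map σ * Φ ⊗ₖ Ψ = T * A) (N : ℕ) :
    A.map (σ ^ N : L ≃+* L) * frobIter σ Φ N ⊗ₖ frobIter σ Ψ N = frobIter σ T N * A := by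
  induction N with
  | zero =>
    rw [frobIter, frobIter, frobIter, Matrix.one_kronecker_one, Matrix.mul_one, Matrix.one_mul]
    ext i j
    rfl
  | succ N ih =>
    have h1 := congrArg (fun M => M.map (σ : L →+* L)) ih
    simp only [Matrix.map_mul, map_kronecker] at h1
    rw [frobIter, frobIter, frobIter, map_pow_succ, Matrix.mul_kronecker_mul, ← Matrix.mul_assoc]
    refine (congrArg (· * Φ ⊗ₖ Ψ) h1).trans ?_
    rw [Matrix.mul_assoc, Matrix.mul_assoc]
    exact congrArg _ h

lemma blockTriangular_frobIter {a : ι → ℝ} {Φ : Matrix ι ι L} (hΦ : Φ.BlockTriangular a) (N : ℕ) :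
    (frobIter σ Φ N).BlockTriangular a := by
  induction N with
  | zero => exact Matrix.blockTriangular_one
  | succ N ih => exact (ih.map σ).mul hΦ

/-- The diagonal blocks of the iterates are the iterates of the diagonal blocks. -/
lemma blk_frobIter {a : ι → ℝ} {Φ : Matrix ι ι L} (hΦ : Φ.BlockTriangular a) (N : ℕ) :
    blk a (frobIter σ Φ N) = mkBlock a fun s => frobIter σ (Φ.toSquareBlock a s) N := by
  induction N with
  | zero =>
    have h1 := mkBlock_one (R := L) (a := a)
    rw [frobIter]
    conv_lhs => rw [← h1]
    rw [blk_mkBlock]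
    rfl
  | succ N ih =>
    have h1 : blk a ((frobIter σ Φ N).map σ) = (blk a (frobIter σ Φ N)).map σ := by
      ext i j
      rw [Matrix.map_apply, blk, blk]
      split_ifs <;> simp
    rw [frobIter, blk_mul ((blockTriangular_frobIter hΦ N).map σ) hΦ, h1, ih,
      blk_eq_mkBlock Φ]
    refine (congrArg (· * _) (mkBlock_map (σ : L →+* L) _)).trans ?_
    exact mkBlock_mul _ _

end FrobIter

namespace Isoc

section OfMatrix

variable {L : Type*} [Field L] (σ : L ≃+* L) {ι : Type*} [Fintype ι] [DecidableEq ι]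

/-- The isocrystal on the space of row vectors given by an invertible matrix. -/
def ofMatrix (Φ : Matrix ι ι L) (hΦ : Φ.det ≠ 0) : Isoc σ where
  V := ι → L
  φ :=
    { toFun := fun x => (σ ∘ x) ᵥ* Φ
      map_add' := fun x y => by
        rw [← Matrix.add_vecMul]
        congr 1
        ext i
        simp
      map_smul' := fun c x => by
        rw [← Matrix.smul_vecMul]
        congr 1
        ext i
        simp }
  bij := by
    have hu : IsUnit Φ.det := hΦ.isUnit
    constructor
    · intro x y hxy
      have h1 : (σ ∘ x) ᵥ* Φ ᵥ* Φ⁻¹ = (σ ∘ y) ᵥ* Φ ᵥ* Φ⁻¹ := congrArg (· ᵥ* Φ⁻¹) hxy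
      rw [Matrix.vecMul_vecMul, Matrix.vecMul_vecMul, Matrix.mul_nonsing_inv _ hu, Matrix.vecMul_one,
        Matrix.vecMul_one] at h1
      exact funext fun i => σ.injective (congrFun h1 i)
    · intro y
      refine ⟨σ.symm ∘ (y ᵥ* Φ⁻¹), ?_⟩
      change (σ ∘ (σ.symm ∘ (y ᵥ* Φ⁻¹))) ᵥ* Φ = y
      have h1 : σ ∘ (σ.symm ∘ (y ᵥ* Φ⁻¹)) = y ᵥ* Φ⁻¹ := funext fun i => σ.apply_symm_apply _
      rw [h1, Matrix.vecMul_vecMul, Matrix.nonsing_inv_mul _ hu, Matrix.vecMul_one]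

/-- The standard basis of the space of row vectors. -/
def ofMatrixBasis (Φ : Matrix ι ι L) (hΦ : Φ.det ≠ 0) : Module.Basis ι L (ofMatrix σ Φ hΦ).V :=
  Pi.basisFun L ι

lemma ofMatrixBasis_apply (Φ : Matrix ι ι L) (hΦ : Φ.det ≠ 0) (i : ι) :
    ofMatrixBasis σ Φ hΦ i = (Pi.single i 1 : ι → L) :=
  Pi.basisFun_apply L ι i

lemma ofMatrixBasis_repr (Φ : Matrix ι ι L) (hΦ : Φ.det ≠ 0) (x : (ofMatrix σ Φ hΦ).V) (i : ι) :
    (ofMatrixBasis σ Φ hΦ).repr x i = (x : ι → L) i :=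
  Pi.basisFun_repr ..

lemma ofMatrix_iter (Φ : Matrix ι ι L) (hΦ : Φ.det ≠ 0) (N : ℕ) (i : ι) :
    (ofMatrix σ Φ hΦ).iter N (ofMatrixBasis σ Φ hΦ i) = frobIter σ Φ N i := by
  induction N with
  | zero =>
    rw [iter_zero, frobIter, ofMatrixBasis_apply]
    refine funext fun j => ?_
    rw [Matrix.one_apply, Pi.single_apply]
    simp only [eq_comm]
  | succ N ih =>
    rw [iter_succ, ih]
    rfl

lemma phiMatrix_ofMatrix (Φ : Matrix ι ι L) (hΦ : Φ.det ≠ 0) :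
    (ofMatrix σ Φ hΦ).phiMatrix (ofMatrixBasis σ Φ hΦ) = Φᵀ := by
  ext i j
  have h1 := congrFun (ofMatrix_iter σ Φ hΦ 1 j) i
  have h2 : frobIter σ Φ 1 j i = Φ j i := by
    rw [frobIter, frobIter]
    have : (1 : Matrix ι ι L).map σ = 1 := Matrix.map_one _ (map_zero _) (map_one _)
    rw [this, Matrix.one_mul]
  rw [h2] at h1
  rw [Matrix.transpose_apply, ← h1]
  exact ofMatrixBasis_repr σ Φ hΦ _ i

end OfMatrix

end Isoc

variable {L : Type*} [NormedField L] {σ : L ≃+* L} [IsUltrametricDist L] [CompleteSpace L]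

variable (σ) in
/-- The growth of the iterates of a semilinear map, in terms of matrices. -/
lemma exists_newton_matrix (K : Type*) [NormedField K] [IsUltrametricDist K] [Algebra L K]
    [Admissible σ K] [IsDiscreteValuationRing (integers K)]
    (hL : ∃ w : L, 1 < ‖w‖) (hlog : Real.log (uniformizerNorm L) < 0)
    {ι : Type*} [Fintype ι] [DecidableEq ι] {Φ : Matrix ι ι L} (hΦ : Φ.det ≠ 0) :
    ∃ (g g' : Matrix ι ι L) (η : ι → ℝ), g * g' = 1 ∧ ∑ i, η i = Real.log ‖Φ.det‖ ∧
      ∀ ε > 0, ∃ C : ℝ, 0 ≤ C ∧ ∀ N i j,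
        ‖(frobIter σ Φ N * g) i j‖ ≤ C * Real.exp (η j + ε) ^ N := by
  have hσ : ∀ x, ‖σ x‖ = ‖x‖ := Admissible.norm_map K
  let D := Isoc.ofMatrix σ Φ hΦ
  let e : Module.Basis ι L D.V := Isoc.ofMatrixBasis σ Φ hΦ
  obtain ⟨κ, _, b, η, hη, hgrow⟩ := Isoc.exists_newton_basis K hL hlog D
  let q : κ ≃ ι := b.indexEquiv e
  let c := b.reindex q
  have hc : ∀ x j, c.repr x j = b.repr x (q.symm j) := fun x j => by
    simp [c, Module.Basis.repr_reindex, Finsupp.mapDomain_equiv_apply]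
  have hmul : ∀ (N : ℕ) i j, (frobIter σ Φ N * Matrix.of fun i j => c.repr (e i) j) i j =
      c.repr (D.iter N (e i)) j := by
    intro N i j
    have h1 : D.iter N (e i) = frobIter σ Φ N i := Isoc.ofMatrix_iter σ Φ hΦ N i
    have h2 : (frobIter σ Φ N i : D.V) = ∑ k, frobIter σ Φ N i k • e k :=
      ((Pi.basisFun L ι).sum_equivFun (frobIter σ Φ N i)).symm
    rw [h1.trans h2, map_sum, Finsupp.finsetSum_apply, Matrix.mul_apply]
    refine Finset.sum_congr rfl fun k _ => ?_
    rw [map_smul, Finsupp.smul_apply, smul_eq_mul, Matrix.of_apply]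
  refine ⟨Matrix.of fun i j => c.repr (e i) j, Matrix.of fun i j => e.repr (c i) j,
    fun i => η (q.symm i), ?_, ?_, fun ε hε => ?_⟩
  · have h1 := c.toMatrix_mul_toMatrix_flip e
    have h2 := e.toMatrix_mul_toMatrix_flip c
    have h3 := congrArg Matrix.transpose h2
    rw [Matrix.transpose_mul, Matrix.transpose_one] at h3
    exact h3
  · rw [q.symm.sum_comp, hη, Isoc.logDet_eq hσ D e]
    have h1 := Isoc.phiMatrix_ofMatrix σ Φ hΦ
    have h2 : (D.phiMatrix e).det = Φ.det := (congrArg Matrix.det h1).trans Φ.det_transpose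
    rw [h2]
  · choose C hC h using fun i => hgrow ε hε (e i)
    refine ⟨∑ i, C i, Finset.sum_nonneg fun i _ => hC i, fun N i j => ?_⟩
    rw [hmul, hc]
    refine (h i N (q.symm j)).trans (mul_le_mul_of_nonneg_right ?_ (by positivity))
    exact Finset.single_le_sum (f := C) (fun i _ => hC i) (Finset.mem_univ i)

/-- The growth of the iterates of a semilinear map respecting a weight filtration, blockwise. -/
lemma exists_newton_blk (K : Type*) [NormedField K] [IsUltrametricDist K] [Algebra L K]
    [Admissible σ K] [IsDiscreteValuationRing (integers K)]
    (hL : ∃ w : L, 1 < ‖w‖) (hlog : Real.log (uniformizerNorm L) < 0)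
    {ι : Type*} [Fintype ι] [DecidableEq ι] {a : ι → ℝ} {Φ : Matrix ι ι L}
    (hΦt : Φ.BlockTriangular a) (hΦ : Φ.det ≠ 0) :
    ∃ (g : Matrix ι ι L) (η : ι → ℝ), g.det ≠ 0 ∧ g.BlockTriangular a ∧
      (∀ i j, g i j ≠ 0 → a i = a j) ∧
      (∀ s, ∑ i : {i // s ≤ a i}, η i =
        Real.log ‖(Φ.submatrix (Subtype.val : {i // s ≤ a i} → ι) Subtype.val).det‖) ∧
      ∀ ε > 0, ∃ C : ℝ, 0 ≤ C ∧ ∀ N i j,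
        ‖blk a (frobIter σ Φ N * g) i j‖ ≤ C * Real.exp (η j + ε) ^ N := by
  have h1 := fun s => exists_newton_matrix σ K hL hlog (det_toSquareBlock_ne_zero hΦt hΦ s)
  choose g g' η hg hη hgrow using h1
  have hval : ∀ s (i : {i // a i = s}), η (a i) ⟨i, rfl⟩ = η s i := fun s ⟨i, hi⟩ => by
    subst hi
    rfl
  refine ⟨mkBlock a g, fun i => η (a i) ⟨i, rfl⟩, ?_, blockTriangular_mkBlock g,
    fun i j => eq_of_mkBlock_ne_zero, ?_, fun ε hε => ?_⟩
  · have h2 : mkBlock a g * mkBlock a g' = 1 := by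
      rw [mkBlock_mul, funext hg]
      exact mkBlock_one
    intro h0
    have h3 := congrArg Matrix.det h2
    rw [Matrix.det_mul, h0, zero_mul, Matrix.det_one] at h3
    exact zero_ne_one h3
  · refine sum_eq_of_blocks (F := fun x => Real.log ‖x‖) (h := fun i => η (a i) ⟨i, rfl⟩) hΦt hΦ
      (by simp) (fun x y hx hy => ?_) fun s => ?_
    · rw [norm_mul, Real.log_mul (norm_ne_zero_iff.2 hx) (norm_ne_zero_iff.2 hy)]
    · rw [← hη s]
      exact Finset.sum_congr rfl fun i _ => hval s i
  · choose C hC h using fun s => hgrow s ε hε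
    refine ⟨∑ i, C (a i), Finset.sum_nonneg fun i _ => hC _, fun N i j => ?_⟩
    rw [blk_mul (blockTriangular_frobIter hΦt N) (blockTriangular_mkBlock g), blk_frobIter hΦt,
      blk_mkBlock, mkBlock_mul]
    have h0 : 0 ≤ (∑ i, C (a i)) * Real.exp (η (a j) ⟨j, rfl⟩ + ε) ^ N :=
      mul_nonneg (Finset.sum_nonneg fun i _ => hC _) (by positivity)
    by_cases hij : a i = a j
    · rw [mkBlock_apply _ (s := a j) ⟨i, hij⟩ ⟨j, rfl⟩]
      refine (h (a j) N ⟨i, hij⟩ ⟨j, rfl⟩).trans (mul_le_mul_of_nonneg_right ?_ (by positivity))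
      exact Finset.single_le_sum (f := fun i => C (a i)) (fun i _ => hC _) (Finset.mem_univ j)
    · rw [mkBlock_apply_of_ne _ hij, norm_zero]
      exact h0

lemma norm_det_frobIter (hσ : ∀ x : L, ‖σ x‖ = ‖x‖) {ι : Type*} [Fintype ι] [DecidableEq ι]
    (T : Matrix ι ι L) (N : ℕ) : ‖(frobIter σ T N).det‖ = ‖T.det‖ ^ N := by
  induction N with
  | zero => simp [frobIter]
  | succ N ih =>
    have h1 : ((frobIter σ T N).map σ).det = σ (frobIter σ T N).det :=
      (RingHom.map_det (σ : L →+* L) _).symm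
    rw [frobIter, Matrix.det_mul, norm_mul, h1, hσ, ih, pow_succ]

/-- The Frobenius part of the degree bound: the determinant of the Frobenius on the subspace is
compared with the growth of the iterates of the Frobenius, by means of a minor which only involves
the graded pieces of the optimal filtrations. -/
theorem IsGeomOptimal.log_det_le (K : Type*) [NormedField K] [IsUltrametricDist K] [Algebra L K]
    [Admissible σ K] [IsDiscreteValuationRing (integers K)]
    (hL : ∃ w : L, 1 < ‖w‖)
    (hlog : Real.log (uniformizerNorm L) < 0) {d : ℕ} {ι κ : Type*} [Fintype ι] [Fintype κ]
    [DecidableEq ι] [DecidableEq κ] {A : Matrix (Fin d) (ι × κ) L} {a : ι → ℝ} {b : κ → ℝ} {m : ℝ}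
    (hopt : IsGeomOptimal A a b m) {Φ : Matrix ι ι L} {Ψ : Matrix κ κ L}
    {T : Matrix (Fin d) (Fin d) L} (hΦ : Φ.det ≠ 0) (hΨ : Ψ.det ≠ 0) (hT : T.det ≠ 0)
    (h : A.map σ * Φ ⊗ₖ Ψ = T * A) :
    ∃ (η : ι → ℝ) (θ : κ → ℝ),
      (∀ s, ∑ i : {i // s ≤ a i}, η i =
        Real.log ‖(Φ.submatrix (Subtype.val : {i // s ≤ a i} → ι) Subtype.val).det‖) ∧
      (∀ s, ∑ i : {i // s ≤ b i}, θ i =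
        Real.log ‖(Ψ.submatrix (Subtype.val : {i // s ≤ b i} → κ) Subtype.val).det‖) ∧
      Real.log ‖T.det‖ ≤ ∑ i, a i * η i + ∑ j, b j * θ j := by
  have hσ : ∀ x, ‖σ x‖ = ‖x‖ := Admissible.norm_map K
  obtain ⟨hΦt, hΨt⟩ := hopt.triangular hΦ hΨ h
  have hΦt' : Φ.BlockTriangular a := fun i j hij => by
    by_contra h0
    exact hij.not_ge (hΦt i j h0)
  have hΨt' : Ψ.BlockTriangular b := fun i j hij => by
    by_contra h0
    exact hij.not_ge (hΨt i j h0)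
  obtain ⟨g, η, hg, hgt, hga, hη, hgrow⟩ := exists_newton_blk (σ := σ) K hL hlog hΦt' hΦ
  obtain ⟨g', θ, hg', hgt', hgb, hθ, hgrow'⟩ := exists_newton_blk (σ := σ) K hL hlog hΨt' hΨ
  obtain ⟨J, hJ, hmin, hle⟩ := hopt.exists_weight_le (E := L) hg hg' hga hgb η θ
  have hid : A.map (algebraMap L L) = A := by ext; simp
  rw [hid] at hJ
  refine ⟨η, θ, hη, hθ, le_trans ?_ hle⟩
  refine le_of_forall_pos_le_add fun δ hδ => ?_
  set ε := δ / (2 * d + 1) with hε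
  have hε0 : 0 < ε := by positivity
  obtain ⟨C, hC, hCb⟩ := hgrow ε hε0
  obtain ⟨C', hC', hCb'⟩ := hgrow' ε hε0
  -- `‖det T‖ ^ N` is compared with the growth of the minor `J` under the `N`-th iterate
  have hexp : ‖T.det‖ ≤ Real.exp (wt η θ J + 2 * d * ε) := by
    refine le_of_pow_le (y := ‖minor (A * g ⊗ₖ g') J‖) (norm_pos_iff.2 hJ) (Real.exp_pos _)
      (C := ∑ I, C ^ d * C' ^ d * ‖minor A I‖) fun N => ?_
    have hmap : ∀ I, minor (A.map (σ ^ N : L ≃+* L)) I = (σ ^ N : L ≃+* L) (minor A I) := fun I =>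
      minor_map ((σ ^ N : L ≃+* L) : L →+* L) A I
    have hminN : ∀ I, minor (A.map (σ ^ N : L ≃+* L)) I ≠ 0 →
        wt a b J ≤ wt a b I := by
      intro I hI
      rw [hmap] at hI
      refine hmin I ?_
      change minor (A * 1 ⊗ₖ 1) I ≠ 0
      rw [Matrix.one_kronecker_one, Matrix.mul_one]
      exact fun h0 => hI (by rw [h0, map_zero])
    -- a minor of minimal weight only depends on the diagonal blocks
    have h1 : minor (frobIter σ T N * (A * g ⊗ₖ g')) J =
        minor (A.map (σ ^ N : L ≃+* L) * blk a (frobIter σ Φ N * g) ⊗ₖ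
          blk b (frobIter σ Ψ N * g')) J := by
      rw [← minor_eq_blk hminN ((blockTriangular_frobIter hΦt' N).mul hgt)
        ((blockTriangular_frobIter hΨt' N).mul hgt'), Matrix.mul_kronecker_mul, ← Matrix.mul_assoc,
        ← Matrix.mul_assoc, frobIter_kronecker h]
    rw [← norm_det_frobIter hσ, ← norm_mul, ← minor_mul_left, h1, minor_mul, Finset.sum_mul]
    refine (norm_sum_le _ _).trans (Finset.sum_le_sum fun I _ => ?_)
    rw [norm_mul, hmap, Isoc.norm_pow_apply hσ, mul_right_comm]
    refine mul_le_mul_of_nonneg_right ?_ (norm_nonneg _)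
    rw [norm_prod]
    have h2 : ∀ k ∈ Finset.univ, ‖(blk a (frobIter σ Φ N * g) ⊗ₖ
        blk b (frobIter σ Ψ N * g')) (I k) (J k)‖ ≤
        C * C' * Real.exp (η (J k).1 + θ (J k).2 + 2 * ε) ^ N := by
      intro k _
      rw [Matrix.kroneckerMap_apply, norm_mul]
      refine (mul_le_mul (hCb N _ _) (hCb' N _ _) (norm_nonneg _) (by positivity)).trans
        (le_of_eq ?_)
      rw [mul_mul_mul_comm, ← mul_pow, ← Real.exp_add]
      congr 3
      ring
    refine (Finset.prod_le_prod (fun _ _ => norm_nonneg _) h2).trans (le_of_eq ?_)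
    rw [Finset.prod_mul_distrib, Finset.prod_pow, ← Real.exp_sum, Finset.prod_const,
      Finset.card_univ, Fintype.card_fin, mul_pow]
    congr 3
    rw [Finset.sum_add_distrib, Finset.sum_const, Finset.card_univ, Fintype.card_fin, nsmul_eq_mul,
      wt]
    ring
  have h2 := Real.log_le_log (norm_pos_iff.2 hT) hexp
  rw [Real.log_exp] at h2
  refine h2.trans (add_le_add le_rfl ?_)
  rw [hε, mul_div_assoc', div_le_iff₀ (by positivity)]
  nlinarith

end NewtonBound

/-! ### Degrees in a flag of subisocrystals -/

section Abel

/-- Summation by parts: if the partial sums over the sets `{a ≥ s}` are not positive and the total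
sum vanishes, then the sum weighted by `a` is not positive. -/
lemma sum_mul_nonpos {ι : Type*} [Fintype ι] {a x : ι → ℝ}
    (h : ∀ s, ∑ i : {i // s ≤ a i}, x i ≤ 0) (h0 : ∑ i, x i = 0) : ∑ i, a i * x i ≤ 0 := by
  classical
  have h' : ∀ s, ∑ i with s ≤ a i, x i ≤ 0 := fun s => by
    rw [Finset.sum_subtype (p := fun i => s ≤ a i) _ (fun i => by simp)]
    exact h s
  have key : ∀ (n : ℕ) (t : ℝ), (Finset.univ.filter fun i => t < a i).card ≤ n →
      ∑ i with t < a i, (a i - t) * x i ≤ 0 := by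
    intro n
    induction n with
    | zero =>
      intro t ht
      rw [Finset.card_eq_zero.1 (Nat.le_zero.1 ht), Finset.sum_empty]
    | succ n ih =>
      intro t ht
      rcases (Finset.univ.filter fun i => t < a i).eq_empty_or_nonempty with he | hne
      · rw [he, Finset.sum_empty]
      obtain ⟨k, hk, hmin⟩ := Finset.exists_min_image _ a hne
      have hk' : t < a k := (Finset.mem_filter.1 hk).2
      have hS : (Finset.univ.filter fun i => t < a i) = Finset.univ.filter fun i => a k ≤ a i := by
        ext i
        simp only [Finset.mem_filter, Finset.mem_univ, true_and]
        exact ⟨fun hi => hmin i (by simpa using hi), fun hi => hk'.trans_le hi⟩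
      have hsub : (Finset.univ.filter fun i => a k < a i) ⊂ Finset.univ.filter fun i => t < a i := by
        refine Finset.ssubset_iff_of_subset (fun i hi => ?_) |>.2 ⟨k, hk, by simp⟩
        simp only [Finset.mem_filter, Finset.mem_univ, true_and] at hi ⊢
        exact hk'.trans hi
      have h1 := ih (a k) (by have := Finset.card_lt_card hsub; omega)
      have h2 : ∑ i with t < a i, (a i - a k) * x i = ∑ i with a k < a i, (a i - a k) * x i := by
        refine (Finset.sum_subset hsub.1 fun i hi hi' => ?_).symm
        simp only [Finset.mem_filter, Finset.mem_univ, true_and] at hi hi'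
        rw [le_antisymm (not_lt.1 hi') (hmin i (by simpa using hi)), sub_self, zero_mul]
      have h3 : ∑ i with t < a i, (a i - t) * x i =
          ∑ i with t < a i, (a i - a k) * x i + (a k - t) * ∑ i with t < a i, x i := by
        rw [Finset.mul_sum, ← Finset.sum_add_distrib]
        exact Finset.sum_congr rfl fun i _ => by ring
      have h4 := h' (a k)
      rw [← hS] at h4
      rw [h3, h2]
      nlinarith
  obtain ⟨t, ht⟩ : ∃ t, ∀ i, t < a i := by
    obtain ⟨t, ht⟩ := (Set.finite_range a).bddBelow
    exact ⟨t - 1, fun i => by linarith [ht (Set.mem_range_self i)]⟩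
  have h1 := key _ t le_rfl
  rw [Finset.filter_true_of_mem fun i _ => ht i] at h1
  have h2 : ∑ i, (a i - t) * x i = ∑ i, a i * x i - t * ∑ i, x i := by
    rw [Finset.mul_sum, ← Finset.sum_sub_distrib]
    exact Finset.sum_congr rfl fun i _ => by ring
  rw [h2, h0, mul_zero, sub_zero] at h1
  exact h1

end Abel

namespace Isoc

variable {L : Type*} [NormedField L] {σ : L ≃+* L} {K : Type*} [NormedField K]
  [IsUltrametricDist K] [Algebra L K] [Admissible σ K] [IsDiscreteValuationRing (integers K)]
  {D : Isoc.{w} σ}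

/-- The degree of a subisocrystal spanned by a part of a basis, if the lattice has an adapted
basis. -/
lemma degLat_eq_of_subbasis {E : Isoc.{w} σ} (f : E ⟶ D) (Ξ : Submodule (integers K) (D.bc K))
    (Θ : Submodule (integers K) (E.bc K)) (hΘ : ∀ u, u ∈ Θ ↔ f.lin.baseChange K u ∈ Ξ)
    {ι : Type*} [Fintype ι] [DecidableEq ι] (v : Module.Basis ι L D.V)
    {e : Module.Basis ι K (D.bc K)} (he : IsBasisOf e Ξ) (P : ι → Prop) [DecidablePred P]
    (v' : Module.Basis {i // P i} L E.V) (hv' : ∀ i, f.lin (v' i) = v i)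
    (hM : ∀ i, P i → ∀ j, ¬ P j → (Algebra.TensorProduct.basis K v).repr (e i) j = 0) :
    E.degLat Θ =
      addVal ((e.toMatrix (Algebra.TensorProduct.basis K v)).submatrix
        (Subtype.val : {i // P i} → ι) Subtype.val).det -
      addVal ((D.phiMatrix v).submatrix (Subtype.val : {i // P i} → ι) Subtype.val).det := by
  set bv := Algebra.TensorProduct.basis K v with hbv
  set bv' := Algebra.TensorProduct.basis K v' with hbv'
  have hfv : ∀ i, f.lin.baseChange K (bv' i) = bv i := fun i => by
    rw [hbv, hbv', Algebra.TensorProduct.basis_apply, Algebra.TensorProduct.basis_apply,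
      LinearMap.baseChange_tmul, hv']
  let x : {i // P i} → E.bc K := fun i => ∑ j : {j // P j}, bv.repr (e i) j • bv' j
  have hx : ∀ i, f.lin.baseChange K (x i) = e i := fun i => by
    conv_rhs => rw [← bv.sum_repr (e i)]
    simp only [x, map_sum, map_smul, hfv]
    rw [← Finset.sum_subtype (Finset.univ.filter P) (by simp)
      (fun j => bv.repr (e i) j • bv j)]
    refine Finset.sum_filter_of_ne fun j _ hj => ?_
    by_contra h
    exact hj (by rw [hM i i.2 j h, zero_smul])
  have hli : LinearIndependent K x := by
    refine LinearIndependent.of_comp (f.lin.baseChange K) ?_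
    have h1 : (f.lin.baseChange K : E.bc K → D.bc K) ∘ x = e ∘ Subtype.val := funext hx
    rw [h1]
    exact e.linearIndependent.comp _ Subtype.val_injective
  let e' : Module.Basis {i // P i} K (E.bc K) := basisOfLinearIndependentOfCardEqFinrank' x hli
    (Module.finrank_eq_card_basis bv').symm
  have he'x : ∀ i, f.lin.baseChange K (e' i) = e i := fun i => by
    rw [← hx i]
    congr 1
    simp [e']
  have hrepr : ∀ y, f.lin.baseChange K y = ∑ k, e'.repr y k • e k := fun y => by
    conv_lhs => rw [← e'.sum_repr y]
    simp only [map_sum, map_smul, he'x]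
  have hin : ∀ y (i : {i // P i}), e.repr (f.lin.baseChange K y) i = e'.repr y i := fun y i => by
    rw [hrepr, map_sum, Finsupp.finsetSum_apply, Finset.sum_eq_single i]
    · simp
    · intro j _ hj
      rw [map_smul, Finsupp.smul_apply, Module.Basis.repr_self, Finsupp.single_eq_of_ne, smul_zero]
      exact fun h => hj (Subtype.ext h.symm)
    · simp
  have hout : ∀ y (i : ι), ¬ P i → e.repr (f.lin.baseChange K y) i = 0 := fun y i hi => by
    rw [hrepr, map_sum, Finsupp.finsetSum_apply]
    refine Finset.sum_eq_zero fun j _ => ?_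
    rw [map_smul, Finsupp.smul_apply, Module.Basis.repr_self, Finsupp.single_eq_of_ne, smul_zero]
    rintro rfl
    exact hi j.2
  have he' : IsBasisOf e' Θ := fun y => by
    rw [hΘ, he]
    refine ⟨fun h i => hin y i ▸ h i, fun h i => ?_⟩
    by_cases hi : P i
    · exact (congrArg norm (hin y ⟨i, hi⟩)).trans_le (h ⟨i, hi⟩)
    · rw [hout y i hi, norm_zero]
      exact zero_le_one
  rw [E.degLat_eq v' he', Module.Basis.det_apply]
  have h1 : e'.toMatrix bv' = (e.toMatrix bv).submatrix Subtype.val Subtype.val := by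
    ext i j
    rw [Matrix.submatrix_apply, Module.Basis.toMatrix_apply, Module.Basis.toMatrix_apply, ← hin,
      hfv]
  have h2 : E.phiMatrix v' = (D.phiMatrix v).submatrix Subtype.val Subtype.val := by
    have hrepr' : ∀ y, f.lin y = ∑ k, v'.repr y k • v k := fun y => by
      conv_lhs => rw [← v'.sum_repr y]
      simp only [map_sum, map_smul, hv']
    ext i j
    change v'.repr (E.φ (v' j)) i = v.repr (D.φ (v j)) i
    rw [← hv', ← f.comm, hrepr', map_sum, Finsupp.finsetSum_apply, Finset.sum_eq_single i]
    · simp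
    · intro k _ hk
      rw [map_smul, Finsupp.smul_apply, Module.Basis.repr_self, Finsupp.single_eq_of_ne, smul_zero]
      exact fun h => hk (Subtype.ext h.symm)
    · simp
  rw [h1, h2]

/-- The subisocrystals spanned by the vectors of large weight of a basis in which the Frobenius is
triangular, and their degrees in terms of a triangular basis of the lattice. -/
lemma exists_flag_degrees (Ξ : Submodule (integers K) (D.bc K)) [Submodule.IsLattice K Ξ]
    {ι : Type*} [Fintype ι] [DecidableEq ι] (v : Module.Basis ι L D.V) {a : ι → ℝ}
    (ha : (D.phiMatrix v)ᵀ.BlockTriangular a) :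
    ∃ e : Module.Basis ι K (D.bc K), IsBasisOf e Ξ ∧
      (e.toMatrix (Algebra.TensorProduct.basis K v))ᵀ.BlockTriangular a ∧
      ∀ s, ∃ W : D.subobjects, D.subRank W = Fintype.card {i // s ≤ a i} ∧
        D.subDeg Ξ W =
          addVal ((e.toMatrix (Algebra.TensorProduct.basis K v))ᵀ.submatrix
            (Subtype.val : {i // s ≤ a i} → ι) Subtype.val).det -
          addVal ((D.phiMatrix v)ᵀ.submatrix
            (Subtype.val : {i // s ≤ a i} → ι) Subtype.val).det := by
  obtain ⟨r, hr, hra⟩ := exists_numbering a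
  set bv := Algebra.TensorProduct.basis K v with hbv
  obtain ⟨e, he, hev⟩ := exists_triangular_isBasisOf Ξ bv hr
  have hev' : ∀ i j, a j < a i → bv.repr (e i) j = 0 := fun i j hij => by
    by_contra h
    rcases (hev i j h).lt_or_eq with h1 | h1
    · exact hij.not_ge (hra i j h1)
    · exact hij.ne (by rw [hr h1])
  have hinv : (bv.toMatrix e)ᵀ * (e.toMatrix bv)ᵀ = 1 := by
    rw [← Matrix.transpose_mul, Module.Basis.toMatrix_mul_toMatrix_flip, Matrix.transpose_one]
  have hT : ((bv.toMatrix e)ᵀ).BlockTriangular a := fun i j hij => hev' i j hij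
  refine ⟨e, he, ?_, fun s => ?_⟩
  · have := invertibleOfRightInverse _ _ hinv
    rw [← Matrix.inv_eq_right_inv hinv]
    exact Matrix.blockTriangular_inv_of_blockTriangular hT
  · let W : Submodule L D.V := Submodule.span L (Set.range (v ∘ (Subtype.val : {i // s ≤ a i} → ι)))
    have hli : LinearIndependent L (v ∘ (Subtype.val : {i // s ≤ a i} → ι)) :=
      v.linearIndependent.comp _ Subtype.val_injective
    have hφ : ∀ i, s ≤ a i → D.φ (v i) ∈ W := fun i hi => by
      rw [← v.sum_repr (D.φ (v i))]
      refine Submodule.sum_mem _ fun j _ => ?_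
      by_cases hj : s ≤ a j
      · exact Submodule.smul_mem _ _ (Submodule.subset_span ⟨⟨j, hj⟩, rfl⟩)
      · have h1 : v.repr (D.φ (v i)) j = 0 := ha (i := i) (j := j) ((not_le.1 hj).trans_le hi)
        rw [h1, zero_smul]
        exact zero_mem _
    have hW : D.IsSub W := D.isSub_of_le fun x hx => by
      induction hx using Submodule.span_induction with
      | mem x hx =>
        obtain ⟨i, rfl⟩ := hx
        exact hφ _ i.2
      | zero => rw [map_zero]; exact zero_mem _
      | add x y _ _ hx hy => rw [map_add]; exact add_mem hx hy
      | smul c x _ hx => rw [LinearMap.map_smulₛₗ]; exact Submodule.smul_mem _ _ hx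
    let v' : Module.Basis {i // s ≤ a i} L W := Module.Basis.span hli
    have hv' : ∀ i, ((v' i : W) : D.V) = v i := fun i =>
      congrArg Subtype.val (Module.Basis.span_apply hli i)
    refine ⟨⟨W, hW⟩, Module.finrank_eq_card_basis v', ?_⟩
    have h1 := degLat_eq_of_subbasis (subtypeHom hW) Ξ (D.subisocLat Ξ W hW) (fun u => Iff.rfl) v he
      (fun i => s ≤ a i) v' hv' fun i hi j hj => hev' i j ((not_le.1 hj).trans_le hi)
    exact h1.trans (congrArg₂ (fun x y => addVal x - addVal y) (Matrix.det_transpose _).symm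
      (Matrix.det_transpose _).symm)

end Isoc

/-! ### Tensor products of isocrystals with lattice -/

/-- The change of coordinates in a tensor product. -/
lemma tensorProduct_repr_vecMul {L V W ι κ : Type*} [Field L] [AddCommGroup V] [Module L V]
    [AddCommGroup W] [Module L W] [Fintype ι] [Fintype κ] {v v' : Module.Basis ι L V}
    {w w' : Module.Basis κ L W} {G : Matrix ι ι L} {H : Matrix κ κ L}
    (hG : ∀ x j, v'.repr x j = ∑ i, v.repr x i * G i j)
    (hH : ∀ y j, w'.repr y j = ∑ i, w.repr y i * H i j) (t : V ⊗[L] W) (j : ι × κ) :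
    (v'.tensorProduct w').repr t j = ∑ i, (v.tensorProduct w).repr t i * (G ⊗ₖ H) i j := by
  induction t using TensorProduct.induction_on with
  | zero => simp
  | tmul x y =>
    obtain ⟨j, j'⟩ := j
    rw [Module.Basis.tensorProduct_repr_tmul_apply, hG, hH, smul_eq_mul, mul_comm,
      Finset.sum_mul_sum, Fintype.sum_prod_type]
    refine Finset.sum_congr rfl fun k _ => Finset.sum_congr rfl fun l _ => ?_
    rw [Module.Basis.tensorProduct_repr_tmul_apply, Matrix.kroneckerMap_apply, smul_eq_mul]
    ring
  | add x y hx hy => simp only [map_add, Finsupp.add_apply, add_mul, Finset.sum_add_distrib, hx, hy]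

namespace Isoc

section Tensor

variable {L : Type*} [Field L] {σ : L ≃+* L} {D E : Isoc.{w} σ} {ι κ : Type*} [Fintype ι] [Fintype κ]
  [DecidableEq ι] [DecidableEq κ]

variable (D E) in
/-- The basis of a tensor product of isocrystals formed by the tensors of basis vectors. -/
def tensorBasis (v : Module.Basis ι L D.V) (w : Module.Basis κ L E.V) :
    Module.Basis (ι × κ) L (D.tensor E).V :=
  v.tensorProduct w

lemma tensorBasis_apply (v : Module.Basis ι L D.V) (w : Module.Basis κ L E.V) (i : ι × κ) :
    tensorBasis D E v w i = (v i.1 ⊗ₜ[L] w i.2 : D.V ⊗[L] E.V) :=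
  Module.Basis.tensorProduct_apply' ..

lemma tensorBasis_repr (v : Module.Basis ι L D.V) (w : Module.Basis κ L E.V) (x : D.V) (y : E.V)
    (i : ι × κ) : (tensorBasis D E v w).repr (x ⊗ₜ[L] y : D.V ⊗[L] E.V) i =
      v.repr x i.1 * w.repr y i.2 :=
  (Module.Basis.tensorProduct_repr_tmul_apply v w x y i.1 i.2).trans (mul_comm _ _)

lemma phiMatrix_tensor (v : Module.Basis ι L D.V) (w : Module.Basis κ L E.V) :
    (D.tensor E).phiMatrix (tensorBasis D E v w) = D.phiMatrix v ⊗ₖ E.phiMatrix w := by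
  ext i j
  change (tensorBasis D E v w).repr ((D.tensor E).φ (tensorBasis D E v w j)) i = _
  rw [tensorBasis_apply]
  exact tensorBasis_repr v w _ _ i

lemma rank_tensor : (D.tensor E).rank = D.rank * E.rank := Module.finrank_tensorProduct

lemma tensorBasis_repr_vecMul {v v' : Module.Basis ι L D.V} {w w' : Module.Basis κ L E.V}
    {G : Matrix ι ι L} {H : Matrix κ κ L} (hG : ∀ x j, v'.repr x j = ∑ i, v.repr x i * G i j)
    (hH : ∀ y j, w'.repr y j = ∑ i, w.repr y i * H i j) (t : (D.tensor E).V) (j : ι × κ) :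
    (tensorBasis D E v' w').repr t j =
      ∑ i, (tensorBasis D E v w).repr t i * (G ⊗ₖ H) i j :=
  tensorProduct_repr_vecMul hG hH t j

/-- The basis of row coordinates changed by an invertible matrix. -/
lemma exists_basis_repr_vecMul {V : Type*} [AddCommGroup V] [Module L V] (v : Module.Basis ι L V)
    {G : Matrix ι ι L} (hG : G.det ≠ 0) :
    ∃ v' : Module.Basis ι L V, ∀ x j, v'.repr x j = ∑ i, v.repr x i * G i j := by
  have hu : IsUnit G.det := hG.isUnit
  refine ⟨Module.Basis.ofEquivFun (v.equivFun.trans (Matrix.toLinearEquivRight'OfInv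
    (Matrix.nonsing_inv_mul G hu) (Matrix.mul_nonsing_inv G hu))), fun x j => ?_⟩
  rfl

/-- The matrix identity expressing that a subspace of a tensor product is stable under the
Frobenius. -/
lemma map_mul_kronecker_eq {F : Isoc.{w} σ} (f : F ⟶ D.tensor E) {d : ℕ}
    (u : Module.Basis (Fin d) L F.V) (v : Module.Basis ι L D.V) (w : Module.Basis κ L E.V)
    {A : Matrix (Fin d) (ι × κ) L} (hA : ∀ k i, A k i = (tensorBasis D E v w).repr (f.lin (u k)) i) :
    A.map σ * (D.phiMatrix v)ᵀ ⊗ₖ (E.phiMatrix w)ᵀ = (F.phiMatrix u)ᵀ * A := by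
  ext k i
  have h1 : (tensorBasis D E v w).repr ((D.tensor E).φ (f.lin (u k))) i =
      (A.map σ * (D.phiMatrix v)ᵀ ⊗ₖ (E.phiMatrix w)ᵀ) k i := by
    rw [(D.tensor E).repr_phi (tensorBasis D E v w), Matrix.mul_apply]
    refine Finset.sum_congr rfl fun j _ => ?_
    rw [Matrix.map_apply, hA, mul_comm]
    congr 1
    exact congrFun (congrFun (phiMatrix_tensor v w) i) j
  rw [← h1, ← f.comm, Matrix.mul_apply]
  conv_lhs => rw [← u.sum_repr (F.φ (u k))]
  rw [map_sum, map_sum, Finsupp.finsetSum_apply]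
  refine Finset.sum_congr rfl fun l _ => ?_
  rw [map_smul, map_smul, Finsupp.smul_apply, smul_eq_mul, ← hA]
  rfl

end Tensor

section TensorLat

variable {L : Type*} [NormedField L] {σ : L ≃+* L} {K : Type*} [NormedField K]
  [IsUltrametricDist K] [Algebra L K] {D E : Isoc.{w} σ}
  {ι κ : Type*} [Fintype ι] [Fintype κ] [DecidableEq ι] [DecidableEq κ]

variable (K D E) in
/-- The identification of `(D ⊗ E)_K` with `D_K ⊗ E_K`. -/
def distribBC : (D.tensor E).bc K ≃ₗ[K] D.bc K ⊗[K] E.bc K :=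
  AlgebraTensorModule.distribBaseChange L K D.V E.V

variable (D E) in
/-- The basis of the base change of a tensor product formed by the tensors of basis vectors. -/
def tensorBasisBC (e : Module.Basis ι K (D.bc K)) (e' : Module.Basis κ K (E.bc K)) :
    Module.Basis (ι × κ) K ((D.tensor E).bc K) :=
  (e.tensorProduct e').map (distribBC K D E).symm

variable (K D E) in
/-- The tensor product of vectors in the base changes. -/
def tmulBC (x : D.bc K) (y : E.bc K) : (D.tensor E).bc K := (distribBC K D E).symm (x ⊗ₜ[K] y)

lemma tmulBC_tmul (x : D.V) (y : E.V) (a b : K) : tmulBC K D E (a ⊗ₜ x) (b ⊗ₜ y) =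
    (a * b) ⊗ₜ[L] (x ⊗ₜ[L] y : D.V ⊗[L] E.V) :=
  AlgebraTensorModule.distribBaseChange_symm_tmul ..

lemma tensorBasisBC_apply (e : Module.Basis ι K (D.bc K)) (e' : Module.Basis κ K (E.bc K))
    (i : ι × κ) : tensorBasisBC D E e e' i = tmulBC K D E (e i.1) (e' i.2) := by
  rw [tensorBasisBC, Module.Basis.map_apply, Module.Basis.tensorProduct_apply']
  rfl

lemma tensorBasisBC_repr (e : Module.Basis ι K (D.bc K)) (e' : Module.Basis κ K (E.bc K))
    (x : D.bc K) (y : E.bc K) (i : ι × κ) :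
    (tensorBasisBC D E e e').repr (tmulBC K D E x y) i = e.repr x i.1 * e'.repr y i.2 := by
  rw [tensorBasisBC, tmulBC, Module.Basis.map_repr, LinearEquiv.trans_apply, LinearEquiv.symm_symm,
    LinearEquiv.apply_symm_apply]
  exact (Module.Basis.tensorProduct_repr_tmul_apply e e' x y i.1 i.2).trans (mul_comm _ _)

lemma tmulBC_mem {Ξ : Submodule (integers K) (D.bc K)} {Θ : Submodule (integers K) (E.bc K)}
    {x : D.bc K} {y : E.bc K} (hx : x ∈ Ξ) (hy : y ∈ Θ) : tmulBC K D E x y ∈ tensorLat D E Ξ Θ :=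
  Submodule.subset_span ⟨x, hx, y, hy, rfl⟩

lemma isBasisOf_tensorLat {Ξ : Submodule (integers K) (D.bc K)}
    {Θ : Submodule (integers K) (E.bc K)} {e : Module.Basis ι K (D.bc K)}
    {e' : Module.Basis κ K (E.bc K)} (he : IsBasisOf e Ξ) (he' : IsBasisOf e' Θ) :
    IsBasisOf (tensorBasisBC D E e e') (tensorLat D E Ξ Θ) := by
  intro x
  constructor
  · intro hx
    induction hx using Submodule.span_induction with
    | mem x hx =>
      obtain ⟨ξ, hξ, θ, hθ, rfl⟩ := hx
      intro i
      refine (congrArg norm (tensorBasisBC_repr e e' ξ θ i)).trans_le ?_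
      rw [norm_mul]
      exact mul_le_one₀ ((he _).1 hξ _) (norm_nonneg _) ((he' _).1 hθ _)
    | zero => simp
    | add x y _ _ hx hy =>
      intro i
      rw [map_add, Finsupp.add_apply]
      exact (IsUltrametricDist.norm_add_le_max _ _).trans (max_le (hx i) (hy i))
    | smul a x _ hx =>
      intro i
      rw [← algebraMap_smul K a x, map_smul, Finsupp.smul_apply, smul_eq_mul, norm_mul]
      exact mul_le_one₀ (mem_integers.1 a.2) (norm_nonneg _) (hx i)
  · intro hx
    rw [← (tensorBasisBC D E e e').sum_repr x]
    refine IsBasisOf.sum_smul_mem (fun i => ?_) hx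
    rw [tensorBasisBC_apply]
    exact tmulBC_mem (he.mem _) (he'.mem _)

lemma toMatrix_tensorBasisBC (e : Module.Basis ι K (D.bc K)) (e' : Module.Basis κ K (E.bc K))
    (v : Module.Basis ι L D.V) (w : Module.Basis κ L E.V) :
    (tensorBasisBC D E e e').toMatrix (Algebra.TensorProduct.basis K (tensorBasis D E v w)) =
      e.toMatrix (Algebra.TensorProduct.basis K v) ⊗ₖ
        e'.toMatrix (Algebra.TensorProduct.basis K w) := by
  ext i j
  rw [Module.Basis.toMatrix_apply, Matrix.kroneckerMap_apply, Module.Basis.toMatrix_apply,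
    Module.Basis.toMatrix_apply, Algebra.TensorProduct.basis_apply,
    Algebra.TensorProduct.basis_apply, Algebra.TensorProduct.basis_apply, ← tensorBasisBC_repr,
    tmulBC_tmul, tensorBasis_apply, mul_one]
  rfl

variable [Admissible σ K] [IsDiscreteValuationRing (integers K)]

/-- The degree of a tensor product. -/
lemma degLat_tensor (Ξ : Submodule (integers K) (D.bc K)) [Submodule.IsLattice K Ξ]
    (Θ : Submodule (integers K) (E.bc K)) [Submodule.IsLattice K Θ] :
    (D.tensor E).degLat (tensorLat D E Ξ Θ) =
      E.rank * D.degLat Ξ + D.rank * E.degLat Θ := by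
  let v := Module.finBasis L D.V
  let w := Module.finBasis L E.V
  obtain ⟨e, he⟩ := exists_isBasisOf Ξ (Algebra.TensorProduct.basis K v)
  obtain ⟨e', he'⟩ := exists_isBasisOf Θ (Algebra.TensorProduct.basis K w)
  have h1 := IsBasisOf.det_ne_zero (K := K) e (Algebra.TensorProduct.basis K v)
  have h2 := IsBasisOf.det_ne_zero (K := K) e' (Algebra.TensorProduct.basis K w)
  have h3 := D.det_phiMatrix_ne_zero v
  have h4 := E.det_phiMatrix_ne_zero w
  rw [(D.tensor E).degLat_eq (tensorBasis D E v w) (isBasisOf_tensorLat he he'), D.degLat_eq v he,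
    E.degLat_eq w he', phiMatrix_tensor, Module.Basis.det_apply, toMatrix_tensorBasisBC,
    Matrix.det_kronecker, Matrix.det_kronecker, ← Module.Basis.det_apply, ← Module.Basis.det_apply,
    addVal_mul (pow_ne_zero _ h1) (pow_ne_zero _ h2), addVal_mul (pow_ne_zero _ h3)
    (pow_ne_zero _ h4), addVal_pow, addVal_pow, addVal_pow, addVal_pow, Fintype.card_fin,
    Fintype.card_fin]
  change (E.rank : ℝ) * _ + (D.rank : ℝ) * _ - ((E.rank : ℝ) * _ + (D.rank : ℝ) * _) = _
  ring

end TensorLat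

end Isoc

/-! ### Semistability of tensor products -/

namespace Isoc

variable {L : Type*} [NormedField L] {σ : L ≃+* L} {D E F : Isoc.{w} σ}

/-- The coordinate matrix of a subobject of a tensor product has linearly independent rows. -/
lemma exists_rightInverse_of_injective (f : F ⟶ D.tensor E) (hf : Function.Injective f.lin) {d : ℕ}
    {X : Type*} [Fintype X] [DecidableEq X] (u : Module.Basis (Fin d) L F.V)
    (b : Module.Basis X L (D.tensor E).V) :
    ∃ R : Matrix X (Fin d) L, (Matrix.of fun k i => b.repr (f.lin (u k)) i) * R = 1 := by
  obtain ⟨g, hg⟩ := f.lin.exists_leftInverse_of_injective (LinearMap.ker_eq_bot.2 hf)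
  refine ⟨Matrix.of fun i k => u.repr (g (b i)) k, ?_⟩
  ext k l
  have h1 : g (f.lin (u k)) = u k := LinearMap.congr_fun hg (u k)
  rw [Matrix.mul_apply, Matrix.one_apply]
  have h2 : u.repr (g (f.lin (u k))) l = ∑ i, b.repr (f.lin (u k)) i * u.repr (g (b i)) l := by
    conv_lhs => rw [← b.sum_repr (f.lin (u k))]
    simp only [map_sum, map_smul]
    rw [Finsupp.finsetSum_apply]
    rfl
  refine h2.symm.trans ?_
  rw [h1, Module.Basis.repr_self, Finsupp.single_apply]

variable {K : Type*} [NormedField K] [IsUltrametricDist K] [Algebra L K] [Admissible σ K]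
  [IsDiscreteValuationRing (integers K)] {ι κ : Type*} [Fintype ι] [Fintype κ] [DecidableEq ι]
  [DecidableEq κ]

/-- The base changed coordinate matrix of a sublattice of a tensor product is the product of its
covolume matrix and an integral matrix. -/
lemma exists_integral_factor (f : F ⟶ D.tensor E) {Ξ : Submodule (integers K) (D.bc K)}
    {Θ : Submodule (integers K) (E.bc K)} {Λ : Submodule (integers K) (F.bc K)}
    (hmap : ∀ u ∈ Λ, f.lin.baseChange K u ∈ tensorLat D E Ξ Θ) {d : ℕ}
    (u : Module.Basis (Fin d) L F.V) (v : Module.Basis ι L D.V) (w : Module.Basis κ L E.V)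
    {A : Matrix (Fin d) (ι × κ) L} (hA : ∀ k i, A k i = (tensorBasis D E v w).repr (f.lin (u k)) i)
    {e : Module.Basis ι K (D.bc K)} {e' : Module.Basis κ K (E.bc K)}
    {l : Module.Basis (Fin d) K (F.bc K)} (he : IsBasisOf e Ξ) (he' : IsBasisOf e' Θ)
    (hl : IsBasisOf l Λ) :
    ∃ C : Matrix (Fin d) (ι × κ) K, (∀ k i, ‖C k i‖ ≤ 1) ∧
      A.map (algebraMap L K) * (e.toMatrix (Algebra.TensorProduct.basis K v))ᵀ ⊗ₖ
        (e'.toMatrix (Algebra.TensorProduct.basis K w))ᵀ =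
      (l.toMatrix (Algebra.TensorProduct.basis K u))ᵀ * C := by
  set ē := tensorBasisBC D E e e' with hē
  set b := tensorBasis D E v w with hb
  refine ⟨Matrix.of fun k i => ē.repr (f.lin.baseChange K (l k)) i, fun k i =>
    (isBasisOf_tensorLat he he' _).1 (hmap _ (hl.mem k)) i, ?_⟩
  ext k i
  have h1 : ē.repr (f.lin.baseChange K (Algebra.TensorProduct.basis K u k)) i =
      ((l.toMatrix (Algebra.TensorProduct.basis K u))ᵀ *
        Matrix.of fun k i => ē.repr (f.lin.baseChange K (l k)) i) k i := by
    conv_lhs => rw [← l.sum_repr (Algebra.TensorProduct.basis K u k)]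
    simp only [map_sum, map_smul]
    rw [Finsupp.finsetSum_apply, Matrix.mul_apply]
    rfl
  have h2 : f.lin.baseChange K (Algebra.TensorProduct.basis K u k) =
      ∑ j, algebraMap L K (A k j) • Algebra.TensorProduct.basis K b j := by
    rw [Algebra.TensorProduct.basis_apply, LinearMap.baseChange_tmul]
    conv_lhs => rw [← b.sum_repr (f.lin (u k))]
    rw [TensorProduct.tmul_sum]
    refine Finset.sum_congr rfl fun j _ => ?_
    rw [← hA, Algebra.TensorProduct.basis_apply, TensorProduct.tmul_smul, algebraMap_smul]
  rw [← h1, h2, map_sum, Finsupp.finsetSum_apply, Matrix.mul_apply]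
  refine Finset.sum_congr rfl fun j _ => ?_
  rw [map_smul, Finsupp.smul_apply, Matrix.map_apply, smul_eq_mul]
  congr 1
  exact (congrFun (congrFun (toMatrix_tensorBasisBC e e' v w) i) j).symm

variable [IsUltrametricDist L] [CompleteSpace L]

/-- The Frobenius part of the degree bound in terms of valuations. -/
lemma exists_addVal_det_bound (K : Type*) [NormedField K] [IsUltrametricDist K] [Algebra L K]
    [Admissible σ K] [IsDiscreteValuationRing (integers K)] (hL : ∃ w : L, 1 < ‖w‖) {d : ℕ}
    {A : Matrix (Fin d) (ι × κ) L} {a : ι → ℝ} {b : κ → ℝ} {m : ℝ} (hopt : IsGeomOptimal A a b m)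
    {Φ : Matrix ι ι L} {Ψ : Matrix κ κ L} {T : Matrix (Fin d) (Fin d) L} (hΦ : Φ.det ≠ 0)
    (hΨ : Ψ.det ≠ 0) (hT : T.det ≠ 0) (h : A.map σ * Φ ⊗ₖ Ψ = T * A) :
    ∃ (η : ι → ℝ) (θ : κ → ℝ),
      (∀ s, ∑ i : {i // s ≤ a i}, η i =
        addVal (Φ.submatrix (Subtype.val : {i // s ≤ a i} → ι) Subtype.val).det) ∧
      (∀ s, ∑ i : {i // s ≤ b i}, θ i =
        addVal (Ψ.submatrix (Subtype.val : {i // s ≤ b i} → κ) Subtype.val).det) ∧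
      ∑ i, a i * η i + ∑ j, b j * θ j ≤ addVal T.det := by
  rcases (log_uniformizerNorm_nonpos (E := L)).lt_or_eq with hlog | hlog
  · obtain ⟨η, θ, hη, hθ, hle⟩ := hopt.log_det_le K hL hlog hΦ hΨ hT h
    refine ⟨fun i => η i / Real.log (uniformizerNorm L), fun i => θ i / Real.log (uniformizerNorm L),
      fun s => ?_, fun s => ?_, ?_⟩
    · rw [← Finset.sum_div, hη]
      rfl
    · rw [← Finset.sum_div, hθ]
      rfl
    · simp only [mul_div_assoc']
      rw [← Finset.sum_div, ← Finset.sum_div, ← add_div]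
      exact div_le_div_of_nonpos_of_le hlog.le hle
  · -- all valuations vanish
    have h0 : ∀ x : L, addVal x = 0 := fun x => by rw [addVal, expo, hlog, div_zero]
    exact ⟨0, 0, by simp [h0], by simp [h0], by simp [h0]⟩

/-- The degree of a subobject of a tensor product is bounded in terms of the degrees of the
subobjects in two weight filtrations on the factors, whose weights have total sum the rank. -/
theorem exists_degree_bound [CharZero L] (hL : ∃ w : L, 1 < ‖w‖) (f : F ⟶ D.tensor E)
    (hf : Function.Injective f.lin) (Ξ : Submodule (integers K) (D.bc K)) [Submodule.IsLattice K Ξ]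
    (Θ : Submodule (integers K) (E.bc K)) [Submodule.IsLattice K Θ]
    (Λ : Submodule (integers K) (F.bc K)) [Submodule.IsLattice K Λ]
    (hmap : ∀ u ∈ Λ, f.lin.baseChange K u ∈ tensorLat D E Ξ Θ) :
    ∃ (a x : Fin D.rank → ℝ) (b y : Fin E.rank → ℝ), ∑ i, a i = F.rank ∧ ∑ j, b j = F.rank ∧
      (∀ s, ∃ W : D.subobjects, D.subRank W = Fintype.card {i // s ≤ a i} ∧
        D.subDeg Ξ W = ∑ i : {i // s ≤ a i}, x i) ∧
      (∀ s, ∃ W : E.subobjects, E.subRank W = Fintype.card {i // s ≤ b i} ∧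
        E.subDeg Θ W = ∑ i : {i // s ≤ b i}, y i) ∧
      F.degLat Λ ≤ ∑ i, a i * x i + ∑ j, b j * y j := by
  let u : Module.Basis (Fin F.rank) L F.V := Module.finBasis L F.V
  let v₀ : Module.Basis (Fin D.rank) L D.V := Module.finBasis L D.V
  let w₀ : Module.Basis (Fin E.rank) L E.V := Module.finBasis L E.V
  obtain ⟨R, hR⟩ := exists_rightInverse_of_injective f hf u (tensorBasis D E v₀ w₀)
  obtain ⟨G, H, a, b, m, hG, hH, hopt⟩ := exists_isGeomOptimal hR
  obtain ⟨v, hv⟩ := exists_basis_repr_vecMul v₀ hG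
  obtain ⟨w, hw⟩ := exists_basis_repr_vecMul w₀ hH
  set A := Matrix.of (fun k i => (tensorBasis D E v₀ w₀).repr (f.lin (u k)) i) * G ⊗ₖ H with hAdef
  have hA : ∀ k i, A k i = (tensorBasis D E v w).repr (f.lin (u k)) i := fun k i =>
    (tensorBasis_repr_vecMul hv hw (f.lin (u k)) i).symm
  have hfrob := map_mul_kronecker_eq f u v w hA
  have hΦ : (D.phiMatrix v)ᵀ.det ≠ 0 := by
    rw [Matrix.det_transpose]
    exact D.det_phiMatrix_ne_zero v
  have hΨ : (E.phiMatrix w)ᵀ.det ≠ 0 := by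
    rw [Matrix.det_transpose]
    exact E.det_phiMatrix_ne_zero w
  have hT : (F.phiMatrix u)ᵀ.det ≠ 0 := by
    rw [Matrix.det_transpose]
    exact F.det_phiMatrix_ne_zero u
  obtain ⟨htri, htri'⟩ := hopt.triangular hΦ hΨ hfrob
  obtain ⟨η, θ, hη, hθ, hle⟩ := exists_addVal_det_bound K hL hopt hΦ hΨ hT hfrob
  obtain ⟨e, he, hM, hW⟩ := exists_flag_degrees Ξ v (a := a) fun i j hij => by
    by_contra h0
    exact hij.not_ge (htri i j h0)
  obtain ⟨e', he', hN, hW'⟩ := exists_flag_degrees Θ w (a := b) fun i j hij => by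
    by_contra h0
    exact hij.not_ge (htri' i j h0)
  obtain ⟨l, hl⟩ := exists_isBasisOf Λ (Algebra.TensorProduct.basis K u)
  obtain ⟨C, hC, hAC⟩ := exists_integral_factor f hmap u v w hA he he' hl
  have hMdet : (e.toMatrix (Algebra.TensorProduct.basis K v))ᵀ.det ≠ 0 := by
    rw [Matrix.det_transpose, ← Module.Basis.det_apply]
    exact IsBasisOf.det_ne_zero _ _
  have hNdet : (e'.toMatrix (Algebra.TensorProduct.basis K w))ᵀ.det ≠ 0 := by
    rw [Matrix.det_transpose, ← Module.Basis.det_apply]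
    exact IsBasisOf.det_ne_zero _ _
  obtain ⟨h, h', J, hh, hh', hJ, hJle⟩ := hopt.exists_addVal_minor_le
    (fun x => mem_integers.2 (norm_algebraMap_le σ x)) hM hN hMdet hNdet
  -- the coordinates of `Λ` in the bases `e` and `e'` are integral
  have hlat : addVal (l.det (Algebra.TensorProduct.basis K u)) ≤ ∑ i, a i * h i + ∑ j, b j * h' j := by
    refine le_trans (addVal_le_of_norm_le hJ ?_) hJle
    rw [hAC, minor_mul_left, norm_mul, Matrix.det_transpose, ← Module.Basis.det_apply]
    refine mul_le_of_le_one_right (norm_nonneg _) ?_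
    exact IsocLat.norm_det_le_one _ fun i j => hC i (J j)
  refine ⟨a, fun i => h i - η i, b, fun j => h' j - θ j, hopt.sum_eq.1, hopt.sum_eq.2, fun s => ?_,
    fun s => ?_, ?_⟩
  · obtain ⟨W, hW1, hW2⟩ := hW s
    refine ⟨W, hW1, ?_⟩
    rw [hW2, Finset.sum_sub_distrib, hh, hη]
  · obtain ⟨W, hW1, hW2⟩ := hW' s
    refine ⟨W, hW1, ?_⟩
    rw [hW2, Finset.sum_sub_distrib, hh', hθ]
  · rw [F.degLat_eq u hl, ← Matrix.det_transpose (F.phiMatrix u)]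
    simp only [mul_sub, Finset.sum_sub_distrib]
    linarith

lemma exists_forall_le {ι : Type*} [Finite ι] (a : ι → ℝ) : ∃ t, ∀ i, t ≤ a i := by
  obtain ⟨t, ht⟩ := (Set.finite_range a).bddBelow
  exact ⟨t, fun i => ht (Set.mem_range_self i)⟩

/-- The weighted sum of degrees on a semistable object. -/
lemma sum_mul_le_of_isSemistableLat (Ξ : Submodule (integers K) (D.bc K)) [Submodule.IsLattice K Ξ]
    (hss : D.IsSemistableLat Ξ) {a x : Fin D.rank → ℝ}
    (h : ∀ s, ∃ W : D.subobjects, D.subRank W = Fintype.card {i // s ≤ a i} ∧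
        D.subDeg Ξ W = ∑ i : {i // s ≤ a i}, x i) :
    ∑ i, a i * x i ≤ D.slopeLat Ξ * ∑ i, a i := by
  obtain ⟨hnt, hss⟩ := (isSemistableLat_iff Ξ).1 hss
  have hpos : (0 : ℝ) < D.rank := Nat.cast_pos.2 (Module.finrank_pos_iff.2 hnt)
  have h1 : ∑ i, a i * (x i - D.slopeLat Ξ) ≤ 0 := by
    refine sum_mul_nonpos (fun s => ?_) ?_
    · obtain ⟨W, hW1, hW2⟩ := h s
      have := hss W
      rw [hW1, hW2] at this
      rw [Finset.sum_sub_distrib, Finset.sum_const, Finset.card_univ, nsmul_eq_mul]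
      linarith
    -- for small `t` the subobject is everything
    · obtain ⟨t, ht⟩ := exists_forall_le a
      obtain ⟨W, hW1, hW2⟩ := h t
      have hcard : Fintype.card {i // t ≤ a i} = D.rank := by
        rw [Fintype.card_subtype, Finset.filter_true_of_mem fun i _ => ht i, Finset.card_univ,
          Fintype.card_fin]
      have hW : W = ⊤ := by
        refine Subtype.ext (Submodule.eq_top_of_finrank_eq ?_)
        exact hW1.trans hcard
      have hsum : ∑ i : {i // t ≤ a i}, x i = ∑ i, x i := by
        rw [← Finset.sum_subtype Finset.univ (fun i => by simp [ht i]) x]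
      rw [hW, subDeg_top, hsum] at hW2
      rw [Finset.sum_sub_distrib, ← hW2, Finset.sum_const, Finset.card_univ, Fintype.card_fin,
        nsmul_eq_mul, slopeLat, mul_div_cancel₀ _ hpos.ne', sub_self]
  simp only [mul_sub, Finset.sum_sub_distrib] at h1
  rw [← Finset.sum_mul] at h1
  linarith

/-- The tensor product of two semistable objects is semistable. -/
theorem isSemistableLat_tensor [CharZero L] (hL : ∃ w : L, 1 < ‖w‖)
    (Ξ : Submodule (integers K) (D.bc K)) [Submodule.IsLattice K Ξ]
    (Θ : Submodule (integers K) (E.bc K)) [Submodule.IsLattice K Θ]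
    (hD : D.IsSemistableLat Ξ) (hE : E.IsSemistableLat Θ) :
    (D.tensor E).IsSemistableLat (tensorLat D E Ξ Θ) ∧
      (D.tensor E).slopeLat (tensorLat D E Ξ Θ) = D.slopeLat Ξ + E.slopeLat Θ := by
  have hΞΘ : Submodule.IsLattice K (tensorLat D E Ξ Θ) :=
    tensorLat_isLattice (⟨D, Ξ, inferInstance⟩ : BunIsoc σ K) ⟨E, Θ, inferInstance⟩
  have hposD : 0 < D.rank := Module.finrank_pos_iff.2 hD.1
  have hposE : 0 < E.rank := Module.finrank_pos_iff.2 hE.1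
  have hslope : (D.tensor E).slopeLat (tensorLat D E Ξ Θ) = D.slopeLat Ξ + E.slopeLat Θ := by
    have h1 : (D.rank : ℝ) ≠ 0 := by exact_mod_cast hposD.ne'
    have h2 : (E.rank : ℝ) ≠ 0 := by exact_mod_cast hposE.ne'
    rw [slopeLat, slopeLat, slopeLat, degLat_tensor, rank_tensor, Nat.cast_mul]
    field_simp
  refine ⟨(isSemistableLat_iff _).2 ⟨?_, fun W => ?_⟩, hslope⟩
  · have h1 : 0 < (D.tensor E).rank := by
      rw [rank_tensor]
      positivity
    exact Module.finrank_pos_iff.1 h1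
  · have hsub : Submodule.IsLattice K ((D.tensor E).subisocLat (tensorLat D E Ξ Θ) W.1 W.2) :=
      subLat_isLattice (D.tensor E) (tensorLat D E Ξ Θ) W.1
    obtain ⟨a, x, b, y, ha, hb, hW, hW', hle⟩ := exists_degree_bound hL (subtypeHom W.2)
      (Submodule.injective_subtype W.1) Ξ Θ ((D.tensor E).subisocLat (tensorLat D E Ξ Θ) W.1 W.2)
      fun u hu => hu
    have h1 := sum_mul_le_of_isSemistableLat Ξ hD hW
    have h2 := sum_mul_le_of_isSemistableLat Θ hE hW'
    rw [ha] at h1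
    rw [hb] at h2
    rw [hslope, add_mul]
    exact hle.trans (add_le_add h1 h2)

end Isoc

/-! ### Bases adapted to the Harder–Narasimhan filtration -/

namespace Isoc

section AdaptedBasis

variable {L : Type*} [NormedField L] {σ : L ≃+* L} {D : Isoc.{w} σ}

/-- Every nonzero step of a filtration is constant up to a jump. -/
lemma Filtration.exists_jump (f : D.Filtration) {s : ℝ} (h : f.level s ≠ ⊥) :
    ∃ t ≥ s, f.level t = f.level s ∧ f.next t < f.level t := by
  let T : Set ℝ := {r | f.level r = f.level s}
  have hne : T.Nonempty := ⟨s, rfl⟩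
  have hbdd : BddAbove T := by
    obtain ⟨r, hr⟩ := f.separated
    refine ⟨r, fun t ht => not_lt.1 fun hrt => h ?_⟩
    rw [← show f.level t = f.level s from ht]
    exact le_bot_iff.1 ((f.level_antitone hrt.le).trans (le_of_eq (Subtype.ext hr)))
  have hst : s ≤ sSup T := le_csSup hbdd rfl
  have hlevel : f.level (sSup T) = f.level s := by
    obtain ⟨t, hts, ht⟩ := f.exists_level_eq (sSup T)
    obtain ⟨r, hr, htr⟩ := exists_lt_of_lt_csSup hne hts
    refine le_antisymm (f.level_antitone hst) ?_
    rw [← ht, ← show f.level r = f.level s from hr]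
    exact f.level_antitone htr.le
  refine ⟨sSup T, hst, hlevel, (f.next_le_level _).lt_of_ne fun heq => ?_⟩
  obtain ⟨t, ht, hnt⟩ := f.exists_next_eq (sSup T)
  have h1 : t ∈ T := (hnt.symm.trans heq).trans hlevel
  exact (le_csSup hbdd h1).not_gt ht

/-- A filtration has an adapted basis. -/
lemma Filtration.exists_adapted_basis (f : D.Filtration) {ι : Type*} [Fintype ι] [DecidableEq ι]
    (b : Module.Basis ι L D.V) : ∃ (b' : Module.Basis ι L D.V) (a : ι → ℝ),
      ∀ s x, x ∈ f.Fil s ↔ ∀ i, b'.repr x i ≠ 0 → s ≤ a i := by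
  classical
  -- the last index at which a vector lies in the filtration
  have hlast : ∀ x : D.V, x ≠ 0 → ∃ t : ℝ, ∀ s, x ∈ f.Fil s ↔ s ≤ t := by
    intro x hx
    obtain ⟨r, hr⟩ := f.exhaustive
    obtain ⟨r', hr'⟩ := f.separated
    let T : Set ℝ := {s | x ∈ f.Fil s}
    have hne : T.Nonempty := ⟨r, by change x ∈ f.Fil r; rw [hr]; trivial⟩
    have hbdd : BddAbove T := ⟨r', fun t (ht : x ∈ f.Fil t) => not_lt.1 fun hrt => hx (by
      have := f.antitone hrt.le ht
      rwa [hr', Submodule.mem_bot] at this)⟩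
    refine ⟨sSup T, fun s => ⟨fun hs => le_csSup hbdd hs, fun hs => ?_⟩⟩
    obtain ⟨t, hts, ht⟩ := f.exists_level_eq (sSup T)
    obtain ⟨q, hq, htq⟩ := exists_lt_of_lt_csSup hne hts
    refine f.antitone hs ?_
    have h1 : f.Fil t = f.Fil (sSup T) := congrArg Subtype.val ht
    rw [← h1]
    exact f.antitone htq.le hq
  choose! τ hτ using hlast
  let N : D.V → WithTop ℝ := fun x => if x = 0 then ⊤ else (τ x : WithTop ℝ)
  have hN : ∀ (x : D.V) (s : ℝ), x ∈ f.Fil s ↔ (s : WithTop ℝ) ≤ N x := by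
    intro x s
    by_cases hx : x = 0
    · simp [N, hx]
    · rw [hτ x hx, show N x = (τ x : WithTop ℝ) from if_neg hx, WithTop.coe_le_coe]
  have hle : ∀ u v : WithTop ℝ, (∀ s : ℝ, (s : WithTop ℝ) ≤ u → (s : WithTop ℝ) ≤ v) → u ≤ v := by
    intro u v h
    induction u using WithTop.recTopCoe with
    | coe u => exact h u le_rfl
    | top =>
      induction v using WithTop.recTopCoe with
      | top => exact le_rfl
      | coe v =>
        have := WithTop.coe_le_coe.1 (h (v + 1) le_top)
        linarith
  have hadd : ∀ x y, min (N x) (N y) ≤ N (x + y) := fun x y => hle _ _ fun s hs => by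
    rw [le_min_iff, ← hN, ← hN] at hs
    rw [← hN]
    exact add_mem hs.1 hs.2
  have hsmul : ∀ (c : L) x, c ≠ 0 → N (c • x) = N x := fun c x hc => by
    refine le_antisymm (hle _ _ fun s hs => ?_) (hle _ _ fun s hs => ?_)
    · rw [← hN] at hs ⊢
      have := Submodule.smul_mem _ c⁻¹ hs
      rwa [inv_smul_smul₀ hc] at this
    · rw [← hN] at hs ⊢
      exact Submodule.smul_mem _ c hs
  have hfin : (Set.range N).Finite := by
    let J : Set ℝ := {t | f.next t < f.level t}
    have hJ : J.Finite := by
      have hinj : Set.InjOn (fun t => D.subRank (f.level t)) J := by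
        have key : ∀ t ∈ J, ∀ t', t < t' → D.subRank (f.level t') ≠ D.subRank (f.level t) :=
          fun t ht t' h => (D.subRank_strictMono ((f.level_le_next h).trans_lt ht)).ne
        intro t ht t' ht' h
        rcases lt_trichotomy t t' with h1 | h1 | h1
        · exact absurd h.symm (key t ht t' h1)
        · exact h1
        · exact absurd h (key t' ht' t h1)
      refine Set.Finite.of_injOn (t := Set.Iic D.rank) (fun t _ => ?_) hinj (Set.finite_Iic _)
      exact Submodule.finrank_le _
    refine ((hJ.image fun t : ℝ => (t : WithTop ℝ)).insert ⊤).subset ?_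
    rintro _ ⟨x, rfl⟩
    by_cases hx : x = 0
    · left
      simp [N, hx]
    · right
      refine ⟨τ x, (f.next_le_level _).lt_of_ne fun heq => ?_, (if_neg hx).symm⟩
      obtain ⟨t, ht, hnt⟩ := f.exists_next_eq (τ x)
      have h1 : x ∈ f.Fil (τ x) := (hτ x hx _).2 le_rfl
      have h2 : f.Fil t = f.Fil (τ x) := congrArg Subtype.val (hnt.symm.trans heq)
      rw [← h2, hτ x hx] at h1
      exact h1.not_gt ht
  obtain ⟨b', -, hb'⟩ := IsocLat.exists_adapted_basis b hadd hsmul hfin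
    (r := fun i => (Fintype.equivFin ι i : ℕ))
    (fun i j h => (Fintype.equivFin ι).injective (Fin.ext h))
  have hb : ∀ i s, b' i ∈ f.Fil s ↔ s ≤ τ (b' i) := fun i => hτ _ (b'.ne_zero i)
  refine ⟨b', fun i => τ (b' i), fun s x => ⟨fun hx i hi => ?_, fun h => ?_⟩⟩
  · rw [← hb, hN]
    exact ((hN x s).1 hx).trans (hb' x i hi)
  · rw [← b'.sum_repr x]
    refine Submodule.sum_mem _ fun i _ => ?_
    by_cases hi : b'.repr x i = 0
    · rw [hi, zero_smul]
      exact zero_mem _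
    · exact Submodule.smul_mem _ _ ((hb i s).2 (h i hi))

lemma mem_Fil_of_adapted {f : D.Filtration} {ι : Type*} [Fintype ι] {b : Module.Basis ι L D.V}
    {a : ι → ℝ} (h : ∀ s x, x ∈ f.Fil s ↔ ∀ i, b.repr x i ≠ 0 → s ≤ a i) {s : ℝ} {i : ι} :
    b i ∈ f.Fil s ↔ s ≤ a i := by
  classical
  rw [h]
  refine ⟨fun h => h i (by simp), fun h j hj => ?_⟩
  rw [Module.Basis.repr_self, Finsupp.single_apply, ne_eq, ite_eq_right_iff, not_forall] at hj
  exact hj.1 ▸ h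

lemma finrank_Fil_of_adapted {f : D.Filtration} {ι : Type*} [Fintype ι] {b : Module.Basis ι L D.V}
    {a : ι → ℝ} (h : ∀ s x, x ∈ f.Fil s ↔ ∀ i, b.repr x i ≠ 0 → s ≤ a i) (s : ℝ) :
    Module.finrank L (f.Fil s) = Fintype.card {i // s ≤ a i} := by
  have hspan : f.Fil s = Submodule.span L (Set.range (b ∘ (Subtype.val : {i // s ≤ a i} → ι))) := by
    refine le_antisymm (fun x hx => ?_) (Submodule.span_le.2 ?_)
    · rw [← b.sum_repr x]
      refine Submodule.sum_mem _ fun i _ => ?_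
      by_cases hi : b.repr x i = 0
      · rw [hi, zero_smul]
        exact zero_mem _
      · exact Submodule.smul_mem _ _ (Submodule.subset_span ⟨⟨i, (h s x).1 hx i hi⟩, rfl⟩)
    · rintro _ ⟨i, rfl⟩
      exact (mem_Fil_of_adapted h).2 i.2
  rw [hspan]
  exact finrank_span_eq_card (b.linearIndependent.comp _ Subtype.val_injective)

end AdaptedBasis

variable {L : Type*} [NormedField L] {σ : L ≃+* L}
  {K : Type*} [NormedField K] [IsUltrametricDist K] [Algebra L K] [Admissible σ K]
  [IsDiscreteValuationRing (integers K)] {D : Isoc.{w} σ}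

/-- The function `deg - s · rank` takes the same value at the step `s` and at the following one. -/
lemma tilt_level_eq_tilt_next (Ξ : Submodule (integers K) (D.bc K)) [Submodule.IsLattice K Ξ]
    (s : ℝ) : D.tilt Ξ s ((D.hnFil Ξ).level s) = D.tilt Ξ s ((D.hnFil Ξ).next s) :=
  ((subquo_semistable_iff Ξ ((D.hnFil Ξ).next s).2 ((D.hnFil Ξ).isSub s)
    ((D.hnFil Ξ).next_le_level s) s).1 ((isHNLat_iff_eq Ξ _).2 rfl s)).1

/-- The degree is the sum of the weights of a basis adapted to the Harder–Narasimhan filtration. -/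
lemma sum_weights_eq_degLat (Ξ : Submodule (integers K) (D.bc K)) [Submodule.IsLattice K Ξ]
    {ι : Type*} [Fintype ι] {b : Module.Basis ι L D.V} {a : ι → ℝ}
    (h : ∀ s x, x ∈ (D.hnFil Ξ).Fil s ↔ ∀ i, b.repr x i ≠ 0 → s ≤ a i) :
    ∑ i, a i = D.degLat Ξ := by
  classical
  set f := D.hnFil Ξ with hf
  have hcard : ∀ s, D.subRank (f.level s) = (Finset.univ.filter fun i => s ≤ a i).card := fun s => by
    rw [← Fintype.card_subtype]
    exact finrank_Fil_of_adapted h s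
  have key : ∀ (n : ℕ) (s : ℝ), D.subRank (f.level s) ≤ n →
      ∑ i with s ≤ a i, a i = D.subDeg Ξ (f.level s) := by
    intro n
    induction n with
    | zero =>
      intro s hs
      have h1 : f.level s = ⊥ := Subtype.ext (Submodule.finrank_eq_zero.1 (Nat.le_zero.1 hs))
      have h2 := hcard s
      rw [Nat.le_zero.1 hs, eq_comm, Finset.card_eq_zero] at h2
      rw [h1, subDeg_bot, h2, Finset.sum_empty]
    | succ n ih =>
      intro s hs
      by_cases hbot : f.level s = ⊥
      · refine ih s ?_
        rw [hbot, subRank_bot]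
        exact Nat.zero_le _
      obtain ⟨t, hst, hlevel, hlt⟩ := f.exists_jump hbot
      obtain ⟨r, hr, hnext⟩ := f.exists_next_eq t
      have h1 := ih r (by
        rw [← hnext]
        have := D.subRank_strictMono hlt
        rw [hlevel] at this
        omega)
      have h2 := tilt_level_eq_tilt_next Ξ t
      change D.tilt Ξ t (f.level t) = D.tilt Ξ t (f.next t) at h2
      rw [hnext, tilt, tilt, ← h1, hlevel, ← hlevel, hcard, hcard] at h2
      have hS : (Finset.univ.filter fun i => s ≤ a i) = Finset.univ.filter fun i => t ≤ a i := by
        ext i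
        have h3 : f.Fil t = f.Fil s := congrArg Subtype.val hlevel
        rw [Finset.mem_filter, Finset.mem_filter, ← mem_Fil_of_adapted h, ← mem_Fil_of_adapted h,
          ← h3]
      have hsub : (Finset.univ.filter fun i => r ≤ a i) ⊆ Finset.univ.filter fun i => t ≤ a i :=
        Finset.monotone_filter_right _ fun i _ hi => hr.le.trans hi
      have h4 : ∑ i with t ≤ a i, (a i - t) = ∑ i with r ≤ a i, (a i - t) := by
        refine (Finset.sum_subset hsub fun i hi hi' => ?_).symm
        simp only [Finset.mem_filter, Finset.mem_univ, true_and] at hi hi'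
        rcases hi.eq_or_lt with h5 | h5
        · rw [h5, sub_self]
        · refine absurd ?_ hi'
          have h6 : b i ∈ (f.next t).1 := f.level_le_next h5 ((mem_Fil_of_adapted h).2 le_rfl)
          rw [hnext] at h6
          exact (mem_Fil_of_adapted h).1 h6
      simp only [Finset.sum_sub_distrib, Finset.sum_const, nsmul_eq_mul] at h4
      rw [hS, ← hlevel]
      linarith
  obtain ⟨s, hs⟩ := f.exhaustive
  have h1 : f.level s = ⊤ := Subtype.ext hs
  have h2 := key _ s le_rfl
  rw [h1, subDeg_top, Finset.filter_true_of_mem] at h2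
  · exact h2
  · intro i _
    rw [← mem_Fil_of_adapted h, hs]
    trivial

end Isoc

/-! ### Maps from tensor products of quotients -/

/-- A linear map on `V ⊗ W` which kills `ker p ⊗ W` and `V ⊗ ker q` factors through `p ⊗ q`. -/
lemma exists_tensor_factor {L V W V' W' Z : Type*} [Field L] [AddCommGroup V] [Module L V]
    [AddCommGroup W] [Module L W] [AddCommGroup V'] [Module L V'] [AddCommGroup W'] [Module L W']
    [AddCommGroup Z] [Module L Z] {p : V →ₗ[L] V'} {q : W →ₗ[L] W'} (hp : Function.Surjective p)
    (hq : Function.Surjective q) (g : V ⊗[L] W →ₗ[L] Z)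
    (h1 : ∀ x y, p x = 0 → g (x ⊗ₜ y) = 0) (h2 : ∀ x y, q y = 0 → g (x ⊗ₜ y) = 0) :
    ∃ h : V' ⊗[L] W' →ₗ[L] Z, ∀ x y, h (p x ⊗ₜ q y) = g (x ⊗ₜ y) := by
  obtain ⟨s, hs⟩ := p.exists_rightInverse_of_surjective (LinearMap.range_eq_top.2 hp)
  obtain ⟨t, ht⟩ := q.exists_rightInverse_of_surjective (LinearMap.range_eq_top.2 hq)
  refine ⟨g ∘ₗ TensorProduct.map s t, fun x y => ?_⟩
  have h3 : p (s (p x) - x) = 0 := by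
    rw [map_sub, sub_eq_zero]
    exact LinearMap.congr_fun hs (p x)
  have h4 : q (t (q y) - y) = 0 := by
    rw [map_sub, sub_eq_zero]
    exact LinearMap.congr_fun ht (q y)
  have h5 := h1 _ (t (q y)) h3
  have h6 := h2 x _ h4
  rw [TensorProduct.sub_tmul, map_sub, sub_eq_zero] at h5
  rw [TensorProduct.tmul_sub, map_sub, sub_eq_zero] at h6
  exact h5.trans h6

namespace Isoc

section TensorHom

variable {L : Type*} [Field L] {σ : L ≃+* L} {D E D' E' Z : Isoc.{w} σ}

/-- The tensor product of two morphisms. -/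
def tensorHom (f : D ⟶ D') (g : E ⟶ E') : D.tensor E ⟶ D'.tensor E' :=
  (⟨TensorProduct.map f.lin g.lin, fun t => by
    refine TensorProduct.induction_on (motive := fun t : D.V ⊗[L] E.V =>
      TensorProduct.map f.lin g.lin ((D.tensor E).φ t) =
        (D'.tensor E').φ (TensorProduct.map f.lin g.lin t)) t ?_ (fun x y => ?_) fun x y hx hy => ?_
    · exact (congrArg _ (map_zero (D.tensor E).φ)).trans ((map_zero _).trans
        ((congrArg _ (map_zero (TensorProduct.map f.lin g.lin))).trans
          (map_zero (D'.tensor E').φ)).symm)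
    · exact congrArg₂ (fun x y => x ⊗ₜ[L] y) (f.comm x) (g.comm y)
    · refine (congrArg _ (map_add (D.tensor E).φ x y)).trans ((map_add _ _ _).trans ?_)
      refine (congrArg₂ (· + ·) hx hy).trans ?_
      exact ((congrArg _ (map_add (TensorProduct.map f.lin g.lin) x y)).trans
          (map_add (D'.tensor E').φ _ _)).symm⟩ : Hom _ _)

/-- A morphism from a tensor product which vanishes on the kernels of two projections factors
through the tensor product of the quotients. -/
lemma exists_hom_of_quotients {p : D ⟶ D'} {q : E ⟶ E'} (hp : Function.Surjective p.lin)
    (hq : Function.Surjective q.lin) (g : D.tensor E ⟶ Z)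
    (h1 : ∀ x y, p.lin x = 0 → g.lin (x ⊗ₜ[L] y : D.V ⊗[L] E.V) = 0)
    (h2 : ∀ x y, q.lin y = 0 → g.lin (x ⊗ₜ[L] y : D.V ⊗[L] E.V) = 0) :
    ∃ h : D'.tensor E' ⟶ Z, ∀ x y, h.lin (p.lin x ⊗ₜ[L] q.lin y : D'.V ⊗[L] E'.V) =
      g.lin (x ⊗ₜ[L] y : D.V ⊗[L] E.V) := by
  obtain ⟨h, hh⟩ := exists_tensor_factor hp hq g.lin h1 h2
  refine ⟨(⟨h, fun t => ?_⟩ : Hom _ _), hh⟩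
  refine TensorProduct.induction_on (motive := fun t : D'.V ⊗[L] E'.V =>
    h ((D'.tensor E').φ t) = Z.φ (h t)) t ?_ (fun x y => ?_) fun x y hx hy => ?_
  · exact (congrArg h (map_zero (D'.tensor E').φ)).trans ((map_zero _).trans
      ((congrArg _ (map_zero h)).trans (map_zero Z.φ)).symm)
  · obtain ⟨x, rfl⟩ := hp x
    obtain ⟨y, rfl⟩ := hq y
    have h3 : (D'.tensor E').φ (p.lin x ⊗ₜ[L] q.lin y : D'.V ⊗[L] E'.V) =
        (p.lin (D.φ x) ⊗ₜ[L] q.lin (E.φ y) : D'.V ⊗[L] E'.V) := by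
      rw [p.comm, q.comm]
      rfl
    exact (congrArg h h3).trans ((hh _ _).trans ((g.comm _).trans (congrArg Z.φ (hh x y).symm)))
  · refine (congrArg h (map_add (D'.tensor E').φ x y)).trans ((map_add _ _ _).trans ?_)
    exact (congrArg₂ (· + ·) hx hy).trans
      ((congrArg Z.φ (map_add h x y)).trans (map_add Z.φ _ _)).symm

end TensorHom

section BaseChange

variable {L : Type*} [NormedField L] {σ : L ≃+* L} {K : Type*} [NormedField K]
  [IsUltrametricDist K] [Algebra L K] {D E D' E' Z : Isoc.{w} σ}

lemma tmulBC_add (x : D.bc K) (y y' : E.bc K) :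
    tmulBC K D E x (y + y') = tmulBC K D E x y + tmulBC K D E x y' := by
  rw [tmulBC, TensorProduct.tmul_add, map_add]
  rfl

lemma add_tmulBC (x x' : D.bc K) (y : E.bc K) :
    tmulBC K D E (x + x') y = tmulBC K D E x y + tmulBC K D E x' y := by
  rw [tmulBC, TensorProduct.add_tmul, map_add]
  rfl

lemma tmulBC_zero (x : D.bc K) : tmulBC K D E x 0 = 0 := by
  rw [tmulBC, TensorProduct.tmul_zero, map_zero]

lemma zero_tmulBC (y : E.bc K) : tmulBC K D E 0 y = 0 := by
  rw [tmulBC, TensorProduct.zero_tmul, map_zero]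

/-- Two morphisms related on pure tensors are related after base change. -/
lemma baseChange_tmulBC_eq {p : D ⟶ D'} {q : E ⟶ E'} (h : D'.tensor E' ⟶ Z) (g : D.tensor E ⟶ Z)
    (hh : ∀ x y, h.lin (p.lin x ⊗ₜ[L] q.lin y : D'.V ⊗[L] E'.V) =
      g.lin (x ⊗ₜ[L] y : D.V ⊗[L] E.V)) (ξ : D.bc K) (θ : E.bc K) :
    h.lin.baseChange K (tmulBC K D' E' (p.lin.baseChange K ξ) (q.lin.baseChange K θ)) =
      g.lin.baseChange K (tmulBC K D E ξ θ) := by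
  induction ξ using TensorProduct.induction_on with
  | zero => rw [map_zero, zero_tmulBC, zero_tmulBC, map_zero, map_zero]
  | add x y hx hy => rw [map_add, add_tmulBC, add_tmulBC, map_add, map_add, hx, hy]
  | tmul a x =>
    induction θ using TensorProduct.induction_on with
    | zero => rw [map_zero, tmulBC_zero, tmulBC_zero, map_zero, map_zero]
    | add x y hx hy => rw [map_add, tmulBC_add, tmulBC_add, map_add, map_add, hx, hy]
    | tmul b y =>
      rw [LinearMap.baseChange_tmul, LinearMap.baseChange_tmul, tmulBC_tmul, tmulBC_tmul]
      refine (LinearMap.baseChange_tmul ..).trans ?_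
      rw [hh]
      exact (LinearMap.baseChange_tmul ..).symm

/-- Whether a morphism maps the tensor product of two lattices into a lattice can be checked on pure
tensors. -/
lemma tensorLat_induction {Ξ : Submodule (integers K) (D.bc K)} {Θ : Submodule (integers K) (E.bc K)}
    {Λ : Submodule (integers K) (Z.bc K)} (g : D.tensor E ⟶ Z)
    (h : ∀ ξ ∈ Ξ, ∀ θ ∈ Θ, g.lin.baseChange K (tmulBC K D E ξ θ) ∈ Λ) :
    ∀ v ∈ tensorLat D E Ξ Θ, g.lin.baseChange K v ∈ Λ := by
  intro v hv
  induction hv using Submodule.span_induction with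
  | mem v hv =>
    obtain ⟨ξ, hξ, θ, hθ, rfl⟩ := hv
    exact h ξ hξ θ hθ
  | zero => rw [map_zero]; exact zero_mem _
  | add x y _ _ hx hy => rw [map_add]; exact add_mem hx hy
  | smul c x _ hx =>
    have h1 : g.lin.baseChange K (c • x) = c • g.lin.baseChange K x :=
      map_smul ((g.lin.baseChange K).restrictScalars (integers K)) c x
    rw [h1]
    exact Submodule.smul_mem _ _ hx

end BaseChange

section HN

variable {L : Type*} [NormedField L] {σ : L ≃+* L}
  {K : Type*} [NormedField K] [IsUltrametricDist K] [Algebra L K] [Admissible σ K]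
  [IsDiscreteValuationRing (integers K)] {D E : Isoc.{w} σ}

/-- A semistable object is equal to the step of its Harder–Narasimhan filtration given by its
slope. -/
lemma hnFil_eq_top_of_isSemistableLat (Ξ : Submodule (integers K) (D.bc K))
    [Submodule.IsLattice K Ξ] (h : D.IsSemistableLat Ξ) : (D.hnFil Ξ).Fil (D.slopeLat Ξ) = ⊤ := by
  obtain ⟨hnt, hss⟩ := (isSemistableLat_iff Ξ).1 h
  have hpos : (0 : ℝ) < D.rank := Nat.cast_pos.2 (Module.finrank_pos_iff.2 hnt)
  refine top_le_iff.1 ((hnFil_spec Ξ (D.slopeLat Ξ)).2 ⊤ ?_)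
  have h1 : D.tilt Ξ (D.slopeLat Ξ) ⊤ = 0 := by
    rw [tilt, subDeg_top, subRank_top, slopeLat, div_mul_cancel₀ _ hpos.ne', sub_self]
  rw [h1]
  have h2 := hss ((D.hnFil Ξ).level (D.slopeLat Ξ))
  rw [tilt]
  linarith

/-- The morphism from an isocrystal to its quotient. -/
def toSubquo {A : Submodule L D.V} (hA : D.IsSub A) : D ⟶ D.subquo A ⊤ hA D.isSub_top :=
  (⟨LinearMap.codRestrict ⊤ LinearMap.id (fun _ => trivial), fun _ => rfl⟩ : Hom D (D.sub ⊤ D.isSub_top)) ≫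
    subquoHom hA D.isSub_top

lemma toSubquo_eq_zero {A : Submodule L D.V} (hA : D.IsSub A) {x : D.V} :
    (toSubquo hA).lin x = 0 ↔ x ∈ A :=
  Submodule.Quotient.mk_eq_zero _

lemma toSubquo_mem (Ξ : Submodule (integers K) (D.bc K)) {A : Submodule L D.V} (hA : D.IsSub A)
    {v : D.bc K} (hv : v ∈ Ξ) :
    (toSubquo hA).lin.baseChange K v ∈ D.subquoLat Ξ A ⊤ hA D.isSub_top := by
  refine ⟨(LinearMap.codRestrict ⊤ LinearMap.id (fun _ => trivial) :
    D.V →ₗ[L] (⊤ : Submodule L D.V)).baseChange K v, ?_, baseChange_comp_apply _ _ _⟩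
  change (⊤ : Submodule L D.V).subtype.baseChange K _ ∈ Ξ
  rw [baseChange_comp_apply]
  exact (baseChange_id_lin D v).symm ▸ hv

/-- The quotient by a step of the Harder–Narasimhan filtration has only smaller slopes. -/
lemma hnFil_subquo_eq_bot (Ξ : Submodule (integers K) (D.bc K)) [Submodule.IsLattice K Ξ] (c : ℝ) :
    ((D.subquo ((D.hnFil Ξ).Fil c) ⊤ ((D.hnFil Ξ).isSub c) D.isSub_top).hnFil
      (D.subquoLat Ξ ((D.hnFil Ξ).Fil c) ⊤ ((D.hnFil Ξ).isSub c) D.isSub_top)).Fil c = ⊥ := by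
  set A := (D.hnFil Ξ).Fil c with hAdef
  have hA : D.IsSub A := (D.hnFil Ξ).isSub c
  set Z := D.subquo A ⊤ hA D.isSub_top with hZ
  set Λ := D.subquoLat Ξ A ⊤ hA D.isSub_top with hΛ
  let W : Z.subobjects := (Z.hnFil Λ).level c
  have h1 := (hnFil_spec Λ c).1 ⊥
  change Z.tilt Λ c ⊥ ≤ Z.tilt Λ c W at h1
  obtain ⟨h2, h3⟩ := subDeg_liftSub Ξ hA D.isSub_top le_top W
  have h4 : liftSub D.isSub_top W ≤ (D.hnFil Ξ).level c := by
    refine (hnFil_spec Ξ c).2 _ ?_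
    rw [tilt, subDeg_bot, subRank_bot, tilt] at h1
    rw [tilt, tilt, h2, h3]
    change D.subDeg Ξ ⟨A, hA⟩ - c * (D.subRank ⟨A, hA⟩ : ℝ) ≤ _
    push_cast at h1 ⊢
    linarith
  rw [Submodule.eq_bot_iff]
  intro y hy
  obtain ⟨x, rfl⟩ := Submodule.mkQ_surjective _ y
  exact (Submodule.Quotient.mk_eq_zero _).2 (h4 (mem_liftSub.2 ⟨x.2, hy⟩))

end HN

end Isoc

/-! ### Harder–Narasimhan filtrations of tensor products -/

namespace Isoc

variable {L : Type*} [NormedField L] {σ : L ≃+* L} [IsUltrametricDist L] [CompleteSpace L]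
  [CharZero L] {K : Type*} [NormedField K] [IsUltrametricDist K] [Algebra L K] [Admissible σ K]
  [IsDiscreteValuationRing (integers K)] {D E : Isoc.{w} σ}

lemma isLattice_tensorLat (Ξ : Submodule (integers K) (D.bc K)) [Submodule.IsLattice K Ξ]
    (Θ : Submodule (integers K) (E.bc K)) [Submodule.IsLattice K Θ] :
    Submodule.IsLattice K (tensorLat D E Ξ Θ) :=
  tensorLat_isLattice (⟨D, Ξ, inferInstance⟩ : BunIsoc σ K) ⟨E, Θ, inferInstance⟩

attribute [local instance] isLattice_tensorLat

/-- A map from the tensor product of two subobjects to an object with small slopes vanishes, if it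
factors through the tensor product of semistable quotients of these subobjects of larger slope. -/
lemma eq_zero_of_quotients (hL : ∃ w : L, 1 < ‖w‖) {P Q Z : Isoc.{w} σ} {p : D ⟶ P} {q : E ⟶ Q}
    (hp : Function.Surjective p.lin) (hq : Function.Surjective q.lin) (g : D.tensor E ⟶ Z)
    (h1 : ∀ x y, p.lin x = 0 → g.lin (x ⊗ₜ[L] y : D.V ⊗[L] E.V) = 0)
    (h2 : ∀ x y, q.lin y = 0 → g.lin (x ⊗ₜ[L] y : D.V ⊗[L] E.V) = 0)
    {Ξ : Submodule (integers K) (D.bc K)} {Θ : Submodule (integers K) (E.bc K)}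
    (Ξ' : Submodule (integers K) (P.bc K)) [Submodule.IsLattice K Ξ']
    (Θ' : Submodule (integers K) (Q.bc K)) [Submodule.IsLattice K Θ']
    (Λ : Submodule (integers K) (Z.bc K)) [Submodule.IsLattice K Λ]
    (hΞ : ∀ u ∈ Ξ', ∃ v ∈ Ξ, p.lin.baseChange K v = u)
    (hΘ : ∀ u ∈ Θ', ∃ v ∈ Θ, q.lin.baseChange K v = u)
    (hg : ∀ ξ ∈ Ξ, ∀ θ ∈ Θ, g.lin.baseChange K (tmulBC K D E ξ θ) ∈ Λ)
    (hP : P.IsSemistableLat Ξ') (hQ : Q.IsSemistableLat Θ')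
    (hZ : (Z.hnFil Λ).Fil (P.slopeLat Ξ' + Q.slopeLat Θ') = ⊥) (x : D.V) (y : E.V) :
    g.lin (x ⊗ₜ[L] y : D.V ⊗[L] E.V) = 0 := by
  obtain ⟨h, hh⟩ := exists_hom_of_quotients hp hq g h1 h2
  obtain ⟨hss, hslope⟩ := isSemistableLat_tensor hL Ξ' Θ' hP hQ
  have htop := hnFil_eq_top_of_isSemistableLat _ hss
  have hmap : ∀ v ∈ tensorLat P Q Ξ' Θ', h.lin.baseChange K v ∈ Λ := by
    refine tensorLat_induction h fun ξ hξ θ hθ => ?_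
    obtain ⟨ξ, hξ', rfl⟩ := hΞ ξ hξ
    obtain ⟨θ, hθ', rfl⟩ := hΘ θ hθ
    rw [baseChange_tmulBC_eq h g hh]
    exact hg ξ hξ' θ hθ'
  have h3 := hnFil_map (tensorLat P Q Ξ' Θ') h Λ hmap ((P.tensor Q).slopeLat (tensorLat P Q Ξ' Θ'))
  rw [htop, hslope, hZ] at h3
  rw [← hh]
  exact h3 (Submodule.mem_top)

/-- The product of two steps of the Harder–Narasimhan filtrations of the factors lies in the step
of the Harder–Narasimhan filtration of the tensor product given by the sum of the indices. -/
lemma tmul_mem_hnFil (hL : ∃ w : L, 1 < ‖w‖) (Ξ : Submodule (integers K) (D.bc K))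
    [Submodule.IsLattice K Ξ] (Θ : Submodule (integers K) (E.bc K)) [Submodule.IsLattice K Θ]
    {s t : ℝ} {x : D.V} {y : E.V} (hx : x ∈ (D.hnFil Ξ).Fil s) (hy : y ∈ (E.hnFil Θ).Fil t) :
    (x ⊗ₜ[L] y : D.V ⊗[L] E.V) ∈ ((D.tensor E).hnFil (tensorLat D E Ξ Θ)).Fil (s + t) := by
  set f := D.hnFil Ξ with hf
  set g := E.hnFil Θ with hg
  set h := (D.tensor E).hnFil (tensorLat D E Ξ Θ) with hh
  suffices key : ∀ (n : ℕ) (s t : ℝ), D.subRank (f.level s) + E.subRank (g.level t) ≤ n →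
      ∀ x ∈ f.Fil s, ∀ y ∈ g.Fil t, (x ⊗ₜ[L] y : D.V ⊗[L] E.V) ∈ h.Fil (s + t) from
    key _ s t le_rfl x hx y hy
  intro n
  induction n with
  | zero =>
    intro s t hst x hx y _
    have h1 : f.Fil s = ⊥ := Submodule.finrank_eq_zero.1 (show D.subRank (f.level s) = 0 by omega)
    rw [h1, Submodule.mem_bot] at hx
    rw [hx, TensorProduct.zero_tmul]
    exact zero_mem _
  | succ n ih =>
    intro s t hst x hx y hy
    by_cases hs : f.level s = ⊥
    · have h1 : f.Fil s = ⊥ := congrArg Subtype.val hs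
      rw [h1, Submodule.mem_bot] at hx
      rw [hx, TensorProduct.zero_tmul]
      exact zero_mem _
    by_cases ht : g.level t = ⊥
    · have h1 : g.Fil t = ⊥ := congrArg Subtype.val ht
      rw [h1, Submodule.mem_bot] at hy
      rw [hy, TensorProduct.tmul_zero]
      exact zero_mem _
    -- replace the indices by the next jumps, so that the graded pieces are not zero
    obtain ⟨s', hss', hslevel, hslt⟩ := f.exists_jump hs
    obtain ⟨t', htt', htlevel, htlt⟩ := g.exists_jump ht
    have hx' : x ∈ f.Fil s' := (show f.Fil s ≤ f.Fil s' from hslevel.ge) hx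
    have hy' : y ∈ g.Fil t' := (show g.Fil t ≤ g.Fil t' from htlevel.ge) hy
    refine h.antitone (add_le_add hss' htt') ?_
    have hrs := D.subRank_strictMono hslt
    have hrt := E.subRank_strictMono htlt
    have h1 : ∀ x ∈ f.plus s', ∀ y ∈ g.Fil t', (x ⊗ₜ[L] y : D.V ⊗[L] E.V) ∈ h.Fil (s' + t') := by
      intro x hx y hy
      obtain ⟨r, hr, hnext⟩ := f.exists_next_eq s'
      refine h.antitone (add_le_add hr.le le_rfl) (ih r t' ?_ x ?_ y hy)
      · rw [htlevel, ← hnext]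
        rw [hslevel] at hrs
        omega
      · exact (show f.plus s' ≤ f.Fil r from hnext.le) hx
    have h2 : ∀ x ∈ f.Fil s', ∀ y ∈ g.plus t', (x ⊗ₜ[L] y : D.V ⊗[L] E.V) ∈ h.Fil (s' + t') := by
      intro x hx y hy
      obtain ⟨r, hr, hnext⟩ := g.exists_next_eq t'
      refine h.antitone (add_le_add le_rfl hr.le) (ih s' r ?_ x hx y ?_)
      · rw [hslevel, ← hnext]
        rw [htlevel] at hrt
        omega
      · exact (show g.plus t' ≤ g.Fil r from hnext.le) hy
    -- the graded pieces are semistable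
    have hgr := (isHNLat_iff_eq Ξ f).2 rfl s'
    have hgr' := (isHNLat_iff_eq Θ g).2 rfl t'
    have hnt : ¬ Subsingleton (f.gr s').V := fun hsub => hslt.not_ge fun x hx =>
      (Submodule.Quotient.mk_eq_zero (f.plusIn s') (x := (⟨x, hx⟩ : f.Fil s'))).1
        (hsub.elim _ _)
    have hnt' : ¬ Subsingleton (g.gr t').V := fun hsub => htlt.not_ge fun x hx =>
      (Submodule.Quotient.mk_eq_zero (g.plusIn t') (x := (⟨x, hx⟩ : g.Fil t'))).1
        (hsub.elim _ _)
    obtain ⟨hss, hslope⟩ := hgr.resolve_left hnt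
    obtain ⟨hss', hslope'⟩ := hgr'.resolve_left hnt'
    have hI : Submodule.IsLattice K (f.grLat Ξ s') :=
      quotLat_isLattice (D.sub (f.Fil s') (f.isSub s')) (D.subisocLat Ξ _ (f.isSub s')) _
    have hI' : Submodule.IsLattice K (g.grLat Θ t') :=
      quotLat_isLattice (E.sub (g.Fil t') (g.isSub t')) (E.subisocLat Θ _ (g.isSub t')) _
    -- the quotient by the step `s' + t'` has only slopes smaller than `s' + t'`
    let Z := (D.tensor E).subquo (h.Fil (s' + t')) ⊤ (h.isSub (s' + t')) (D.tensor E).isSub_top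
    let Λ : Submodule (integers K) (Z.bc K) := (D.tensor E).subquoLat (tensorLat D E Ξ Θ)
      (h.Fil (s' + t')) ⊤ (h.isSub (s' + t')) (D.tensor E).isSub_top
    let i := tensorHom (subtypeHom (f.isSub s')) (subtypeHom (g.isSub t'))
    let π : D.tensor E ⟶ Z := toSubquo (h.isSub (s' + t'))
    let p : D.sub (f.Fil s') (f.isSub s') ⟶ f.gr s' := mkQHom (f.isSub_plusIn s')
    let q : E.sub (g.Fil t') (g.isSub t') ⟶ g.gr t' := mkQHom (g.isSub_plusIn t')
    have hπ : ∀ (x : f.Fil s') (y : g.Fil t'),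
        (i ≫ π).lin (x ⊗ₜ[L] y : f.Fil s' ⊗[L] g.Fil t') = 0 ↔
          (x.1 ⊗ₜ[L] y.1 : D.V ⊗[L] E.V) ∈ h.Fil (s' + t') := fun x y =>
      toSubquo_eq_zero (h.isSub (s' + t'))
    refine (hπ ⟨x, hx'⟩ ⟨y, hy'⟩).1 ?_
    refine eq_zero_of_quotients hL (p := p) (q := q) (Submodule.mkQ_surjective _)
      (Submodule.mkQ_surjective _) (i ≫ π) (fun x y hx => (hπ x y).2 ?_) (fun x y hy => (hπ x y).2 ?_)
      (Ξ := D.subisocLat Ξ _ (f.isSub s')) (Θ := E.subisocLat Θ _ (g.isSub t'))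
      (f.grLat Ξ s') (g.grLat Θ t') Λ (fun u hu => hu) (fun u hu => hu) (fun ξ hξ θ hθ => ?_)
      hss hss' ?_ ⟨x, hx'⟩ ⟨y, hy'⟩
    · exact h1 x.1 ((Submodule.Quotient.mk_eq_zero (f.plusIn s') (x := x)).1 hx) y.1 y.2
    · exact h2 x.1 x.2 y.1 ((Submodule.Quotient.mk_eq_zero (g.plusIn t') (x := y)).1 hy)
    · rw [baseChange_comp_lin]
      refine toSubquo_mem _ _ ?_
      have h3 := baseChange_tmulBC_eq (p := subtypeHom (f.isSub s')) (q := subtypeHom (g.isSub t'))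
        (𝟙 (D.tensor E)) i (fun _ _ => rfl) ξ θ
      rw [← h3, baseChange_id_lin]
      exact tmulBC_mem hξ hθ
    · rw [hslope, hslope']
      exact hnFil_subquo_eq_bot (tensorLat D E Ξ Θ) (s' + t')

/-- The Harder–Narasimhan filtration is compatible with tensor products. -/
theorem hnFil_tensor (hL : ∃ w : L, 1 < ‖w‖) (Ξ : Submodule (integers K) (D.bc K))
    [Submodule.IsLattice K Ξ] (Θ : Submodule (integers K) (E.bc K)) [Submodule.IsLattice K Θ]
    (c : ℝ) : ((D.tensor E).hnFil (tensorLat D E Ξ Θ)).Fil c =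
      (D.hnFil Ξ).tensorFil (E.hnFil Θ) c := by
  set f := D.hnFil Ξ with hf
  set g := E.hnFil Θ with hg
  set h := (D.tensor E).hnFil (tensorLat D E Ξ Θ) with hh
  have hle : f.tensorFil g c ≤ h.Fil c := by
    refine iSup_le fun ⟨⟨s, t⟩, hst⟩ => Submodule.map₂_le.2 fun x hx y hy => ?_
    rw [← show s + t = c from hst]
    exact tmul_mem_hnFil hL Ξ Θ hx hy
  obtain ⟨v, a, hv⟩ := f.exists_adapted_basis (Module.finBasis L D.V)
  obtain ⟨w, b, hw⟩ := g.exists_adapted_basis (Module.finBasis L E.V)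
  let vw := tensorBasis D E v w
  obtain ⟨u, e, hu⟩ := h.exists_adapted_basis vw
  have hmem : ∀ i j, vw (i, j) ∈ h.Fil (a i + b j) := fun i j => by
    rw [show vw (i, j) = (v i ⊗ₜ[L] w j : D.V ⊗[L] E.V) from tensorBasis_apply v w (i, j)]
    exact tmul_mem_hnFil hL Ξ Θ ((mem_Fil_of_adapted hv).2 le_rfl) ((mem_Fil_of_adapted hw).2 le_rfl)
  -- the identity maps one filtration into the other and both have the same sum of weights, so up
  -- to a permutation they have the same weights
  let G := (u.toMatrix vw)ᵀ
  have hG : G.det ≠ 0 := by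
    rw [Matrix.det_transpose, ← Module.Basis.det_apply]
    exact (u.isUnit_det vw).ne_zero
  have hsumD : ∑ i, a i = D.degLat Ξ := sum_weights_eq_degLat Ξ hv
  have hsumE : ∑ j, b j = E.degLat Θ := sum_weights_eq_degLat Θ hw
  have hsum : ∑ i, e i = ∑ i : Fin _ × Fin _, (a i.1 + b i.2) := by
    rw [sum_weights_eq_degLat (tensorLat D E Ξ Θ) hu, degLat_tensor, ← hsumD, ← hsumE,
      Fintype.sum_prod_type]
    simp only [Finset.sum_add_distrib, Finset.sum_const, Finset.card_univ, Fintype.card_fin,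
      nsmul_eq_mul, ← Finset.mul_sum]
    rfl
  obtain ⟨π, hπ⟩ := exists_perm_eq_of_level_le (G₁ := 1) (G₂ := G)
    (a₁ := fun i : Fin _ × Fin _ => a i.1 + b i.2) (a₂ := e) (by simp) hG (fun x => by
      have h1 := level_le_of_triangular (G := 1) (M := G) (a₁ := fun i : Fin _ × Fin _ =>
        a i.1 + b i.2) (a₂ := e) (fun i j hij => (hu _ _).1 (hmem i.1 i.2) j hij) x
      rwa [Matrix.one_mul] at h1) hsum.le
  have hcard : Fintype.card {i // c ≤ e i} =
      Fintype.card {i : Fin _ × Fin _ // c ≤ a i.1 + b i.2} :=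
    Fintype.card_congr (π.subtypeEquiv fun i => by rw [← hπ i])
  refine (Submodule.eq_of_le_of_finrank_le hle ?_).symm
  rw [finrank_Fil_of_adapted hu c, hcard, ← finrank_span_eq_card (R := L)
    (b := vw ∘ (Subtype.val : {i : Fin _ × Fin _ // c ≤ a i.1 + b i.2} → _))
    (vw.linearIndependent.comp _ Subtype.val_injective)]
  refine Submodule.finrank_mono (Submodule.span_le.2 ?_)
  rintro _ ⟨⟨⟨i, j⟩, hij⟩, rfl⟩
  have h1 : vw (i, j) = TensorProduct.mk L D.V E.V (v i) (w j) := tensorBasis_apply v w (i, j)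
  change vw (i, j) ∈ _
  rw [h1]
  refine Submodule.mem_iSup_of_mem ⟨(a i, c - a i), add_sub_cancel _ _⟩
    (Submodule.apply_mem_map₂ _ ((mem_Fil_of_adapted hv).2 le_rfl) ((mem_Fil_of_adapted hw).2 ?_))
  change c ≤ a i + b j at hij
  change c - a i ≤ b j
  linarith

end Isoc

end IsocLat

end

theorem theorem2 {p : ℕ} [Fact p.Prime]
    {F : Type*} [Field F] [Algebra ℚ_[p] F] [FiniteDimensional ℚ_[p] F]
    (ι : F →ₐ[ℚ_[p]] ℂ_[p])
    (σ : IsocLat.Breve ι ≃+* IsocLat.Breve ι) (hσ : IsocLat.IsFrobenius ι σ)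
    {K : Type*} [NormedField K] [IsUltrametricDist K]
    [IsDiscreteValuationRing (IsocLat.integers K)] [HenselianLocalRing (IsocLat.integers K)]
    [Algebra (IsocLat.Breve ι) K]
    (hK : ∀ x : IsocLat.Breve ι, algebraMap (IsocLat.Breve ι) K x ∈ IsocLat.integers K) :
    -- rank and degree satisfy the axioms of a Harder–Narasimhan formalism
    IsocLat.BunIsoc.RankDegreeAxioms σ K ∧
    ∃ HN : IsocLat.FilteringFunctor σ K,
      -- `HN` sends each object to its unique Harder–Narasimhan filtration
      (∀ (X : IsocLat.BunIsoc σ K) (f : X.D.Filtration), X.IsHN f ↔ f = HN.fil X) ∧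
      -- `HN` is induced by the Harder–Narasimhan filtration on normed isocrystals
      (∀ (X : IsocLat.BunIsoc σ K) (f : X.D.Filtration),
        (IsocLat.gaugeFunctor.obj X).IsHN f ↔ f = HN.fil X) ∧
      -- `HN` is compatible with tensor products
      (∀ (X Y : IsocLat.BunIsoc σ K) (a : ℝ),
        (HN.fil (X.tensor Y)).Fil a = (HN.fil X).tensorFil (HN.fil Y) a) ∧
      -- tensor products of semistable objects are semistable
      (∀ X Y : IsocLat.BunIsoc σ K,
        X.IsSemistable → Y.IsSemistable → (X.tensor Y).IsSemistable) := by
  have hp := (Fact.out : p.Prime)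
  have hadm : IsocLat.Admissible σ K :=
    ⟨hσ.norm_map, fun _ hx => IsocLat.norm_algebraMap_of_integral hK hx⟩
  have hL : ∃ w : IsocLat.Breve ι, 1 < ‖w‖ := by
    refine ⟨(p : IsocLat.Breve ι)⁻¹, ?_⟩
    rw [norm_inv, IsocLat.norm_p_breve, inv_inv]
    exact_mod_cast hp.one_lt
  refine ⟨IsocLat.BunIsoc.rankDegreeAxioms, IsocLat.hnFunctor σ K, fun X f => ?_, fun X f => ?_,
    fun X Y a => ?_, fun X Y hX hY => ?_⟩
  · have := X.lattice
    exact IsocLat.Isoc.isHNLat_iff_eq X.Ξ f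
  · have := X.lattice
    exact (IsocLat.Isoc.isHN_gauge X.Ξ f).trans (IsocLat.Isoc.isHNLat_iff_eq X.Ξ f)
  · have := X.lattice
    have := Y.lattice
    exact IsocLat.Isoc.hnFil_tensor hL X.Ξ Y.Ξ a
  · have := X.lattice
    have := Y.lattice
    exact (IsocLat.Isoc.isSemistableLat_tensor hL X.Ξ Y.Ξ hX hY).1
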